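/- Let $n\ge 1$, let $(M^{2n+1},\xi=\ker\alpha)$ be a smooth contact manifold with contact form $\alpha$, let $Y$ be a non-empty closed $(n+1)$-manifold, and let $\iota:Y\hookrightarrow M$ be a smooth embedding which is coisotropic (i.e. $T_yY\cap\xi_y$ is a coisotropic subspace of $(\xi_y,d\alpha)$ for all $y$) and such that $\lambda:=\iota^*\alpha$ vanishes nowhere; so $\mathcal F:=\ker\lambda$ is the (nonsingular) Legendrian foliation of $Y$. Fix a smooth line field $L$ on $Y$ transverse to $\mathcal F$. For a section $s$ of the leafwise cotangent bundle $\pi:T^*\mathcal F\to Y$, let $\overline s\in\Omega^1(Y)$ be the one-form that equals $s$ on $\mathcal F$ and vanishes on $L$; similarly, for $e\in T_y^*\mathcal F$ let $\overline e\in T_y^*Y$ be its extension by $0$ on $L_y$. Equip $T^*\mathcal F$ with the form $\alpha_0=\pi^*\lambda-\eta$, $\eta_e(v)=\overline e(\pi_*v)$. A standard neighborhood $N$ of $Y$ is an open neighborhood of $Y$ in $M$ together with a diffeomorphism $\Phi$ onto an open neighborhood of the zero section of $T^*\mathcal F$ that takes $\ker\alpha$ to $\ker\alpha_0$ and $\iota(y)$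 to $0\in T^*_y\mathcal F$. Then: (1) Every open neighborhood of $Y$ in $M$ contains a standard neighborhood of $Y$. (2) Let $N$ be any standard neighborhood. Let $\mathcal C_N$ be the set of coisotropic submanifolds of $M$ that are graphs in $N$, i.e. of the form $Y_s=\Phi^{-1}(s(Y))$ with $s$ a smooth section of $T^*\mathcal F$ with values in $\Phi(N)$, and let $\mathcal V_N$ be the set of codimension one foliations of $Y$ of the form $\ker(\overline s-\lambda)$ with such $s$. Then $\mathcal C_N$ contains all coisotropic submanifolds sufficiently $C^1$-close to $Y$, and $\mathcal V_N$ contains all codimension one foliations sufficiently $C^0$-close to $\mathcal F$. Each $S\in\mathcal C_N$ is $Y_s$ for a unique $s$, and $\Theta(Y_s)=\ker(\overline s-\lambda)$ defines a bijection $\Theta:\mathcal C_N\to\mathcal V_N$. It identifies the coisotropic submanifolds $C^1$-close to $Y$ with the codimension one foliations $C^1$-close to $\mathcal F$, i.e. it maps the filter of $C^1$-neighborhoods of $Y$ in the space of coisotropic submanifolds onto the filter of $C^1$-neighborhoods of $\mathcal F$ in the space of codimension one foliations. (3) For every $S\in\mathcal C_N$, there is a smooth path of coisotropic submanifolds from $Y$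 to $S$, all of which are graphs in $N$, if and only if there is a smooth homotopy from $\mathcal F$ to $\Theta(S)$ through codimension one foliations belonging to the $C^0$-neighborhood $\mathcal V_N$ of $\mathcal F$. The neighborhoods $\mathcal V_N$ are arbitrarily $C^0$-small: for each $C^0$-neighborhood $\mathcal W$ of $\mathcal F$ in the space of codimension one foliations there is a standard neighborhood $N'\subseteq N$, with map the restriction of $\Phi$, such that $\mathcal V_{N'}\subseteq\mathcal W$. -/

import Mathlib

open Set Filter Topology Manifold Bundle
open scoped ContDiff

noncomputable section

/-! ### One-forms, hyperplane fields and foliations on a manifold -/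

/-- The cotangent space at a point of a `d`-dimensional manifold. -/
abbrev CotangentAt (d : ℕ) {X : Type*} [TopologicalSpace X]
    [ChartedSpace (EuclideanSpace ℝ (Fin d)) X] (x : X) : Type :=
  TangentSpace (𝓡 d) x →L[ℝ] ℝ

/-- The cotangent bundle `T*X`, with Mathlib's topology and smooth structure on a bundle of
continuous linear maps. -/
abbrev CotangentBundle (d : ℕ) (X : Type*) [TopologicalSpace X]
    [ChartedSpace (EuclideanSpace ℝ (Fin d)) X] : Type _ :=
  TotalSpace (EuclideanSpace ℝ (Fin d) →L[ℝ] ℝ) (fun x : X => CotangentAt d x)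

/-- The model with corners of the total space of `T*X`. -/
abbrev cotModel (d : ℕ) :=
  (𝓡 d).prod 𝓘(ℝ, EuclideanSpace ℝ (Fin d) →L[ℝ] ℝ)

section Forms

variable {d : ℕ} {X : Type*} [TopologicalSpace X] [ChartedSpace (EuclideanSpace ℝ (Fin d)) X]

/-- A one-form regarded as a map `X → T*X`. -/
def formMap (μ : (x : X) → CotangentAt d x) (x : X) : CotangentBundle d X := ⟨x, μ x⟩

/-- Smooth one-forms. -/
def IsSmoothForm [IsManifold (𝓡 d) ∞ X] (μ : (x : X) → CotangentAt d x) : Prop :=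
  ContMDiff (𝓡 d) (cotModel d) ∞ (formMap μ)

/-- The coordinate expression of the one-form `μ` in the preferred chart at `x`. -/
def formInChart (μ : (x : X) → CotangentAt d x) (x : X)
    (z : EuclideanSpace ℝ (Fin d)) : EuclideanSpace ℝ (Fin d) →L[ℝ] ℝ :=
  (μ ((extChartAt (𝓡 d) x).symm z)).comp
    (mfderiv 𝓘(ℝ, EuclideanSpace ℝ (Fin d)) (𝓡 d) (extChartAt (𝓡 d) x).symm z)

/-- The exterior derivative `(dμ)_x(u, v)` of a one-form. Mathlib identifies `T_x X` with the
model space through the preferred chart at `x`, and the formula is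
`∂_u μ(v) - ∂_v μ(u)` in that chart. -/
def extD (μ : (x : X) → CotangentAt d x) (x : X) (u v : TangentSpace (𝓡 d) x) : ℝ :=
  fderiv ℝ (formInChart μ x) (extChartAt (𝓡 d) x x) u v -
    fderiv ℝ (formInChart μ x) (extChartAt (𝓡 d) x x) v u

/-- The kernel of a one-form, as a field of subspaces of the tangent spaces. -/
def kerField (μ : (x : X) → CotangentAt d x) (x : X) : Submodule ℝ (TangentSpace (𝓡 d) x) :=
  LinearMap.ker (μ x : TangentSpace (𝓡 d) x →ₗ[ℝ] ℝ)

/-- A (smooth, nonsingular) codimension one foliation, given by its tangent hyperplanes: near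
every point, the leaves are the level sets of a smooth function without critical points. -/
def IsCodimOneFoliation (D : (x : X) → Submodule ℝ (TangentSpace (𝓡 d) x)) : Prop :=
  ∀ x : X, ∃ (O : Set X) (f : X → ℝ), IsOpen O ∧ x ∈ O ∧ ContMDiffOn (𝓡 d) 𝓘(ℝ, ℝ) ∞ f O ∧
    ∀ z ∈ O, mfderiv (𝓡 d) 𝓘(ℝ, ℝ) f z ≠ 0 ∧
      ∀ v : TangentSpace (𝓡 d) z, v ∈ D z ↔ mfderiv (𝓡 d) 𝓘(ℝ, ℝ) f z v = 0

/-- A smooth line field: locally spanned by a nowhere vanishing smooth vector field. -/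
def IsSmoothLineField [IsManifold (𝓡 d) ∞ X]
    (L : (x : X) → Submodule ℝ (TangentSpace (𝓡 d) x)) : Prop :=
  ∀ x : X, ∃ (O : Set X) (V : (z : X) → TangentSpace (𝓡 d) z), IsOpen O ∧ x ∈ O ∧
    ContMDiffOn (𝓡 d) (𝓡 d).tangent ∞
      (fun z => (⟨z, V z⟩ : TangentBundle (𝓡 d) X)) O ∧
    ∀ z ∈ O, V z ≠ 0 ∧ L z = Submodule.span ℝ {V z}

/-- `α` is a contact form on a manifold of dimension `2n+1`: a smooth nowhere vanishing one-form
such that `dα` is nondegenerate on `ker α` (that is, `α ∧ (dα)ⁿ` vanishes nowhere). -/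
def IsContactForm [IsManifold (𝓡 d) ∞ X] (α : (x : X) → CotangentAt d x) : Prop :=
  IsSmoothForm α ∧ ∀ x : X, α x ≠ 0 ∧
    ∀ v ∈ kerField α x, (∀ w ∈ kerField α x, extD α x v w = 0) → v = 0

end Forms

/-! ### `C⁰` and `C¹` neighborhoods -/

/-- Neighborhoods of a map `f` in the compact-open (`C⁰`) topology. -/
def nhdsC0 {X Z : Type*} [TopologicalSpace X] [TopologicalSpace Z] (f : X → Z) :
    Filter (X → Z) :=
  ⨅ (K : Set X) (_ : IsCompact K) (O : Set Z) (_ : IsOpen O) (_ : MapsTo f K O),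
    𝓟 {g | MapsTo g K O}

/-- Neighborhoods of a map `f` between manifolds in the `C¹` topology: the `C⁰` topology for the
tangent maps. -/
def nhdsC1 {E E' H H' : Type*} [NormedAddCommGroup E] [NormedSpace ℝ E]
    [NormedAddCommGroup E'] [NormedSpace ℝ E'] [TopologicalSpace H] [TopologicalSpace H']
    (I : ModelWithCorners ℝ E H) (I' : ModelWithCorners ℝ E' H')
    {X Z : Type*} [TopologicalSpace X] [ChartedSpace H X] [IsManifold I 1 X]
    [TopologicalSpace Z] [ChartedSpace H' Z] [IsManifold I' 1 Z]
    (f : X → Z) : Filter (X → Z) :=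
  (nhdsC0 (tangentMap I I' f)).comap (tangentMap I I')

section Foliations

variable {d : ℕ} {X : Type*} [TopologicalSpace X] [ChartedSpace (EuclideanSpace ℝ (Fin d)) X]
  [IsManifold (𝓡 d) ∞ X]

/-- The nowhere vanishing smooth one-forms that define a codimension one foliation. -/
def foliationForms (d : ℕ) (X : Type*) [TopologicalSpace X]
    [ChartedSpace (EuclideanSpace ℝ (Fin d)) X] [IsManifold (𝓡 d) ∞ X] :
    Set ((x : X) → CotangentAt d x) :=
  {μ | IsSmoothForm μ ∧ (∀ x, μ x ≠ 0) ∧ IsCodimOneFoliation (kerField μ)}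

/-- `C⁰` neighborhoods of the foliation `ker lam` in the space of codimension one foliations:
a foliation is close to `ker lam` when it is the kernel of a one-form that is close to `lam`. -/
def nhdsFoliationC0 (lam : (x : X) → CotangentAt d x) :
    Filter ((x : X) → Submodule ℝ (TangentSpace (𝓡 d) x)) :=
  map kerField ((nhdsC0 (formMap lam)).comap formMap ⊓ 𝓟 (foliationForms d X))

/-- `C¹` neighborhoods of the foliation `ker lam` in the space of codimension one foliations. -/
def nhdsFoliationC1 (lam : (x : X) → CotangentAt d x) :
    Filter ((x : X) → Submodule ℝ (TangentSpace (𝓡 d) x)) :=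
  map kerField
    ((nhdsC1 (𝓡 d) (cotModel d) (formMap lam)).comap formMap ⊓ 𝓟 (foliationForms d X))

/-- `D₀` and `D₁` are connected by a smooth homotopy `ker (μ t)`, `t ∈ [0,1]`, of foliations
belonging to the set `𝒱` of foliations. -/
def FoliationHomotopicIn (𝒱 : Set ((x : X) → Submodule ℝ (TangentSpace (𝓡 d) x)))
    (D₀ D₁ : (x : X) → Submodule ℝ (TangentSpace (𝓡 d) x)) : Prop :=
  ∃ μ : ℝ → (x : X) → CotangentAt d x,
    ContMDiffOn (𝓘(ℝ, ℝ).prod (𝓡 d)) (cotModel d) ∞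
      (fun p : ℝ × X => formMap (μ p.1) p.2) (Icc 0 1 ×ˢ univ) ∧
    (∀ t ∈ Icc (0 : ℝ) 1, (∀ x, μ t x ≠ 0) ∧ kerField (μ t) ∈ 𝒱) ∧
    kerField (μ 0) = D₀ ∧ kerField (μ 1) = D₁

end Foliations

/-! ### The leafwise cotangent bundle `T*F` of a hyperplane field with transverse line field -/

section Leafwise

variable {d : ℕ} {X : Type*} [TopologicalSpace X] [ChartedSpace (EuclideanSpace ℝ (Fin d)) X]

/-- The leafwise cotangent bundle `T*F`, whose fiber over `x` is the dual of `F_x`. -/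
def LeafCotangent (F : (x : X) → Submodule ℝ (TangentSpace (𝓡 d) x)) : Type _ :=
  Σ x : X, (F x →L[ℝ] ℝ)

variable {F L : (x : X) → Submodule ℝ (TangentSpace (𝓡 d) x)}

/-- The restriction map `T*X → T*F`. It exhibits `T*F` as a quotient bundle of `T*X`. -/
def restrictLeaf (F : (x : X) → Submodule ℝ (TangentSpace (𝓡 d) x)) (p : CotangentBundle d X) :
    LeafCotangent F :=
  ⟨p.proj, (p.snd : TangentSpace (𝓡 d) p.proj →L[ℝ] ℝ).comp (F p.proj).subtypeL⟩

instance instFiniteDimensionalTangentSpaceEuclidean (x : X) :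
    FiniteDimensional ℝ (TangentSpace (𝓡 d) x) :=
  inferInstanceAs (FiniteDimensional ℝ (EuclideanSpace ℝ (Fin d)))

instance instT2SpaceTangentSpaceEuclidean (x : X) : T2Space (TangentSpace (𝓡 d) x) :=
  inferInstanceAs (T2Space (EuclideanSpace ℝ (Fin d)))

/-- The extension `i_L e` of a leafwise covector `e` at `x`: it agrees with `e` on `F_x` and
vanishes on the transverse line `L_x`. -/
def extendAt (hLF : ∀ x, IsCompl (F x) (L x)) (x : X) (e : F x →L[ℝ] ℝ) : CotangentAt d x :=
  LinearMap.toContinuousLinearMap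
    ((e : F x →ₗ[ℝ] ℝ) ∘ₗ Submodule.projectionOnto (F x) (L x) (hLF x))

/-- The inclusion `i_L : T*F → T*X` as the covectors that vanish on `L`. -/
def extendLeaf (hLF : ∀ x, IsCompl (F x) (L x)) (e : LeafCotangent F) : CotangentBundle d X :=
  ⟨e.1, extendAt hLF e.1 e.2⟩

/-- The one-form `i_L s` (written `s̄`) associated with a leafwise one-form `s`. -/
def barForm (hLF : ∀ x, IsCompl (F x) (L x)) (s : (x : X) → (F x →L[ℝ] ℝ)) :
    (x : X) → CotangentAt d x :=
  fun x => extendAt hLF x (s x)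

end Leafwise

/-! ### Coisotropic submanifolds -/

section Coisotropic

variable {m : ℕ} {M : Type*} [TopologicalSpace M] [ChartedSpace (EuclideanSpace ℝ (Fin m)) M]
  {d : ℕ} {Y : Type*} [TopologicalSpace Y] [ChartedSpace (EuclideanSpace ℝ (Fin d)) Y]

/-- The pullback `j^* α` of a one-form. -/
def pullbackForm (α : (x : M) → CotangentAt m x) (j : Y → M) (y : Y) : CotangentAt d y :=
  (α (j y)).comp (mfderiv (𝓡 d) (𝓡 m) j y)

/-- The image `T` of `dj` at each point meets `ξ = ker α` in a coisotropic subspace of the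
symplectic vector space `(ξ, dα)`: the `dα`-orthogonal complement of `T ∩ ξ` in `ξ` is contained
in `T ∩ ξ`. -/
def IsCoisotropicMap (α : (x : M) → CotangentAt m x) (j : Y → M) : Prop :=
  ∀ y : Y, ∀ v ∈ kerField α (j y),
    (∀ w : TangentSpace (𝓡 d) y, mfderiv (𝓡 d) (𝓡 m) j y w ∈ kerField α (j y) →
      extD α (j y) v (mfderiv (𝓡 d) (𝓡 m) j y w) = 0) →
    ∃ w : TangentSpace (𝓡 d) y, mfderiv (𝓡 d) (𝓡 m) j y w = v

/-- The coisotropic smooth embeddings `Y → M`. -/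
def coisotropicEmbeddings (Y : Type*) [TopologicalSpace Y]
    [ChartedSpace (EuclideanSpace ℝ (Fin d)) Y] (α : (x : M) → CotangentAt m x) : Set (Y → M) :=
  {j | IsSmoothEmbedding (𝓡 d) (𝓡 m) ∞ j ∧ IsCoisotropicMap (d := d) α j}

/-- `C¹` neighborhoods of the submanifold `ι(Y)` in the space of coisotropic submanifolds:
a coisotropic submanifold is close to `ι(Y)` when it is the image of a `C¹`-close embedding. -/
def nhdsCoisotropicC1 [IsManifold (𝓡 d) ∞ Y] [IsManifold (𝓡 m) ∞ M]
    (α : (x : M) → CotangentAt m x) (ι : Y → M) : Filter (Set M) :=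
  map range (nhdsC1 (𝓡 d) (𝓡 m) ι ⊓ 𝓟 (coisotropicEmbeddings (d := d) Y α))

/-- The characteristic (Legendrian) foliation `ker (ι^* α)`. -/
abbrev charFoliation (α : (x : M) → CotangentAt m x) (ι : Y → M) (y : Y) :
    Submodule ℝ (TangentSpace (𝓡 d) y) :=
  kerField (pullbackForm (d := d) α ι) y

/-- A standard neighborhood of `ι(Y)` in `(M, ker α)`: a contactomorphism, equal to the zero
section on `ι(Y)`, from an open neighborhood `source` of `ι(Y)` onto an open neighborhood `target`
of the zero section of `T*F`, where `F` is the characteristic foliation, `λ = ι^* α` and `T*F`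
carries the contact form `π^* λ - η`, `η_e(v) = (i_L e)(π_* v)`.

The smooth structure of `T*F` is the usual one: `T*F` is the quotient of `T*Y` by the line bundle
of covectors vanishing on `F`, and it is also the subbundle of covectors in `T*Y` vanishing on `L`;
maps out of (into) `T*F` are smooth when they are so on (in) `T*Y`. -/
structure StandardNbhd [IsManifold (𝓡 d) ∞ Y] [IsManifold (𝓡 m) ∞ M]
    (α : (x : M) → CotangentAt m x) (ι : Y → M)
    {L : (y : Y) → Submodule ℝ (TangentSpace (𝓡 d) y)}
    (hLF : ∀ y : Y, IsCompl (charFoliation (d := d) α ι y) (L y))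
    extends PartialEquiv M (LeafCotangent (charFoliation (d := d) α ι)) where
  open_source : IsOpen source
  open_target : IsOpen (restrictLeaf (charFoliation (d := d) α ι) ⁻¹' target)
  contMDiffOn_toFun :
    ContMDiffOn (𝓡 m) (cotModel d) ∞ (fun u => extendLeaf hLF (toFun u)) source
  contMDiffOn_invFun :
    ContMDiffOn (cotModel d) (𝓡 m) ∞ (fun p => invFun (restrictLeaf (charFoliation (d := d) α ι) p))
      (restrictLeaf (charFoliation (d := d) α ι) ⁻¹' target)
  mem_source : ∀ y, ι y ∈ source
  map_zero : ∀ y, toFun (ι y) = ⟨y, 0⟩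
  contact : ∀ u ∈ source, ∀ v : TangentSpace (𝓡 m) u,
    α u v = 0 ↔
      pullbackForm (d := d) α ι (toFun u).1 (mfderiv (𝓡 m) (𝓡 d) (fun u' => (toFun u').1) u v) -
        extendAt hLF (toFun u).1 (toFun u).2
          (mfderiv (𝓡 m) (𝓡 d) (fun u' => (toFun u').1) u v) = 0

namespace StandardNbhd

variable [IsManifold (𝓡 d) ∞ Y] [IsManifold (𝓡 m) ∞ M]
  {α : (x : M) → CotangentAt m x} {ι : Y → M}
  {L : (y : Y) → Submodule ℝ (TangentSpace (𝓡 d) y)}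
  {hLF : ∀ y : Y, IsCompl (charFoliation (d := d) α ι y) (L y)}

/-- The smooth sections `s` of `T*F` whose graph lies in the standard neighborhood. -/
def sections (N : StandardNbhd α ι hLF) : Set ((y : Y) → (charFoliation (d := d) α ι y →L[ℝ] ℝ)) :=
  {s | IsSmoothForm (barForm hLF s) ∧
    ∀ y, (⟨y, s y⟩ : LeafCotangent (charFoliation (d := d) α ι)) ∈ N.target}

/-- The graph of a section of `T*F`, as a subset of `M`. -/
def graph (N : StandardNbhd α ι hLF) (s : (y : Y) → (charFoliation (d := d) α ι y →L[ℝ] ℝ)) : Set M :=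
  range fun y => N.invFun ⟨y, s y⟩

/-- The coisotropic submanifolds of `M` that are graphs in the standard neighborhood. -/
def coisotropicGraphs (N : StandardNbhd α ι hLF) : Set (Set M) :=
  {S | (∃ j ∈ coisotropicEmbeddings (d := d) Y α, range j = S) ∧ ∃ s ∈ N.sections, S = N.graph s}

/-- The hyperplane field `ker (s̄ - λ)`. -/
def sectionField (_N : StandardNbhd α ι hLF) (s : (y : Y) → (charFoliation (d := d) α ι y →L[ℝ] ℝ)) :
    (y : Y) → Submodule ℝ (TangentSpace (𝓡 d) y) :=
  kerField fun y => barForm hLF s y - pullbackForm (d := d) α ι y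

/-- The codimension one foliations of the form `ker (s̄ - λ)`, where the graph of `s` lies in the
standard neighborhood. -/
def foliations (N : StandardNbhd α ι hLF) :
    Set ((y : Y) → Submodule ℝ (TangentSpace (𝓡 d) y)) :=
  {D | IsCodimOneFoliation D ∧ ∃ s ∈ N.sections, D = N.sectionField s}

/-- `S₀` and `S₁` are connected by a smooth path `j t (Y)`, `t ∈ [0,1]`, of coisotropic
submanifolds, all of which are graphs in the standard neighborhood. -/
def CoisotropicHomotopic (N : StandardNbhd α ι hLF) (S₀ S₁ : Set M) : Prop :=
  ∃ j : ℝ → Y → M,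
    ContMDiffOn (𝓘(ℝ, ℝ).prod (𝓡 d)) (𝓡 m) ∞ (fun p : ℝ × Y => j p.1 p.2) (Icc 0 1 ×ˢ univ) ∧
    (∀ t ∈ Icc (0 : ℝ) 1,
      j t ∈ coisotropicEmbeddings (d := d) Y α ∧ range (j t) ∈ N.coisotropicGraphs) ∧
    range (j 0) = S₀ ∧ range (j 1) = S₁

end StandardNbhd

end Coisotropic

end

noncomputable section

set_option linter.unusedSectionVars false

/-! ### Smooth dependence of flows near a compact set of stationary points -/

section CurveSpace

open unitInterval

variable {K : Type} [TopologicalSpace K] [CompactSpace K]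
  {E F : Type} [NormedAddCommGroup E] [NormedSpace ℝ E] [NormedAddCommGroup F] [NormedSpace ℝ F]

/-! The correspondence rests on a dimension count. If `j : Y → M` is an immersion with `j^*α`
nowhere zero, then `dj(TY) ∩ ξ` has dimension `n` in the `2n`-dimensional symplectic space `ξ`, so
it is coisotropic if and only if it is isotropic (`coisotropic_iff_isotropic`). Isotropy says that
`d(j^*α)` vanishes on `ker j^*α`, which by Frobenius means that this kernel is a foliation
(`isCodimOneFoliation_kerField_iff`, `isCoisotropicMap_iff`). Along the graph of `s` the model form
restricts to `λ - s̄`, hence `Y_s` is coisotropic exactly when `ker (s̄ - λ)` is a foliation.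

Let `ν` be the section of `L` with `λ(ν) = 1`. Since `s̄ - λ` takes the value `-1` on `ν`, it is
determined by its kernel. Conversely, a form `μ` with `μ(ν) ≠ 0` has the kernel of `s̄ - λ` for `s̄
= λ - μ / μ(ν)`. So `Θ` is a bijection given in both directions by fixed smooth maps, between points
of the neighborhood and covectors on `Y`. Fixed smooth maps preserve `C¹` convergence and smooth
dependence on a parameter, and only pointwise values decide whether a form belongs to a section of
the neighborhood, which is why `C⁰`-closeness of foliations is enough there. What remains is that a
submanifold near `Y`, or in a path of graphs, comes with an arbitrary parametrization. Its
projection to `Y` is a diffeomorphism, by `C¹`-closeness to the identity in one case and because the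
image is a graph in the other. Composing with the inverse gives a section that converges, or varies
smoothly, with the submanifold (`exists_inverse_of_tendstoC1At`,
`exists_contMDiffOn_inverse_family`).

For the existence of standard neighborhoods it suffices to find a retraction `p` onto `Y` near `Y`
and covectors `b(u)` at `p(u)`, equal to `λ` along `Y`, with `ker α = ker (b ∘ dp)`. After rescaling
to `b(ν) = 1`, the map `u ↦ (λ - b)|F` pulls the model contact structure back to `ker α`.
Nondegeneracy of `dα` makes it an immersion, and the inverse function theorem along the compact set
`Y` applies (`exists_standardNbhd`).

To find `p`, choose a retraction with `α ∘ dp = α` along `Y`, and put `f = α - p^*α` and `σ = f ∘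
(dp - id)`. Then `α + σ` factors through `dp`, `σ` vanishes along `Y`, and `dσ(X, w) = 0` for `w`
tangent to `Y`. Together with coisotropy this keeps `d(α + tσ)` nondegenerate on `ker α` along `Y`
for all `t`, so the Moser method carries `ker α` to `ker (α + σ)` by a map that fixes `Y`
(`exists_moser`, `exists_legendrian_retraction`).

The analysis takes place in Euclidean space, where `Y` and a neighborhood of it in `M` are smooth
retracts. Flows near a compact set of stationary points come from the inverse function theorem in
the Banach space of curves. The resulting transport of kernels, `exists_kernel_transport`, serves
both the Moser method and the Frobenius theorem. -/

instance instNormedAddCommGroupCurve : NormedAddCommGroup C(K, E →L[ℝ] F) :=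
  ContinuousMap.instNormedAddCommGroup

instance instNormedSpaceCurve : NormedSpace ℝ C(K, E →L[ℝ] F) := ContinuousMap.normedSpace

/-- Pointwise application of a continuous family of linear maps to a continuous family of
vectors. -/
def pointwiseApply (K : Type) [TopologicalSpace K] [CompactSpace K] (E F : Type)
    [NormedAddCommGroup E] [NormedSpace ℝ E] [NormedAddCommGroup F] [NormedSpace ℝ F] :
    C(K, E →L[ℝ] F) →L[ℝ] C(K, E) →L[ℝ] C(K, F) :=
  LinearMap.mkContinuous₂
    (LinearMap.mk₂ ℝ (fun (A : C(K, E →L[ℝ] F)) (c : C(K, E)) => (⟨fun k => A k (c k), by fun_prop⟩ : C(K, F)))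
      (fun _ _ _ => by ext; simp) (fun _ _ _ => by ext; simp)
      (fun _ _ _ => by ext; simp) (fun _ _ _ => by ext; simp)) 1
    (fun A c => by
      rw [one_mul]
      refine (ContinuousMap.norm_le _ (by positivity)).2 fun k => ?_
      exact ((A k).le_opNorm _).trans
        (mul_le_mul (A.norm_coe_le_norm k) (c.norm_coe_le_norm k) (norm_nonneg _) (norm_nonneg _)))

@[simp] lemma pointwiseApply_apply (A : C(K, E →L[ℝ] F)) (c : C(K, E)) (k : K) :
    pointwiseApply K E F A c k = A k (c k) := rfl

/-- Composition of continuous curves with a fixed continuous map. -/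
def postcompCurve (H : E → F) (hH : Continuous H) (γ : C(K, E)) : C(K, F) :=
  (⟨H, hH⟩ : C(E, F)).comp γ

/-- The mean value inequality is applied at each `k` on the segment from `γ k` to `γ k + h k`.
Post-composition with `fderiv ℝ H` is continuous for the uniform norm because `K` is compact, so the
error is small uniformly in `k`. -/
lemma hasFDerivAt_postcompCurve {H : E → F} (hH : ContDiff ℝ 1 H) (γ : C(K, E)) :
    HasFDerivAt (postcompCurve (K := K) H hH.continuous)
      (pointwiseApply K E F
        (postcompCurve (fderiv ℝ H) (hH.continuous_fderiv one_ne_zero) γ)) γ := by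
  have hD : Continuous (postcompCurve (K := K) (fderiv ℝ H) (hH.continuous_fderiv one_ne_zero)) :=
    ContinuousMap.continuous_postcomp _
  rw [hasFDerivAt_iff_isLittleO_nhds_zero, Asymptotics.isLittleO_iff]
  intro ε hε
  obtain ⟨δ, hδ, hball⟩ := Metric.continuous_iff.1 hD γ ε hε
  filter_upwards [Metric.ball_mem_nhds (0 : C(K, E)) hδ] with h hh
  rw [mem_ball_zero_iff] at hh
  refine (ContinuousMap.norm_le _ (by positivity)).2 fun k => ?_
  have key : ∀ x ∈ segment ℝ (γ k) (γ k + h k), ‖fderiv ℝ H x - fderiv ℝ H (γ k)‖ ≤ ε := by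
    intro x hx
    rw [segment_eq_image'] at hx
    obtain ⟨s, hs, rfl⟩ := hx
    have h1 : dist (γ + s • h) γ < δ := by
      rw [dist_eq_norm, add_sub_cancel_left, norm_smul, Real.norm_eq_abs, abs_of_nonneg hs.1]
      exact lt_of_le_of_lt (mul_le_of_le_one_left (norm_nonneg _) hs.2) hh
    have h2 := hball _ h1
    have h3 := ContinuousMap.dist_apply_le_dist (f := postcompCurve (K := K) (fderiv ℝ H)
      (hH.continuous_fderiv one_ne_zero) (γ + s • h)) (g := postcompCurve (K := K) (fderiv ℝ H)
      (hH.continuous_fderiv one_ne_zero) γ) k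
    rw [dist_eq_norm] at h3
    have : fderiv ℝ H (γ k + s • (γ k + h k - γ k)) - fderiv ℝ H (γ k)
        = postcompCurve (K := K) (fderiv ℝ H) (hH.continuous_fderiv one_ne_zero) (γ + s • h) k -
          postcompCurve (K := K) (fderiv ℝ H) (hH.continuous_fderiv one_ne_zero) γ k := by
      simp [postcompCurve]
    rw [this]
    exact h3.trans h2.le
  have := (convex_segment (γ k) (γ k + h k)).norm_image_sub_le_of_norm_hasFDerivWithin_le'
    (fun x _ => ((hH.differentiable one_ne_zero) x).hasFDerivAt.hasFDerivWithinAt) key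
    (left_mem_segment ..) (right_mem_segment ..)
  rw [add_sub_cancel_left] at this
  exact this.trans (mul_le_mul_of_nonneg_left (h.norm_coe_le_norm k) hε.le)

/-- The derivative at `γ` is post-composition with `fderiv ℝ H` followed by the bounded bilinear map
`pointwiseApply`, so it falls under the preceding order of smoothness with another target. This is
why the target `F` is quantified inside the induction. -/
lemma contDiff_postcompCurve_nat (n : ℕ) : ∀ {F : Type} [NormedAddCommGroup F] [NormedSpace ℝ F]
    {H : E → F} (hH : ContDiff ℝ n H), ContDiff ℝ n (postcompCurve (K := K) H hH.continuous) := by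
  induction n with
  | zero =>
    intro F _ _ H hH
    exact contDiff_zero.2 (ContinuousMap.continuous_postcomp _)
  | succ n ih =>
    intro F _ _ H hH
    have h1 : ContDiff ℝ 1 H := hH.of_le (by norm_cast; omega)
    have h2 : ContDiff ℝ n (fderiv ℝ H) := hH.fderiv_right (by norm_cast)
    have := (contDiff_succ_iff_hasFDerivAt (𝕜 := ℝ) (n := n)
      (f := postcompCurve (K := K) H hH.continuous)).2
      ⟨fun γ => pointwiseApply K E F (postcompCurve (fderiv ℝ H) h2.continuous γ),
        (pointwiseApply K E F).contDiff.comp (ih h2), fun γ => hasFDerivAt_postcompCurve h1 γ⟩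
    exact_mod_cast this

lemma contDiff_postcompCurve {H : E → F} (hH : ContDiff ℝ ∞ H) :
    ContDiff ℝ ∞ (postcompCurve (K := K) H hH.continuous) :=
  contDiff_infty.2 fun n => contDiff_postcompCurve_nat n (contDiff_infty.1 hH n)

variable [CompleteSpace E]

/-- The primitive vanishing at `0` of a continuous curve on `[0,1]`. -/
def primitiveCurve (E : Type) [NormedAddCommGroup E] [NormedSpace ℝ E] [CompleteSpace E] :
    C(I, E) →L[ℝ] C(I, E) :=
  LinearMap.mkContinuous
    { toFun := fun c => ⟨fun t => ∫ s in (0 : ℝ)..t, IccExtend zero_le_one c s, by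
        have : Continuous fun t : ℝ => ∫ s in (0 : ℝ)..t, IccExtend zero_le_one c s :=
          intervalIntegral.continuous_primitive
            (fun a b => (c.continuous.Icc_extend'.intervalIntegrable a b)) 0
        exact this.comp continuous_subtype_val⟩
      map_add' := fun c c' => by
        ext t
        simp only [ContinuousMap.coe_mk, ContinuousMap.add_apply]
        rw [← intervalIntegral.integral_add (c.continuous.Icc_extend'.intervalIntegrable _ _)
          (c'.continuous.Icc_extend'.intervalIntegrable _ _)]
        rfl
      map_smul' := fun r c => by
        ext t
        simp only [ContinuousMap.coe_mk, ContinuousMap.smul_apply, RingHom.id_apply]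
        rw [← intervalIntegral.integral_smul]
        rfl } 1
    (fun c => by
      rw [one_mul]
      refine (ContinuousMap.norm_le _ (norm_nonneg _)).2 fun t => ?_
      refine (intervalIntegral.norm_integral_le_of_norm_le_const (C := ‖c‖) fun s _ =>
        c.norm_coe_le_norm _).trans ?_
      rw [sub_zero, abs_of_nonneg t.2.1]
      exact mul_le_of_le_one_right (norm_nonneg _) t.2.2)

lemma hasDerivAt_primitiveCurve (c : C(I, E)) (t : ℝ) :
    HasDerivAt (fun t => ∫ s in (0 : ℝ)..t, IccExtend zero_le_one c s)
      (IccExtend zero_le_one c t) t :=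
  intervalIntegral.integral_hasDerivAt_right (c.continuous.Icc_extend'.intervalIntegrable _ _)
    (c.continuous.Icc_extend'.stronglyMeasurableAtFilter _ _) c.continuous.Icc_extend'.continuousAt

/-- Multiplication of curves by `exp (w t)`. -/
def expWeight (E : Type) [NormedAddCommGroup E] [NormedSpace ℝ E] (w : ℝ) :
    C(I, E) →L[ℝ] C(I, E) :=
  pointwiseApply I E E ⟨fun t => Real.exp (w * t) • ContinuousLinearMap.id ℝ E, by fun_prop⟩

@[simp] lemma expWeight_apply (w : ℝ) (c : C(I, E)) (t : I) :
    expWeight E w c t = Real.exp (w * t) • c t := rfl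

lemma expWeight_mul (w : ℝ) : expWeight E w * expWeight E (-w) = 1 := by
  ext c t
  simp [smul_smul, ← Real.exp_add]

/-- A Volterra operator need not have norm less than one, but conjugation by multiplication with
`exp (w t)` brings its norm below `‖A‖ / w`. For large `w` the Neumann series inverts the conjugated
operator. -/
lemma isUnit_one_sub_volterra (A : C(I, E →L[ℝ] E)) :
    IsUnit (1 - primitiveCurve E * pointwiseApply I E E A) := by
  set V := primitiveCurve E * pointwiseApply I E E A with hV
  set w : ℝ := ‖A‖ + 1 with hw
  have hwpos : 0 < w := by positivity
  have hbound : ‖expWeight E (-w) * V * expWeight E w‖ ≤ ‖A‖ / w := by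
    refine ContinuousLinearMap.opNorm_le_bound _ (by positivity) fun c => ?_
    refine (ContinuousMap.norm_le _ (by positivity)).2 fun t => ?_
    have e1 : (expWeight E (-w) * V * expWeight E w) c t
        = Real.exp (-w * t) • ∫ s in (0 : ℝ)..t,
          IccExtend zero_le_one (pointwiseApply I E E A (expWeight E w c)) s := rfl
    rw [e1, norm_smul, Real.norm_eq_abs, abs_of_pos (Real.exp_pos _)]
    have e2 : ‖∫ s in (0 : ℝ)..t,
        IccExtend zero_le_one (pointwiseApply I E E A (expWeight E w c)) s‖
        ≤ ∫ s in (0 : ℝ)..t, ‖A‖ * ‖c‖ * Real.exp (w * s) := by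
      refine intervalIntegral.norm_integral_le_of_norm_le t.2.1 (Eventually.of_forall ?_)
        (by apply Continuous.intervalIntegrable; fun_prop)
      intro s hs
      have hs' : s ∈ Icc (0 : ℝ) 1 := ⟨hs.1.le, hs.2.trans t.2.2⟩
      rw [IccExtend_of_mem _ _ hs', pointwiseApply_apply, expWeight_apply, map_smul, norm_smul,
        Real.norm_eq_abs, abs_of_pos (Real.exp_pos _), mul_comm]
      refine mul_le_mul_of_nonneg_right ?_ (Real.exp_pos _).le
      exact ((A _).le_opNorm _).trans
        (mul_le_mul (A.norm_coe_le_norm _) (c.norm_coe_le_norm _) (norm_nonneg _) (norm_nonneg _))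
    have e3 : ∫ s in (0 : ℝ)..t, ‖A‖ * ‖c‖ * Real.exp (w * s)
        = ‖A‖ * ‖c‖ * ((Real.exp (w * t) - 1) / w) := by
      rw [intervalIntegral.integral_const_mul, intervalIntegral.integral_comp_mul_left _ hwpos.ne',
        integral_exp]
      simp [div_eq_inv_mul]
    calc Real.exp (-w * t) * _ ≤ Real.exp (-w * t) * (‖A‖ * ‖c‖ * ((Real.exp (w * t) - 1) / w)) :=
          mul_le_mul_of_nonneg_left (e2.trans e3.le) (Real.exp_pos _).le
      _ = ‖A‖ / w * ‖c‖ * (1 - Real.exp (-w * t)) := by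
          have : Real.exp (-w * t) * Real.exp (w * t) = 1 := by
            rw [← Real.exp_add]; simp
          linear_combination (‖A‖ * ‖c‖ / w) * this
      _ ≤ ‖A‖ / w * ‖c‖ := mul_le_of_le_one_right (by positivity) (by linarith [Real.exp_pos (-w * t)])
  have hlt : ‖expWeight E (-w) * V * expWeight E w‖ < 1 :=
    hbound.trans_lt ((div_lt_one hwpos).2 (by linarith))
  have hu : IsUnit (1 - expWeight E (-w) * V * expWeight E w) :=
    isUnit_one_sub_of_norm_lt_one (x := expWeight E (-w) * V * expWeight E w) hlt
  have hw1 : expWeight E w * expWeight E (-w) = 1 := expWeight_mul w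
  have hw2 : expWeight E (-w) * expWeight E w = 1 := by simpa using expWeight_mul (E := E) (-w)
  let u : (C(I, E) →L[ℝ] C(I, E))ˣ := ⟨expWeight E w, expWeight E (-w), hw1, hw2⟩
  have : 1 - V = u * (1 - expWeight E (-w) * V * expWeight E w) * (u⁻¹ : (C(I, E) →L[ℝ] C(I, E))ˣ) := by
    change _ = expWeight E w * (1 - expWeight E (-w) * V * expWeight E w) * expWeight E (-w)
    rw [mul_sub, sub_mul, mul_one, hw1]
    congr 1
    rw [← mul_assoc, ← mul_assoc, hw1, one_mul, mul_assoc, hw1, mul_one]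
  rw [this]
  exact (u.isUnit.mul hu).mul (u⁻¹).isUnit

end CurveSpace

/-! ### Inverse functions near a compact set -/

section CompactInverse

/-- A map that is a local homeomorphism near a compact set and injective on it restricts to a
homeomorphism between open sets near the compact set. -/
lemma exists_openPartialHomeomorph_of_isCompact {X Z : Type*} [TopologicalSpace X]
    [TopologicalSpace Z] [T2Space Z] [Nonempty X] {f : X → Z} {C U : Set X} (hC : IsCompact C)
    (hinj : InjOn f C) (hU : IsOpen U) (hCU : C ⊆ U) (hf : IsLocalHomeomorphOn f U) :
    ∃ e : OpenPartialHomeomorph X Z, C ⊆ e.source ∧ e.source ⊆ U ∧ ⇑e = f := by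
  -- Injectivity on the compact set and local injectivity at each of its points give injectivity on
  -- a neighborhood of the set.
  obtain ⟨t, ht, htinj⟩ := hinj.exists_mem_nhdsSet hC
    (fun x hx => hf.continuousAt (hCU hx)) (fun x hx => by
      obtain ⟨e, hxe, rfl⟩ := hf x (hCU hx)
      exact ⟨e.source, e.open_source.mem_nhds hxe, e.injOn⟩)
  obtain ⟨V, hV, hCV, hVt⟩ := mem_nhdsSet_iff_exists.1 ht
  have hopen : ∀ O ⊆ U, IsOpen O → IsOpen (f '' O) := by
    intro O hO hOo
    rw [isOpen_iff_mem_nhds]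
    rintro _ ⟨x, hx, rfl⟩
    rw [← hf.map_nhds_eq (hO hx)]
    exact image_mem_map (hOo.mem_nhds hx)
  let e0 : PartialEquiv X Z := (htinj.mono (inter_subset_left.trans hVt) : InjOn f (V ∩ U)).toPartialEquiv
  refine ⟨OpenPartialHomeomorph.ofContinuousOpenRestrict e0
    (hf.continuousOn.mono inter_subset_right) ?_ (hV.inter hU), subset_inter hCV hCU,
    inter_subset_right, rfl⟩
  intro O hO
  obtain ⟨O', hO', rfl⟩ := isOpen_induced_iff.1 hO
  have : (e0.source.domRestrict e0) '' (Subtype.val ⁻¹' O') = f '' (O' ∩ (V ∩ U)) := by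
    ext z
    constructor
    · rintro ⟨x, hx, rfl⟩
      exact ⟨x, ⟨hx, x.2⟩, rfl⟩
    · rintro ⟨x, ⟨hx, hx'⟩, rfl⟩
      exact ⟨⟨x, hx'⟩, hx, rfl⟩
  rw [this]
  exact hopen _ (fun x hx => hx.2.2) (hO'.inter (hV.inter hU))

/-- The inverse function theorem along a compact set. -/
lemma exists_smooth_inverse_of_isCompact {E F : Type*} [NormedAddCommGroup E] [NormedSpace ℝ E]
    [CompleteSpace E] [NormedAddCommGroup F] [NormedSpace ℝ F] {f : E → F} {C U : Set E}
    (hC : IsCompact C) (hinj : InjOn f C) (hU : IsOpen U) (hCU : C ⊆ U)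
    (hf : ContDiffOn ℝ ∞ f U) (hd : ∀ x ∈ C, ∃ f' : E ≃L[ℝ] F, HasFDerivAt f (f' : E →L[ℝ] F) x) :
    ∃ e : OpenPartialHomeomorph E F, C ⊆ e.source ∧ e.source ⊆ U ∧ ⇑e = f ∧
      ContDiffOn ℝ ∞ e.symm e.target := by
  -- Invertible operators form an open set, so the derivative stays invertible near `C`.
  let U' : Set E := U ∩ fderiv ℝ f ⁻¹' (range ((↑) : (E ≃L[ℝ] F) → (E →L[ℝ] F)))
  have hU' : IsOpen U' :=
    (hf.continuousOn_fderiv_of_isOpen hU (by simp)).isOpen_inter_preimage hU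
      ContinuousLinearEquiv.isOpen
  have hfat : ∀ x ∈ U, ContDiffAt ℝ ∞ f x := fun x hx => hf.contDiffAt (hU.mem_nhds hx)
  have hder : ∀ x ∈ U', ∃ f' : E ≃L[ℝ] F, HasFDerivAt f (f' : E →L[ℝ] F) x := by
    rintro x ⟨hx, f', hf'⟩
    exact ⟨f', hf' ▸ ((hfat x hx).differentiableAt (by simp)).hasFDerivAt⟩
  have hloc : IsLocalHomeomorphOn f U' := by
    intro x hx
    obtain ⟨f', hf'⟩ := hder x hx
    exact ⟨(hfat x hx.1).toOpenPartialHomeomorph f hf' (by simp),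
      (hfat x hx.1).mem_toOpenPartialHomeomorph_source hf' (by simp), rfl⟩
  obtain ⟨e, hCe, heU, he⟩ := exists_openPartialHomeomorph_of_isCompact hC hinj hU'
    (fun x hx => ⟨hCU hx, by
      obtain ⟨f', hf'⟩ := hd x hx
      exact ⟨f', hf'.fderiv.symm⟩⟩) hloc
  refine ⟨e, hCe, heU.trans inter_subset_left, he, fun z hz => ?_⟩
  obtain ⟨f', hf'⟩ := hder _ (heU (e.map_target hz))
  have h1 := hfat _ (heU (e.map_target hz)).1
  rw [← he] at hf' h1
  exact (e.contDiffAt_symm hz hf' h1).contDiffWithinAt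

end CompactInverse

/-! ### Flows near stationary points and transport of kernels of one-forms -/

section Flow

open unitInterval

variable {E : Type} [NormedAddCommGroup E] [NormedSpace ℝ E] [FiniteDimensional ℝ E]

/-- A smooth function near a compact set agrees near that set with a globally smooth function. -/
lemma exists_contDiff_eqOn_of_isCompact {P F : Type*} [NormedAddCommGroup P] [NormedSpace ℝ P]
    [FiniteDimensional ℝ P] [NormedAddCommGroup F] [NormedSpace ℝ F] {X : P → F} {K U : Set P}
    (hK : IsCompact K) (hU : IsOpen U) (hKU : K ⊆ U) (hX : ContDiffOn ℝ ∞ X U) :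
    ∃ (X' : P → F) (V : Set P), ContDiff ℝ ∞ X' ∧ IsOpen V ∧ K ⊆ V ∧ V ⊆ U ∧ EqOn X' X V := by
  obtain ⟨O, hO, hKO, hOU⟩ := normal_exists_closure_subset hK.isClosed hU hKU
  obtain ⟨χ, h1, h0, -⟩ := exists_contMDiffMap_one_nhds_of_subset_interior (n := ⊤) 𝓘(ℝ, P)
    hK.isClosed (t := O) (by rwa [hO.interior_eq])
  obtain ⟨V, hV, hKV, hV1⟩ := mem_nhdsSet_iff_exists.1 h1
  refine ⟨fun p => χ p • X p, V ∩ U, ?_, hV.inter hU, subset_inter hKV hKU, inter_subset_right,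
    fun p hp => ?_⟩
  · rw [contDiff_iff_contDiffAt]
    intro p
    by_cases hp : p ∈ U
    · exact (χ.contMDiff.contDiff.contDiffAt).smul (hX.contDiffAt (hU.mem_nhds hp))
    · have : (fun p => χ p • X p) =ᶠ[𝓝 p] fun _ => 0 := by
        filter_upwards [isClosed_closure.isOpen_compl.mem_nhds (fun h => hp (hOU h))] with q hq
        simp [h0 q (fun h => hq (subset_closure h))]
      exact contDiffAt_const.congr_of_eventuallyEq this
  · have h2 : χ p = 1 := hV1 hp.1
    simp [h2]

/-- The flow of a time dependent vector field near a compact set of stationary points, as a smooth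
map into the space of curves `[0,1] → E`, together with its variational equation. -/
lemma exists_flow_near_stationary {C : Set E} (hC : IsCompact C) {X : ℝ × E → E} {U : Set (ℝ × E)}
    (hU : IsOpen U) (hCU : Icc (0 : ℝ) 1 ×ˢ C ⊆ U) (hX : ContDiffOn ℝ ∞ X U)
    (hX0 : ∀ t ∈ Icc (0 : ℝ) 1, ∀ c ∈ C, X (t, c) = 0) :
    ∃ (S : E → C(I, E)) (O : Set E), IsOpen O ∧ C ⊆ O ∧ ContDiffOn ℝ ∞ S O ∧
      (∀ c ∈ C, ∀ t, S c t = c) ∧ ∀ x ∈ O, ∃ (γ : ℝ → E), γ 0 = x ∧ (∀ t : I, γ t = S x t) ∧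
        (∀ t : I, ((t : ℝ), γ t) ∈ U) ∧ (∀ t : I, HasDerivAt γ (X (t, γ t)) t) ∧
        ∀ v, ∃ q : ℝ → E, q 0 = v ∧ (∀ t : I, q t = fderiv ℝ S x v t) ∧
          ∀ t : I, HasDerivAt q (fderiv ℝ X (t, γ t) (0, q t)) t := by
  have hcomp : CompleteSpace E := FiniteDimensional.complete ℝ E
  obtain ⟨X', V, hX', hV, hCV, hVU, hXX'⟩ :=
    exists_contDiff_eqOn_of_isCompact (isCompact_Icc.prod hC) hU hCU hX
  let T : C(I, ℝ) := ⟨fun t => t, continuous_subtype_val⟩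
  let inr : C(I, E) →L[ℝ] C(I, ℝ × E) :=
    (ContinuousLinearMap.inr ℝ ℝ E).compLeftContinuous ℝ I
  let inl : C(I, ℝ) →L[ℝ] C(I, ℝ × E) :=
    (ContinuousLinearMap.inl ℝ ℝ E).compLeftContinuous ℝ I
  let N : C(I, E) → C(I, E) := fun γ => postcompCurve X' hX'.continuous (inl T + inr γ)
  have hNapp : ∀ γ t, N γ t = X' (t, γ t) := fun γ t => by
    change X' (((t : ℝ), (0 : E)) + ((0 : ℝ), γ t)) = _
    simp
  let dN : C(I, E) → C(I, E) →L[ℝ] C(I, E) := fun γ =>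
    (pointwiseApply I (ℝ × E) E (postcompCurve (fderiv ℝ X')
      (hX'.continuous_fderiv (by simp)) (inl T + inr γ))).comp inr
  have hN : ContDiff ℝ ∞ N :=
    (contDiff_postcompCurve hX').comp (contDiff_const.add inr.contDiff)
  have hdN : ∀ γ, HasFDerivAt N (dN γ) γ := fun γ =>
    (hasFDerivAt_postcompCurve (hX'.of_le (by simp)) _).comp γ (inr.hasFDerivAt.const_add _)
  have hdNapp : ∀ γ q t, dN γ q t = fderiv ℝ X' (t, γ t) (0, q t) := fun γ q t => by
    change fderiv ℝ X' (((t : ℝ), (0 : E)) + ((0 : ℝ), γ t)) (0, q t) = _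
    simp
  let cst : E →L[ℝ] C(I, E) := ContinuousLinearMap.const ℝ I
  -- The second component vanishes at `(x, γ)` exactly when `γ` solves the integral equation of the
  -- flow with initial value `x`. Inverting `H` near the pairs of a stationary point and its
  -- constant curve gives all nearby trajectories up to time one, as smooth functions of `x`.
  let H : E × C(I, E) → E × C(I, E) := fun p =>
    (p.1, p.2 - cst p.1 - primitiveCurve E (N p.2))
  have hH : ContDiff ℝ ∞ H := contDiff_fst.prodMk
    ((contDiff_snd.sub (cst.contDiff.comp contDiff_fst)).sub
      ((primitiveCurve E).contDiff.comp (hN.comp contDiff_snd)))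
  let C' : Set (E × C(I, E)) := (fun c => (c, cst c)) '' C
  have hC' : IsCompact C' := hC.image (by fun_prop)
  have hinj : InjOn H C' := by
    rintro _ ⟨c, -, rfl⟩ _ ⟨c', -, rfl⟩ h
    have : c = c' := congrArg Prod.fst h
    rw [this]
  have hder : ∀ p ∈ C', ∃ f' : (E × C(I, E)) ≃L[ℝ] (E × C(I, E)),
      HasFDerivAt H (f' : (E × C(I, E)) →L[ℝ] (E × C(I, E))) p := by
    rintro p ⟨c, hc, rfl⟩
    -- At a constant curve, the derivative of `H` in the second variable is the identity minus a
    -- Volterra operator.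
    have hu : IsUnit (1 - primitiveCurve E * dN (cst c)) := by
      let A : C(I, E →L[ℝ] E) := ⟨fun t => (fderiv ℝ X' (t, c)).comp (ContinuousLinearMap.inr ℝ ℝ E),
        ((hX'.continuous_fderiv (by simp)).comp (by fun_prop)).clm_comp_const _⟩
      have : dN (cst c) = pointwiseApply I E E A := by
        ext q t
        rw [hdNapp]
        rfl
      rw [this]
      exact isUnit_one_sub_volterra A
    obtain ⟨u, hu⟩ := hu
    let uinv : C(I, E) →L[ℝ] C(I, E) := ((u⁻¹ : (C(I, E) →L[ℝ] C(I, E))ˣ) : C(I, E) →L[ℝ] C(I, E))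
    have hu1 : ∀ q, u.1 (uinv q) = q := fun q => by
      exact congrArg (fun f : C(I, E) →L[ℝ] C(I, E) => f q) u.mul_inv
    have hu2 : ∀ q, uinv (u.1 q) = q := fun q => by
      exact congrArg (fun f : C(I, E) →L[ℝ] C(I, E) => f q) u.inv_mul
    let f1 : (E × C(I, E)) →L[ℝ] (E × C(I, E)) :=
      (ContinuousLinearMap.fst ℝ _ _).prod
        (u.1.comp (ContinuousLinearMap.snd ℝ _ _) - cst.comp (ContinuousLinearMap.fst ℝ _ _))
    let f2 : (E × C(I, E)) →L[ℝ] (E × C(I, E)) :=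
      (ContinuousLinearMap.fst ℝ _ _).prod
        (uinv.comp (ContinuousLinearMap.snd ℝ _ _ + cst.comp (ContinuousLinearMap.fst ℝ _ _)))
    refine ⟨ContinuousLinearEquiv.equivOfInverse f1 f2 (fun p => ?_) (fun p => ?_), ?_⟩
    · refine Prod.ext rfl ?_
      change uinv ((u.1 p.2 - cst p.1) + cst p.1) = p.2
      rw [sub_add_cancel, hu2]
    · refine Prod.ext rfl ?_
      change u.1 (uinv (p.2 + cst p.1)) - cst p.1 = p.2
      rw [hu1, add_sub_cancel_right]
    · have h1 : HasFDerivAt H ((ContinuousLinearMap.fst ℝ _ _).prod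
          (ContinuousLinearMap.snd ℝ _ _ - cst.comp (ContinuousLinearMap.fst ℝ _ _) -
            (primitiveCurve E).comp ((dN (cst c)).comp (ContinuousLinearMap.snd ℝ _ _))))
          (c, cst c) := by
        have ha : HasFDerivAt (fun p : E × C(I, E) => N p.2)
            ((dN (cst c)).comp (ContinuousLinearMap.snd ℝ _ _)) (c, cst c) :=
          HasFDerivAt.comp (g := N) (f := Prod.snd) (c, cst c) (hdN (cst c)) hasFDerivAt_snd
        exact hasFDerivAt_fst.prodMk ((hasFDerivAt_snd.sub
          (cst.hasFDerivAt.comp _ hasFDerivAt_fst)).sub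
          ((primitiveCurve E).hasFDerivAt.comp _ ha))
      convert h1 using 1
      refine ContinuousLinearMap.ext fun p => Prod.ext rfl ?_
      change u.1 p.2 - cst p.1 = _
      rw [hu]
      change p.2 - primitiveCurve E (dN (cst c) p.2) - cst p.1 =
        p.2 - cst p.1 - primitiveCurve E (dN (cst c) p.2)
      abel
  obtain ⟨e, hCe, -, he, hesymm⟩ := exists_smooth_inverse_of_isCompact hC' hinj isOpen_univ
    (subset_univ _) hH.contDiffOn hder
  have hNc : ∀ c ∈ C, N (cst c) = 0 := fun c hc => by
    ext t
    rw [hNapp, hXX' (hCV ⟨t.2, hc⟩)]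
    exact hX0 t t.2 c hc
  have hHc : ∀ c ∈ C, H (c, cst c) = (c, 0) := fun c hc => by
    simp [H, hNc c hc]
  let S : E → C(I, E) := fun x => (e.symm (x, 0)).2
  let O1 : Set E := (fun x => ((x, 0) : E × C(I, E))) ⁻¹' e.target
  have hO1 : IsOpen O1 := e.open_target.preimage (by fun_prop)
  have hS : ContDiffOn ℝ ∞ S O1 :=
    contDiff_snd.comp_contDiffOn (hesymm.comp (by fun_prop) fun x hx => hx)
  have hSc : ∀ c ∈ C, S c = cst c := fun c hc => by
    change (e.symm (c, 0)).2 = _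
    rw [← hHc c hc, ← he, e.left_inv (hCe ⟨c, hc, rfl⟩)]
  have hCO1 : C ⊆ O1 := fun c hc => by
    change (c, 0) ∈ e.target
    rw [← hHc c hc, ← he]
    exact e.map_source (hCe ⟨c, hc, rfl⟩)
  -- For initial values in `O` the whole trajectory stays in `V`, where the globally defined `X'`
  -- agrees with `X`.
  let O : Set E := O1 ∩ S ⁻¹' {γ | MapsTo (inl T + inr γ) univ V}
  have hO : IsOpen O := hS.continuousOn.isOpen_inter_preimage hO1
    ((ContinuousMap.isOpen_setOfPred_mapsTo isCompact_univ hV).preimage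
      (continuous_const.add inr.continuous))
  have hfix : ∀ x ∈ O1, S x = cst x + primitiveCurve E (N (S x)) := fun x hx => by
    have h1 : H (e.symm (x, 0)) = (x, 0) := by
      rw [← he]
      exact e.right_inv hx
    have h2 : (e.symm (x, 0)).1 = x := congrArg Prod.fst h1
    have h3 : S x - cst (e.symm (x, 0)).1 - primitiveCurve E (N (S x)) = 0 := congrArg Prod.snd h1
    rw [h2, sub_sub, sub_eq_zero] at h3
    exact h3
  refine ⟨S, O, hO, fun c hc => ⟨hCO1 hc, fun t _ => ?_⟩, hS.mono inter_subset_left,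
    fun c hc t => by rw [hSc c hc]; rfl, fun x hx => ?_⟩
  · change (((t : ℝ), (0 : E)) + ((0 : ℝ), S c t)) ∈ V
    rw [hSc c hc]
    simpa using hCV ⟨t.2, hc⟩
  have hxV : ∀ t : I, ((t : ℝ), S x t) ∈ V := fun t => by
    have : (((t : ℝ), (0 : E)) + ((0 : ℝ), S x t)) ∈ V := hx.2 (mem_univ t)
    simpa using this
  let γ : ℝ → E := fun t => x + ∫ s in (0 : ℝ)..t, IccExtend zero_le_one (N (S x)) s
  have hγS : ∀ t : I, γ t = S x t := fun t => by
    conv_rhs => rw [hfix x hx.1]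
    rfl
  refine ⟨γ, by simp [γ], hγS, fun t => by rw [hγS]; exact hVU (hxV t), fun t => ?_, fun v => ?_⟩
  · have h1 := (hasDerivAt_primitiveCurve (N (S x)) t).const_add x
    rw [IccExtend_val, hNapp, hXX' (hxV t), ← hγS] at h1
    exact h1
  let Q : C(I, E) := fderiv ℝ S x v
  -- The integrated variational equation, by differentiation of the fixed point equation `hfix`.
  have hQ : Q = cst v + primitiveCurve E (dN (S x) Q) := by
    have hSx : HasFDerivAt S (fderiv ℝ S x) x :=
      ((hS.contDiffAt (hO1.mem_nhds hx.1)).differentiableAt (by simp)).hasFDerivAt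
    have h1 : HasFDerivAt (fun x => cst x + primitiveCurve E (N (S x)))
        (cst + (primitiveCurve E).comp ((dN (S x)).comp (fderiv ℝ S x))) x :=
      cst.hasFDerivAt.add ((primitiveCurve E).hasFDerivAt.comp x ((hdN (S x)).comp x hSx))
    have h2 := h1.congr_of_eventuallyEq (f₁ := S)
      (by filter_upwards [hO1.mem_nhds hx.1] with y hy using hfix y hy)
    exact congrArg (fun f : E →L[ℝ] C(I, E) => f v) (hSx.unique h2)
  let q : ℝ → E := fun t => v + ∫ s in (0 : ℝ)..t, IccExtend zero_le_one (dN (S x) Q) s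
  have hqQ : ∀ t : I, q t = Q t := fun t => by
    conv_rhs => rw [hQ]
    rfl
  refine ⟨q, by simp [q], hqQ, fun t => ?_⟩
  have h1 := (hasDerivAt_primitiveCurve (dN (S x) Q) t).const_add v
  rw [IccExtend_val, hdNapp, ← hqQ, ← hγS] at h1
  have h2 : fderiv ℝ X ((t : ℝ), γ t) = fderiv ℝ X' (t, γ t) := by
    refine Filter.EventuallyEq.fderiv_eq ?_
    filter_upwards [hV.mem_nhds (hγS t ▸ hxV t)] with p hp using (hXX' hp).symm
  rw [h2]
  exact h1

/-- Transport of the kernel of a time dependent one-form `a` along the flow of a vector field `X`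
tangent to it, provided that `∂ₜ a + dₓa (X, ·) = h • a`. -/
lemma exists_kernel_transport {C : Set E} (hC : IsCompact C) {X : ℝ × E → E}
    {a : ℝ × E → E →L[ℝ] ℝ} {h : ℝ × E → ℝ} {U : Set (ℝ × E)}
    (hU : IsOpen U) (hCU : Icc (0 : ℝ) 1 ×ˢ C ⊆ U) (hX : ContDiffOn ℝ ∞ X U)
    (ha : ContDiffOn ℝ ∞ a U) (hh : ContinuousOn h U)
    (hX0 : ∀ t ∈ Icc (0 : ℝ) 1, ∀ c ∈ C, X (t, c) = 0) (haX : ∀ p ∈ U, a p (X p) = 0)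
    (heq : ∀ p ∈ U, ∀ w, fderiv ℝ a p (1, X p) w - fderiv ℝ a p (0, w) (X p) = h p * a p w) :
    ∃ (φ : E → E) (O : Set E), IsOpen O ∧ C ⊆ O ∧ ContDiffOn ℝ ∞ φ O ∧ (∀ c ∈ C, φ c = c) ∧
      ∀ x ∈ O, (1, φ x) ∈ U ∧ (∀ v, a (1, φ x) (fderiv ℝ φ x v) = 0 ↔ a (0, x) v = 0) ∧
        ∃ γ : ℝ → E, γ 0 = x ∧ γ 1 = φ x ∧ ∀ t : I, HasDerivAt γ (X (t, γ t)) t := by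
  obtain ⟨S, O, hO, hCO, hS, hSc, hflow⟩ := exists_flow_near_stationary hC hU hCU hX hX0
  let ev : C(I, E) →L[ℝ] E := ContinuousMap.evalCLM ℝ (1 : I)
  refine ⟨fun x => ev (S x), O, hO, hCO, ev.contDiff.comp_contDiffOn hS,
    fun c hc => hSc c hc 1, fun x hx => ?_⟩
  obtain ⟨γ, hγ0, hγS, hγU, hγ, hvar⟩ := hflow x hx
  have hφ : ev (S x) = γ 1 := (hγS 1).symm
  beta_reduce
  rw [hφ]
  refine ⟨hγU 1, fun v => ?_, γ, hγ0, rfl, hγ⟩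
  obtain ⟨q, hq0, hqS, hq⟩ := hvar v
  have hdφ : fderiv ℝ (fun x => ev (S x)) x v = q 1 := by
    have hSx : HasFDerivAt S (fderiv ℝ S x) x :=
      ((hS.contDiffAt (hO.mem_nhds hx)).differentiableAt (by simp)).hasFDerivAt
    have h1 : HasFDerivAt (fun x => ev (S x)) (ev.comp (fderiv ℝ S x)) x := ev.hasFDerivAt.comp x hSx
    rw [h1.fderiv]
    exact (hqS 1).symm
  rw [hdφ]
  have hcont : Continuous fun t : I => h (t, γ t) := by
    have h1 : Continuous fun t : I => ((t : ℝ), γ t) :=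
      continuous_subtype_val.prodMk (continuous_iff_continuousAt.2 fun t =>
        (hγ t).continuousAt.comp continuous_subtype_val.continuousAt)
    exact hh.comp_continuous h1 hγU
  let κ : C(I, ℝ) := ⟨fun t : I => h (t, γ t), hcont⟩
  let m : ℝ → ℝ := fun t => ∫ s in (0 : ℝ)..t, IccExtend zero_le_one κ s
  have hm : ∀ t : I, HasDerivAt m (h (t, γ t)) t := fun t => by
    have := hasDerivAt_primitiveCurve κ t
    rwa [IccExtend_val] at this
  -- The value of the moving form on the transported vector. It solves the scalar linear equation
  -- `g' = h g`, so it vanishes at time one if and only if it vanishes at time zero.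
  let g : ℝ → ℝ := fun t => a (t, γ t) (q t)
  have hg : ∀ t : I, HasDerivAt g (h (t, γ t) * g t) t := fun t => by
    have hUn := hU.mem_nhds (hγU t)
    have ha' : HasFDerivAt a (fderiv ℝ a (t, γ t)) (t, γ t) :=
      ((ha.contDiffAt hUn).differentiableAt (by simp)).hasFDerivAt
    have hX' : HasFDerivAt X (fderiv ℝ X (t, γ t)) (t, γ t) :=
      ((hX.contDiffAt hUn).differentiableAt (by simp)).hasFDerivAt
    have h1 : HasDerivAt (fun t => a (t, γ t)) (fderiv ℝ a (t, γ t) (1, X (t, γ t))) t :=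
      ha'.comp_hasDerivAt (t : ℝ) ((hasDerivAt_id (t : ℝ)).prodMk (hγ t))
    have h2 := h1.clm_apply (hq t)
    -- The identity `a(X) = 0`, differentiated in the direction of the transported vector. It trades
    -- the term with the derivative of `X` for the second half of the exterior derivative.
    have h3 : fderiv ℝ a (t, γ t) (0, q t) (X (t, γ t)) +
        a (t, γ t) (fderiv ℝ X (t, γ t) (0, q t)) = 0 := by
      have h4 := (ha'.clm_apply hX').congr_of_eventuallyEq (f₁ := fun _ => (0 : ℝ))
        (by filter_upwards [hUn] with p hp using (haX p hp).symm)
      have := congrArg (fun f : (ℝ × E) →L[ℝ] ℝ => f (0, q t)) (h4.unique (hasFDerivAt_const _ _))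
      simp only [add_apply, ContinuousLinearMap.comp_apply,
        ContinuousLinearMap.flip_apply, zero_apply] at this
      linarith
    have h5 := heq _ (hγU t) (q t)
    refine h2.congr_deriv ?_
    change _ = h (t, γ t) * a (t, γ t) (q t)
    linarith
  have hconst : ∀ t ∈ Icc (0 : ℝ) 1, g t * Real.exp (-m t) = g 0 * Real.exp (-m 0) := by
    have hd : ∀ t ∈ Icc (0 : ℝ) 1, HasDerivAt (fun t => g t * Real.exp (-m t)) 0 t := fun t ht => by
      refine ((hg ⟨t, ht⟩).mul ((hm ⟨t, ht⟩).neg.exp)).congr_deriv ?_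
      ring
    exact constant_of_has_deriv_right_zero (fun t ht => (hd t ht).continuousAt.continuousWithinAt)
      fun t ht => (hd t ⟨ht.1, ht.2.le⟩).hasDerivWithinAt
  have h1 := hconst 1 (by simp)
  have hg0 : g 0 = a (0, x) v := by simp only [g, hγ0, hq0]
  have hg1 : g 1 = a (1, γ 1) (q 1) := rfl
  rw [← hg0, ← hg1]
  constructor
  · intro h0
    rw [h0, zero_mul] at h1
    exact (mul_eq_zero.1 h1.symm).resolve_right (Real.exp_ne_zero _)
  · intro h0
    rw [h0, zero_mul] at h1
    exact (mul_eq_zero.1 h1).resolve_right (Real.exp_ne_zero _)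

end Flow

/-! ### One-forms on vector spaces and the Moser method -/

lemma two_le_infty : (2 : WithTop ℕ∞) ≤ ∞ := ENat.LEInfty.out

section VectorForms

variable {E F : Type*} [NormedAddCommGroup E] [NormedSpace ℝ E]
  [NormedAddCommGroup F] [NormedSpace ℝ F]

/-- The exterior derivative of a one-form on a vector space. -/
def dForm (a : E → E →L[ℝ] ℝ) (z u v : E) : ℝ := fderiv ℝ a z u v - fderiv ℝ a z v u

/-- The pullback of a one-form between vector spaces. -/
def pullForm (f : E → F) (a : F → F →L[ℝ] ℝ) (z : E) : E →L[ℝ] ℝ := (a (f z)).comp (fderiv ℝ f z)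

lemma ContDiffOn.pullForm {f : E → F} {a : F → F →L[ℝ] ℝ} {s : Set E} {t : Set F} (hs : IsOpen s)
    (hf : ContDiffOn ℝ ∞ f s) (ha : ContDiffOn ℝ ∞ a t) (hst : MapsTo f s t) :
    ContDiffOn ℝ ∞ (pullForm f a) s :=
  (ha.comp hf hst).clm_comp (hf.fderiv_of_isOpen hs (by simp))

lemma dForm_congr {a b : E → E →L[ℝ] ℝ} {z : E} (h : a =ᶠ[𝓝 z] b) (u v : E) :
    dForm a z u v = dForm b z u v := by
  rw [dForm, dForm, h.fderiv_eq]

lemma dForm_swap (a : E → E →L[ℝ] ℝ) (z u v : E) : dForm a z u v = -dForm a z v u := by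
  simp only [dForm]; ring

/-- The second derivative of `f` enters both terms of the antisymmetrization and cancels by its
symmetry. -/
lemma dForm_pullForm {f : E → F} {a : F → F →L[ℝ] ℝ} {z : E} (hf : ContDiffAt ℝ 2 f z)
    (ha : DifferentiableAt ℝ a (f z)) (u v : E) :
    dForm (pullForm f a) z u v = dForm a (f z) (fderiv ℝ f z u) (fderiv ℝ f z v) := by
  have h1 : HasFDerivAt (fun z => a (f z)) ((fderiv ℝ a (f z)).comp (fderiv ℝ f z)) z :=
    ha.hasFDerivAt.comp z (hf.differentiableAt (by simp)).hasFDerivAt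
  have h2 : HasFDerivAt (fderiv ℝ f) (fderiv ℝ (fderiv ℝ f) z) z :=
    ((hf.fderiv_right (m := 1) (by norm_num)).differentiableAt (by simp)).hasFDerivAt
  have h3 := (h1.clm_comp h2).fderiv
  have hsymm : IsSymmSndFDerivAt ℝ f z := hf.isSymmSndFDerivAt (by simp)
  change fderiv ℝ (fun z => (a (f z)).comp (fderiv ℝ f z)) z u v -
    fderiv ℝ (fun z => (a (f z)).comp (fderiv ℝ f z)) z v u = _
  rw [h3]
  simp only [add_apply, ContinuousLinearMap.comp_apply, ContinuousLinearMap.compL_apply,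
    ContinuousLinearMap.flip_apply]
  rw [hsymm u v, dForm]
  ring

end VectorForms

section Moser

set_option synthInstance.maxHeartbeats 400000

variable {W : Type} [NormedAddCommGroup W] [InnerProductSpace ℝ W] [FiniteDimensional ℝ W]

instance instNormedAddCommGroupDual : NormedAddCommGroup (W →L[ℝ] ℝ) :=
  ContinuousLinearMap.toNormedAddCommGroup

instance instNormedAddCommGroupBilin : NormedAddCommGroup (W →L[ℝ] W →L[ℝ] ℝ) :=
  ContinuousLinearMap.toNormedAddCommGroup

instance instNormedSpaceBilin : NormedSpace ℝ (W →L[ℝ] W →L[ℝ] ℝ) :=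
  ContinuousLinearMap.toNormedSpace

instance instNormedAddCommGroupMoser : NormedAddCommGroup ((W × ℝ) →L[ℝ] ((W →L[ℝ] ℝ) × ℝ)) :=
  ContinuousLinearMap.toNormedAddCommGroup

instance instNormedSpaceMoser : NormedSpace ℝ ((W × ℝ) →L[ℝ] ((W →L[ℝ] ℝ) × ℝ)) :=
  ContinuousLinearMap.toNormedSpace

/-- The inner product as a bilinear form. -/
def innerForm (W : Type) [NormedAddCommGroup W] [InnerProductSpace ℝ W] : W →L[ℝ] W →L[ℝ] ℝ :=
  innerSL ℝ

/-- The bilinear form `⟪Q ·, Q ·⟫`. -/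
def squareForm (Q : W →L[ℝ] W) : W →L[ℝ] W →L[ℝ] ℝ :=
  ((ContinuousLinearMap.compL ℝ W W ℝ).flip Q).comp ((innerForm W).comp Q)

lemma squareForm_apply (Q : W →L[ℝ] W) (u v : W) : squareForm Q u v = inner ℝ (Q u) (Q v) := rfl

lemma ContDiffOn.squareForm {X : Type*} [NormedAddCommGroup X] [NormedSpace ℝ X] {s : Set X}
    {Q : X → W →L[ℝ] W} (hQ : ContDiffOn ℝ ∞ Q s) :
    ContDiffOn ℝ ∞ (fun x => squareForm (Q x)) s := by
  have h1 : ContDiffOn ℝ ∞ (fun x => (ContinuousLinearMap.compL ℝ W W ℝ).flip (Q x)) s :=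
    (ContinuousLinearMap.contDiff _).comp_contDiffOn hQ
  exact h1.clm_comp (contDiffOn_const.clm_comp hQ)

/-- The linear operator of the Moser method, `(X, h) ↦ (Ω(X, ·) - h a, a(X))`. -/
def moserOperator (W : Type) [NormedAddCommGroup W] [InnerProductSpace ℝ W]
    [FiniteDimensional ℝ W] :
    ((W →L[ℝ] W →L[ℝ] ℝ) × (W →L[ℝ] ℝ)) →L[ℝ] ((W × ℝ) →L[ℝ] ((W →L[ℝ] ℝ) × ℝ)) :=
  LinearMap.toContinuousLinearMap
    { toFun := fun q : (W →L[ℝ] W →L[ℝ] ℝ) × (W →L[ℝ] ℝ) => LinearMap.toContinuousLinearMap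
        { toFun := fun p : W × ℝ => (q.1 p.1 - p.2 • q.2, q.2 p.1)
          map_add' := fun p p' => by
            simp only [Prod.fst_add, Prod.snd_add, map_add, add_smul, Prod.mk_add_mk]
            congr 1
            abel
          map_smul' := fun r p => by simp [smul_sub, smul_smul] }
      map_add' := fun q q' => by
        refine ContinuousLinearMap.ext fun p => ?_
        change (_, _) = ((_, _) : (W →L[ℝ] ℝ) × ℝ) + (_, _)
        simp only [Prod.fst_add, Prod.snd_add, add_apply, smul_add, Prod.mk_add_mk]
        congr 1
        abel
      map_smul' := fun r q => by
        refine ContinuousLinearMap.ext fun p => ?_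
        change (_, _) = r • ((_, _) : (W →L[ℝ] ℝ) × ℝ)
        simp [smul_sub, smul_comm r] }

lemma moserOperator_eq_iff (Ω : W →L[ℝ] W →L[ℝ] ℝ) (a b : W →L[ℝ] ℝ) (p : W × ℝ) :
    moserOperator W (Ω, a) p = (b, 0) ↔ (∀ w, Ω p.1 w - p.2 * a w = b w) ∧ a p.1 = 0 := by
  change (Ω p.1 - p.2 • a, a p.1) = (b, 0) ↔ _
  rw [Prod.mk.injEq, ContinuousLinearMap.ext_iff]
  rfl

set_option maxHeartbeats 1000000 in
/-- The Moser method for one-forms that are pulled back from a smooth retract (the image of `ϖ`) of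
an open subset of a vector space, near a compact set `C`. -/
theorem exists_moser {C Z : Set W} (hC : IsCompact C) (hZ : IsOpen Z) (hCZ : C ⊆ Z)
    {ϖ : W → W} {a τ : W → W →L[ℝ] ℝ} (hϖ : ContDiffOn ℝ ∞ ϖ Z) (hϖZ : MapsTo ϖ Z Z)
    (hϖϖ : ∀ z ∈ Z, ϖ (ϖ z) = ϖ z) (hϖC : ∀ c ∈ C, ϖ c = c)
    (ha : ContDiffOn ℝ ∞ a Z) (hτ : ContDiffOn ℝ ∞ τ Z)
    (haϖ : ∀ z ∈ Z, a z = pullForm ϖ a z) (hτϖ : ∀ z ∈ Z, τ z = pullForm ϖ τ z)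
    (hτC : ∀ c ∈ C, τ c = 0) (haC : ∀ c ∈ C, a c ≠ 0)
    (hnd : ∀ c ∈ C, ∀ t ∈ Icc (0 : ℝ) 1, ∀ X, fderiv ℝ ϖ c X = X → a c X = 0 →
      (∀ w, fderiv ℝ ϖ c w = w → a c w = 0 → dForm a c X w + t * dForm τ c X w = 0) → X = 0) :
    ∃ (φ : W → W) (O : Set W), IsOpen O ∧ C ⊆ O ∧ ContDiffOn ℝ ∞ φ O ∧ (∀ c ∈ C, φ c = c) ∧
      ∀ x ∈ O, φ x ∈ Z ∧ ∀ v, (a + τ) (φ x) (fderiv ℝ φ x v) = 0 ↔ a x v = 0 := by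
  have hatϖ : ∀ z ∈ Z, ContDiffAt ℝ ∞ ϖ z := fun z hz => hϖ.contDiffAt (hZ.mem_nhds hz)
  have hata : ∀ z ∈ Z, ContDiffAt ℝ ∞ a z := fun z hz => ha.contDiffAt (hZ.mem_nhds hz)
  have hatτ : ∀ z ∈ Z, ContDiffAt ℝ ∞ τ z := fun z hz => hτ.contDiffAt (hZ.mem_nhds hz)
  have hdϖ : ContDiffOn ℝ ∞ (fderiv ℝ ϖ) Z := hϖ.fderiv_of_isOpen hZ (by simp)
  have hda : ContDiffOn ℝ ∞ (fderiv ℝ a) Z := ha.fderiv_of_isOpen hZ (by simp)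
  have hdτ : ContDiffOn ℝ ∞ (fderiv ℝ τ) Z := hτ.fderiv_of_isOpen hZ (by simp)
  -- derivatives of the idempotent map
  have hPA : ∀ z ∈ Z, ∀ v, fderiv ℝ ϖ (ϖ z) (fderiv ℝ ϖ z v) = fderiv ℝ ϖ z v := fun z hz v => by
    have h1 := ((hatϖ _ (hϖZ hz)).differentiableAt (by simp)).hasFDerivAt.comp z
      ((hatϖ _ hz).differentiableAt (by simp)).hasFDerivAt
    have h2 := h1.congr_of_eventuallyEq (f₁ := ϖ)
      (by filter_upwards [hZ.mem_nhds hz] with y hy using (hϖϖ y hy).symm)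
    exact congrArg (fun f : W →L[ℝ] W => f v)
      (h2.unique ((hatϖ _ hz).differentiableAt (by simp)).hasFDerivAt)
  -- `dϖ` at `ϖ z` is a projection onto the tangent space of the retract there, and `Q z` is the
  -- complementary projection.
  let Q : W → W →L[ℝ] W := fun z => ContinuousLinearMap.id ℝ W - fderiv ℝ ϖ (ϖ z)
  have hQ : ContDiffOn ℝ ∞ Q Z := contDiffOn_const.sub (hdϖ.comp hϖ hϖZ)
  -- `Bop` is the identity along `C`, hence invertible nearby. Where it is invertible, the kernel of
  -- `dϖ` at `z` and the tangent space of the retract at `ϖ z` still span `W`, although they belong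
  -- to different points.
  let Bop : W → W →L[ℝ] W := fun z => Q z + (fderiv ℝ ϖ z).comp (fderiv ℝ ϖ (ϖ z))
  have hBop : ContDiffOn ℝ ∞ Bop Z := hQ.add (hdϖ.clm_comp (hdϖ.comp hϖ hϖZ))
  have hBC : ∀ c ∈ C, Bop c = ContinuousLinearMap.id ℝ W := fun c hc => by
    ext v
    have := hPA c (hCZ hc) v
    simp only [Bop, Q, hϖC c hc, add_apply, sub_apply, ContinuousLinearMap.comp_apply,
      ContinuousLinearMap.id_apply] at this ⊢
    rw [this, sub_add_cancel]
  -- every vector is congruent modulo the image of the projection to the kernel of `dϖ`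
  have hker : ∀ z ∈ Z, Bop z ∈ range ((↑) : (W ≃L[ℝ] W) → (W →L[ℝ] W)) →
      ∀ w, ∃ n, fderiv ℝ ϖ z n = 0 ∧ Q z n = Q z w := by
    rintro z hz ⟨B, hB⟩ w
    have hQA : ∀ v, Q z (fderiv ℝ ϖ z v) = 0 := fun v => by
      simp only [Q, sub_apply, ContinuousLinearMap.id_apply, hPA z hz v, sub_self]
    have hQQ : ∀ v, Q z (Q z v) = Q z v := fun v => by
      have := hPA (ϖ z) (hϖZ hz) v
      rw [hϖϖ z hz] at this
      simp only [Q, sub_apply, ContinuousLinearMap.id_apply, map_sub, this, sub_self, sub_zero]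
    set v := B.symm (fderiv ℝ ϖ z w) with hv
    have hBv : Bop z v = fderiv ℝ ϖ z w := by
      rw [← hB]
      exact B.apply_symm_apply _
    have hBv' : Q z v + fderiv ℝ ϖ z (fderiv ℝ ϖ (ϖ z) v) = fderiv ℝ ϖ z w := hBv
    have hQv : Q z v = 0 := by
      have := congrArg (Q z) hBv'
      rwa [map_add, hQQ, hQA, hQA, add_zero] at this
    have hPv : fderiv ℝ ϖ (ϖ z) v = v := (sub_eq_zero.1 hQv).symm
    refine ⟨w - v, ?_, ?_⟩
    · rw [map_sub, ← hBv', hQv, hPv, zero_add, sub_self]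
    · rw [map_sub, hQv, sub_zero]
  let aT : ℝ × W → W →L[ℝ] ℝ := fun p => a p.2 + p.1 • τ p.2
  let D : ℝ × W → W →L[ℝ] W →L[ℝ] ℝ := fun p => fderiv ℝ a p.2 + p.1 • fderiv ℝ τ p.2
  let flipL : (W →L[ℝ] W →L[ℝ] ℝ) →L[ℝ] (W →L[ℝ] W →L[ℝ] ℝ) :=
    (ContinuousLinearMap.flipₗᵢ ℝ W W ℝ).toContinuousLinearEquiv
  let Ω : ℝ × W → W →L[ℝ] W →L[ℝ] ℝ := fun p => D p - flipL (D p)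
  have hΩapp : ∀ p X w, Ω p X w = dForm a p.2 X w + p.1 * dForm τ p.2 X w := fun p X w => by
    change D p X w - D p w X = _
    simp only [D, dForm, add_apply, smul_apply, smul_eq_mul]
    ring
  let ZZ : Set (ℝ × W) := univ ×ˢ Z
  have hZZ : IsOpen ZZ := isOpen_univ.prod hZ
  have hsnd : MapsTo Prod.snd ZZ Z := fun p hp => hp.2
  have haT : ContDiffOn ℝ ∞ aT ZZ :=
    (ha.comp contDiffOn_snd hsnd).add (contDiffOn_fst.smul (hτ.comp contDiffOn_snd hsnd))
  have hD : ContDiffOn ℝ ∞ D ZZ :=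
    (hda.comp contDiffOn_snd hsnd).add (contDiffOn_fst.smul (hdτ.comp contDiffOn_snd hsnd))
  have hΩ : ContDiffOn ℝ ∞ Ω ZZ := hD.sub (flipL.contDiff.comp_contDiffOn hD)
  -- The forms are pulled back by `ϖ`, so `Ω` is degenerate on `W`. The term `⟪Q ·, Q ·⟫` restores
  -- invertibility near `C`, and it does not disturb the Moser equation because the solutions have
  -- no `Q` component.
  let T : ℝ × W → (W × ℝ) →L[ℝ] ((W →L[ℝ] ℝ) × ℝ) := fun p => moserOperator W (Ω p + squareForm (Q p.2), aT p)
  have hT : ContDiffOn ℝ ∞ T ZZ := 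
    (moserOperator W).contDiff.comp_contDiffOn
      ((hΩ.add (hQ.comp contDiffOn_snd hsnd).squareForm).prodMk haT)
  let EB : Set (W →L[ℝ] W) := range ((↑) : (W ≃L[ℝ] W) → (W →L[ℝ] W))
  let ET : Set ((W × ℝ) →L[ℝ] ((W →L[ℝ] ℝ) × ℝ)) :=
    range ((↑) : ((W × ℝ) ≃L[ℝ] ((W →L[ℝ] ℝ) × ℝ)) → _)
  let U : Set (ℝ × W) := (ZZ ∩ T ⁻¹' ET) ∩ (ZZ ∩ (fun p => Bop p.2) ⁻¹' EB)
  have hU : IsOpen U := (hT.continuousOn.isOpen_inter_preimage hZZ ContinuousLinearEquiv.isOpen).inter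
    ((hBop.comp contDiffOn_snd hsnd).continuousOn.isOpen_inter_preimage hZZ
      ContinuousLinearEquiv.isOpen)
  -- a solution of the Moser equation has no component transverse to the retract
  have hsol : ∀ p ∈ ZZ, Bop p.2 ∈ EB → ∀ (x : W × ℝ) (b : ℝ),
      T p x = (b • τ p.2, 0) →
      Q p.2 x.1 = 0 ∧ (∀ w, Ω p x.1 w - x.2 * aT p w = b * τ p.2 w) ∧ aT p x.1 = 0 := by
    intro p hp hBp x b hx
    obtain ⟨h1, h2⟩ := (moserOperator_eq_iff _ _ _ _).1 hx
    obtain ⟨n, hn, hQn⟩ := hker p.2 hp.2 hBp x.1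
    have ha0 : a p.2 n = 0 := by
      rw [haϖ _ hp.2]; change a (ϖ p.2) (fderiv ℝ ϖ p.2 n) = 0; rw [hn, map_zero]
    have hτ0 : τ p.2 n = 0 := by
      rw [hτϖ _ hp.2]; change τ (ϖ p.2) (fderiv ℝ ϖ p.2 n) = 0; rw [hn, map_zero]
    -- The exterior derivative of a form pulled back by `ϖ` vanishes on the kernel of `dϖ`. Hence
    -- testing the equation on `n` leaves only `‖Q X‖²`.
    have hd : ∀ μ : W → W →L[ℝ] ℝ, (∀ z ∈ Z, ContDiffAt ℝ ∞ μ z) →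
        (∀ z ∈ Z, μ z = pullForm ϖ μ z) → dForm μ p.2 x.1 n = 0 := fun μ hμ hμϖ => by
      have h3 : μ =ᶠ[𝓝 p.2] pullForm ϖ μ := by
        filter_upwards [hZ.mem_nhds hp.2] with z hz using hμϖ z hz
      rw [dForm_congr h3, dForm_pullForm ((hatϖ _ hp.2).of_le two_le_infty)
        ((hμ _ (hϖZ hp.2)).differentiableAt (by simp)), hn]
      simp [dForm]
    have hQ0 : Q p.2 x.1 = 0 := by
      have := h1 n
      rw [add_apply, add_apply, squareForm_apply, hΩapp, hd a hata haϖ, hd τ hatτ hτϖ] at this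
      simp only [aT, add_apply, smul_apply, smul_eq_mul, ha0, hτ0, hQn, mul_zero, add_zero, zero_add,
        sub_zero] at this
      exact inner_self_eq_zero.1 this
    refine ⟨hQ0, fun w => ?_, h2⟩
    have := h1 w
    rw [add_apply, add_apply, squareForm_apply, hQ0, inner_zero_left, add_zero] at this
    simpa using this
  have hCU : Icc (0 : ℝ) 1 ×ˢ C ⊆ U := by
    rintro ⟨t, c⟩ ⟨ht, hc⟩
    have hp : ((t, c) : ℝ × W) ∈ ZZ := ⟨mem_univ _, hCZ hc⟩
    have hB : Bop c ∈ EB := ⟨ContinuousLinearEquiv.refl ℝ W, (hBC c hc).symm⟩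
    refine ⟨⟨hp, ?_⟩, hp, hB⟩
    -- Source and target have equal dimension, so injectivity suffices. Over `C` the form `aT`
    -- equals `a` at all times because `τ` vanishes there.
    have hinj : Function.Injective (T (t, c)) := by
      rw [injective_iff_map_eq_zero]
      intro x hx
      obtain ⟨h1, h2, h3⟩ := hsol (t, c) hp hB x 0 (by rw [hx, zero_smul]; rfl)
      have haTc : aT (t, c) = a c := by simp [aT, hτC c hc]
      rw [haTc] at h2 h3
      have hx1 : x.1 = 0 := by
        refine hnd c hc t ht x.1 ?_ h3 fun w _ hw => ?_
        · have := sub_eq_zero.1 h1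
          simp only [hϖC c hc] at this
          exact this.symm
        · have := h2 w
          rwa [hΩapp, hw, mul_zero, sub_zero, zero_mul] at this
      have hx2 : x.2 = 0 := by
        by_contra hne
        refine haC c hc (ContinuousLinearMap.ext fun w => ?_)
        have := h2 w
        rw [hx1] at this
        simp only [map_zero, zero_apply, zero_sub, zero_mul, neg_eq_zero, mul_eq_zero] at this
        exact this.resolve_left hne
      exact Prod.ext hx1 hx2
    have hdim : Module.finrank ℝ (W × ℝ) = Module.finrank ℝ ((W →L[ℝ] ℝ) × ℝ) := by
      rw [Module.finrank_prod, Module.finrank_prod]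
      congr 1
      rw [← LinearMap.toContinuousLinearMap.finrank_eq]
      exact (Subspace.dual_finrank_eq (K := ℝ) (V := W)).symm
    refine ⟨(LinearEquiv.ofInjectiveOfFinrankEq (T (t, c) : (W × ℝ) →ₗ[ℝ] _) hinj
      hdim).toContinuousLinearEquiv, ?_⟩
    exact ContinuousLinearMap.ext fun x => rfl
  -- The pair `(X, h)` with `Ω(X, ·) - h aT = -τ` and `aT(X) = 0`. Since `τ` is the time derivative
  -- of `aT`, this is the equation required by `exists_kernel_transport`.
  let sol : ℝ × W → W × ℝ := fun p => (T p).inverse (-τ p.2, 0)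
  have hsolU : ContDiffOn ℝ ∞ sol U := by
    intro p hp
    obtain ⟨e, he⟩ := hp.1.2
    have h1 : ContDiffAt ℝ ∞ (fun p => (T p).inverse) p := by
      have := contDiffAt_map_inverse (n := ∞) (𝕜 := ℝ) e
      rw [he] at this
      exact this.comp p (hT.contDiffAt (hZZ.mem_nhds hp.1.1))
    have h2 : ContDiffAt ℝ ∞ (fun p : ℝ × W => ((-τ p.2, 0) : (W →L[ℝ] ℝ) × ℝ)) p :=
      (((hatτ _ hp.1.1.2).comp p contDiffAt_snd).neg).prodMk contDiffAt_const
    exact (h1.clm_apply h2).contDiffWithinAt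
  have hTsol : ∀ p ∈ U, T p (sol p) = ((-1 : ℝ) • τ p.2, 0) := by
    intro p hp
    obtain ⟨e, he⟩ := hp.1.2
    simp only [sol, ← he, ContinuousLinearMap.inverse_equiv, neg_smul, one_smul]
    exact e.apply_symm_apply _
  have hfd : ∀ p ∈ ZZ, ∀ s w, fderiv ℝ aT p (s, w) = s • τ p.2 + D p w := by
    intro p hp s w
    have h1 : HasFDerivAt (fun p : ℝ × W => a p.2)
        ((fderiv ℝ a p.2).comp (ContinuousLinearMap.snd ℝ ℝ W)) p :=
      HasFDerivAt.comp (g := a) p ((hata _ hp.2).differentiableAt (by simp)).hasFDerivAt hasFDerivAt_snd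
    have h2 : HasFDerivAt (fun p : ℝ × W => τ p.2)
        ((fderiv ℝ τ p.2).comp (ContinuousLinearMap.snd ℝ ℝ W)) p :=
      HasFDerivAt.comp (g := τ) p ((hatτ _ hp.2).differentiableAt (by simp)).hasFDerivAt hasFDerivAt_snd
    have h3 : HasFDerivAt aT _ p := h1.add ((hasFDerivAt_fst (𝕜 := ℝ) (p := p)).smul h2)
    rw [h3.fderiv]
    ext v
    simp [D]
    ring
  obtain ⟨φ, O, hO, hCO, hφ, hφC, hφa⟩ := exists_kernel_transport (a := aT) hC
    (X := fun p => (sol p).1) (h := fun p => (sol p).2) hU hCU hsolU.fst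
    (haT.mono fun p hp => hp.1.1) hsolU.snd.continuousOn
    (fun t ht c hc => by
      change ((T (t, c)).inverse (-τ c, 0)).1 = 0
      rw [hτC c hc, neg_zero]
      change ((T (t, c)).inverse 0).1 = 0
      rw [map_zero]
      rfl)
    (fun p hp => (hsol p hp.1.1 hp.2.2 _ _ (hTsol p hp)).2.2)
    (fun p hp w => by
      obtain ⟨-, h2, -⟩ := hsol p hp.1.1 hp.2.2 _ _ (hTsol p hp)
      have := h2 w
      rw [hfd p hp.1.1, hfd p hp.1.1]
      change D p (sol p).1 w - D p w (sol p).1 - _ = _ at this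
      simp only [add_apply, smul_apply, smul_eq_mul, zero_mul, one_mul, zero_add]
      linarith)
  refine ⟨φ, O, hO, hCO, hφ, hφC, fun x hx => ⟨(hφa x hx).1.1.1.2, fun v => ?_⟩⟩
  have := (hφa x hx).2.1 v
  simpa [aT] using this

end Moser

/-! ### Retractions with Legendrian fibers -/

section NormalForm

set_option synthInstance.maxHeartbeats 400000

variable {W : Type} [NormedAddCommGroup W] [InnerProductSpace ℝ W] [FiniteDimensional ℝ W]

/-- Derivative of a relation `f ∘ g = g`. -/
lemma fderiv_apply_of_comp_eq {E : Type*} [NormedAddCommGroup E] [NormedSpace ℝ E]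
    {f : W → W} {g : E → W} {z : E} (hf : DifferentiableAt ℝ f (g z))
    (hg : DifferentiableAt ℝ g z) (h : ∀ᶠ y in 𝓝 z, f (g y) = g y) (v : E) :
    fderiv ℝ f (g z) (fderiv ℝ g z v) = fderiv ℝ g z v := by
  have h1 := (hf.hasFDerivAt.comp z hg.hasFDerivAt).congr_of_eventuallyEq (f₁ := g)
    (by filter_upwards [h] with y hy using hy.symm)
  exact congrArg (fun f : E →L[ℝ] W => f v) (h1.unique hg.hasFDerivAt)

/-- A retraction `p` onto `C` whose derivative along `C` intertwines `a` with its restriction to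
`C`. -/
lemma exists_tangent_retraction {C Z : Set W} (hZ : IsOpen Z) (hCZ : C ⊆ Z)
    {r : W → W} {a : W → W →L[ℝ] ℝ} (hr : ContDiffOn ℝ ∞ r Z) (hrZ : ∀ z ∈ Z, r z ∈ C)
    (hrC : ∀ c ∈ C, r c = c) (ha : ContDiffOn ℝ ∞ a Z)
    (hne : ∀ c ∈ C, (a c).comp (fderiv ℝ r c) ≠ 0) :
    ∃ (p : W → W) (O : Set W), IsOpen O ∧ C ⊆ O ∧ O ⊆ Z ∧ ContDiffOn ℝ ∞ p O ∧
      (∀ z ∈ O, p z ∈ C) ∧ (∀ c ∈ C, p c = c) ∧ ∀ c ∈ C, ∀ v, a c (fderiv ℝ p c v) = a c v := by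
  have hrr : MapsTo r Z Z := fun z hz => hCZ (hrZ z hz)
  have hdr : ContDiffOn ℝ ∞ (fderiv ℝ r) Z := hr.fderiv_of_isOpen hZ (by simp)
  have hrat : ∀ z ∈ Z, DifferentiableAt ℝ r z := fun z hz =>
    (hr.contDiffAt (hZ.mem_nhds hz)).differentiableAt (by simp)
  -- `ell z` is `a` composed with the projection to the tangent space of `C` at `r z`. The vector
  -- field `V` below is normalized by `ell(V) = 1`.
  let ell : W → W →L[ℝ] ℝ := fun z => (a (r z)).comp (fderiv ℝ r (r z))
  have hell : ContDiffOn ℝ ∞ ell Z := (ha.comp hr hrr).clm_comp (hdr.comp hr hrr)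
  have hell0 : ∀ z ∈ Z, ell z ≠ 0 := fun z hz => hne _ (hrZ z hz)
  let sh : W → W := fun z => (InnerProductSpace.toDual ℝ W).symm (ell z)
  have hsh : ContDiffOn ℝ ∞ sh Z :=
    (InnerProductSpace.toDual ℝ W).symm.contDiff.comp_contDiffOn hell
  have hsh0 : ∀ z ∈ Z, sh z ≠ 0 := fun z hz h => hell0 z hz (by simpa [sh] using h)
  let V : W → W := fun z => (‖sh z‖ ^ 2)⁻¹ • sh z
  have hV : ContDiffOn ℝ ∞ V Z :=
    ((hsh.norm_sq ℝ).inv fun z hz => pow_ne_zero _ (norm_ne_zero_iff.2 (hsh0 z hz))).smul hsh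
  have hellV : ∀ z ∈ Z, ell z (V z) = 1 := fun z hz => by
    have h1 : ell z (sh z) = ‖sh z‖ ^ 2 := by
      rw [← real_inner_self_eq_norm_sq, InnerProductSpace.toDual_symm_apply]
    simp only [V, map_smul, h1, smul_eq_mul]
    exact inv_mul_cancel₀ (pow_ne_zero _ (norm_ne_zero_iff.2 (hsh0 z hz)))
  -- `δ` measures the failure of `a ∘ dr = a` along `C`. Pushing `z` by `δ(z - r z) V` before
  -- retracting leaves `C` fixed and adds the missing amount to the value of `a` to first order.
  let δ : W → W →L[ℝ] ℝ := fun z => a z - pullForm r a z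
  have hδ : ContDiffOn ℝ ∞ δ Z := ha.sub (hr.pullForm hZ ha hrr)
  let s : W → ℝ := fun z => δ z (z - r z)
  have hs : ContDiffOn ℝ ∞ s Z := hδ.clm_apply (contDiffOn_id.sub hr)
  let g : W → W := fun z => z + s z • V z
  have hg : ContDiffOn ℝ ∞ g Z := contDiffOn_id.add (hs.smul hV)
  have hgC : ∀ c ∈ C, g c = c := fun c hc => by simp [g, s, hrC c hc]
  refine ⟨r ∘ g, Z ∩ g ⁻¹' Z, hg.continuousOn.isOpen_inter_preimage hZ hZ,
    fun c hc => ⟨hCZ hc, by rw [mem_preimage, hgC c hc]; exact hCZ hc⟩, inter_subset_left,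
    hr.comp (hg.mono inter_subset_left) fun z hz => hz.2, fun z hz => hrZ _ hz.2,
    fun c hc => by rw [Function.comp_apply, hgC c hc, hrC c hc], fun c hc v => ?_⟩
  have hc' := hCZ hc
  have hs' : HasFDerivAt s ((δ c).comp (ContinuousLinearMap.id ℝ W - fderiv ℝ r c)) c := by
    have h1 := (((hδ.contDiffAt (hZ.mem_nhds hc')).differentiableAt (by simp)).hasFDerivAt).clm_apply
      ((hasFDerivAt_id c).sub (hrat c hc').hasFDerivAt)
    refine h1.congr_fderiv (ContinuousLinearMap.ext fun v => ?_)
    simp [hrC c hc]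
  have hg' : HasFDerivAt g (ContinuousLinearMap.id ℝ W +
      ((δ c).comp (ContinuousLinearMap.id ℝ W - fderiv ℝ r c)).smulRight (V c)) c := by
    have h1 := (hasFDerivAt_id c).add (hs'.smul
      ((hV.contDiffAt (hZ.mem_nhds hc')).differentiableAt (by simp)).hasFDerivAt)
    refine h1.congr_fderiv (ContinuousLinearMap.ext fun v => ?_)
    simp [s, hrC c hc]
  have hrg : HasFDerivAt r (fderiv ℝ r c) (g c) := by
    rw [hgC c hc]; exact (hrat c hc').hasFDerivAt
  rw [(hrg.comp c hg').fderiv]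
  have hDD : fderiv ℝ r c (fderiv ℝ r c v) = fderiv ℝ r c v := by
    have h1 := fderiv_apply_of_comp_eq (f := r) (g := r) (z := c) (by rw [hrC c hc]; exact hrat c hc')
      (hrat c hc') (by filter_upwards [hZ.mem_nhds hc'] with z hz using hrC _ (hrZ z hz)) v
    rwa [hrC c hc] at h1
  have hδ1 : ∀ u, δ c u = a c u - a c (fderiv ℝ r c u) := fun u => by
    change a c u - a (r c) (fderiv ℝ r c u) = _
    rw [hrC c hc]
  have hV1 : a c (fderiv ℝ r c (V c)) = 1 := by
    have := hellV c hc'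
    simp only [ell, hrC c hc] at this
    exact this
  simp only [ContinuousLinearMap.comp_apply, add_apply, ContinuousLinearMap.id_apply,
    ContinuousLinearMap.smulRight_apply, sub_apply, map_add, map_smul, smul_eq_mul, map_sub, hV1,
    hδ1, hDD]
  ring

set_option maxHeartbeats 800000 in
/-- Near a compact coisotropic submanifold `C` of a smooth retract (the image of `ϖ`) with contact
form `a`, there is a smooth retraction `P` onto `C` with Legendrian fibers. The contact hyperplanes
are the preimages under `dP` of the kernels of the covectors `B`. -/
theorem exists_legendrian_retraction {C Z : Set W} (hC : IsCompact C) (hZ : IsOpen Z) (hCZ : C ⊆ Z)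
    {ϖ r : W → W} {a : W → W →L[ℝ] ℝ} (hϖ : ContDiffOn ℝ ∞ ϖ Z) (hϖZ : MapsTo ϖ Z Z)
    (hϖϖ : ∀ z ∈ Z, ϖ (ϖ z) = ϖ z) (hϖC : ∀ c ∈ C, ϖ c = c)
    (hr : ContDiffOn ℝ ∞ r Z) (hrZ : ∀ z ∈ Z, r z ∈ C) (hrC : ∀ c ∈ C, r c = c)
    (ha : ContDiffOn ℝ ∞ a Z) (haϖ : ∀ z ∈ Z, a z = pullForm ϖ a z)
    (hne : ∀ c ∈ C, (a c).comp (fderiv ℝ r c) ≠ 0)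
    (hco : ∀ c ∈ C, ∀ X, fderiv ℝ ϖ c X = X → a c X = 0 →
      (∀ w, fderiv ℝ r c w = w → a c w = 0 → dForm a c X w = 0) → fderiv ℝ r c X = X)
    (hnd : ∀ c ∈ C, ∀ X, fderiv ℝ ϖ c X = X → a c X = 0 →
      (∀ w, fderiv ℝ ϖ c w = w → a c w = 0 → dForm a c X w = 0) → X = 0) :
    ∃ (P : W → W) (B : W → W →L[ℝ] ℝ) (O : Set W), IsOpen O ∧ C ⊆ O ∧ ContDiffOn ℝ ∞ P O ∧
      ContDiffOn ℝ ∞ B O ∧ (∀ z ∈ O, P z ∈ C) ∧ (∀ c ∈ C, P c = c) ∧ (∀ c ∈ C, B c = a c) ∧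
      ∀ z ∈ O, ∀ v, a z v = 0 ↔ B z (fderiv ℝ P z v) = 0 := by
  obtain ⟨p, Z₁, hZ₁, hCZ₁, hZ₁Z, hp, hpZ, hpC, hap⟩ :=
    exists_tangent_retraction hZ hCZ hr hrZ hrC ha hne
  have hat : ∀ {f : W → W} {s : Set W}, IsOpen s → ContDiffOn ℝ ∞ f s → ∀ z ∈ s,
      DifferentiableAt ℝ f z := fun hs hf z hz =>
    (hf.contDiffAt (hs.mem_nhds hz)).differentiableAt (by simp)
  have hpZ' : MapsTo p Z₁ Z := fun z hz => hCZ (hpZ z hz)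
  have hdp : ContDiffOn ℝ ∞ (fderiv ℝ p) Z₁ := hp.fderiv_of_isOpen hZ₁ (by simp)
  let f : W → W →L[ℝ] ℝ := fun z => a z - pullForm p a z
  have hf : ContDiffOn ℝ ∞ f Z₁ := (ha.mono hZ₁Z).sub (hp.pullForm hZ₁ ha hpZ')
  have hfC : ∀ c ∈ C, f c = 0 := fun c hc => by
    refine ContinuousLinearMap.ext fun v => ?_
    change a c v - a (p c) (fderiv ℝ p c v) = 0
    rw [hpC c hc, hap c hc, sub_self]
  let β : W → W →L[ℝ] ℝ := fun z => a (p z) + f z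
  have hβ : ContDiffOn ℝ ∞ β Z₁ := (ha.comp hp hpZ').add hf
  -- `σ` is chosen so that `a + σ` factors through `dp`, with `β` as the covector at the base point.
  -- Thus the kernel of `a + σ` contains the tangent spaces of the fibers of `p`.
  let σ : W → W →L[ℝ] ℝ := fun z => (f z).comp (fderiv ℝ p z - ContinuousLinearMap.id ℝ W)
  have hσ : ContDiffOn ℝ ∞ σ Z₁ := hf.clm_comp (hdp.sub contDiffOn_const)
  have haσ : ∀ z v, a z v + σ z v = β z (fderiv ℝ p z v) := fun z v => by
    simp only [σ, β, f, pullForm, ContinuousLinearMap.comp_apply, add_apply, sub_apply, map_sub,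
      ContinuousLinearMap.id_apply]
    ring
  -- As `f` vanishes along `C`, `dσ(X, w)` is `df(X)(dp w - w) - df(w)(dp X - X)` there. For `w`
  -- tangent to `C` one has `dp w = w` and `df(w) = 0`.
  have hσd : ∀ c ∈ C, ∀ X w, fderiv ℝ r c w = w → dForm σ c X w = 0 := by
    intro c hc X w hw
    have hrc : r c ∈ Z₁ := by rw [hrC c hc]; exact hCZ₁ hc
    have hrat := hat hZ hr c (hCZ hc)
    have hpw : fderiv ℝ p c w = w := by
      have h1 := fderiv_apply_of_comp_eq (f := p) (g := r) (z := c) (hat hZ₁ hp _ hrc) hrat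
        (by filter_upwards [hZ.mem_nhds (hCZ hc)] with z hz using hpC _ (hrZ z hz)) w
      rwa [hrC c hc, hw] at h1
    have hfat : DifferentiableAt ℝ f c :=
      (hf.contDiffAt (hZ₁.mem_nhds (hCZ₁ hc))).differentiableAt (by simp)
    have hfw : fderiv ℝ f c w = 0 := by
      have h1 : HasFDerivAt f (fderiv ℝ f c) (r c) := by rw [hrC c hc]; exact hfat.hasFDerivAt
      have h2 := (h1.comp c hrat.hasFDerivAt).congr_of_eventuallyEq (f₁ := fun _ => 0)
        (by filter_upwards [hZ.mem_nhds (hCZ hc)] with z hz using (hfC _ (hrZ z hz)).symm)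
      have h3 := congrArg (fun L : W →L[ℝ] W →L[ℝ] ℝ => L w) (h2.unique (hasFDerivAt_const _ _))
      simpa [hw] using h3
    have hσ' := (hfat.hasFDerivAt.clm_comp
      (((hdp.contDiffAt (hZ₁.mem_nhds (hCZ₁ hc))).differentiableAt (by simp)).hasFDerivAt.sub_const
        (ContinuousLinearMap.id ℝ W))).fderiv
    have hval : ∀ u v, fderiv ℝ σ c u v = fderiv ℝ f c u (fderiv ℝ p c v - v) := fun u v => by
      have : fderiv ℝ σ c = _ := hσ'
      rw [this]
      simp [hfC c hc]
    rw [dForm, hval, hval, hpw, sub_self, map_zero, hfw]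
    simp
  let Z₂ : Set W := Z₁ ∩ (Z ∩ ϖ ⁻¹' Z₁)
  have hZ₂ : IsOpen Z₂ := hZ₁.inter (hϖ.continuousOn.isOpen_inter_preimage hZ hZ₁)
  have hCZ₂ : C ⊆ Z₂ := fun c hc =>
    ⟨hCZ₁ hc, hCZ hc, by rw [mem_preimage, hϖC c hc]; exact hCZ₁ hc⟩
  have hϖZ₂ : MapsTo ϖ Z₂ Z₂ := fun z hz =>
    ⟨hz.2.2, hϖZ hz.2.1, by rw [mem_preimage, hϖϖ z hz.2.1]; exact hz.2.2⟩
  have hZ₂Z : Z₂ ⊆ Z := fun z hz => hz.2.1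
  have hϖ₂ : ContDiffOn ℝ ∞ ϖ Z₂ := hϖ.mono hZ₂Z
  -- `exists_moser` asks for a form that is pulled back from the retract, which `σ` is not. Along
  -- `C` the exterior derivatives of `τ` and `σ` agree on vectors tangent to the retract.
  let τ : W → W →L[ℝ] ℝ := pullForm ϖ σ
  have hτ : ContDiffOn ℝ ∞ τ Z₂ := hϖ₂.pullForm hZ₂ (hσ.mono fun z hz => hz.1) hϖZ₂
  have hτϖ : ∀ z ∈ Z₂, τ z = pullForm ϖ τ z := fun z hz => by
    refine ContinuousLinearMap.ext fun v => ?_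
    change σ (ϖ z) (fderiv ℝ ϖ z v) = σ (ϖ (ϖ z)) (fderiv ℝ ϖ (ϖ z) (fderiv ℝ ϖ z v))
    rw [hϖϖ z hz.2.1, fderiv_apply_of_comp_eq (hat hZ hϖ _ (hϖZ hz.2.1)) (hat hZ hϖ _ hz.2.1)
      (by filter_upwards [hZ.mem_nhds hz.2.1] with y hy using hϖϖ y hy)]
  have hτd : ∀ c ∈ C, ∀ X w, dForm τ c X w = dForm σ c (fderiv ℝ ϖ c X) (fderiv ℝ ϖ c w) := by
    intro c hc X w
    have h1 : ContDiffAt ℝ 2 ϖ c := (hϖ.contDiffAt (hZ.mem_nhds (hCZ hc))).of_le two_le_infty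
    have h2 : DifferentiableAt ℝ σ (ϖ c) := by
      rw [hϖC c hc]
      exact (hσ.contDiffAt (hZ₁.mem_nhds (hCZ₁ hc))).differentiableAt (by simp)
    rw [dForm_pullForm h1 h2, hϖC c hc]
  have hrϖ : ∀ c ∈ C, ∀ w, fderiv ℝ r c w = w → fderiv ℝ ϖ c w = w := fun c hc w hw => by
    have h1 := fderiv_apply_of_comp_eq (f := ϖ) (g := r) (z := c)
      (by rw [hrC c hc]; exact hat hZ hϖ c (hCZ hc)) (hat hZ hr c (hCZ hc))
      (by filter_upwards [hZ.mem_nhds (hCZ hc)] with z hz using hϖC _ (hrZ z hz)) w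
    rwa [hrC c hc, hw] at h1
  obtain ⟨φ, O, hO, hCO, hφ, hφC, hφa⟩ := exists_moser hC hZ₂ hCZ₂ hϖ₂ hϖZ₂
    (fun z hz => hϖϖ z (hZ₂Z hz)) hϖC (ha.mono hZ₂Z) hτ (fun z hz => haϖ z (hZ₂Z hz)) hτϖ
    (fun c hc => by
      refine ContinuousLinearMap.ext fun v => ?_
      change (f (ϖ c)) _ = 0
      rw [hϖC c hc, hfC c hc, zero_apply])
    (fun c hc h0 => hne c hc (by rw [h0, ContinuousLinearMap.zero_comp]))
    -- Tested on vectors tangent to `C`, where `dτ` contributes nothing, the hypothesis and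
    -- coisotropy show that `X` is tangent to `C`. Then `dτ(X, ·)` vanishes on all vectors tangent
    -- to the retract, and nondegeneracy of `da` alone gives `X = 0`.
    (fun c hc t ht X hX haX h => by
      have hXr : fderiv ℝ r c X = X := hco c hc X hX haX fun w hw haw => by
        have h1 := h w (hrϖ c hc w hw) haw
        rwa [hτd c hc, hX, hrϖ c hc w hw, hσd c hc X w hw, mul_zero, add_zero] at h1
      refine hnd c hc X hX haX fun w hw haw => ?_
      have h1 := h w hw haw
      rwa [hτd c hc, hX, hw, dForm_swap σ, hσd c hc w X hXr, neg_zero, mul_zero, add_zero] at h1)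
  have hg : ContDiffOn ℝ ∞ (fun x => ϖ (φ x)) O :=
    hϖ₂.comp hφ fun x hx => (hφa x hx).1
  have hgZ : MapsTo (fun x => ϖ (φ x)) O Z₁ := fun x hx => (hφa x hx).1.2.2
  refine ⟨fun x => p (ϖ (φ x)), fun x => β (ϖ (φ x)), O, hO, hCO, hp.comp hg hgZ,
    hβ.comp hg hgZ, fun x hx => hpZ _ (hgZ hx), fun c hc => ?_, fun c hc => ?_, fun x hx v => ?_⟩
  · simp only [hφC c hc, hϖC c hc, hpC c hc]
  · simp only [hφC c hc, hϖC c hc, β, hpC c hc, hfC c hc, add_zero]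
  · obtain ⟨hφx, hiff⟩ := hφa x hx
    rw [← hiff v]
    have h1 : fderiv ℝ (fun x => p (ϖ (φ x))) x v =
        fderiv ℝ p (ϖ (φ x)) (fderiv ℝ ϖ (φ x) (fderiv ℝ φ x v)) := by
      have h2 := (hat hZ₁ hp _ (hgZ hx)).hasFDerivAt.comp x
        ((hat hZ₂ hϖ₂ _ hφx).hasFDerivAt.comp x (hat hO hφ x hx).hasFDerivAt)
      have h3 : HasFDerivAt (fun x => p (ϖ (φ x))) _ x := h2
      rw [h3.fderiv]
      rfl
    rw [h1, ← haσ, Pi.add_apply, haϖ _ hφx.2.1]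
    rfl

end NormalForm

/-! ### The Frobenius theorem for hyperplane fields -/

section Frobenius

set_option synthInstance.maxHeartbeats 400000

/-- The additional term of `d(c a)` is `dc ∧ a`, which vanishes on two vectors of `ker a`. -/
lemma dForm_smul_of_eq_zero {E : Type*} [NormedAddCommGroup E] [NormedSpace ℝ E] {c : E → ℝ}
    {a : E → E →L[ℝ] ℝ} {z : E} (hc : DifferentiableAt ℝ c z) (ha : DifferentiableAt ℝ a z)
    {u v : E} (hu : a z u = 0) (hv : a z v = 0) :
    dForm (fun z => c z • a z) z u v = c z * dForm a z u v := by
  simp only [dForm, fderiv_fun_smul hc ha, add_apply, smul_apply,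
    ContinuousLinearMap.smulRight_apply, hu, hv, smul_eq_mul]
  ring

variable {E : Type} [NormedAddCommGroup E] [NormedSpace ℝ E] [FiniteDimensional ℝ E]

/-- The Frobenius theorem for the kernel of a one-form `μ`: if `dμ` vanishes on `ker μ`, then
`ker μ` is locally the kernel of the differential of a function. -/
theorem exists_fderiv_ker_eq {μ : E → E →L[ℝ] ℝ} {U : Set E} {x₀ : E} (hU : IsOpen U)
    (hx₀ : x₀ ∈ U) (hμ : ContDiffOn ℝ ∞ μ U) (hne : μ x₀ ≠ 0)
    (hint : ∀ x ∈ U, ∀ u v, μ x u = 0 → μ x v = 0 → dForm μ x u v = 0) :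
    ∃ (O : Set E) (f : E → ℝ), IsOpen O ∧ x₀ ∈ O ∧ O ⊆ U ∧ ContDiffOn ℝ ∞ f O ∧
      ∀ z ∈ O, fderiv ℝ f z ≠ 0 ∧ ∀ v, μ z v = 0 ↔ fderiv ℝ f z v = 0 := by
  obtain ⟨v₀, hv₀⟩ : ∃ v₀, μ x₀ v₀ ≠ 0 := by
    by_contra! h
    exact hne (ContinuousLinearMap.ext h)
  have hc : ContDiffOn ℝ ∞ (fun x => μ x v₀) U := hμ.clm_apply contDiffOn_const
  let U' : Set E := U ∩ (fun x => μ x v₀) ⁻¹' {0}ᶜ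
  have hU' : IsOpen U' := hc.continuousOn.isOpen_inter_preimage hU isOpen_compl_singleton
  let ν : E → E →L[ℝ] ℝ := fun x => (μ x v₀)⁻¹ • μ x
  have hcinv : ContDiffOn ℝ ∞ (fun x => (μ x v₀)⁻¹) U' :=
    (hc.mono inter_subset_left).inv fun x hx => hx.2
  have hν : ContDiffOn ℝ ∞ ν U' := hcinv.smul (hμ.mono inter_subset_left)
  have hν1 : ∀ x ∈ U', ν x v₀ = 1 := fun x hx => inv_mul_cancel₀ hx.2
  have hνμ : ∀ x ∈ U', ∀ v, ν x v = 0 ↔ μ x v = 0 := fun x hx v => by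
    change (μ x v₀)⁻¹ * μ x v = 0 ↔ _
    rw [mul_eq_zero, or_iff_right (inv_ne_zero hx.2)]
  have hνat : ∀ x ∈ U', HasFDerivAt ν (fderiv ℝ ν x) x := fun x hx =>
    ((hν.contDiffAt (hU'.mem_nhds hx)).differentiableAt (by simp)).hasFDerivAt
  have hνint : ∀ x ∈ U', ∀ u v, ν x u = 0 → ν x v = 0 → dForm ν x u v = 0 := by
    intro x hx u v hu hv
    rw [hνμ x hx] at hu hv
    rw [dForm_smul_of_eq_zero ((hcinv.contDiffAt (hU'.mem_nhds hx)).differentiableAt (by simp))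
      ((hμ.contDiffAt (hU.mem_nhds hx.1)).differentiableAt (by simp)) hu hv,
      hint x hx.1 u v hu hv, mul_zero]
  -- The projection of a constant vector `q.1` to `ker ν` along `v₀`. The vector is carried along as
  -- a constant coordinate of a flow on `E × E`, for which `(0, x₀)` is stationary.
  let Y : E × E → E := fun q => q.1 - ν q.2 q.1 • v₀
  have hνY : ∀ q : E × E, q.2 ∈ U' → ν q.2 (Y q) = 0 := fun q hq => by
    simp [Y, hν1 q.2 hq]
  let V : Set (ℝ × E × E) := univ ×ˢ univ ×ˢ U'
  have hV : IsOpen V := isOpen_univ.prod (isOpen_univ.prod hU')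
  have hsnd : ContDiff ℝ ∞ fun p : ℝ × E × E => p.2.2 := contDiff_snd.comp contDiff_snd
  have hfst : ContDiff ℝ ∞ fun p : ℝ × E × E => p.2.1 := contDiff_fst.comp contDiff_snd
  have hνV : ContDiffOn ℝ ∞ (fun p : ℝ × E × E => ν p.2.2) V :=
    hν.comp hsnd.contDiffOn fun p hp => hp.2.2
  have hYV : ContDiffOn ℝ ∞ (fun p : ℝ × E × E => Y p.2) V :=
    hfst.contDiffOn.sub ((hνV.clm_apply hfst.contDiffOn).smul contDiffOn_const)
  have hx₀' : x₀ ∈ U' := ⟨hx₀, hv₀⟩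
  obtain ⟨φ, O, hO, hCO, hφ, hφC, hφa⟩ := exists_kernel_transport (E := E × E)
    (C := {((0 : E), x₀)}) isCompact_singleton
    (X := fun p => ((0 : E), Y p.2)) (U := V)
    (a := fun p => (ν p.2.2).comp (ContinuousLinearMap.snd ℝ E E))
    (h := fun p => dForm ν p.2.2 (Y p.2) v₀) hV
    (by
      rintro ⟨t, q⟩ ⟨-, hq⟩
      obtain rfl : q = (0, x₀) := hq
      exact ⟨trivial, trivial, hx₀'⟩)
    (contDiffOn_const.prodMk hYV) (hνV.clm_comp contDiffOn_const)
    (by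
      have h1 : ContinuousOn (fun p : ℝ × E × E => fderiv ℝ ν p.2.2) V :=
        (hν.continuousOn_fderiv_of_isOpen hU' (by simp)).comp hsnd.continuous.continuousOn
          fun p hp => hp.2.2
      exact ((h1.clm_apply hYV.continuousOn).clm_apply continuousOn_const).sub
        ((h1.clm_apply continuousOn_const).clm_apply hYV.continuousOn))
    (by
      rintro t - c hc
      rw [mem_singleton_iff.1 hc]
      simp [Y])
    (fun p hp => hνY p.2 hp.2.2)
    (by
      rintro ⟨t, x, p⟩ hp ⟨k, w⟩
      have hp' : p ∈ U' := hp.2.2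
      have hd : HasFDerivAt (fun p : ℝ × E × E => (ν p.2.2).comp (ContinuousLinearMap.snd ℝ E E)) _
          (t, x, p) := (((hνat p hp').comp (t, x, p) (f := fun p : ℝ × E × E => p.2.2)
            (hasFDerivAt_snd.comp _ hasFDerivAt_snd))).clm_comp (hasFDerivAt_const _ _)
      -- Integrability kills the component `w - ν(w) v₀`, which lies in the kernel, so only the
      -- component along `v₀` remains.
      have key : dForm ν p (Y (x, p)) w = dForm ν p (Y (x, p)) v₀ * ν p w := by
        have h1 := hνint p hp' (Y (x, p)) (w - ν p w • v₀) (hνY (x, p) hp')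
          (by simp [hν1 p hp'])
        simp only [dForm, map_sub, map_smul, sub_apply, smul_apply, smul_eq_mul] at h1 ⊢
        linarith
      rw [hd.fderiv]
      simpa [dForm] using key)
  have hν₀ : ν x₀ v₀ = 1 := hν1 x₀ hx₀'
  -- The velocity is minus the projection of `p - x₀` along `v₀`, so that the trajectory starting at
  -- `p` meets the line `x₀ + ℝ v₀` at time one.
  let j : E → E × E := fun p => (ν x₀ (p - x₀) • v₀ - (p - x₀), p)
  have hj : ContDiff ℝ ∞ j :=
    ((((ν x₀).contDiff.comp (contDiff_id.sub contDiff_const)).smul contDiff_const).sub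
      (contDiff_id.sub contDiff_const)).prodMk contDiff_id
  let O' : Set E := j ⁻¹' O ∩ U'
  have hO' : IsOpen O' := (hO.preimage hj.continuous).inter hU'
  let F : E → E × E := fun p => φ (j p)
  have hF : ContDiffOn ℝ ∞ F O' := hφ.comp hj.contDiffOn fun p hp => hp.1
  have hFU : ∀ p ∈ O', (F p).2 ∈ U' := fun p hp => (hφa _ hp.1).1.2.2
  have hFv : ∀ p ∈ O', (F p).2 = x₀ + ν x₀ ((F p).2 - x₀) • v₀ := by
    intro p hp
    obtain ⟨-, -, γ, h0, h1, hγ⟩ := hφa _ hp.1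
    have hγ1 : ∀ t ∈ Icc (0 : ℝ) 1, (γ t).1 = (γ 0).1 :=
      constant_of_has_deriv_right_zero (f := fun t => (γ t).1)
        (fun t ht => (hγ ⟨t, ht⟩).continuousAt.fst.continuousWithinAt)
        fun t ht => HasDerivAt.hasDerivWithinAt
          (show HasDerivAt (fun t => (γ t).1) 0 t from (hγ ⟨t, ht.1, ht.2.le⟩).fst)
    let ϖ : E →L[ℝ] E := ContinuousLinearMap.id ℝ E - (ν x₀).smulRight v₀
    have hϖ : ∀ w, ϖ w = w - ν x₀ w • v₀ := fun w => rfl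
    -- Modulo `v₀`, which `ϖ` kills, the trajectory moves with constant velocity.
    have hder : ∀ t ∈ Icc (0 : ℝ) 1, HasDerivAt (fun t => ϖ (γ t).2 - t • ϖ (j p).1) 0 t := by
      intro t ht
      have h2 : HasDerivAt (fun t => (γ t).2) (Y (γ t)) t := (hγ ⟨t, ht⟩).snd
      have h3 := (ϖ.hasFDerivAt.comp_hasDerivAt t h2).sub
        ((hasDerivAt_id t).smul_const (ϖ (j p).1))
      refine h3.congr_deriv ?_
      simp only [Y, hϖ, map_sub, map_smul, smul_eq_mul, hν₀, one_smul, hγ1 t ht, h0]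
      module
    have h2 := constant_of_has_deriv_right_zero
      (fun t ht => (hder t ht).continuousAt.continuousWithinAt)
      (fun t ht => (hder t ⟨ht.1, ht.2.le⟩).hasDerivWithinAt) 1 (by simp)
    rw [h0, h1, one_smul, zero_smul, sub_zero] at h2
    have h3 : ϖ (F p).2 = ϖ x₀ := by
      change ϖ (φ (j p)).2 = _
      rw [sub_eq_iff_eq_add.1 h2]
      simp only [hϖ, j, map_sub, map_smul, smul_eq_mul, hν₀]
      module
    rw [hϖ, hϖ] at h3
    rw [map_sub]
    rw [sub_eq_iff_eq_add] at h3
    refine h3.trans ?_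
    rw [sub_smul]
    abel
  -- The coordinate on the line of the end point of the trajectory. The flow preserves `ker ν`, and
  -- `ν(v₀) = 1` on the line, so `df` has the kernel of `ν`.
  let f : E → ℝ := fun p => ν x₀ ((F p).2 - x₀)
  have hf : ContDiffOn ℝ ∞ f O' :=
    (ν x₀).contDiff.comp_contDiffOn (hF.snd.sub contDiffOn_const)
  refine ⟨O', f, hO', ⟨?_, hx₀'⟩, fun z hz => hz.2.1, hf, fun z hz => ?_⟩
  · refine hCO ?_
    simp [j]
  have hfz : HasFDerivAt f (fderiv ℝ f z) z :=
    ((hf.contDiffAt (hO'.mem_nhds hz)).differentiableAt (by simp)).hasFDerivAt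
  have hφz : HasFDerivAt φ (fderiv ℝ φ (j z)) (j z) :=
    ((hφ.contDiffAt (hO.mem_nhds hz.1)).differentiableAt (by simp)).hasFDerivAt
  have hjz : ∀ w, (fderiv ℝ j z w).2 = w := fun w => by
    have h1 := ((hj.differentiable (by simp)) z).hasFDerivAt.snd
    have h2 := h1.unique (hasFDerivAt_id z)
    exact congrArg (fun L : E →L[ℝ] E => L w) h2
  have hFz : ∀ w, (fderiv ℝ φ (j z) (fderiv ℝ j z w)).2 = fderiv ℝ f z w • v₀ := fun w => by
    have h1 := (hφz.comp z ((hj.differentiable (by simp)) z).hasFDerivAt).snd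
    have h2 : HasFDerivAt (fun p => x₀ + f p • v₀) _ z := (hfz.smul_const v₀).const_add x₀
    have h3 := h2.congr_of_eventuallyEq (f₁ := fun p => (F p).2)
      (by filter_upwards [hO'.mem_nhds hz] with p hp using hFv p hp)
    exact congrArg (fun L : E →L[ℝ] E => L w) (h1.unique h3)
  have hker : ∀ v, μ z v = 0 ↔ fderiv ℝ f z v = 0 := fun v => by
    have h1 := (hφa _ hz.1).2.1 (fderiv ℝ j z v)
    simp only [ContinuousLinearMap.comp_apply, ContinuousLinearMap.coe_snd', hjz, hFz,
      map_smul, smul_eq_mul] at h1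
    rw [← hνμ z hz.2, ← show ν (j z).2 v = 0 ↔ ν z v = 0 from Iff.rfl, ← h1,
      hν1 _ (hFU z hz), mul_one]
  refine ⟨fun h0 => hz.2.2 ((hker v₀).2 (by rw [h0, zero_apply])), hker⟩

end Frobenius

/-! ### Smoothness of covectors along a map -/

section SmoothForms

variable {d : ℕ} {X : Type*} [TopologicalSpace X] [ChartedSpace (EuclideanSpace ℝ (Fin d)) X]
  [IsManifold (𝓡 d) ∞ X]
  {EN HN : Type*} [NormedAddCommGroup EN] [NormedSpace ℝ EN] [TopologicalSpace HN]
  {IN : ModelWithCorners ℝ EN HN} {N : Type*} [TopologicalSpace N] [ChartedSpace HN N]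
  {W : Type*} [NormedAddCommGroup W] [NormedSpace ℝ W]

/-- A family of covectors on a finite dimensional space is smooth if its values on vectors are. -/
lemma contMDiffAt_clm_of_apply [FiniteDimensional ℝ W] {f : N → W →L[ℝ] ℝ} {p : N}
    (hf : ∀ w, ContMDiffAt IN 𝓘(ℝ, ℝ) ∞ (fun x => f x w) p) :
    ContMDiffAt IN 𝓘(ℝ, W →L[ℝ] ℝ) ∞ f p := by
  let b := Module.finBasis ℝ W
  have h : f = fun x => ∑ i, f x (b i) • LinearMap.toContinuousLinearMap (b.coord i) := by
    funext x
    refine ContinuousLinearMap.ext fun w => ?_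
    conv_lhs => rw [← b.sum_repr w, map_sum]
    simp [mul_comm]
  rw [h]
  exact contMDiffAt_finsetSum fun i _ => (hf (b i)).smul contMDiffAt_const

/-- The pairing of a smooth covector and a smooth vector along a map. -/
lemma contMDiffAt_cotangent_apply {b : N → X} {ξ : (n : N) → CotangentAt d (b n)}
    {v : (n : N) → TangentSpace (𝓡 d) (b n)} {p : N}
    (hξ : ContMDiffAt IN (cotModel d) ∞ (fun n => (⟨b n, ξ n⟩ : CotangentBundle d X)) p)
    (hv : ContMDiffAt IN (𝓡 d).tangent ∞ (fun n => (⟨b n, v n⟩ : TangentBundle (𝓡 d) X)) p) :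
    ContMDiffAt IN 𝓘(ℝ, ℝ) ∞ (fun n => ξ n (v n)) p := by
  have h := ContMDiffAt.clm_bundle_apply (F₁ := EuclideanSpace ℝ (Fin d)) (F₂ := ℝ)
    (E₁ := fun x : X => TangentSpace (𝓡 d) x) (E₂ := Bundle.Trivial X ℝ) (IB := 𝓡 d)
    (ϕ := ξ) hξ hv
  exact (contMDiffAt_totalSpace.1 h).2

/-- Smoothness of a differential is expressed in trivializations. When the source is a vector space,
whose tangent bundle is trivialized by the identity, this expression is the fiber coordinate in the
tangent bundle of the target. -/
lemma inCoordinates_apply_of_model_source {x₀ x : W} {y₀ y : X}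
    (hy : y ∈ (trivializationAt (EuclideanSpace ℝ (Fin d)) (TangentSpace (𝓡 d)) y₀).baseSet)
    (A : TangentSpace 𝓘(ℝ, W) x →L[ℝ] TangentSpace (𝓡 d) y) (u : W) :
    ContinuousLinearMap.inCoordinates W (TangentSpace 𝓘(ℝ, W)) (EuclideanSpace ℝ (Fin d))
      (TangentSpace (𝓡 d)) x₀ x y₀ y A u =
      (trivializationAt (EuclideanSpace ℝ (Fin d)) (TangentSpace (𝓡 d)) y₀ ⟨y, A u⟩).2 := by
  rw [ContinuousLinearMap.inCoordinates, ContinuousLinearMap.comp_apply,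
    ContinuousLinearMap.comp_apply, Trivialization.continuousLinearMapAt_apply,
    Trivialization.linearMapAt_apply, if_pos hy, TangentBundle.symmL_model_space]
  rfl

/-- The dual situation: with a vector space as target, the trivialized differential yields the fiber
coordinate in the cotangent bundle of the source. -/
lemma inCoordinates_comp_of_model_target {x₀ x : X} {y₀ y : W}
    (A : TangentSpace (𝓡 d) x →L[ℝ] TangentSpace 𝓘(ℝ, W) y) (ζ : W →L[ℝ] ℝ) :
    ζ.comp (ContinuousLinearMap.inCoordinates (EuclideanSpace ℝ (Fin d)) (TangentSpace (𝓡 d)) W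
      (TangentSpace 𝓘(ℝ, W)) x₀ x y₀ y A) =
      (trivializationAt (EuclideanSpace ℝ (Fin d) →L[ℝ] ℝ) (fun x : X => CotangentAt d x) x₀
        ⟨x, ζ.comp A⟩).2 := by
  change _ = ContinuousLinearMap.inCoordinates (EuclideanSpace ℝ (Fin d)) (TangentSpace (𝓡 d)) ℝ
    (Bundle.Trivial X ℝ) x₀ x x₀ x (ζ.comp A)
  rw [ContinuousLinearMap.inCoordinates, ContinuousLinearMap.inCoordinates,
    TangentBundle.continuousLinearMapAt_model_space]
  have h : Trivialization.continuousLinearMapAt ℝ (trivializationAt ℝ (Bundle.Trivial X ℝ) x₀) x =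
    ContinuousLinearMap.id ℝ ℝ := Bundle.Trivial.continuousLinearMapAt_trivialization ℝ X ℝ x
  rw [h]
  rfl

/-- The derivative of a smooth map applied to a smooth vector. -/
lemma contMDiffAt_mfderiv_apply {f : W → X} {g v : N → W} {p : N}
    (hf : ContMDiffAt 𝓘(ℝ, W) (𝓡 d) ∞ f (g p)) (hg : ContMDiffAt IN 𝓘(ℝ, W) ∞ g p)
    (hv : ContMDiffAt IN 𝓘(ℝ, W) ∞ v p) :
    ContMDiffAt IN (𝓡 d).tangent ∞
      (fun n => (⟨f (g n), mfderiv 𝓘(ℝ, W) (𝓡 d) f (g n) (v n)⟩ : TangentBundle (𝓡 d) X)) p := by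
  have hfg : ContMDiffAt IN (𝓡 d) ∞ (fun n => f (g n)) p := hf.comp p hg
  refine contMDiffAt_totalSpace.2 ⟨hfg, ?_⟩
  have h1 := ((hf.mfderiv_const (m := ∞) (by simp)).comp p hg).clm_apply hv
  refine h1.congr_of_eventuallyEq ?_
  filter_upwards [hfg.continuousAt.preimage_mem_nhds
    ((trivializationAt (EuclideanSpace ℝ (Fin d)) (TangentSpace (𝓡 d)) (f (g p))).open_baseSet.mem_nhds
      (mem_baseSet_trivializationAt _ _ _))] with n hn
  exact (inCoordinates_apply_of_model_source hn _ _).symm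

/-- The pullback under a map to a vector space of a smooth family of covectors. -/
lemma contMDiffAt_cotangent_mk {f : X → W} {b : N → X} {ζ : N → W →L[ℝ] ℝ} {p : N}
    (hf : ContMDiffAt (𝓡 d) 𝓘(ℝ, W) ∞ f (b p)) (hb : ContMDiffAt IN (𝓡 d) ∞ b p)
    (hζ : ContMDiffAt IN 𝓘(ℝ, W →L[ℝ] ℝ) ∞ ζ p) :
    ContMDiffAt IN (cotModel d) ∞
      (fun n => (⟨b n, (ζ n).comp (mfderiv (𝓡 d) 𝓘(ℝ, W) f (b n))⟩ : CotangentBundle d X)) p := by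
  refine contMDiffAt_totalSpace.2 ⟨hb, ?_⟩
  have h1 := hζ.clm_comp ((hf.mfderiv_const (m := ∞) (by simp)).comp p hb)
  refine h1.congr_of_eventuallyEq ?_
  exact Eventually.of_forall fun n => (inCoordinates_comp_of_model_target _ _).symm

end SmoothForms

/-! ### Exterior derivatives of one-forms on manifolds -/

section ExtD

variable {d : ℕ} {X : Type*} [TopologicalSpace X] [ChartedSpace (EuclideanSpace ℝ (Fin d)) X]
  [IsManifold (𝓡 d) ∞ X]
  {d' : ℕ} {X' : Type*} [TopologicalSpace X'] [ChartedSpace (EuclideanSpace ℝ (Fin d')) X']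
  [IsManifold (𝓡 d') ∞ X']
  {E : Type*} [NormedAddCommGroup E] [NormedSpace ℝ E]

/-- The pullback of a one-form on a manifold to a vector space. -/
def formAlong (f : E → X) (μ : (x : X) → CotangentAt d x) (z : E) : E →L[ℝ] ℝ :=
  (μ (f z)).comp (mfderiv 𝓘(ℝ, E) (𝓡 d) f z)

lemma contMDiffAt_extChartAt_symm_of_mem {x : X} {z : EuclideanSpace ℝ (Fin d)}
    (hz : z ∈ (extChartAt (𝓡 d) x).target) :
    ContMDiffAt 𝓘(ℝ, EuclideanSpace ℝ (Fin d)) (𝓡 d) ∞ (extChartAt (𝓡 d) x).symm z :=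
  (contMDiffOn_extChartAt_symm x).contMDiffAt ((isOpen_extChartAt_target x).mem_nhds hz)

lemma contMDiffAt_extChartAt_of_mem {x y : X} (hy : y ∈ (extChartAt (𝓡 d) x).source) :
    ContMDiffAt (𝓡 d) 𝓘(ℝ, EuclideanSpace ℝ (Fin d)) ∞ (extChartAt (𝓡 d) x) y :=
  contMDiffAt_extChartAt' (by simpa using hy)

lemma eventually_mdifferentiableAt {EN HN : Type*} [NormedAddCommGroup EN] [NormedSpace ℝ EN]
    [TopologicalSpace HN] {IN : ModelWithCorners ℝ EN HN} {N : Type*} [TopologicalSpace N]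
    [ChartedSpace HN N] [IsManifold IN ∞ N] {EP HP : Type*} [NormedAddCommGroup EP]
    [NormedSpace ℝ EP] [TopologicalSpace HP] {IP : ModelWithCorners ℝ EP HP} {P : Type*}
    [TopologicalSpace P] [ChartedSpace HP P] [IsManifold IP ∞ P] {f : N → P} {x : N}
    (hf : ContMDiffAt IN IP ∞ f x) : ∀ᶠ y in 𝓝 x, MDifferentiableAt IN IP f y := by
  have : IsManifold IN 1 N := IsManifold.of_le (n := ∞) (by simp)
  have : IsManifold IP 1 P := IsManifold.of_le (n := ∞) (by simp)
  filter_upwards [(contMDiffAt_iff_contMDiffAt_nhds (n := 1) (by simp)).1 (hf.of_le (by simp))]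
    with y hy using hy.mdifferentiableAt (by simp)

lemma contDiffAt_formAlong [FiniteDimensional ℝ E] {f : E → X} {μ : (x : X) → CotangentAt d x}
    {z : E} (hf : ContMDiffAt 𝓘(ℝ, E) (𝓡 d) ∞ f z)
    (hμ : ContMDiffAt (𝓡 d) (cotModel d) ∞ (formMap μ) (f z)) :
    ContDiffAt ℝ ∞ (formAlong f μ) z := by
  refine contMDiffAt_iff_contDiffAt.1 (contMDiffAt_clm_of_apply fun w => ?_)
  exact contMDiffAt_cotangent_apply (b := f) (ξ := fun z => μ (f z)) (hμ.comp z hf)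
    (contMDiffAt_mfderiv_apply (g := id) (v := fun _ => w) hf contMDiffAt_id contMDiffAt_const)

lemma formAlong_congr {f g : E → X} (μ : (x : X) → CotangentAt d x) {z : E} (h : f =ᶠ[𝓝 z] g) :
    formAlong f μ z = formAlong g μ z := by
  have h1 : f z = g z := h.self_of_nhds
  have h2 := h.mfderiv_eq (I := 𝓘(ℝ, E)) (I' := 𝓡 d)
  simp only [formAlong]
  rw [h2]
  congr 1
  rw [h1]

lemma formAlong_comp {E' : Type*} [NormedAddCommGroup E'] [NormedSpace ℝ E'] {f : E' → X}
    {g : E → E'} (μ : (x : X) → CotangentAt d x) {z : E}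
    (hf : MDifferentiableAt 𝓘(ℝ, E') (𝓡 d) f (g z)) (hg : DifferentiableAt ℝ g z) :
    formAlong (f ∘ g) μ z = pullForm g (formAlong f μ) z := by
  refine ContinuousLinearMap.ext fun v => ?_
  refine congrArg (μ (f (g z))) ((mfderiv_comp_apply z hf hg.mdifferentiableAt v).trans ?_)
  rw [mfderiv_eq_fderiv]
  rfl

/-- Naturality of the exterior derivative, in the preferred chart of the target. -/
lemma dForm_formAlong {f : E → X} {μ : (x : X) → CotangentAt d x} {z : E} {y : X} (hy : f z = y)
    (hf : ContMDiffAt 𝓘(ℝ, E) (𝓡 d) ∞ f z)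
    (hμ : ContMDiffAt (𝓡 d) (cotModel d) ∞ (formMap μ) y) (u v : E) :
    dForm (formAlong f μ) z u v =
      extD μ y (fderiv ℝ (extChartAt (𝓡 d) y ∘ f) z u) (fderiv ℝ (extChartAt (𝓡 d) y ∘ f) z v) := by
  let φ := extChartAt (𝓡 d) y
  let g : E → EuclideanSpace ℝ (Fin d) := φ ∘ f
  have hg : ContDiffAt ℝ ∞ g z := contMDiffAt_iff_contDiffAt.1
    ((contMDiffAt_extChartAt' (by rw [hy]; exact mem_chart_source _ y)).comp z hf)
  have hgz : g z = φ y := by simp [g, hy]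
  have hφy : φ y ∈ φ.target := mem_extChartAt_target y
  have hsymm : ContMDiffAt 𝓘(ℝ, EuclideanSpace ℝ (Fin d)) (𝓡 d) ∞ φ.symm (φ y) :=
    contMDiffAt_extChartAt_symm_of_mem hφy
  have hev : ∀ᶠ z' in 𝓝 z, φ.symm (g z') = f z' := by
    filter_upwards [hf.continuousAt.preimage_mem_nhds
      (by rw [hy]; exact extChartAt_source_mem_nhds (I := 𝓡 d) y)] with z' hz'
    exact φ.left_inv hz'
  have h1 : formAlong f μ =ᶠ[𝓝 z] pullForm g (formInChart μ y) := by
    have h2 := hg.continuousAt.preimage_mem_nhds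
      (by rw [hgz]; exact (isOpen_extChartAt_target (I := 𝓡 d) y).mem_nhds hφy)
    have h3 := eventually_mdifferentiableAt (contMDiffAt_iff_contDiffAt.2 hg)
    filter_upwards [hev.eventually_nhds, h2, h3] with z' h4 h5 h6
    rw [← formAlong_congr μ (f := φ.symm ∘ g) h4]
    exact formAlong_comp μ
      ((contMDiffAt_extChartAt_symm_of_mem h5).mdifferentiableAt (by simp))
      h6.differentiableAt
  have h7 : DifferentiableAt ℝ (formInChart μ y) (g z) := by
    rw [hgz]
    have h8 : φ.symm (φ y) = y := φ.left_inv (mem_extChartAt_source y)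
    exact (contDiffAt_formAlong hsymm (by rw [h8]; exact hμ)).differentiableAt (by simp)
  rw [dForm_congr h1, dForm_pullForm (hg.of_le two_le_infty) h7, hgz]
  rfl

/-- Tangent spaces are identified with the model space through the preferred charts, so the
differential at `z` is computed in the chart at `f z`. -/
lemma mfderiv_eq_fderiv_extChartAt_comp {f : E → X} {z : E}
    (hf : MDifferentiableAt 𝓘(ℝ, E) (𝓡 d) f z) :
    mfderiv 𝓘(ℝ, E) (𝓡 d) f z = fderiv ℝ (extChartAt (𝓡 d) (f z) ∘ f) z := by
  refine (show mfderiv 𝓘(ℝ, E) (𝓡 d) f z = fderivWithin ℝ _ _ _ from if_pos hf).trans ?_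
  simp only [writtenInExtChartAt, modelWithCornersSelf_coe, range_id]
  exact congrFun fderivWithin_univ _

/-- This is `dForm_formAlong` for `f` composed with the inverse chart at `x`. The differential of
`f` is by definition the derivative of its expression in the preferred charts. -/
lemma extD_pullbackForm {f : X' → X} {μ : (x : X) → CotangentAt d x} {x : X'}
    (hf : ContMDiffAt (𝓡 d') (𝓡 d) ∞ f x)
    (hμ : ContMDiffAt (𝓡 d) (cotModel d) ∞ (formMap μ) (f x)) (u v : TangentSpace (𝓡 d') x) :
    extD (pullbackForm (d := d') μ f) x u v =
      extD μ (f x) (mfderiv (𝓡 d') (𝓡 d) f x u) (mfderiv (𝓡 d') (𝓡 d) f x v) := by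
  let φ := extChartAt (𝓡 d') x
  have hφx : φ x ∈ φ.target := mem_extChartAt_target x
  have hsymm := contMDiffAt_extChartAt_symm_of_mem hφx
  have hxx : φ.symm (φ x) = x := φ.left_inv (mem_extChartAt_source x)
  have hf' : ContMDiffAt (𝓡 d') (𝓡 d) ∞ f (φ.symm (φ x)) := by rw [hxx]; exact hf
  have h1 : formInChart (pullbackForm (d := d') μ f) x =ᶠ[𝓝 (φ x)] formAlong (f ∘ φ.symm) μ := by
    filter_upwards [eventually_mdifferentiableAt hsymm,
      hsymm.continuousAt.eventually (eventually_mdifferentiableAt hf')] with z hz hz'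
    refine ContinuousLinearMap.ext fun w => ?_
    exact congrArg (μ (f (φ.symm z))) (mfderiv_comp_apply z hz' hz w).symm
  have h2 := dForm_formAlong (f := f ∘ φ.symm) (y := f x) (by simp [hxx]) (hf'.comp _ hsymm) hμ u v
  replace h2 := (dForm_congr h1 _ _).trans h2
  have h3 : mfderiv (𝓡 d') (𝓡 d) f x =
      fderiv ℝ (extChartAt (𝓡 d) (f x) ∘ f ∘ φ.symm) (φ x) := by
    refine (show mfderiv (𝓡 d') (𝓡 d) f x = fderivWithin ℝ _ _ _ from
      if_pos (hf.mdifferentiableAt (by simp))).trans ?_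
    simp only [writtenInExtChartAt, modelWithCornersSelf_coe, range_id]
    exact congrFun fderivWithin_univ _
  rw [h3]
  exact h2

/-- One-forms with the same kernels have proportional exterior derivatives on the kernel. -/
lemma exists_dForm_eq_mul {a b : E → E →L[ℝ] ℝ} {z : E} (ha : DifferentiableAt ℝ a z)
    (hb : DifferentiableAt ℝ b z) (h : ∀ᶠ y in 𝓝 z, ∀ v, a y v = 0 ↔ b y v = 0) (h0 : a z ≠ 0) :
    ∃ c : ℝ, c ≠ 0 ∧ ∀ u v, a z u = 0 → a z v = 0 → dForm b z u v = c * dForm a z u v := by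
  obtain ⟨v₀, hv₀⟩ : ∃ v₀, a z v₀ ≠ 0 := by
    by_contra! h
    exact h0 (ContinuousLinearMap.ext h)
  have hav : DifferentiableAt ℝ (fun y => a y v₀) z := ha.clm_apply (differentiableAt_const _)
  have hbv : DifferentiableAt ℝ (fun y => b y v₀) z := hb.clm_apply (differentiableAt_const _)
  -- The factor of proportionality is read off on a vector outside the kernel, so it is
  -- differentiable; its differential plays no role on the kernel.
  let c : E → ℝ := fun y => b y v₀ / a y v₀
  have hc : DifferentiableAt ℝ c z := by
    simp only [c, div_eq_mul_inv]
    exact hbv.mul (hav.inv hv₀)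
  refine ⟨c z, div_ne_zero (fun h1 => hv₀ ((h.self_of_nhds v₀).2 h1)) hv₀, fun u v hu hv => ?_⟩
  have h1 : b =ᶠ[𝓝 z] fun y => c y • a y := by
    filter_upwards [h, hav.continuousAt.eventually_ne hv₀] with y hy hy0
    refine ContinuousLinearMap.ext fun w => ?_
    have h2 := (hy (w - (a y w / a y v₀) • v₀)).1 (by simp [div_mul_cancel₀ _ hy0])
    rw [map_sub, map_smul, sub_eq_zero, smul_eq_mul] at h2
    rw [h2, smul_apply, smul_eq_mul]
    simp only [c]
    ring
  rw [dForm_congr h1, dForm_smul_of_eq_zero hc ha hu hv]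

/-- At its base point the preferred chart has the identity as differential, because the chart itself
defines the identification of the tangent space. -/
lemma formInChart_self (μ : (x : X) → CotangentAt d x) (x : X) (v : TangentSpace (𝓡 d) x) :
    formInChart μ x (extChartAt (𝓡 d) x x) v = μ x v := by
  have h1 := mfderivWithin_range_extChartAt_symm (I := 𝓡 d) (x := x)
  have h2 : (extChartAt (𝓡 d) x).symm (extChartAt (𝓡 d) x x) = x :=
    (extChartAt (𝓡 d) x).left_inv (mem_extChartAt_source x)
  simp only [modelWithCornersSelf_coe, range_id, mfderivWithin_univ] at h1
  have h3 : ∀ y (_ : y = x), (μ y : EuclideanSpace ℝ (Fin d) →L[ℝ] ℝ) v = μ x v := by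
    rintro y rfl; rfl
  refine Eq.trans ?_ (h3 _ h2)
  exact congrArg (μ ((extChartAt (𝓡 d) x).symm (extChartAt (𝓡 d) x x)))
    (congrArg (fun L : EuclideanSpace ℝ (Fin d) →L[ℝ] EuclideanSpace ℝ (Fin d) => L v) h1)

lemma differentiableAt_formInChart {μ : (x : X) → CotangentAt d x} {x : X}
    (hμ : ContMDiffAt (𝓡 d) (cotModel d) ∞ (formMap μ) x) :
    DifferentiableAt ℝ (formInChart μ x) (extChartAt (𝓡 d) x x) := by
  refine (contDiffAt_formAlong (contMDiffAt_extChartAt_symm_of_mem (mem_extChartAt_target x))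
    ?_).differentiableAt (by simp)
  rwa [(extChartAt (𝓡 d) x).left_inv (mem_extChartAt_source x)]

/-- The kernel of a nowhere vanishing one-form `μ` is a foliation if and only if `dμ` vanishes on
it. -/
theorem isCodimOneFoliation_kerField_iff {μ : (x : X) → CotangentAt d x} (hμ : IsSmoothForm μ)
    (h0 : ∀ x, μ x ≠ 0) : IsCodimOneFoliation (kerField μ) ↔
      ∀ x u v, μ x u = 0 → μ x v = 0 → extD μ x u v = 0 := by
  constructor
  · intro h x u v hu hv
    obtain ⟨O, f, hO, hxO, hf, hfO⟩ := h x
    let φ := extChartAt (𝓡 d) x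
    have hsymm := contMDiffAt_extChartAt_symm_of_mem (mem_extChartAt_target (I := 𝓡 d) x)
    have hxx : φ.symm (φ x) = x := φ.left_inv (mem_extChartAt_source x)
    have hO' : O ∈ 𝓝 (φ.symm (φ x)) := by rw [hxx]; exact hO.mem_nhds hxO
    have hg : ContDiffAt ℝ ∞ (f ∘ φ.symm) (φ x) := contMDiffAt_iff_contDiffAt.1
      (((hf.contMDiffAt hO').comp _ hsymm))
    -- In the chart, `μ` has the kernel of the exact form `d(f ∘ φ.symm)`, whose exterior derivative
    -- is zero.
    obtain ⟨c, hc, h1⟩ := exists_dForm_eq_mul (differentiableAt_formInChart (hμ x))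
      (b := fderiv ℝ (f ∘ φ.symm)) ((hg.fderiv_right (m := 1) two_le_infty).differentiableAt (by simp))
      (by
        filter_upwards [hsymm.continuousAt.preimage_mem_nhds hO', eventually_mdifferentiableAt hsymm]
          with z hz hz' v
        have h3 := mfderiv_comp_apply z
          ((hf.contMDiffAt (hO.mem_nhds hz)).mdifferentiableAt (by simp)) hz' v
        rw [mfderiv_eq_fderiv] at h3
        exact ((hfO _ hz).2 _).trans (Eq.congr_left h3.symm))
      (fun h2 => h0 x (ContinuousLinearMap.ext fun v => by
        rw [← formInChart_self μ x v, h2]; rfl))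
    have h2 := h1 u v (by rwa [formInChart_self]) (by rwa [formInChart_self])
    have hsm : IsSymmSndFDerivAt ℝ (f ∘ φ.symm) (φ x) :=
      (hg.of_le two_le_infty).isSymmSndFDerivAt (by simp)
    have h3 : dForm (fderiv ℝ (f ∘ φ.symm)) (φ x) u v = 0 := sub_eq_zero.2 (hsm u v)
    rw [h3] at h2
    exact (mul_eq_zero.1 h2.symm).resolve_left hc
  · intro h x
    let φ := extChartAt (𝓡 d) x
    have hφt : IsOpen φ.target := isOpen_extChartAt_target x
    have hφs : IsOpen φ.source := isOpen_extChartAt_source x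
    have hsymm : ∀ z ∈ φ.target, ContMDiffAt 𝓘(ℝ, EuclideanSpace ℝ (Fin d)) (𝓡 d) ∞ φ.symm z :=
      fun z hz => contMDiffAt_extChartAt_symm_of_mem hz
    obtain ⟨O, f, hO, hxO, hOt, hf, hfO⟩ := exists_fderiv_ker_eq (μ := formInChart μ x) hφt
      (mem_extChartAt_target x)
      (fun z hz => (contDiffAt_formAlong (hsymm z hz) (hμ _)).contDiffWithinAt)
      (fun h2 => h0 x (ContinuousLinearMap.ext fun v => by
        rw [← formInChart_self μ x v, h2]; rfl))
      (fun z hz u v hu hv => by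
        change dForm (formAlong φ.symm μ) z u v = 0
        rw [dForm_formAlong rfl (hsymm z hz) (hμ _),
          ← mfderiv_eq_fderiv_extChartAt_comp ((hsymm z hz).mdifferentiableAt (by simp))]
        exact h _ _ _ hu hv)
    refine ⟨φ.source ∩ φ ⁻¹' O, f ∘ φ,
      (continuousOn_extChartAt x).isOpen_inter_preimage hφs hO,
      ⟨mem_extChartAt_source x, hxO⟩, fun z hz => ?_, fun z hz => ?_⟩
    · exact (((contMDiffOn_iff_contDiffOn.2 hf).contMDiffAt (hO.mem_nhds hz.2)).comp z
        (contMDiffAt_extChartAt_of_mem hz.1)).contMDiffWithinAt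
    have hd : ∀ v, mfderiv (𝓡 d) 𝓘(ℝ, ℝ) (f ∘ φ) z v =
        fderiv ℝ f (φ z) (mfderiv (𝓡 d) 𝓘(ℝ, EuclideanSpace ℝ (Fin d)) φ z v) := fun v => by
      rw [← mfderiv_eq_fderiv]
      exact mfderiv_comp_apply z (((hf.contDiffAt (hO.mem_nhds hz.2)).differentiableAt
        (by simp)).mdifferentiableAt) ((contMDiffAt_extChartAt_of_mem hz.1).mdifferentiableAt
        (by simp)) v
    have hμz : ∀ v, formInChart μ x (φ z)
        (mfderiv (𝓡 d) 𝓘(ℝ, EuclideanSpace ℝ (Fin d)) φ z v) = μ z v := fun v => by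
      have h1 := mfderivWithin_extChartAt_symm_comp_mfderiv_extChartAt' (I := 𝓡 d) hz.1
      simp only [modelWithCornersSelf_coe, range_id, mfderivWithin_univ] at h1
      have h3 : ∀ y (_ : y = z), (μ y : EuclideanSpace ℝ (Fin d) →L[ℝ] ℝ) v = μ z v := by
        rintro y rfl; rfl
      refine Eq.trans ?_ (h3 _ (φ.left_inv hz.1))
      exact congrArg (μ (φ.symm (φ z)))
        (congrArg (fun L : EuclideanSpace ℝ (Fin d) →L[ℝ] EuclideanSpace ℝ (Fin d) => L v) h1)
    have hiff : ∀ v, v ∈ kerField μ z ↔ mfderiv (𝓡 d) 𝓘(ℝ, ℝ) (f ∘ φ) z v = 0 := fun v => by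
      rw [hd]
      exact (Eq.congr_left (hμz v)).symm.trans ((hfO _ hz.2).2 _)
    refine ⟨fun h2 => h0 z (ContinuousLinearMap.ext fun v => ?_), hiff⟩
    have := (hiff v).2 (by rw [h2]; rfl)
    exact LinearMap.mem_ker.1 this

end ExtD

/-! ### Inverse functions and immersions on manifolds without boundary -/

section Inverse

variable {E H : Type*} [NormedAddCommGroup E] [NormedSpace ℝ E] [CompleteSpace E]
  [TopologicalSpace H] {I : ModelWithCorners ℝ E H} [I.Boundaryless]
  {X : Type*} [TopologicalSpace X] [ChartedSpace H X] [IsManifold I ∞ X]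
  {E' H' : Type*} [NormedAddCommGroup E'] [NormedSpace ℝ E']
  [TopologicalSpace H'] {J : ModelWithCorners ℝ E' H'} [J.Boundaryless]
  {Z : Type*} [TopologicalSpace Z] [ChartedSpace H' Z] [IsManifold J ∞ Z]

lemma mfderiv_apply_of_leftInverse {f : X → Z} {g : Z → X} {x : X}
    (hg : MDifferentiableAt J I g (f x)) (hf : MDifferentiableAt I J f x)
    (h : ∀ᶠ y in 𝓝 x, g (f y) = y) (v : TangentSpace I x) :
    (mfderiv J I g (f x) (mfderiv I J f x v) : E) = v := by
  have h1 : g ∘ f =ᶠ[𝓝 x] id := h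
  have h2 := (mfderiv_comp x hg hf).symm.trans h1.mfderiv_eq
  exact (congrArg (fun L : E →L[ℝ] E => L v) h2).trans
    (congrArg (fun L : E →L[ℝ] E => L v) mfderiv_id)

lemma mfderiv_injective_of_leftInverse {f : X → Z} {g : Z → X} {x : X}
    (hg : MDifferentiableAt J I g (f x)) (hf : MDifferentiableAt I J f x)
    (h : ∀ᶠ y in 𝓝 x, g (f y) = y) : Function.Injective (mfderiv I J f x) := by
  intro v w hvw
  rw [← show (mfderiv J I g (f x) (mfderiv I J f x v) : E) = v from
    mfderiv_apply_of_leftInverse hg hf h v, hvw]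
  exact mfderiv_apply_of_leftInverse hg hf h w

/-- The extended chart as a homeomorphism onto an open subset of the model vector space. -/
def boundarylessChart (I : ModelWithCorners ℝ E H) [I.Boundaryless] (x : X) :
    OpenPartialHomeomorph X E where
  toPartialEquiv := extChartAt I x
  open_source := isOpen_extChartAt_source x
  open_target := isOpen_extChartAt_target x
  continuousOn_toFun := continuousOn_extChartAt x
  continuousOn_invFun := continuousOn_extChartAt_symm x

/-- `exists_smooth_inverse_of_isCompact` for a single point, transferred through charts. -/
lemma exists_openPartialHomeomorph_of_mfderiv {f : X → Z} {x : X} {U : Set X} (hU : IsOpen U)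
    (hx : x ∈ U) (hf : ContMDiffOn I J ∞ f U) (A : E ≃L[ℝ] E')
    (hA : ∀ v : E, (mfderiv I J f x v : E') = A v) :
    ∃ e : OpenPartialHomeomorph X Z, x ∈ e.source ∧ e.source ⊆ U ∧ EqOn f e e.source ∧
      ContMDiffOn J I ∞ e.symm e.target := by
  let φ := boundarylessChart I x
  let ψ := boundarylessChart J (f x)
  have hφx : x ∈ φ.source := mem_extChartAt_source x
  have hψx : f x ∈ ψ.source := mem_extChartAt_source (f x)
  have hφ : ContMDiffOn I 𝓘(ℝ, E) ∞ φ φ.source := fun y hy =>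
    (contMDiffAt_extChartAt' (by simpa [φ, boundarylessChart] using hy)).contMDiffWithinAt
  have hψ : ContMDiffOn J 𝓘(ℝ, E') ∞ ψ ψ.source := fun y hy =>
    (contMDiffAt_extChartAt' (by simpa [ψ, boundarylessChart] using hy)).contMDiffWithinAt
  have hφs : ContMDiffOn 𝓘(ℝ, E) I ∞ φ.symm φ.target := contMDiffOn_extChartAt_symm x
  have hψs : ContMDiffOn 𝓘(ℝ, E') J ∞ ψ.symm ψ.target := contMDiffOn_extChartAt_symm (f x)
  let V : Set X := U ∩ f ⁻¹' ψ.source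
  have hV : IsOpen V := hf.continuousOn.isOpen_inter_preimage hU ψ.open_source
  let U0 : Set E := φ.target ∩ φ.symm ⁻¹' V
  have hU0 : IsOpen U0 := φ.symm.isOpen_inter_preimage hV
  have hxU0 : φ x ∈ U0 := ⟨φ.map_source hφx, by
    rw [mem_preimage, φ.left_inv hφx]; exact ⟨hx, hψx⟩⟩
  let F : E → E' := ψ ∘ f ∘ φ.symm
  have hF : ContDiffOn ℝ ∞ F U0 := contMDiffOn_iff_contDiffOn.1
    (hψ.comp (hf.comp (hφs.mono inter_subset_left) fun z hz => hz.2.1) fun z hz => hz.2.2)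
  have hFd : HasFDerivAt F (A : E →L[ℝ] E') (φ x) := by
    have h1 := ((hf.contMDiffAt (hU.mem_nhds hx)).mdifferentiableAt (by simp)).hasMFDerivAt.2
    rw [I.range_eq_univ] at h1
    have h2 : (A : E →L[ℝ] E') = mfderiv I J f x := ContinuousLinearMap.ext fun v => (hA v).symm
    rw [h2]
    exact hasFDerivWithinAt_univ.1 h1
  obtain ⟨e0, hxe0, he0U, he0, he0s⟩ := exists_smooth_inverse_of_isCompact
    (isCompact_singleton (x := φ x)) (injOn_singleton _ _) hU0 (singleton_subset_iff.2 hxU0) hF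
    (fun z hz => by rw [mem_singleton_iff.1 hz]; exact ⟨A, hFd⟩)
  let e := (φ.trans e0).trans ψ.symm
  have hes : ∀ y ∈ e.source, y ∈ φ.source ∧ φ y ∈ e0.source ∧ e0 (φ y) ∈ ψ.target := by
    intro y hy
    simp only [e, OpenPartialHomeomorph.trans_source, mem_inter_iff, mem_preimage,
      OpenPartialHomeomorph.symm_source] at hy
    exact ⟨hy.1.1, hy.1.2, hy.2⟩
  have hfe : ∀ y ∈ φ.source, φ y ∈ e0.source → y ∈ V ∧ e0 (φ y) = ψ (f y) := by
    intro y hy hy'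
    have h1 := (he0U hy').2
    rw [mem_preimage, φ.left_inv hy] at h1
    refine ⟨h1, ?_⟩
    rw [he0]
    change ψ (f (φ.symm (φ y))) = _
    rw [φ.left_inv hy]
  refine ⟨e, ?_, fun y hy => ?_, fun y hy => ?_, ?_⟩
  · have h1 : φ x ∈ e0.source := hxe0 rfl
    simp only [e, OpenPartialHomeomorph.trans_source, mem_inter_iff, mem_preimage,
      OpenPartialHomeomorph.symm_source]
    refine ⟨⟨hφx, h1⟩, ?_⟩
    change e0 (φ x) ∈ _
    rw [(hfe x hφx h1).2]
    exact ψ.map_source hψx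
  · obtain ⟨h1, h2, -⟩ := hes y hy
    exact (hfe y h1 h2).1.1
  · obtain ⟨h1, h2, -⟩ := hes y hy
    obtain ⟨h3, h4⟩ := hfe y h1 h2
    change f y = ψ.symm (e0 (φ y))
    rw [h4, ψ.left_inv h3.2]
  · have h1 : ∀ z ∈ e.target, z ∈ ψ.source ∧ ψ z ∈ e0.target ∧ e0.symm (ψ z) ∈ φ.target := by
      intro z hz
      simp only [e, OpenPartialHomeomorph.trans_target, mem_inter_iff, mem_preimage,
        OpenPartialHomeomorph.symm_target, OpenPartialHomeomorph.symm_symm] at hz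
      exact ⟨hz.1, hz.2.1, hz.2.2⟩
    exact hφs.comp ((contMDiffOn_iff_contDiffOn.2 he0s).comp (hψ.mono fun z hz => (h1 z hz).1)
      fun z hz => (h1 z hz).2.1) fun z hz => (h1 z hz).2.2

/-- The inverse function theorem along a compact subset of a manifold. -/
theorem exists_diffeo_of_isCompact [FiniteDimensional ℝ E] [FiniteDimensional ℝ E'] [T2Space Z]
    [Nonempty X] (hdim : Module.finrank ℝ E = Module.finrank ℝ E') {f : X → Z} {C U : Set X}
    (hC : IsCompact C) (hinj : InjOn f C) (hU : IsOpen U) (hCU : C ⊆ U)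
    (hf : ContMDiffOn I J ∞ f U) (hd : ∀ x ∈ C, Function.Injective (mfderiv I J f x)) :
    ∃ e : OpenPartialHomeomorph X Z, C ⊆ e.source ∧ e.source ⊆ U ∧ ⇑e = f ∧
      ContMDiffOn J I ∞ e.symm e.target := by
  -- The points near which a smooth local inverse exists form an open set. The topological statement
  -- then produces one inverse near `C`, and it is smooth because it agrees locally with these.
  let U' : Set X := {x | ∃ e : OpenPartialHomeomorph X Z, x ∈ e.source ∧ e.source ⊆ U ∧
      EqOn f e e.source ∧ ContMDiffOn J I ∞ e.symm e.target}
  have hU' : IsOpen U' := isOpen_iff_mem_nhds.2 fun x ⟨e, hx, he⟩ =>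
    mem_of_superset (e.open_source.mem_nhds hx) fun y hy => ⟨e, hy, he⟩
  have hCU' : C ⊆ U' := by
    intro x hx
    let L : E →ₗ[ℝ] E' := (mfderiv I J f x : E →L[ℝ] E').toLinearMap
    have hL : Function.Injective L := hd x hx
    exact exists_openPartialHomeomorph_of_mfderiv hU (hCU hx) hf
      (LinearEquiv.ofInjectiveOfFinrankEq L hL hdim).toContinuousLinearEquiv fun v => rfl
  have hU'U : U' ⊆ U := fun x ⟨e, hx, he, _⟩ => he hx
  obtain ⟨e', hCe', heU', he'⟩ := exists_openPartialHomeomorph_of_isCompact hC hinj hU' hCU'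
    (IsLocalHomeomorphOn.mk f U' fun y ⟨e, hy, _, hfe, _⟩ => ⟨e, hy, hfe⟩)
  refine ⟨e', hCe', heU'.trans hU'U, he', fun z hz => ?_⟩
  have hy := e'.map_target hz
  obtain ⟨e, hyx, -, hfe, hes⟩ := heU' hy
  have hfy : f (e'.symm z) = z := by rw [← he']; exact e'.right_inv hz
  have hzx : z ∈ e.target := by
    rw [← hfy, hfe hyx]
    exact e.map_source hyx
  have hzy : e.symm z = e'.symm z := by
    conv_lhs => rw [← hfy, hfe hyx]
    exact e.left_inv hyx
  have hsm := hes.contMDiffAt (e.open_target.mem_nhds hzx)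
  refine (hsm.congr_of_eventuallyEq ?_).contMDiffWithinAt
  filter_upwards [e.open_target.mem_nhds hzx, e'.open_target.mem_nhds hz,
    hsm.continuousAt.preimage_mem_nhds
      (by rw [hzy]; exact e'.open_source.mem_nhds hy)] with w hw hw' hws
  refine e'.injOn (e'.map_target hw') hws ?_
  rw [e'.right_inv hw', he', hfe (e.map_target hw), e.right_inv hw]

end Inverse

section Immersion

/-- In adapted charts the immersion is `y ↦ (y, 0)`, and the first projection inverts it. -/
lemma exists_leftInverse_of_isImmersionAt {E H : Type*} [NormedAddCommGroup E] [NormedSpace ℝ E]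
    [TopologicalSpace H] {I : ModelWithCorners ℝ E H} [I.Boundaryless]
    {X : Type*} [TopologicalSpace X] [ChartedSpace H X] [IsManifold I ∞ X]
    {E' H' : Type*} [NormedAddCommGroup E'] [NormedSpace ℝ E']
    [TopologicalSpace H'] {J : ModelWithCorners ℝ E' H'} [J.Boundaryless]
    {Z : Type*} [TopologicalSpace Z] [ChartedSpace H' Z] [IsManifold J ∞ Z] {F : Type*}
    [NormedAddCommGroup F] [NormedSpace ℝ F] {f : X → Z} {x : X}
    (h : IsImmersionAtOfComplement F I J ∞ f x) :
    ∃ g : Z → X, ContMDiffAt J I ∞ g (f x) ∧ ∀ᶠ y in 𝓝 x, g (f y) = y := by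
  let φ := h.domChart.extend I
  let ψ := h.codChart.extend J
  have hφx : x ∈ φ.source := by
    rw [OpenPartialHomeomorph.extend_source]; exact h.mem_domChart_source
  have hfx : f x ∈ h.codChart.source := h.mem_codChart_source
  let k : E' → E := fun w => (h.equiv.symm w).1
  have hk : ContDiff ℝ ∞ k := contDiff_fst.comp h.equiv.symm.contDiff
  have hkf : ∀ y ∈ φ.source, k (ψ (f y)) = φ y := by
    intro y hy
    have h1 := h.writtenInCharts (φ.map_source hy)
    simp only [Function.comp_apply] at h1
    change ψ (f (φ.symm (φ y))) = _ at h1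
    rw [φ.left_inv hy] at h1
    simp only [k, h1, ContinuousLinearEquiv.symm_apply_apply]
  refine ⟨fun z => φ.symm (k (ψ z)), ?_, ?_⟩
  · have h1 : ContMDiffAt J 𝓘(ℝ, E') ∞ ψ (f x) :=
      (OpenPartialHomeomorph.contMDiffOn_extend h.codChart_mem_maximalAtlas).contMDiffAt
        (h.codChart.open_source.mem_nhds hfx)
    have h2 : ContMDiffAt 𝓘(ℝ, E) I ∞ φ.symm (k (ψ (f x))) := by
      refine (contMDiffOn_extend_symm h.domChart_mem_maximalAtlas).contMDiffAt ?_
      rw [hkf x hφx]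
      refine (I.toHomeomorph.isOpenMap _ h.domChart.open_target).mem_nhds
        ⟨h.domChart x, h.domChart.map_source h.mem_domChart_source, rfl⟩
    exact h2.comp (f x) ((contMDiffAt_iff_contDiffAt.2 hk.contDiffAt).comp (f x) h1)
  · have h3 : φ.source ∈ 𝓝 x := by
      rw [OpenPartialHomeomorph.extend_source]
      exact h.domChart.open_source.mem_nhds h.mem_domChart_source
    filter_upwards [h3] with y hy
    rw [hkf y hy, φ.left_inv hy]

variable {d m : ℕ} {X : Type*} [TopologicalSpace X] [ChartedSpace (EuclideanSpace ℝ (Fin d)) X]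
  [IsManifold (𝓡 d) ∞ X] {Z : Type*} [TopologicalSpace Z]
  [ChartedSpace (EuclideanSpace ℝ (Fin m)) Z] [IsManifold (𝓡 m) ∞ Z]

/-- A smooth map with injective differentials is an immersion. -/
theorem isImmersion_of_injective_mfderiv {f : X → Z} (hf : ContMDiff (𝓡 d) (𝓡 m) ∞ f)
    (hd : ∀ x, Function.Injective (mfderiv (𝓡 d) (𝓡 m) f x)) : IsImmersion (𝓡 d) (𝓡 m) ∞ f := by
  let E := EuclideanSpace ℝ (Fin d)
  let E' := EuclideanSpace ℝ (Fin m)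
  -- As soon as `X` has a point, injectivity of the differential gives `d ≤ m`, and the truncated
  -- subtraction is the codimension.
  let F := EuclideanSpace ℝ (Fin (m - d))
  refine ⟨F, inferInstance, inferInstance, fun x => ?_⟩
  let L : E →L[ℝ] E' := mfderiv (𝓡 d) (𝓡 m) f x
  have hL : Function.Injective L.toLinearMap := hd x
  obtain ⟨p, hp⟩ := Submodule.exists_isCompl (LinearMap.range L.toLinearMap)
  have hrank : Module.finrank ℝ F = Module.finrank ℝ p := by
    have h1 := Submodule.finrank_add_eq_of_isCompl hp
    rw [LinearMap.finrank_range_of_inj hL] at h1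
    simp only [E, E', F, finrank_euclideanSpace_fin] at h1 ⊢
    omega
  let A : (E × F) ≃L[ℝ] E' := (((LinearEquiv.ofInjective L.toLinearMap hL).prodCongr
    (LinearEquiv.ofFinrankEq F p hrank)).trans
      (Submodule.prodEquivOfIsCompl _ _ hp)).toContinuousLinearEquiv
  have hA : ∀ y, A (y, 0) = L y := fun y => by simp [A]
  let φ := chartAt E x
  let ψ := chartAt E' (f x)
  have hφx : x ∈ φ.source := mem_chart_source _ x
  have hψx : f x ∈ ψ.source := mem_chart_source _ (f x)
  let U0 : Set E := φ.target ∩ φ.symm ⁻¹' (f ⁻¹' ψ.source)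
  have hU0 : IsOpen U0 := φ.symm.isOpen_inter_preimage (ψ.open_source.preimage hf.continuous)
  have hxU0 : φ x ∈ U0 := ⟨φ.map_source hφx, by
    rw [mem_preimage, φ.left_inv hφx]; exact hψx⟩
  let g : E → E' := ψ ∘ f ∘ φ.symm
  have hg : ContDiffOn ℝ ∞ g U0 := contMDiffOn_iff_contDiffOn.1
    ((contMDiffOn_chart (I := 𝓡 m) (n := ∞)).comp (hf.comp_contMDiffOn
      ((contMDiffOn_chart_symm (I := 𝓡 d) (n := ∞)).mono inter_subset_left)) fun z hz => hz.2)
  have hgd : HasFDerivAt g L (φ x) := by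
    have h1 := ((hf x).mdifferentiableAt (by simp)).hasMFDerivAt.2
    rw [(𝓡 d).range_eq_univ] at h1
    exact hasFDerivWithinAt_univ.1 h1
  -- The coordinate expression of `f` is extended along a complement of the image of its
  -- differential to a local diffeomorphism. The inverse of this extension straightens the image and
  -- gives the adapted chart of the target.
  let G : E × F → E' := fun q => g q.1 + A (0, q.2)
  have hG : ContDiffOn ℝ ∞ G (U0 ×ˢ univ) :=
    (hg.comp contDiffOn_fst fun q hq => hq.1).add
      ((A.contDiff.comp (contDiff_const.prodMk contDiff_snd)).contDiffOn)
  have hGd : HasFDerivAt G (A : (E × F) →L[ℝ] E') (φ x, 0) := by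
    have h1 : HasFDerivAt (fun q : E × F => g q.1) (L.comp (ContinuousLinearMap.fst ℝ E F))
        (φ x, 0) := HasFDerivAt.comp (g := g) (f := Prod.fst) ((φ x, 0) : E × F) hgd hasFDerivAt_fst
    have h2 : HasFDerivAt (fun q : E × F => A (0, q.2))
        ((A : (E × F) →L[ℝ] E').comp ((ContinuousLinearMap.inr ℝ E F).comp
          (ContinuousLinearMap.snd ℝ E F))) (φ x, 0) :=
      ((A : (E × F) →L[ℝ] E').comp ((ContinuousLinearMap.inr ℝ E F).comp
          (ContinuousLinearMap.snd ℝ E F))).hasFDerivAt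
    refine (h1.add h2).congr_fderiv (ContinuousLinearMap.ext fun q => ?_)
    change L q.1 + A (0, q.2) = A q
    rw [← hA, ← map_add]
    simp
  obtain ⟨e0, hxe0, he0U, he0, he0s⟩ := exists_smooth_inverse_of_isCompact
    (isCompact_singleton (x := ((φ x, 0) : E × F))) (injOn_singleton _ _)
    (hU0.prod isOpen_univ) (singleton_subset_iff.2 ⟨hxU0, trivial⟩) hG
    (fun z hz => by rw [mem_singleton_iff.1 hz]; exact ⟨A, hGd⟩)
  let e1 : OpenPartialHomeomorph E' E' := e0.symm.trans A.toHomeomorph.toOpenPartialHomeomorph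
  have he1 : ∀ z, e1 z = A (e0.symm z) := fun z => rfl
  have he1s : ∀ z, e1.symm z = e0 (A.symm z) := fun z => rfl
  have he1src : e1.source = e0.target := by simp [e1]
  have he1tgt : e1.target = A.symm ⁻¹' e0.source := by
    ext z; simp [e1]
  let cod : OpenPartialHomeomorph Z E' := ψ.trans e1
  let s : Set X := φ.source ∩ φ ⁻¹' ((fun y => ((y, 0) : E × F)) ⁻¹' e0.source)
  have hs : IsOpen s := φ.isOpen_inter_preimage (e0.open_source.preimage (by fun_prop))
  let dom : OpenPartialHomeomorph X E := φ.restr s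
  have hdoms : dom.source = s := by
    simp only [dom, OpenPartialHomeomorph.restr_source, hs.interior_eq]
    exact inter_eq_right.2 inter_subset_left
  have hxs : x ∈ s := ⟨hφx, hxe0 rfl⟩
  have hGe : ∀ y ∈ φ.source, (φ y, (0 : F)) ∈ e0.source → f y ∈ ψ.source ∧
      ψ (f y) = e0 (φ y, 0) := by
    intro y hy hy'
    have h1 := (he0U hy').1.2
    rw [mem_preimage, mem_preimage, φ.left_inv hy] at h1
    refine ⟨h1, ?_⟩
    rw [he0]
    change _ = ψ (f (φ.symm (φ y))) + A (0, 0)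
    rw [φ.left_inv hy, show ((0 : E), (0 : F)) = 0 from rfl, map_zero, add_zero]
  refine IsImmersionAtOfComplement.mk_of_continuousAt hf.continuous.continuousAt A dom cod
    (by rw [hdoms]; exact hxs) ?_ ?_ ?_ ?_
  · simp only [cod, OpenPartialHomeomorph.trans_source, mem_inter_iff, mem_preimage, he1src]
    refine ⟨hψx, ?_⟩
    rw [(hGe x hφx hxs.2).2]
    exact e0.map_source hxs.2
  · exact restr_mem_maximalAtlas (contDiffGroupoid ∞ (𝓡 d)) (IsManifold.chart_mem_maximalAtlas x) hs
  · refine cod.mem_maximalAtlas_of_contMDiffOn (I := 𝓡 m) (n := ∞) ?_ ?_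
    · have h1 : ContMDiffOn 𝓘(ℝ, E') 𝓘(ℝ, E') ∞ e1 e1.source := by
        rw [he1src]
        exact contMDiffOn_iff_contDiffOn.2 (A.contDiff.comp_contDiffOn he0s)
      refine h1.comp ((contMDiffOn_chart (I := 𝓡 m) (n := ∞) (H := E') (x := f x)).mono ?_) ?_
      · exact fun z hz => ((OpenPartialHomeomorph.trans_source ψ e1) ▸ hz).1
      · exact fun z hz => ((OpenPartialHomeomorph.trans_source ψ e1) ▸ hz).2
    · have h1 : ContMDiffOn 𝓘(ℝ, E') 𝓘(ℝ, E') ∞ e1.symm e1.target := by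
        rw [he1tgt]
        refine contMDiffOn_iff_contDiffOn.2 ?_
        refine ContDiffOn.comp (g := e0) (t := e0.source) ?_ A.symm.contDiff.contDiffOn fun z hz => hz
        rw [he0]
        exact hG.mono he0U
      refine (contMDiffOn_chart_symm (I := 𝓡 m) (n := ∞) (H := E') (x := f x)).comp (h1.mono ?_) ?_
      · exact fun z hz => ((OpenPartialHomeomorph.trans_target ψ e1) ▸ hz).1
      · exact fun z hz => ((OpenPartialHomeomorph.trans_target ψ e1) ▸ hz).2
  · intro y hy
    have hy' : y ∈ dom.target := by
      simpa using hy
    obtain ⟨u, hu, rfl⟩ : ∃ u ∈ s, φ u = y := by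
      refine ⟨dom.symm y, hdoms ▸ dom.map_target hy', dom.right_inv hy'⟩
    change A (e0.symm (ψ (f (φ.symm (φ u))))) = A (φ u, 0)
    rw [φ.left_inv hu.1, (hGe u hu.1 hu.2).2, e0.left_inv hu.2]

end Immersion

/-! ### Embedding and retracting compact parts of manifolds -/

section Retraction

variable {d : ℕ} {X : Type*} [TopologicalSpace X] [T2Space X]
  [ChartedSpace (EuclideanSpace ℝ (Fin d)) X] [IsManifold (𝓡 d) ∞ X]

/-- A smooth map to a Euclidean space that is an embedding near a given compact set. -/
theorem exists_smooth_injOn_nhds_isCompact {C : Set X} (hC : IsCompact C) :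
    ∃ (k : ℕ) (G : X → EuclideanSpace ℝ (Fin k)) (K : Set X),
      ContMDiff (𝓡 d) 𝓘(ℝ, EuclideanSpace ℝ (Fin k)) ∞ G ∧ IsCompact K ∧ C ⊆ interior K ∧
      InjOn G K ∧
      ∀ x ∈ K, Function.Injective (mfderiv (𝓡 d) 𝓘(ℝ, EuclideanSpace ℝ (Fin k)) G x) := by
  have : LocallyCompactSpace X := ChartedSpace.locallyCompactSpace (EuclideanSpace ℝ (Fin d)) X
  obtain ⟨K, hK, hCK⟩ := exists_compact_superset hC
  let f : (c : X) → SmoothBumpFunction (𝓡 d) c := fun c => Classical.choice inferInstance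
  let U : X → Set X := fun c => interior {x | f c x = 1}
  have hU1 : ∀ c, ∀ x ∈ U c, f c x = 1 := fun c x hx =>
    (interior_subset (s := {x | f c x = 1}) hx : x ∈ {x | f c x = 1})
  obtain ⟨t, -, ht⟩ := hK.elim_nhds_subcover U fun c _ => interior_mem_nhds.2 (f c).eventuallyEq_one
  let E := EuclideanSpace ℝ (Fin d)
  let P := (t → E × ℝ)
  -- Finitely many charts cut off by bump functions, together with the bump functions themselves. If
  -- a bump function is one at `x` and `G x = G y`, then it is also one at `y`; so both points lie
  -- in the same chart, where they have equal coordinates.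
  let G : X → P := fun x i => (f i x • extChartAt (𝓡 d) (i : X) x, f i x)
  have hG : ContMDiff (𝓡 d) 𝓘(ℝ, P) ∞ G := contMDiff_pi_space.2 fun i =>
    ((f i).contMDiff_smul contMDiffOn_extChartAt).prodMk_space (f i).contMDiff
  have hcov : ∀ x ∈ K, ∃ i : t, x ∈ U i := fun x hx => by
    obtain ⟨c, hc, hxc⟩ := mem_iUnion₂.1 (ht hx)
    exact ⟨⟨c, hc⟩, hxc⟩
  have hsrc : ∀ (c x : X), f c x = 1 → x ∈ (extChartAt (𝓡 d) c).source := fun c x h => by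
    rw [extChartAt_source]
    exact (f c).support_subset_source (by simp [h])
  let A : P ≃L[ℝ] EuclideanSpace ℝ (Fin (Module.finrank ℝ P)) :=
    ContinuousLinearEquiv.ofFinrankEq finrank_euclideanSpace_fin.symm
  have hAG : ContMDiff (𝓡 d) 𝓘(ℝ, EuclideanSpace ℝ (Fin (Module.finrank ℝ P))) ∞ (A ∘ G) :=
    A.contDiff.contMDiff.comp hG
  refine ⟨Module.finrank ℝ P, A ∘ G, K, hAG, hK, hCK, fun x hx y _ hxy => ?_, fun x hx => ?_⟩
  · have h1 : G x = G y := A.injective hxy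
    obtain ⟨i, hi⟩ := hcov x hx
    have hfx : f i x = 1 := hU1 _ _ hi
    have h2 := congrFun h1 i
    have hfy : f i y = 1 := by rw [← hfx]; exact (congrArg Prod.snd h2).symm
    have h3 : f i x • extChartAt (𝓡 d) (i : X) x = f i y • extChartAt (𝓡 d) (i : X) y :=
      congrArg Prod.fst h2
    rw [hfx, hfy, one_smul, one_smul] at h3
    exact (extChartAt (𝓡 d) (i : X)).injOn (hsrc _ _ hfx) (hsrc _ _ hfy) h3
  · obtain ⟨i, hi⟩ := hcov x hx
    have hU : ∀ y ∈ U i, (A.symm (A (G y)) i).1 = extChartAt (𝓡 d) (i : X) y := fun y hy => by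
      have hfy : f i y = 1 := hU1 _ _ hy
      simp [G, hfy]
    have hxs := hsrc _ _ (hU1 _ _ hi)
    refine mfderiv_injective_of_leftInverse
      (g := fun w => (extChartAt (𝓡 d) (i : X)).symm ((A.symm w i).1)) ?_
      ((hAG x).mdifferentiableAt (by simp)) ?_
    · have h1 : ContDiff ℝ ∞ fun w => (A.symm w i).1 :=
        contDiff_fst.comp ((contDiff_apply ℝ (E × ℝ) i).comp A.symm.contDiff)
      have h2 := contMDiffAt_extChartAt_symm_of_mem (d := d) (x := (i : X))
        (z := (A.symm ((A ∘ G) x) i).1) (by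
          rw [Function.comp_apply, hU x hi]; exact (extChartAt (𝓡 d) (i : X)).map_source hxs)
      exact (ContMDiffAt.comp (f := fun w => (A.symm w i).1) _ h2
        (contMDiffAt_iff_contDiffAt.2 h1.contDiffAt)).mdifferentiableAt (by simp)
    · filter_upwards [isOpen_interior.mem_nhds hi] with y hy
      rw [Function.comp_apply, hU y hy]
      exact (extChartAt (𝓡 d) (i : X)).left_inv (hsrc _ _ (hU1 _ _ hy))

/-- The nearest point retraction. -/
theorem exists_smooth_retraction {W : Type} [NormedAddCommGroup W] [InnerProductSpace ℝ W]
    [FiniteDimensional ℝ W] {C K : Set X} (hK : IsCompact K) (hne : K.Nonempty)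
    (hCK : C ⊆ interior K) {G : X → W} (hG : ContMDiff (𝓡 d) 𝓘(ℝ, W) ∞ G) (hinj : InjOn G K)
    (hd : ∀ x ∈ K, Function.Injective (mfderiv (𝓡 d) 𝓘(ℝ, W) G x)) :
    ∃ (R : W → X) (O : Set W), IsOpen O ∧ G '' C ⊆ O ∧ ContMDiffOn 𝓘(ℝ, W) (𝓡 d) ∞ R O ∧
      (∀ z ∈ O, R z ∈ interior K) ∧ ∀ x ∈ K, R (G x) = x := by
  -- `R` chooses a nearest point of `G '' K`. The choice is arbitrary at first; near `G '' C` it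
  -- turns out to be unique, because it is given by an inverse function.
  have hmin : ∀ z : W, ∃ x ∈ K, ∀ y ∈ K, ‖G x - z‖ ≤ ‖G y - z‖ := fun z => by
    obtain ⟨x, hx, h⟩ := hK.exists_isMinOn hne
      (f := fun x => ‖G x - z‖) ((hG.continuous.sub continuous_const).norm.continuousOn)
    exact ⟨x, hx, fun y hy => h hy⟩
  choose R hRK hR using hmin
  have hRG : ∀ x ∈ K, R (G x) = x := fun x hx => by
    refine hinj (hRK _) hx ?_
    have h1 := hR (G x) x hx
    rw [sub_self, norm_zero] at h1
    exact sub_eq_zero.1 (norm_le_zero_iff.1 h1)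
  have hcont : ∀ c ∈ K, Tendsto R (𝓝 (G c)) (𝓝 c) := by
    intro c hc
    have h1 : Tendsto (fun z => G (R z)) (𝓝 (G c)) (𝓝 (G c)) := by
      have h2 : Tendsto (fun z => G (R z) - z) (𝓝 (G c)) (𝓝 0) := by
        refine squeeze_zero_norm (fun z => hR z c hc) ?_
        have h3 : Continuous fun z => ‖G c - z‖ := by fun_prop
        simpa using h3.tendsto (G c)
      simpa using h2.add (tendsto_id (α := W) (x := 𝓝 (G c)))
    intro N hN
    obtain ⟨N', hN', hNo, hcN⟩ := mem_nhds_iff.1 hN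
    have h3 : IsClosed (G '' (K \ N')) := ((hK.diff hNo).image hG.continuous).isClosed
    have h4 : G c ∉ G '' (K \ N') := by
      rintro ⟨y, ⟨hy, hyN⟩, hyc⟩
      exact hyN (hinj hy hc hyc ▸ hcN)
    change ∀ᶠ z in 𝓝 (G c), R z ∈ N
    filter_upwards [h1.eventually (h3.isOpen_compl.mem_nhds h4)] with z hz
    by_contra h
    exact hz ⟨R z, ⟨hRK z, fun h' => h (hN' h')⟩, rfl⟩
  have hsmooth : ∀ c ∈ C, ∀ᶠ z in 𝓝 (G c), ContMDiffAt 𝓘(ℝ, W) (𝓡 d) ∞ R z := by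
    intro c hc
    have hcK := interior_subset (hCK hc)
    let E := EuclideanSpace ℝ (Fin d)
    let φ := extChartAt (𝓡 d) c
    have hφc : c ∈ φ.source := mem_extChartAt_source c
    have hφt : φ c ∈ φ.target := mem_extChartAt_target c
    have hφs : ContMDiffOn 𝓘(ℝ, E) (𝓡 d) ∞ φ.symm φ.target := contMDiffOn_extChartAt_symm c
    let U0 : Set E := φ.target ∩ φ.symm ⁻¹' interior K
    have hU0 : IsOpen U0 := hφs.continuousOn.isOpen_inter_preimage
      (isOpen_extChartAt_target c) isOpen_interior
    have hcU0 : φ c ∈ U0 := ⟨hφt, by rw [mem_preimage, φ.left_inv hφc]; exact hCK hc⟩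
    let g : E → W := G ∘ φ.symm
    have hg : ContDiffOn ℝ ∞ g U0 := contMDiffOn_iff_contDiffOn.1
      (hG.comp_contMDiffOn (hφs.mono inter_subset_left))
    have hgat : ∀ y ∈ U0, HasFDerivAt g (fderiv ℝ g y) y := fun y hy =>
      ((hg.contDiffAt (hU0.mem_nhds hy)).differentiableAt (by simp)).hasFDerivAt
    let A : E →L[ℝ] W := fderiv ℝ g (φ c)
    have hA : Function.Injective A := by
      have h1 := ((hG c).mdifferentiableAt (by simp)).hasMFDerivAt.2
      rw [(𝓡 d).range_eq_univ] at h1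
      have h2 : HasFDerivAt g (mfderiv (𝓡 d) 𝓘(ℝ, W) G c : E →L[ℝ] W) (φ c) :=
        hasFDerivWithinAt_univ.1 h1
      intro v w hvw
      refine hd c hcK ?_
      have h3 := (hgat _ hcU0).unique h2
      exact ((congrArg (fun L : E →L[ℝ] W => L v) h3).symm.trans hvw).trans
        (congrArg (fun L : E →L[ℝ] W => L w) h3)
    let B : E → W →L[ℝ] E := fun y => ContinuousLinearMap.adjoint (fderiv ℝ g y)
    have hB : ContDiffOn ℝ ∞ B U0 :=
      (ContinuousLinearMap.adjoint (𝕜 := ℝ) (E := E) (F := W)).toContinuousLinearEquiv.contDiff.comp_contDiffOn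
        (hg.fderiv_of_isOpen hU0 (by simp))
    -- The critical point equation `dg*(g y - z) = 0` of the distance. At `(G c, φ c)` the residual
    -- vanishes, so the derivative of `dg*` does not enter and the derivative in `y` is the
    -- invertible operator `dg* dg`.
    let H : W × E → W × E := fun q => (q.1, B q.2 (g q.2 - q.1))
    have hH : ContDiffOn ℝ ∞ H (univ ×ˢ U0) := contDiffOn_fst.prodMk
      ((hB.comp contDiffOn_snd fun q hq => hq.2).clm_apply
        ((hg.comp contDiffOn_snd fun q hq => hq.2).sub contDiffOn_fst))
    have hgc : g (φ c) = G c := by simp only [g, Function.comp_apply, φ.left_inv hφc]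
    let A' : E →L[ℝ] E := (B (φ c)).comp A
    have hA' : Function.Injective A'.toLinearMap := by
      refine (injective_iff_map_eq_zero A'.toLinearMap).2 fun v hv => hA ?_
      rw [map_zero, ← inner_self_eq_zero (𝕜 := ℝ), ← ContinuousLinearMap.adjoint_inner_left]
      have h1 : ContinuousLinearMap.adjoint A (A v) = 0 := hv
      rw [h1, inner_zero_left]
    let Q : E ≃L[ℝ] E := (LinearEquiv.ofInjectiveOfFinrankEq A'.toLinearMap hA' rfl).toContinuousLinearEquiv
    have hQ : ∀ v, Q v = B (φ c) (A v) := fun v => rfl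
    have hder : ∃ T : (W × E) ≃L[ℝ] (W × E), HasFDerivAt H (T : (W × E) →L[ℝ] (W × E)) (G c, φ c) := by
      let f1 : (W × E) →L[ℝ] (W × E) := (ContinuousLinearMap.fst ℝ W E).prod
        ((Q : E →L[ℝ] E).comp (ContinuousLinearMap.snd ℝ W E) -
          (B (φ c)).comp (ContinuousLinearMap.fst ℝ W E))
      let f2 : (W × E) →L[ℝ] (W × E) := (ContinuousLinearMap.fst ℝ W E).prod
        ((Q.symm : E →L[ℝ] E).comp (ContinuousLinearMap.snd ℝ W E +
          (B (φ c)).comp (ContinuousLinearMap.fst ℝ W E)))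
      refine ⟨ContinuousLinearEquiv.equivOfInverse f1 f2 (fun q => ?_) (fun q => ?_), ?_⟩
      · refine Prod.ext rfl ?_
        change Q.symm ((Q q.2 - B (φ c) q.1) + B (φ c) q.1) = q.2
        simp
      · refine Prod.ext rfl ?_
        change Q (Q.symm (q.2 + B (φ c) q.1)) - B (φ c) q.1 = q.2
        simp
      · have h1 : HasFDerivAt (fun q : W × E => g q.2) (A.comp (ContinuousLinearMap.snd ℝ W E))
            (G c, φ c) := HasFDerivAt.comp (g := g) (f := Prod.snd) ((G c, φ c) : W × E)
              (hgat _ hcU0) hasFDerivAt_snd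
        have h2 : HasFDerivAt (fun q : W × E => B q.2)
            ((fderiv ℝ B (φ c)).comp (ContinuousLinearMap.snd ℝ W E)) (G c, φ c) :=
          HasFDerivAt.comp (g := B) (f := Prod.snd) ((G c, φ c) : W × E)
            ((hB.contDiffAt (hU0.mem_nhds hcU0)).differentiableAt (by simp)).hasFDerivAt
            hasFDerivAt_snd
        refine (hasFDerivAt_fst.prodMk (h2.clm_apply (h1.sub hasFDerivAt_fst))).congr_fderiv ?_
        refine ContinuousLinearMap.ext fun q => Prod.ext rfl ?_
        change B (φ c) (A q.2 - q.1) + (fderiv ℝ B (φ c) q.2) (g (φ c) - G c) = Q q.2 - B (φ c) q.1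
        rw [hgc, sub_self, map_zero, add_zero, map_sub, hQ]
    obtain ⟨e, hce, -, he, hes⟩ := exists_smooth_inverse_of_isCompact
      (isCompact_singleton (x := ((G c, φ c) : W × E))) (injOn_singleton _ _)
      (isOpen_univ.prod hU0) (singleton_subset_iff.2 ⟨trivial, hcU0⟩) hH
      (fun z hz => by rw [mem_singleton_iff.1 hz]; exact hder)
    have hHc : H (G c, φ c) = (G c, 0) := by simp only [H, hgc, sub_self, map_zero]
    let ρ : W → X := fun z => φ.symm (e.symm (z, 0)).2
    let O1 : Set W := (fun z => ((z, 0) : W × E)) ⁻¹' e.target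
    have hO1 : IsOpen O1 := e.open_target.preimage (by fun_prop)
    have hcO1 : G c ∈ O1 := by
      change (G c, (0 : E)) ∈ e.target
      rw [← hHc, ← he]; exact e.map_source (hce rfl)
    have hesc : e.symm (G c, 0) = (G c, φ c) := by
      rw [← hHc, ← he]; exact e.left_inv (hce rfl)
    have hρ1 : ContDiffOn ℝ ∞ (fun z => (e.symm (z, 0)).2) O1 :=
      contDiff_snd.comp_contDiffOn (hes.comp (by fun_prop) fun z hz => hz)
    have hρs : ∀ᶠ z in 𝓝 (G c), ContMDiffAt 𝓘(ℝ, W) (𝓡 d) ∞ ρ z := by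
      filter_upwards [hO1.mem_nhds hcO1, (hρ1.continuousOn.continuousAt
        (hO1.mem_nhds hcO1)).preimage_mem_nhds
        (by rw [hesc]; exact (isOpen_extChartAt_target c).mem_nhds hφt)] with z hz hz'
      exact (hφs.contMDiffAt ((isOpen_extChartAt_target c).mem_nhds hz')).comp z
        (contMDiffAt_iff_contDiffAt.2 (hρ1.contDiffAt (hO1.mem_nhds hz)))
    -- By continuity the nearest point stays in the chart, in the interior of `K`, and in the domain
    -- of the inverse function. Being a critical point, it coincides with the smooth solution `ρ`.
    have hRρ : ∀ᶠ z in 𝓝 (G c), R z = ρ z := by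
      have h1 : ∀ᶠ z in 𝓝 (G c), R z ∈ φ.source ∩ interior K := hcont c hcK
        (inter_mem (extChartAt_source_mem_nhds c) (isOpen_interior.mem_nhds (hCK hc)))
      have h2 : Tendsto (fun z => (z, φ (R z))) (𝓝 (G c)) (𝓝 (G c, φ c)) :=
        tendsto_id.prodMk_nhds ((continuousAt_extChartAt c).tendsto.comp (hcont c hcK))
      filter_upwards [h1, h2 (e.open_source.mem_nhds (hce rfl))] with z hz hz'
      have hy0 : φ (R z) ∈ U0 := ⟨φ.map_source hz.1, by
        rw [mem_preimage, φ.left_inv hz.1]; exact hz.2⟩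
      have hcrit : B (φ (R z)) (g (φ (R z)) - z) = 0 := by
        have hmin : IsLocalMin (fun y => ‖g y - z‖ ^ 2) (φ (R z)) := by
          filter_upwards [hU0.mem_nhds hy0] with y hy
          have h3 := hR z (φ.symm y) (interior_subset hy.2)
          have h4 : g (φ (R z)) = G (R z) := by
            simp only [g, Function.comp_apply, φ.left_inv hz.1]
          change ‖g (φ (R z)) - z‖ ^ 2 ≤ ‖G (φ.symm y) - z‖ ^ 2
          rw [h4]
          exact pow_le_pow_left₀ (norm_nonneg _) h3 2
        have h5 := hmin.hasFDerivAt_eq_zero ((hgat _ hy0).sub_const z).norm_sq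
        refine ext_inner_left ℝ fun v => ?_
        rw [ContinuousLinearMap.adjoint_inner_right, inner_zero_right]
        have h6 := congrArg (fun L : E →L[ℝ] ℝ => L v) h5
        simp only [smul_apply, ContinuousLinearMap.comp_apply, innerSL_apply_apply,
          zero_apply] at h6
        rw [real_inner_comm]
        have h7 : (2 : ℝ) * inner ℝ (g (φ (R z)) - z) (fderiv ℝ g (φ (R z)) v) = 0 := by
          simpa using h6
        linarith
      have h8 : e.symm (z, 0) = (z, φ (R z)) := by
        have h9 : e (z, φ (R z)) = (z, 0) := by
          rw [he]
          simp only [H, hcrit]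
        rw [← h9]
        exact e.left_inv hz'
      simp only [ρ, h8, φ.left_inv hz.1]
    filter_upwards [hρs, hRρ.eventually_nhds] with z hz hz'
    exact hz.congr_of_eventuallyEq hz'
  refine ⟨R, interior {z | ContMDiffAt 𝓘(ℝ, W) (𝓡 d) ∞ R z ∧ R z ∈ interior K},
    isOpen_interior, ?_, fun z hz => (interior_subset hz).1.contMDiffWithinAt,
    fun z hz => (interior_subset hz).2, hRG⟩
  rintro _ ⟨c, hc, rfl⟩
  refine mem_interior_iff_mem_nhds.2 ?_
  filter_upwards [hsmooth c hc, hcont c (interior_subset (hCK hc))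
    (isOpen_interior.mem_nhds (hCK hc))] with z h1 h2 using ⟨h1, h2⟩

end Retraction

/-! ### Compact manifolds and their cotangent bundles as smooth retracts of vector spaces -/

/-- A presentation of a manifold as a smooth retract of an open subset of a Euclidean space. -/
structure SmoothRetract (d : ℕ) (Y : Type*) [TopologicalSpace Y]
    [ChartedSpace (EuclideanSpace ℝ (Fin d)) Y] where
  dim : ℕ
  emb : Y → EuclideanSpace ℝ (Fin dim)
  ret : EuclideanSpace ℝ (Fin dim) → Y
  dom : Set (EuclideanSpace ℝ (Fin dim))
  isOpen_dom : IsOpen dom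
  contMDiff_emb : ContMDiff (𝓡 d) 𝓘(ℝ, EuclideanSpace ℝ (Fin dim)) ∞ emb
  contMDiffOn_ret : ContMDiffOn 𝓘(ℝ, EuclideanSpace ℝ (Fin dim)) (𝓡 d) ∞ ret dom
  emb_mem : ∀ y, emb y ∈ dom
  ret_emb : ∀ y, ret (emb y) = y

namespace SmoothRetract

variable {d : ℕ} {Y : Type*} [TopologicalSpace Y] [ChartedSpace (EuclideanSpace ℝ (Fin d)) Y]
  [IsManifold (𝓡 d) ∞ Y] (ρ : SmoothRetract d Y)

/-- The ambient Euclidean space. -/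
abbrev Amb : Type := EuclideanSpace ℝ (Fin ρ.dim)

/-- The differential of the embedding. -/
def demb (y : Y) : EuclideanSpace ℝ (Fin d) →L[ℝ] ρ.Amb := mfderiv (𝓡 d) 𝓘(ℝ, ρ.Amb) ρ.emb y

/-- The differential of the retraction. -/
def dret (z : ρ.Amb) : ρ.Amb →L[ℝ] EuclideanSpace ℝ (Fin d) :=
  mfderiv 𝓘(ℝ, ρ.Amb) (𝓡 d) ρ.ret z

lemma contMDiffAt_ret {z : ρ.Amb} (hz : z ∈ ρ.dom) : ContMDiffAt 𝓘(ℝ, ρ.Amb) (𝓡 d) ∞ ρ.ret z :=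
  ρ.contMDiffOn_ret.contMDiffAt (ρ.isOpen_dom.mem_nhds hz)

lemma dret_demb (y : Y) (v : EuclideanSpace ℝ (Fin d)) : ρ.dret (ρ.emb y) (ρ.demb y v) = v :=
  mfderiv_apply_of_leftInverse
    ((ρ.contMDiffAt_ret (ρ.emb_mem y)).mdifferentiableAt (by simp))
    ((ρ.contMDiff_emb y).mdifferentiableAt (by simp)) (Eventually.of_forall ρ.ret_emb) v

/-- The embedding of the cotangent bundle associated with a smooth retract. -/
def cotEmb (ξ : CotangentBundle d Y) : ρ.Amb × (ρ.Amb →L[ℝ] ℝ) :=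
  (ρ.emb ξ.1, (ξ.2 : EuclideanSpace ℝ (Fin d) →L[ℝ] ℝ).comp (ρ.dret (ρ.emb ξ.1)))

/-- The left inverse of `cotEmb`. -/
def cotRet (p : ρ.Amb × (ρ.Amb →L[ℝ] ℝ)) : CotangentBundle d Y :=
  ⟨ρ.ret p.1, p.2.comp (ρ.demb (ρ.ret p.1))⟩

lemma cotangentBundle_ext {ξ η : CotangentBundle d Y} (h1 : ξ.1 = η.1)
    (h2 : ∀ v : EuclideanSpace ℝ (Fin d), (ξ.2 : EuclideanSpace ℝ (Fin d) →L[ℝ] ℝ) v =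
      (η.2 : EuclideanSpace ℝ (Fin d) →L[ℝ] ℝ) v) : ξ = η := by
  obtain ⟨x, a⟩ := ξ
  obtain ⟨y, b⟩ := η
  obtain rfl : x = y := h1
  congr 1
  exact ContinuousLinearMap.ext h2

lemma cotRet_mk (y : Y) (ζ : ρ.Amb →L[ℝ] ℝ) :
    ρ.cotRet (ρ.emb y, ζ) = ⟨y, ζ.comp (ρ.demb y)⟩ := by
  refine cotangentBundle_ext (ρ.ret_emb y) fun v => ?_
  change ζ (ρ.demb (ρ.ret (ρ.emb y)) v) = ζ (ρ.demb y v)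
  rw [ρ.ret_emb]

lemma cotRet_cotEmb (ξ : CotangentBundle d Y) : ρ.cotRet (ρ.cotEmb ξ) = ξ := by
  refine (ρ.cotRet_mk ξ.1 _).trans (cotangentBundle_ext rfl fun v => ?_)
  exact congrArg (ξ.2 : EuclideanSpace ℝ (Fin d) →L[ℝ] ℝ) (ρ.dret_demb ξ.1 v)

lemma cotEmb_injective : Function.Injective ρ.cotEmb :=
  Function.LeftInverse.injective ρ.cotRet_cotEmb

section Smooth

variable {EN HN : Type*} [NormedAddCommGroup EN] [NormedSpace ℝ EN] [TopologicalSpace HN]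
  {IN : ModelWithCorners ℝ EN HN} {N : Type*} [TopologicalSpace N] [ChartedSpace HN N]

lemma contMDiffAt_dret_apply {b : N → Y} {w : N → ρ.Amb} {p : N}
    (hb : ContMDiffAt IN (𝓡 d) ∞ b p) (hw : ContMDiffAt IN 𝓘(ℝ, ρ.Amb) ∞ w p) :
    ContMDiffAt IN (𝓡 d).tangent ∞
      (fun n => (⟨b n, ρ.dret (ρ.emb (b n)) (w n)⟩ : TangentBundle (𝓡 d) Y)) p := by
  have h := contMDiffAt_mfderiv_apply (f := ρ.ret) (g := fun n => ρ.emb (b n)) (v := w)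
    (ρ.contMDiffAt_ret (ρ.emb_mem (b p))) ((ρ.contMDiff_emb (b p)).comp p hb) hw
  have h1 : ∀ (y y' : Y) (v : EuclideanSpace ℝ (Fin d)), y' = y →
      (⟨y', v⟩ : TangentBundle (𝓡 d) Y) = ⟨y, v⟩ := by
    rintro y _ v rfl; rfl
  exact h.congr_of_eventuallyEq (Eventually.of_forall fun n => (h1 _ _ _ (ρ.ret_emb (b n))).symm)

lemma contMDiff_cotEmb : ContMDiff (cotModel d) 𝓘(ℝ, ρ.Amb × (ρ.Amb →L[ℝ] ℝ)) ∞ ρ.cotEmb := by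
  intro ξ
  have hproj : ContMDiffAt (cotModel d) (𝓡 d) ∞ (fun ξ : CotangentBundle d Y => ξ.1) ξ :=
    contMDiff_proj (fun x : Y => CotangentAt d x) ξ
  refine ContMDiffAt.prodMk_space ((ρ.contMDiff_emb ξ.1).comp ξ hproj)
    (contMDiffAt_clm_of_apply fun w => ?_)
  exact contMDiffAt_cotangent_apply (b := fun ξ : CotangentBundle d Y => ξ.1)
    (ξ := fun ξ => ξ.2) contMDiffAt_id (ρ.contMDiffAt_dret_apply hproj contMDiffAt_const)

lemma contMDiffAt_cotRet {p : ρ.Amb × (ρ.Amb →L[ℝ] ℝ)} (hp : p.1 ∈ ρ.dom) :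
    ContMDiffAt 𝓘(ℝ, ρ.Amb × (ρ.Amb →L[ℝ] ℝ)) (cotModel d) ∞ ρ.cotRet p :=
  contMDiffAt_cotangent_mk (f := ρ.emb) (b := fun q : ρ.Amb × (ρ.Amb →L[ℝ] ℝ) => ρ.ret q.1)
    (ζ := fun q : ρ.Amb × (ρ.Amb →L[ℝ] ℝ) => q.2) (ρ.contMDiff_emb _) ((ρ.contMDiffAt_ret hp).comp p
      (contMDiffAt_iff_contDiffAt.2 contDiffAt_fst)) (contMDiffAt_iff_contDiffAt.2 contDiffAt_snd)

/-- Smoothness of a map to the cotangent bundle can be tested in the ambient space. -/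
lemma contMDiffWithinAt_cotangent_iff {f : N → CotangentBundle d Y} {s : Set N} {p : N} :
    ContMDiffWithinAt IN (cotModel d) ∞ f s p ↔
      ContMDiffWithinAt IN 𝓘(ℝ, ρ.Amb) ∞ (fun n => ρ.emb (f n).1) s p ∧
      ContMDiffWithinAt IN 𝓘(ℝ, ρ.Amb →L[ℝ] ℝ) ∞ (fun n => (ρ.cotEmb (f n)).2) s p := by
  constructor
  · intro h
    have h1 := (ρ.contMDiff_cotEmb (f p)).comp_contMDiffWithinAt p h
    exact ⟨(contMDiffAt_iff_contDiffAt.2 contDiffAt_fst).comp_contMDiffWithinAt p h1,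
      (contMDiffAt_iff_contDiffAt.2 contDiffAt_snd).comp_contMDiffWithinAt p h1⟩
  · rintro ⟨h1, h2⟩
    have h3 := (ρ.contMDiffAt_cotRet (p := ρ.cotEmb (f p)) (ρ.emb_mem _)).comp_contMDiffWithinAt p
      (f := fun n => ρ.cotEmb (f n)) (h1.prodMk_space h2)
    exact h3.congr (fun n _ => (ρ.cotRet_cotEmb _).symm) (ρ.cotRet_cotEmb _).symm

lemma contMDiffAt_cotangent_iff {f : N → CotangentBundle d Y} {p : N} :
    ContMDiffAt IN (cotModel d) ∞ f p ↔
      ContMDiffAt IN 𝓘(ℝ, ρ.Amb) ∞ (fun n => ρ.emb (f n).1) p ∧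
      ContMDiffAt IN 𝓘(ℝ, ρ.Amb →L[ℝ] ℝ) ∞ (fun n => (ρ.cotEmb (f n)).2) p :=
  ρ.contMDiffWithinAt_cotangent_iff

end Smooth

lemma t2Space_cotangentBundle (ρ : SmoothRetract d Y) : T2Space (CotangentBundle d Y) :=
  T2Space.of_injective_continuous ρ.cotEmb_injective ρ.contMDiff_cotEmb.continuous

end SmoothRetract

/-- A compact manifold embedded in a Euclidean space is a smooth retract. -/
def SmoothRetract.ofEmbedding {d : ℕ} {Y : Type*} [TopologicalSpace Y] [T2Space Y] [CompactSpace Y]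
    [Nonempty Y] [ChartedSpace (EuclideanSpace ℝ (Fin d)) Y] [IsManifold (𝓡 d) ∞ Y]
    {k : ℕ} {e : Y → EuclideanSpace ℝ (Fin k)}
    (he : ContMDiff (𝓡 d) 𝓘(ℝ, EuclideanSpace ℝ (Fin k)) ∞ e) (hinj : Function.Injective e)
    (hd : ∀ y, Function.Injective (mfderiv (𝓡 d) 𝓘(ℝ, EuclideanSpace ℝ (Fin k)) e y)) :
    SmoothRetract d Y :=
  have h := exists_smooth_retraction (C := univ) isCompact_univ
    univ_nonempty (by simp) he hinj.injOn fun y _ => hd y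
  { dim := k
    emb := e
    ret := h.choose
    dom := h.choose_spec.choose
    isOpen_dom := h.choose_spec.choose_spec.1
    contMDiff_emb := he
    contMDiffOn_ret := h.choose_spec.choose_spec.2.2.1
    emb_mem := fun y => h.choose_spec.choose_spec.2.1 ⟨y, trivial, rfl⟩
    ret_emb := fun y => h.choose_spec.choose_spec.2.2.2.2 y trivial }

/-! ### Differentials read in the preferred charts -/

section ChartDerivative

variable {d : ℕ} {X : Type*} [TopologicalSpace X] [ChartedSpace (EuclideanSpace ℝ (Fin d)) X]
  [IsManifold (𝓡 d) ∞ X]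
  {d' : ℕ} {X' : Type*} [TopologicalSpace X'] [ChartedSpace (EuclideanSpace ℝ (Fin d')) X']
  [IsManifold (𝓡 d') ∞ X']
  {E : Type*} [NormedAddCommGroup E] [NormedSpace ℝ E]

lemma injective_mfderiv_of_isSmoothEmbedding {j : X' → X}
    (hj : IsSmoothEmbedding (𝓡 d') (𝓡 d) ∞ j) (x : X') :
    Function.Injective (mfderiv (𝓡 d') (𝓡 d) j x) := by
  obtain ⟨F, _, _, h⟩ := hj.isImmersion
  obtain ⟨g, hg, hgj⟩ := exists_leftInverse_of_isImmersionAt (h x)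
  exact mfderiv_injective_of_leftInverse (hg.mdifferentiableAt (by simp))
    ((hj.contMDiff x).mdifferentiableAt (by simp)) hgj

/-- The derivative at `z` of a map `f` with `f z = y`, as a map to the tangent space at `y`. -/
def chartDeriv (f : E → X) (z : E) (y : X) : E →L[ℝ] EuclideanSpace ℝ (Fin d) :=
  fderiv ℝ (extChartAt (𝓡 d) y ∘ f) z

variable {f : E → X} {z : E} {y : X}

lemma chartDeriv_self (hf : MDifferentiableAt 𝓘(ℝ, E) (𝓡 d) f z) (v : E) :
    chartDeriv f z (f z) v = mfderiv 𝓘(ℝ, E) (𝓡 d) f z v :=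
  (congrArg (fun L : E →L[ℝ] EuclideanSpace ℝ (Fin d) => L v)
    (mfderiv_eq_fderiv_extChartAt_comp hf)).symm

lemma formAlong_apply_of_eq (hf : MDifferentiableAt 𝓘(ℝ, E) (𝓡 d) f z) (hy : f z = y)
    (μ : (x : X) → CotangentAt d x) (v : E) :
    formAlong f μ z v = (μ y : EuclideanSpace ℝ (Fin d) →L[ℝ] ℝ) (chartDeriv f z y v) := by
  subst hy
  exact congrArg (μ (f z)) (chartDeriv_self hf v).symm

lemma fderiv_comp_chartDeriv {W : Type*} [NormedAddCommGroup W] [NormedSpace ℝ W] {G : X → W}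
    (hf : MDifferentiableAt 𝓘(ℝ, E) (𝓡 d) f z) (hy : f z = y)
    (hG : MDifferentiableAt (𝓡 d) 𝓘(ℝ, W) G y) (v : E) :
    fderiv ℝ (G ∘ f) z v =
      (mfderiv (𝓡 d) 𝓘(ℝ, W) G y : EuclideanSpace ℝ (Fin d) →L[ℝ] W) (chartDeriv f z y v) := by
  subst hy
  rw [chartDeriv_self hf]
  exact (congrArg (fun L : E →L[ℝ] W => L v) mfderiv_eq_fderiv.symm).trans
    (mfderiv_comp_apply z hG hf v)

/-- The chain rule for a composition `X' → E → X`. -/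
lemma chartDeriv_mfderiv {x : X'} {g : X' → E} {j : X' → X}
    (hf : MDifferentiableAt 𝓘(ℝ, E) (𝓡 d) f (g x))
    (hg : MDifferentiableAt (𝓡 d') 𝓘(ℝ, E) g x) (h : f ∘ g =ᶠ[𝓝 x] j)
    (v : EuclideanSpace ℝ (Fin d')) :
    chartDeriv f (g x) (j x)
      ((mfderiv (𝓡 d') 𝓘(ℝ, E) g x : EuclideanSpace ℝ (Fin d') →L[ℝ] E) v) =
      (mfderiv (𝓡 d') (𝓡 d) j x : EuclideanSpace ℝ (Fin d') →L[ℝ] EuclideanSpace ℝ (Fin d)) v := by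
  have h1 : j x = f (g x) := h.self_of_nhds.symm
  have h2 : (mfderiv (𝓡 d') (𝓡 d) j x :
      EuclideanSpace ℝ (Fin d') →L[ℝ] EuclideanSpace ℝ (Fin d)) = mfderiv (𝓡 d') (𝓡 d) (f ∘ g) x :=
    h.symm.mfderiv_eq
  rw [h1, h2]
  exact (chartDeriv_self hf _).trans (mfderiv_comp_apply x hf hg v).symm

end ChartDerivative

/-! ### Legendrian retractions in contact manifolds -/

section ContactRetraction

variable {m d : ℕ} {M : Type*} [TopologicalSpace M] [ChartedSpace (EuclideanSpace ℝ (Fin m)) M]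
  [IsManifold (𝓡 m) ∞ M] {Y : Type*} [TopologicalSpace Y] [CompactSpace Y]
  [ChartedSpace (EuclideanSpace ℝ (Fin d)) Y] [IsManifold (𝓡 d) ∞ Y]

/-- Transfers `exists_legendrian_retraction` from the ambient vector space, with the form `R^*α`,
the retraction `G ∘ R` onto the image of `M` and the retraction `ρ.emb ∘ ρ.ret` onto the image of
`Y`. Tangency to these images is what the conditions on `dϖ` and `dr` encode, and `b` is the ambient
covector restricted to `TY`. -/
theorem exists_contact_retraction_of_retract {α : (x : M) → CotangentAt m x} (hα : IsContactForm α)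
    {ι : Y → M} (hι : ContMDiff (𝓡 d) (𝓡 m) ∞ ι) (hco : IsCoisotropicMap (d := d) α ι)
    (hns : ∀ y : Y, pullbackForm (d := d) α ι y ≠ 0) (ρ : SmoothRetract d Y) {G : M → ρ.Amb}
    (hG : ContMDiff (𝓡 m) 𝓘(ℝ, ρ.Amb) ∞ G) (hGι : ∀ y, G (ι y) = ρ.emb y) {R : ρ.Amb → M}
    {OR : Set ρ.Amb} (hOR : IsOpen OR) (hOmem : ∀ y, ρ.emb y ∈ OR)
    (hR : ContMDiffOn 𝓘(ℝ, ρ.Amb) (𝓡 m) ∞ R OR) (hRGR : ∀ z ∈ OR, R (G (R z)) = R z)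
    {U : Set M} (hU : IsOpen U) (hιU : ∀ y, ι y ∈ U) (hGU : ∀ u ∈ U, G u ∈ OR)
    (hRG : ∀ u ∈ U, R (G u) = u) :
    ∃ (p : M → Y) (b : (u : M) → CotangentAt d (p u)) (O : Set M), IsOpen O ∧ range ι ⊆ O ∧
      ContMDiffOn (𝓡 m) (𝓡 d) ∞ p O ∧
      ContMDiffOn (𝓡 m) (cotModel d) ∞ (fun u => (⟨p u, b u⟩ : CotangentBundle d Y)) O ∧
      (∀ y, (⟨p (ι y), b (ι y)⟩ : CotangentBundle d Y) = formMap (pullbackForm (d := d) α ι) y) ∧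
      ∀ u ∈ O, ∀ v, α u v = 0 ↔ b u (mfderiv (𝓡 m) (𝓡 d) p u v) = 0 := by
  let E := EuclideanSpace ℝ (Fin d)
  let F := EuclideanSpace ℝ (Fin m)
  let W := ρ.Amb
  have hRι : ∀ y, R (ρ.emb y) = ι y := fun y => by rw [← hGι, hRG _ (hιU y)]
  have hRat : ∀ z ∈ OR, ContMDiffAt 𝓘(ℝ, W) (𝓡 m) ∞ R z := fun z hz =>
    hR.contMDiffAt (hOR.mem_nhds hz)
  have hRd : ∀ z ∈ OR, MDifferentiableAt 𝓘(ℝ, W) (𝓡 m) R z := fun z hz =>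
    (hRat z hz).mdifferentiableAt (by simp)
  have hGd : ∀ u, MDifferentiableAt (𝓡 m) 𝓘(ℝ, W) G u := fun u =>
    (hG u).mdifferentiableAt (by simp)
  have hed : ∀ y, MDifferentiableAt (𝓡 d) 𝓘(ℝ, W) ρ.emb y := fun y =>
    (ρ.contMDiff_emb y).mdifferentiableAt (by simp)
  let dG : M → F →L[ℝ] W := fun u => mfderiv (𝓡 m) 𝓘(ℝ, W) G u
  let dι : Y → E →L[ℝ] F := fun y => mfderiv (𝓡 d) (𝓡 m) ι y
  let dω : Y → F → F → ℝ := fun y => extD α (ι y)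
  let ϖ : W → W := G ∘ R
  let r : W → W := ρ.emb ∘ ρ.ret
  let a : W → W →L[ℝ] ℝ := formAlong R α
  let C : Set W := range ρ.emb
  have hϖs : ∀ z ∈ OR, ContDiffAt ℝ ∞ ϖ z := fun z hz =>
    contMDiffAt_iff_contDiffAt.1 ((hG _).comp z (hRat z hz))
  have hrs : ∀ z ∈ ρ.dom, ContDiffAt ℝ ∞ r z := fun z hz =>
    contMDiffAt_iff_contDiffAt.1 ((ρ.contMDiff_emb _).comp z (ρ.contMDiffAt_ret hz))
  let Z : Set W := (OR ∩ ρ.dom) ∩ (OR ∩ ϖ ⁻¹' (OR ∩ ρ.dom))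
  have hZ : IsOpen Z := (hOR.inter ρ.isOpen_dom).inter
    (ContinuousOn.isOpen_inter_preimage
      (fun z hz => (hϖs z hz).continuousAt.continuousWithinAt) hOR (hOR.inter ρ.isOpen_dom))
  have hϖe : ∀ y, ϖ (ρ.emb y) = ρ.emb y := fun y => by simp only [ϖ, Function.comp, hRι, hGι]
  have hre : ∀ y, r (ρ.emb y) = ρ.emb y := fun y => by simp only [r, Function.comp, ρ.ret_emb]
  have hCZ : C ⊆ Z := by
    rintro _ ⟨y, rfl⟩
    refine ⟨⟨hOmem y, ρ.emb_mem y⟩, hOmem y, ?_⟩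
    change ϖ (ρ.emb y) ∈ OR ∩ ρ.dom
    rw [hϖe]
    exact ⟨hOmem y, ρ.emb_mem y⟩
  have hZO : ∀ z ∈ Z, z ∈ OR := fun z hz => hz.1.1
  have hZd : ∀ z ∈ Z, z ∈ ρ.dom := fun z hz => hz.1.2
  have hϖϖ : ∀ z ∈ Z, ϖ (ϖ z) = ϖ z := fun z hz => congrArg G (hRGR z (hZO z hz))
  have hϖZ : MapsTo ϖ Z Z := fun z hz =>
    ⟨hz.2.2, hz.2.2.1, by change ϖ (ϖ z) ∈ OR ∩ ρ.dom; rw [hϖϖ z hz]; exact hz.2.2⟩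
  have has : ∀ z ∈ Z, ContDiffAt ℝ ∞ a z := fun z hz =>
    contDiffAt_formAlong (hRat z (hZO z hz)) (hα.1 _)
  have haϖ : ∀ z ∈ Z, a z = pullForm ϖ a z := fun z hz => by
    have h1 : R =ᶠ[𝓝 z] R ∘ ϖ := by
      filter_upwards [hOR.mem_nhds (hZO z hz)] with w hw using (hRGR w hw).symm
    exact (formAlong_congr α h1).trans (formAlong_comp α (hRd _ hz.2.2.1)
      ((hϖs z (hZO z hz)).differentiableAt (by simp)))
  -- differentials along the submanifold
  let x : Y → W → F := fun y X => chartDeriv R (ρ.emb y) (ι y) X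
  have hax : ∀ y X, a (ρ.emb y) X = (α (ι y) : F →L[ℝ] ℝ) (x y X) := fun y X =>
    formAlong_apply_of_eq (hRd _ (hOmem y)) (hRι y) α X
  have hxe : ∀ y (w : E), x y (ρ.demb y w) = dι y w :=
    fun y w => chartDeriv_mfderiv (j := ι) (hRd _ (hOmem y)) (hed y)
      (Eventually.of_forall hRι) w
  have hal : ∀ y (w : E), a (ρ.emb y) (ρ.demb y w) =
      (pullbackForm (d := d) α ι y : E →L[ℝ] ℝ) w := fun y w =>
    (hax y _).trans (congrArg (α (ι y) : F →L[ℝ] ℝ) (hxe y w))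
  have hrw : ∀ y (w : E), fderiv ℝ r (ρ.emb y) (ρ.demb y w) = ρ.demb y w := fun y w => by
    have h1 : r ∘ ρ.emb = ρ.emb := funext hre
    have h2 := mfderiv_comp_apply (I := 𝓡 d) (I' := 𝓘(ℝ, W)) (I'' := 𝓘(ℝ, W)) (f := ρ.emb) y
      ((hrs _ (ρ.emb_mem y)).differentiableAt (by simp)).mdifferentiableAt (hed y) w
    rw [h1, mfderiv_eq_fderiv] at h2
    exact h2.symm
  have hϖx : ∀ y X, fderiv ℝ ϖ (ρ.emb y) X = dG (ι y) (x y X) :=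
    fun y X => fderiv_comp_chartDeriv (hRd _ (hOmem y)) (hRι y) (hGd _) X
  have hGe : ∀ y (w : E), dG (ι y)
      (dι y w) = ρ.demb y w := fun y w => by
    have h1 : G ∘ ι = ρ.emb := funext hGι
    have h2 := mfderiv_comp_apply (I := 𝓡 d) (I' := 𝓡 m) (I'' := 𝓘(ℝ, W)) (f := ι) y
      (hGd _) ((hι y).mdifferentiableAt (by simp)) w
    rw [h1] at h2
    exact h2.symm
  have hxG : ∀ u ∈ U, ∀ v : F, chartDeriv R (G u) u
      (dG u v) = v := fun u hu v => by
    have h1 := chartDeriv_mfderiv (j := id) (hRd _ (hGU u hu)) (hGd u)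
      (by filter_upwards [hU.mem_nhds hu] with w hw using hRG w hw) v
    rw [mfderiv_id] at h1
    exact h1
  have hd : ∀ y X X', dForm a (ρ.emb y) X X' = dω y (x y X) (x y X') := fun y X X' =>
    dForm_formAlong (hRι y) (hRat _ (hOmem y)) (hα.1 _) X X'
  obtain ⟨P, B, O, hO, hCO, hP, hB, hPC, hPc, hBc, hker⟩ := exists_legendrian_retraction
    (C := C) (Z := Z) (ϖ := ϖ) (r := r) (a := a) (isCompact_range ρ.contMDiff_emb.continuous) hZ hCZ
    (fun z hz => (hϖs z (hZO z hz)).contDiffWithinAt) hϖZ hϖϖ (by rintro _ ⟨y, rfl⟩; exact hϖe y)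
    (fun z hz => (hrs z (hZd z hz)).contDiffWithinAt) (fun z _ => ⟨_, rfl⟩)
    (by rintro _ ⟨y, rfl⟩; exact hre y) (fun z hz => (has z hz).contDiffWithinAt) haϖ
    (by
      rintro _ ⟨y, rfl⟩ h0
      have h3 : ∀ w : E, (pullbackForm (d := d) α ι y : E →L[ℝ] ℝ) w = 0 := fun w => ?_
      · exact hns y (ContinuousLinearMap.ext h3)
      have h1 := congrArg (fun L : W →L[ℝ] ℝ => L (ρ.demb y w)) h0
      change a (ρ.emb y) (fderiv ℝ r (ρ.emb y) (ρ.demb y w)) = 0 at h1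
      rw [hrw, hal] at h1
      exact h1)
    (by
      rintro _ ⟨y, rfl⟩ X hX haX hw
      have h0 : ∀ w : E, (α (ι y) : F →L[ℝ] ℝ) (dι y w) = 0 → dω y (x y X) (dι y w) = 0 :=
        fun w hw' => by
        have h1 := hw (ρ.demb y w) (hrw y w) ((hal y w).trans hw')
        rw [hd, hxe] at h1
        exact h1
      obtain ⟨w, hw⟩ : ∃ w : E, dι y w = x y X :=
        hco y (x y X) ((hax y X).symm.trans haX) h0
      have h2 : X = ρ.demb y w := by
        rw [← hX, hϖx, ← hGe, hw]
      rw [h2, hrw])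
    (by
      rintro _ ⟨y, rfl⟩ X hX haX hw
      have h0 : ∀ v : F, (α (ι y) : F →L[ℝ] ℝ) v = 0 → dω y (x y X) v = 0 := fun v hv => by
        have h3 : x y (dG (ι y) v) = v := by
          have h4 := hxG (ι y) (hιU y) v
          rw [hGι] at h4
          exact h4
        have h2 := hw (dG (ι y) v)
          (by rw [hϖx, h3]) (by rw [hax, h3]; exact hv)
        rw [hd, h3] at h2
        exact h2
      have h1 : x y X = 0 := (hα.2 (ι y)).2 (x y X) ((hax y X).symm.trans haX) h0
      rw [← hX, hϖx, h1, map_zero])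
  let p : M → Y := fun u => ρ.ret (P (G u))
  have hGc : Continuous G := hG.continuous
  have hPd : ∀ z ∈ O, P z ∈ ρ.dom := fun z hz => hZd _ (hCZ (hPC z hz))
  let V : Set M := G ⁻¹' (O ∩ OR) ∩ U
  have hPGs : ∀ u ∈ V, ContMDiffAt (𝓡 m) 𝓘(ℝ, W) ∞ (fun u => P (G u)) u := fun u hu =>
    ContMDiffAt.comp (I' := 𝓘(ℝ, W)) (g := P) u
      (contMDiffAt_iff_contDiffAt.2 (hP.contDiffAt (hO.mem_nhds hu.1.1))) (hG u)
  have hps : ∀ u ∈ V, ContMDiffAt (𝓡 m) (𝓡 d) ∞ p u := fun u hu =>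
    (ρ.contMDiffAt_ret (hPd _ hu.1.1)).comp u (hPGs u hu)
  have hemb : ∀ z ∈ O, ρ.emb (ρ.ret (P z)) = P z := fun z hz => by
    obtain ⟨y, hy⟩ := hPC z hz
    rw [← hy, ρ.ret_emb]
  refine ⟨p, fun u => (B (G u)).comp (ρ.demb (p u)), V,
    ((hO.inter hOR).preimage hGc).inter hU, ?_, fun u hu => (hps u hu).contMDiffWithinAt,
    fun u hu => ?_, fun y => ?_, fun u hu (v : F) => ?_⟩
  · rintro _ ⟨y, rfl⟩
    exact ⟨by rw [mem_preimage, hGι]; exact ⟨hCO ⟨y, rfl⟩, hOmem y⟩, hιU y⟩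
  · have hBs : ContMDiffAt (𝓡 m) 𝓘(ℝ, W →L[ℝ] ℝ) ∞ (fun u => B (G u)) u :=
      ContMDiffAt.comp (I' := 𝓘(ℝ, W)) (g := B) u
        (contMDiffAt_iff_contDiffAt.2 (hB.contDiffAt (hO.mem_nhds hu.1.1))) (hG u)
    exact ((ρ.contMDiffAt_cotRet (p := (P (G u), B (G u))) (hPd _ hu.1.1)).comp u
      ((hPGs u hu).prodMk_space hBs)).contMDiffWithinAt
  · have h1 : (P (G (ι y)), B (G (ι y))) = (ρ.emb y, a (ρ.emb y)) := by
      rw [hGι, hPc _ ⟨y, rfl⟩, hBc _ ⟨y, rfl⟩]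
    refine (congrArg ρ.cotRet h1).trans ((ρ.cotRet_mk y _).trans ?_)
    exact SmoothRetract.cotangentBundle_ext rfl fun w => hal y w
  · have h1 : (α u : F →L[ℝ] ℝ) v = a (G u) (dG u v) := by
      refine Eq.trans ?_ (formAlong_apply_of_eq (hRd _ hu.1.2) (hRG u hu.2) α _).symm
      exact congrArg (α u : F →L[ℝ] ℝ) (hxG u hu.2 v).symm
    have hPm : MDifferentiableAt 𝓘(ℝ, W) 𝓘(ℝ, W) P (G u) :=
      ((hP.contDiffAt (hO.mem_nhds hu.1.1)).differentiableAt (by simp)).mdifferentiableAt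
    have h2 : ρ.demb (p u) ((mfderiv (𝓡 m) (𝓡 d) p u : F →L[ℝ] E) v) =
        fderiv ℝ P (G u) (dG u v) := by
      have h3 := mfderiv_comp_apply (I := 𝓡 m) (I' := 𝓡 d) (I'' := 𝓘(ℝ, W)) (f := p)
        (g := ρ.emb) u (hed _) ((hps u hu).mdifferentiableAt (by simp)) v
      have h4 := mfderiv_comp_apply (I := 𝓡 m) (I' := 𝓘(ℝ, W)) (I'' := 𝓘(ℝ, W)) (f := G)
        (g := P) u hPm (hGd u) v
      rw [mfderiv_eq_fderiv] at h4
      have h5 : ρ.emb ∘ p =ᶠ[𝓝 u] P ∘ G := by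
        filter_upwards [hGc.continuousAt.eventually (hO.mem_nhds hu.1.1)] with w hw
          using hemb _ hw
      refine h3.symm.trans (Eq.trans ?_ h4)
      exact congrArg (fun L : F →L[ℝ] W => L v) h5.mfderiv_eq
    refine (Eq.congr_left h1).trans ((hker _ hu.1.1 _).trans ?_)
    rw [← h2]
    rfl

/-- A map that embeds a neighborhood of `ι(Y)` in a Euclidean space also embeds `Y` by restriction,
and nearest point retractions for both make the two manifolds retracts of open sets of the same
space. -/
theorem exists_contact_retraction [T2Space M] [SecondCountableTopology M] [T2Space Y] [Nonempty Y]
    {α : (x : M) → CotangentAt m x} (hα : IsContactForm α)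
    {ι : Y → M} (hι : IsSmoothEmbedding (𝓡 d) (𝓡 m) ∞ ι) (hco : IsCoisotropicMap (d := d) α ι)
    (hns : ∀ y : Y, pullbackForm (d := d) α ι y ≠ 0) :
    ∃ (p : M → Y) (b : (u : M) → CotangentAt d (p u)) (O : Set M), IsOpen O ∧ range ι ⊆ O ∧
      ContMDiffOn (𝓡 m) (𝓡 d) ∞ p O ∧
      ContMDiffOn (𝓡 m) (cotModel d) ∞ (fun u => (⟨p u, b u⟩ : CotangentBundle d Y)) O ∧
      (∀ y, (⟨p (ι y), b (ι y)⟩ : CotangentBundle d Y) = formMap (pullbackForm (d := d) α ι) y) ∧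
      ∀ u ∈ O, ∀ v, α u v = 0 ↔ b u (mfderiv (𝓡 m) (𝓡 d) p u v) = 0 := by
  have hC : IsCompact (range ι) := isCompact_range hι.contMDiff.continuous
  obtain ⟨k, G, K, hG, hK, hCK, hinj, hd⟩ := exists_smooth_injOn_nhds_isCompact (d := m) hC
  obtain ⟨R, OR, hOR, hCO, hR, hRK, hRG⟩ := exists_smooth_retraction (d := m) hK
    ((range_nonempty ι).mono (hCK.trans interior_subset)) hCK hG hinj hd
  have hmem : ∀ y, ι y ∈ interior K := fun y => hCK ⟨y, rfl⟩
  have hinj' : Function.Injective (G ∘ ι) := fun y y' h =>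
    hι.isEmbedding.injective (hinj (interior_subset (hmem y)) (interior_subset (hmem y')) h)
  have hd' : ∀ y, Function.Injective
      (mfderiv (𝓡 d) 𝓘(ℝ, EuclideanSpace ℝ (Fin k)) (G ∘ ι) y) := fun y v w h => by
    have h1 := fun v => mfderiv_comp_apply (I := 𝓡 d) (I' := 𝓡 m)
      (I'' := 𝓘(ℝ, EuclideanSpace ℝ (Fin k))) (f := ι) (g := G) y
      ((hG _).mdifferentiableAt (by simp)) ((hι.contMDiff y).mdifferentiableAt (by simp)) v
    exact injective_mfderiv_of_isSmoothEmbedding hι y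
      (hd _ (interior_subset (hmem y)) ((h1 v).symm.trans (h.trans (h1 w))))
  exact exists_contact_retraction_of_retract hα hι.contMDiff hco hns
    (SmoothRetract.ofEmbedding (hG.comp hι.contMDiff) hinj' hd') (G := G) hG (fun y => rfl) (R := R)
    hOR (fun y => hCO ⟨_, ⟨y, rfl⟩, rfl⟩) hR (fun z hz => by rw [hRG _ (interior_subset (hRK z hz))])
    (U := interior K ∩ G ⁻¹' OR) (isOpen_interior.inter (hOR.preimage hG.continuous))
    (fun y => ⟨hmem y, hCO ⟨_, ⟨y, rfl⟩, rfl⟩⟩) (fun u hu => hu.2)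
    fun u hu => hRG u (interior_subset hu.1)

end ContactRetraction

/-! ### Leafwise covectors and the transverse vector field -/

section Leafwise

variable {d : ℕ} {Y : Type*} [TopologicalSpace Y] [ChartedSpace (EuclideanSpace ℝ (Fin d)) Y]

section Extend

variable {F L : (y : Y) → Submodule ℝ (TangentSpace (𝓡 d) y)} (hLF : ∀ y, IsCompl (F y) (L y))

lemma extendAt_apply_of_mem {y : Y} (e : F y →L[ℝ] ℝ) {v : TangentSpace (𝓡 d) y} (hv : v ∈ F y) :
    extendAt hLF y e v = e ⟨v, hv⟩ :=
  congrArg e (Submodule.projectionOnto_apply_left (hLF y) ⟨v, hv⟩)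

lemma extendAt_apply_of_mem_line {y : Y} (e : F y →L[ℝ] ℝ) {v : TangentSpace (𝓡 d) y}
    (hv : v ∈ L y) : extendAt hLF y e v = 0 :=
  (congrArg e (Submodule.projectionOnto_apply_right (hLF y) ⟨v, hv⟩)).trans (map_zero e)

lemma extendAt_zero (y : Y) : extendAt hLF y 0 = 0 :=
  ContinuousLinearMap.ext fun _ => rfl

lemma restrictLeaf_extendLeaf (e : LeafCotangent F) : restrictLeaf F (extendLeaf hLF e) = e :=
  Sigma.ext rfl (heq_of_eq (ContinuousLinearMap.ext fun v =>
    extendAt_apply_of_mem hLF e.2 v.2))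

lemma extendLeaf_injective : Function.Injective (extendLeaf hLF) :=
  Function.LeftInverse.injective (restrictLeaf_extendLeaf hLF)

end Extend

variable {lam : (y : Y) → CotangentAt d y} {L : (y : Y) → Submodule ℝ (TangentSpace (𝓡 d) y)}
  (hLF : ∀ y, IsCompl (kerField lam y) (L y)) {ν : (y : Y) → TangentSpace (𝓡 d) y}

/-- The component of `v` in `ker λ` along `L` is `v - λ(v) ν`. The resulting formula shows that the
projection of `T*Y` onto the covectors vanishing on `L` is smooth. -/
lemma extendAt_restrict (hνL : ∀ y, ν y ∈ L y) (hν : ∀ y, lam y (ν y) = 1) {y : Y} (ξ : CotangentAt d y) :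
    extendAt hLF y (ξ.comp (kerField lam y).subtypeL) = ξ - ξ (ν y) • lam y := by
  refine ContinuousLinearMap.ext fun v => ?_
  have hv : v - lam y v • ν y ∈ kerField lam y := by
    change lam y (v - lam y v • ν y) = 0
    rw [map_sub, map_smul, hν]
    simp
  have h1 : v = (v - lam y v • ν y) + lam y v • ν y := by simp
  have h2 : extendAt hLF y (ξ.comp (kerField lam y).subtypeL) v = ξ (v - lam y v • ν y) := by
    conv_lhs => rw [h1]
    rw [map_add, extendAt_apply_of_mem hLF _ hv,
      extendAt_apply_of_mem_line hLF _ ((L y).smul_mem _ (hνL y)), add_zero]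
    rfl
  rw [h2, map_sub, map_smul]
  simp [mul_comm]

lemma extendLeaf_restrictLeaf (hνL : ∀ y, ν y ∈ L y) (hν : ∀ y, lam y (ν y) = 1) (ξ : CotangentBundle d Y) :
    extendLeaf hLF (restrictLeaf (kerField lam) ξ) = ⟨ξ.1, ξ.2 - ξ.2 (ν ξ.1) • lam ξ.1⟩ :=
  congrArg (fun a => (⟨ξ.1, a⟩ : CotangentBundle d Y)) (extendAt_restrict hLF hνL hν ξ.2)

variable [IsManifold (𝓡 d) ∞ Y]

/-- Each line of `L` meets `ker λ` only in zero, so it contains a unique vector on which `λ` is one.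
Locally this is a generator of `L` divided by its `λ`-value, hence smooth. -/
lemma exists_transverse_field (hlam : IsSmoothForm lam) (hL : IsSmoothLineField L)
    (hLF : ∀ y, IsCompl (kerField lam y) (L y)) :
    ∃ ν : (y : Y) → TangentSpace (𝓡 d) y,
      ContMDiff (𝓡 d) (𝓡 d).tangent ∞ (fun y => (⟨y, ν y⟩ : TangentBundle (𝓡 d) Y)) ∧
      (∀ y, ν y ∈ L y) ∧ ∀ y, lam y (ν y) = 1 := by
  have hker : ∀ y, ∀ v ∈ L y, lam y v = 0 → v = 0 := fun y v hv h0 =>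
    (Submodule.disjoint_def.1 (hLF y).disjoint) v h0 hv
  have hex : ∀ y, ∃ v ∈ L y, lam y v = 1 := fun y => by
    obtain ⟨O, V, -, hyO, -, hV⟩ := hL y
    have hVL : V y ∈ L y := by rw [(hV y hyO).2]; exact Submodule.mem_span_singleton_self _
    have h0 : lam y (V y) ≠ 0 := fun h => (hV y hyO).1 (hker y _ hVL h)
    exact ⟨(lam y (V y))⁻¹ • V y, (L y).smul_mem _ hVL, by
      rw [map_smul, smul_eq_mul, inv_mul_cancel₀ h0]⟩
  choose ν hνL hν using hex
  refine ⟨ν, fun y => ?_, hνL, hν⟩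
  obtain ⟨O, V, hO, hyO, hVs, hV⟩ := hL y
  have hVL : ∀ z ∈ O, V z ∈ L z := fun z hz => by
    rw [(hV z hz).2]; exact Submodule.mem_span_singleton_self _
  have h0 : ∀ z ∈ O, lam z (V z) ≠ 0 := fun z hz h => (hV z hz).1 (hker z _ (hVL z hz) h)
  have hVa : ContMDiffAt (𝓡 d) (𝓡 d).tangent ∞
      (fun z => (⟨z, V z⟩ : TangentBundle (𝓡 d) Y)) y := hVs.contMDiffAt (hO.mem_nhds hyO)
  have h1 : ContMDiffAt (𝓡 d) 𝓘(ℝ, ℝ) ∞ (fun z => lam z (V z)) y :=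
    contMDiffAt_cotangent_apply (b := fun z => z) (hlam y) hVa
  have h2 : ContMDiffAt (𝓡 d) 𝓘(ℝ, ℝ) ∞ (fun z => (lam z (V z))⁻¹) y :=
    (contMDiffAt_iff_contDiffAt.2 (contDiffAt_inv ℝ (h0 y hyO))).comp y h1
  refine (h2.smul_section hVa).congr_of_eventuallyEq ?_
  filter_upwards [hO.mem_nhds hyO] with z hz
  have h3 : ν z = (lam z (V z))⁻¹ • V z := by
    refine sub_eq_zero.1 (hker z _ ((L z).sub_mem (hνL z) ((L z).smul_mem _ (hVL z hz))) ?_)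
    rw [map_sub, hν, map_smul, smul_eq_mul, inv_mul_cancel₀ (h0 z hz), sub_self]
  rw [h3]
  rfl

lemma pullbackForm_congr {m : ℕ} {M : Type*} [TopologicalSpace M]
    [ChartedSpace (EuclideanSpace ℝ (Fin m)) M] {α : (x : M) → CotangentAt m x} {j j' : Y → M}
    {y : Y} (h : j =ᶠ[𝓝 y] j') :
    pullbackForm (d := d) α j y = pullbackForm (d := d) α j' y := by
  have h1 : ∀ (x x' : M) (A A' : EuclideanSpace ℝ (Fin d) →L[ℝ] EuclideanSpace ℝ (Fin m)), x = x' →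
      A = A' → (α x : EuclideanSpace ℝ (Fin m) →L[ℝ] ℝ).comp A =
        (α x' : EuclideanSpace ℝ (Fin m) →L[ℝ] ℝ).comp A' := by
    rintro x _ A _ rfl rfl; rfl
  exact h1 _ _ _ _ h.self_of_nhds h.mfderiv_eq

/-- Near a point, the pullback is the composition of the coordinate expression of `α` in a chart of
the target with the differential of a vector valued map, so only covectors on a fixed space occur.
-/
lemma isSmoothForm_pullbackForm {m : ℕ} {M : Type*} [TopologicalSpace M]
    [ChartedSpace (EuclideanSpace ℝ (Fin m)) M] [IsManifold (𝓡 m) ∞ M]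
    {α : (x : M) → CotangentAt m x} (hα : IsSmoothForm α) {j : Y → M}
    (hj : ContMDiff (𝓡 d) (𝓡 m) ∞ j) : IsSmoothForm (pullbackForm (d := d) α j) := by
  intro y
  let ψ := extChartAt (𝓡 m) (j y)
  have hψ : ∀ x ∈ ψ.source, ContMDiffAt (𝓡 m) 𝓘(ℝ, EuclideanSpace ℝ (Fin m)) ∞ ψ x := fun x hx =>
    contMDiffAt_extChartAt_of_mem hx
  have hψ' : ∀ z ∈ ψ.target, ContMDiffAt 𝓘(ℝ, EuclideanSpace ℝ (Fin m)) (𝓡 m) ∞ ψ.symm z :=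
    fun z hz => contMDiffAt_extChartAt_symm_of_mem hz
  let f : Y → EuclideanSpace ℝ (Fin m) := ψ ∘ j
  have hy : j y ∈ ψ.source := mem_extChartAt_source (j y)
  have hf : ContMDiffAt (𝓡 d) 𝓘(ℝ, EuclideanSpace ℝ (Fin m)) ∞ f y := (hψ _ hy).comp y (hj y)
  have hζ : ContMDiffAt (𝓡 d) 𝓘(ℝ, EuclideanSpace ℝ (Fin m) →L[ℝ] ℝ) ∞
      (fun n => formAlong ψ.symm α (f n)) y :=
    (contMDiffAt_iff_contDiffAt.2 (contDiffAt_formAlong (hψ' _ (ψ.map_source hy)) (hα _))).comp y hf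
  refine (contMDiffAt_cotangent_mk (b := fun n : Y => n) hf contMDiffAt_id hζ).congr_of_eventuallyEq
    ?_
  have hO : IsOpen (j ⁻¹' ψ.source) := (isOpen_extChartAt_source (j y)).preimage hj.continuous
  filter_upwards [hO.mem_nhds hy] with n hn
  refine SmoothRetract.cotangentBundle_ext rfl fun w => ?_
  have h1 : j =ᶠ[𝓝 n] ψ.symm ∘ f := by
    filter_upwards [hO.mem_nhds hn] with n' hn' using (ψ.left_inv hn').symm
  refine (congrArg (fun L : EuclideanSpace ℝ (Fin d) →L[ℝ] ℝ => L w)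
    (pullbackForm_congr (α := α) h1)).trans ?_
  exact congrArg (α (ψ.symm (f n))) (mfderiv_comp_apply n
    ((hψ' _ (ψ.map_source hn)).mdifferentiableAt (by simp))
    (((hψ _ hn).comp n (hj n)).mdifferentiableAt (by simp)) w)

namespace SmoothRetract

variable {EN HN : Type*} [NormedAddCommGroup EN] [NormedSpace ℝ EN]
  [TopologicalSpace HN]
  {IN : ModelWithCorners ℝ EN HN} {N : Type*} [TopologicalSpace N] [ChartedSpace HN N]

lemma contMDiffWithinAt_smul_add (ρ : SmoothRetract d Y) {b : N → Y} {ξ η : (n : N) → CotangentAt d (b n)} {f g : N → ℝ}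
    {s : Set N} {p : N}
    (hξ : ContMDiffWithinAt IN (cotModel d) ∞ (fun n => (⟨b n, ξ n⟩ : CotangentBundle d Y)) s p)
    (hη : ContMDiffWithinAt IN (cotModel d) ∞ (fun n => (⟨b n, η n⟩ : CotangentBundle d Y)) s p)
    (hf : ContMDiffWithinAt IN 𝓘(ℝ, ℝ) ∞ f s p) (hg : ContMDiffWithinAt IN 𝓘(ℝ, ℝ) ∞ g s p) :
    ContMDiffWithinAt IN (cotModel d) ∞
      (fun n => (⟨b n, f n • ξ n + g n • η n⟩ : CotangentBundle d Y)) s p := by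
  have h1 := ρ.contMDiffWithinAt_cotangent_iff.1 hξ
  have h2 := ρ.contMDiffWithinAt_cotangent_iff.1 hη
  exact ρ.contMDiffWithinAt_cotangent_iff.2 ⟨h1.1, (hf.smul h1.2).add (hg.smul h2.2)⟩

lemma contMDiff_extendLeaf_restrictLeaf (ρ : SmoothRetract d Y) (hlam : IsSmoothForm lam)
    (hνs : ContMDiff (𝓡 d) (𝓡 d).tangent ∞ (fun y => (⟨y, ν y⟩ : TangentBundle (𝓡 d) Y)))
    (hνL : ∀ y, ν y ∈ L y) (hν : ∀ y, lam y (ν y) = 1) :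
    ContMDiff (cotModel d) (cotModel d) ∞
      (fun ξ => extendLeaf hLF (restrictLeaf (kerField lam) ξ)) := by
  intro ξ
  have hproj : ContMDiffAt (cotModel d) (𝓡 d) ∞ (fun ξ : CotangentBundle d Y => ξ.1) ξ :=
    contMDiff_proj (fun x : Y => CotangentAt d x) ξ
  have h1 : ContMDiffAt (cotModel d) 𝓘(ℝ, ℝ) ∞
      (fun ξ : CotangentBundle d Y => ξ.2 (ν ξ.1)) ξ :=
    contMDiffAt_cotangent_apply (b := fun ξ : CotangentBundle d Y => ξ.1)
      (ξ := fun ξ => ξ.2) contMDiffAt_id ((hνs _).comp ξ hproj)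
  have h2 := ρ.contMDiffWithinAt_smul_add (s := univ) (b := fun ξ : CotangentBundle d Y => ξ.1)
    (ξ := fun ξ => ξ.2) (η := fun ξ => lam ξ.1) (f := fun _ => 1) (g := fun ξ => - ξ.2 (ν ξ.1))
    contMDiffAt_id.contMDiffWithinAt ((hlam _).comp ξ hproj).contMDiffWithinAt
    contMDiffWithinAt_const h1.neg.contMDiffWithinAt
  refine (contMDiffWithinAt_univ.1 h2).congr_of_eventuallyEq (Eventually.of_forall fun ξ => ?_)
  refine (extendLeaf_restrictLeaf hLF hνL hν ξ).trans (SmoothRetract.cotangentBundle_ext rfl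
    fun v => ?_)
  change ξ.2 v - ξ.2 (ν ξ.1) * lam ξ.1 v = 1 * ξ.2 v + -ξ.2 (ν ξ.1) * lam ξ.1 v
  ring

end SmoothRetract

end Leafwise

/-! ### The rank of a contact form -/

section ContactRank

variable {m : ℕ} {M : Type*} [TopologicalSpace M] [ChartedSpace (EuclideanSpace ℝ (Fin m)) M]
  [IsManifold (𝓡 m) ∞ M]

lemma mfderiv_eq_fderiv_comp_extChartAt_symm {W : Type*} [NormedAddCommGroup W] [NormedSpace ℝ W]
    {f : M → W} {u : M} (hf : MDifferentiableAt (𝓡 m) 𝓘(ℝ, W) f u) :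
    mfderiv (𝓡 m) 𝓘(ℝ, W) f u =
      fderiv ℝ (f ∘ (extChartAt (𝓡 m) u).symm) (extChartAt (𝓡 m) u u) := by
  refine (show mfderiv (𝓡 m) 𝓘(ℝ, W) f u = fderivWithin ℝ _ _ _ from if_pos hf).trans ?_
  simp only [writtenInExtChartAt, modelWithCornersSelf_coe, range_id, extChartAt_model_space_eq_id,
    PartialEquiv.refl_coe, Function.id_comp]
  exact congrFun fderivWithin_univ _

/-- A contact form `α` whose kernel is that of `B ∘ dq` has rank at least the dimension:
the pair `(q, B)` is an immersion. -/
lemma IsContactForm.eq_zero_of_ker_eq {α : (x : M) → CotangentAt m x} (hα : IsContactForm α)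
    {W : Type*} [NormedAddCommGroup W] [NormedSpace ℝ W] {q : M → W} {B : M → W →L[ℝ] ℝ} {u : M}
    (hq : ContMDiffAt (𝓡 m) 𝓘(ℝ, W) ∞ q u) (hB : ContMDiffAt (𝓡 m) 𝓘(ℝ, W →L[ℝ] ℝ) ∞ B u)
    (hker : ∀ᶠ x in 𝓝 u, ∀ v, α x v = 0 ↔ B x (mfderiv (𝓡 m) 𝓘(ℝ, W) q x v) = 0)
    {v : EuclideanSpace ℝ (Fin m)}
    (hv : (mfderiv (𝓡 m) 𝓘(ℝ, W) q u : EuclideanSpace ℝ (Fin m) →L[ℝ] W) v = 0)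
    (hBv : (mfderiv (𝓡 m) 𝓘(ℝ, W →L[ℝ] ℝ) B u :
      EuclideanSpace ℝ (Fin m) →L[ℝ] W →L[ℝ] ℝ) v = 0) : v = 0 := by
  let E := EuclideanSpace ℝ (Fin m)
  let ψ := extChartAt (𝓡 m) u
  let z₀ : E := ψ u
  have hz₀ : z₀ ∈ ψ.target := ψ.map_source (mem_extChartAt_source u)
  have hzu : ψ.symm z₀ = u := ψ.left_inv (mem_extChartAt_source u)
  have hψ := contMDiffAt_extChartAt_symm_of_mem hz₀
  let Q : E → W := q ∘ ψ.symm
  let B' : E → W →L[ℝ] ℝ := B ∘ ψ.symm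
  have hQ : ContDiffAt ℝ ∞ Q z₀ := contMDiffAt_iff_contDiffAt.1
    (ContMDiffAt.comp (g := q) z₀ (by rw [hzu]; exact hq) hψ)
  have hB' : ContDiffAt ℝ ∞ B' z₀ := contMDiffAt_iff_contDiffAt.1
    (ContMDiffAt.comp (g := B) z₀ (by rw [hzu]; exact hB) hψ)
  have hQv : fderiv ℝ Q z₀ v = 0 := by
    exact (congrArg (fun L : E →L[ℝ] W => L v) (mfderiv_eq_fderiv_comp_extChartAt_symm
      (hq.mdifferentiableAt (by simp)))).symm.trans hv
  have hBv' : fderiv ℝ B' z₀ v = 0 := by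
    exact (congrArg (fun L : E →L[ℝ] W →L[ℝ] ℝ => L v) (mfderiv_eq_fderiv_comp_extChartAt_symm
      (hB.mdifferentiableAt (by simp)))).symm.trans hBv
  let a : E → E →L[ℝ] ℝ := formInChart α u
  let b : E → E →L[ℝ] ℝ := fun z => (B' z).comp (fderiv ℝ Q z)
  have hdQ : DifferentiableAt ℝ (fderiv ℝ Q) z₀ :=
    (hQ.fderiv_right (m := 1) two_le_infty).differentiableAt (by simp)
  have hdB : DifferentiableAt ℝ B' z₀ := hB'.differentiableAt (by simp)
  have hb : HasFDerivAt b _ z₀ := hdB.hasFDerivAt.clm_comp hdQ.hasFDerivAt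
  have ha0 : ∀ w : E, a z₀ w = (α u : E →L[ℝ] ℝ) w := fun w => formInChart_self α u w
  have hker' : ∀ᶠ z in 𝓝 z₀, ∀ w, a z w = 0 ↔ b z w = 0 := by
    have h1 : Tendsto ψ.symm (𝓝 z₀) (𝓝 u) := by
      have := hψ.continuousAt.tendsto
      rwa [hzu] at this
    filter_upwards [h1.eventually hker, h1.eventually (eventually_mdifferentiableAt hq),
      eventually_mdifferentiableAt hψ] with z hz hz1 hz2 w
    refine (hz (mfderiv 𝓘(ℝ, E) (𝓡 m) ψ.symm z w)).trans ?_
    have h2 : (mfderiv 𝓘(ℝ, E) 𝓘(ℝ, W) Q z : E →L[ℝ] W) w = _ := mfderiv_comp_apply z hz1 hz2 w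
    rw [mfderiv_eq_fderiv] at h2
    exact Eq.congr_left (congrArg (B (ψ.symm z)) h2.symm)
  have h0 : a z₀ ≠ 0 := fun h => (hα.2 u).1 (ContinuousLinearMap.ext fun w =>
    (ha0 w).symm.trans (congrArg (fun L : E →L[ℝ] ℝ => L w) h))
  obtain ⟨c, hc, hcd⟩ := exists_dForm_eq_mul (differentiableAt_formInChart (hα.1 u))
    hb.differentiableAt hker' h0
  have hαv : (α u : E →L[ℝ] ℝ) v = 0 :=
    (hker.self_of_nhds v).2 ((congrArg (B u) hv).trans (map_zero _))
  refine (hα.2 u).2 v hαv fun (w : E) hw => ?_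
  have h1 := hcd v w ((ha0 v).trans hαv) ((ha0 w).trans hw)
  -- The second derivatives of `Q` cancel in `db(v, w)`, which leaves `dB(v)(dQ w) - dB(w)(dQ v)`.
  -- Both terms vanish for the given `v`, so `v` is in the radical of `dα` on `ker α`.
  have h2 : dForm b z₀ v w = 0 := by
    have h3 : ∀ x y : E, fderiv ℝ b z₀ x y =
        (fderiv ℝ B' z₀ x) (fderiv ℝ Q z₀ y) + B' z₀ (fderiv ℝ (fderiv ℝ Q) z₀ x y) := fun x y => by
      rw [hb.fderiv]
      simp [add_comm]
    have h4 : IsSymmSndFDerivAt ℝ Q z₀ := hQ.isSymmSndFDerivAt (by simpa using two_le_infty)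
    simp only [dForm, h3, hBv', hQv, h4.eq v w]
    simp
  rw [h2] at h1
  exact (mul_eq_zero.1 h1.symm).resolve_left hc

end ContactRank

/-! ### Existence of standard neighborhoods -/

section StandardNeighborhood

lemma exists_smoothRetract (d : ℕ) (Y : Type*) [TopologicalSpace Y] [T2Space Y] [CompactSpace Y]
    [Nonempty Y] [ChartedSpace (EuclideanSpace ℝ (Fin d)) Y] [IsManifold (𝓡 d) ∞ Y] :
    Nonempty (SmoothRetract d Y) := by
  obtain ⟨k, G, K, hG, -, hK, hinj, hd⟩ :=
    exists_smooth_injOn_nhds_isCompact (d := d) (X := Y) isCompact_univ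
  have hmem : ∀ y, y ∈ K := fun y => interior_subset (hK trivial)
  exact ⟨SmoothRetract.ofEmbedding hG (fun x y h => hinj (hmem x) (hmem y) h) fun y => hd y (hmem y)⟩

variable {m d : ℕ} {M : Type*} [TopologicalSpace M] [ChartedSpace (EuclideanSpace ℝ (Fin m)) M]
  [IsManifold (𝓡 m) ∞ M] {Y : Type*} [TopologicalSpace Y]
  [ChartedSpace (EuclideanSpace ℝ (Fin d)) Y] [IsManifold (𝓡 d) ∞ Y]

lemma finrank_cotModel (d : ℕ) : Module.finrank ℝ
    (EuclideanSpace ℝ (Fin d) × (EuclideanSpace ℝ (Fin d) →L[ℝ] ℝ)) = 2 * d := by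
  rw [Module.finrank_prod, ← (LinearMap.toContinuousLinearMap
    (𝕜 := ℝ) (E := EuclideanSpace ℝ (Fin d)) (F' := ℝ)).finrank_eq, Module.finrank_linearMap]
  simp [two_mul]

/-- The map `(u, s) ↦ (p u, (1 + s) λ - b / b(ν))` is an immersion where `ker α = ker (b ∘ dp)`. -/
lemma injective_mfderiv_of_contact (ρ : SmoothRetract d Y) {α : (x : M) → CotangentAt m x}
    (hα : IsContactForm α) {lam : (y : Y) → CotangentAt d y} (hlam : IsSmoothForm lam)
    {ν : (y : Y) → TangentSpace (𝓡 d) y}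
    (hνs : ContMDiff (𝓡 d) (𝓡 d).tangent ∞ (fun y => (⟨y, ν y⟩ : TangentBundle (𝓡 d) Y)))
    (hν : ∀ y, lam y (ν y) = 1) {p : M → Y} {b : (u : M) → CotangentAt d (p u)} {O : Set M}
    (hO : IsOpen O) (hp : ContMDiffOn (𝓡 m) (𝓡 d) ∞ p O) (hb1 : ∀ u ∈ O, b u (ν (p u)) = 1)
    (hker : ∀ u ∈ O, ∀ v, α u v = 0 ↔ b u (mfderiv (𝓡 m) (𝓡 d) p u v) = 0)
    (hΨ : ContMDiffOn ((𝓡 m).prod 𝓘(ℝ, ℝ)) (cotModel d) ∞ (fun z : M × ℝ =>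
      (⟨p z.1, (1 + z.2) • lam (p z.1) - b z.1⟩ : CotangentBundle d Y)) (O ×ˢ univ))
    {u : M} (hu : u ∈ O) : Function.Injective (mfderiv ((𝓡 m).prod 𝓘(ℝ, ℝ)) (cotModel d)
      (fun z : M × ℝ => (⟨p z.1, (1 + z.2) • lam (p z.1) - b z.1⟩ : CotangentBundle d Y))
      (u, 0)) := by
  let E := EuclideanSpace ℝ (Fin d)
  let F := EuclideanSpace ℝ (Fin m)
  let W := ρ.Amb
  let Ψ : M × ℝ → CotangentBundle d Y := fun z => ⟨p z.1, (1 + z.2) • lam (p z.1) - b z.1⟩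
  have hΨs : ∀ x ∈ O, ContMDiffAt ((𝓡 m).prod 𝓘(ℝ, ℝ)) (cotModel d) ∞ Ψ (x, (0 : ℝ)) := fun x hx =>
    hΨ.contMDiffAt ((hO.prod isOpen_univ).mem_nhds ⟨hx, trivial⟩)
  have hΨd := (hΨs u hu).mdifferentiableAt (by simp)
  have hproj : ContMDiff (cotModel d) (𝓡 d) ∞ (fun ξ : CotangentBundle d Y => ξ.1) :=
    contMDiff_proj (fun x : Y => CotangentAt d x)
  let dΨ : F × ℝ →L[ℝ] E × (E →L[ℝ] ℝ) := mfderiv ((𝓡 m).prod 𝓘(ℝ, ℝ)) (cotModel d) Ψ (u, (0 : ℝ))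
  suffices h : ∀ x, dΨ x = 0 → x = 0 from (injective_iff_map_eq_zero dΨ).2 h
  rintro ⟨v, σ⟩ hx
  -- the component along the line field
  have hσ : σ = 0 := by
    let K : CotangentBundle d Y → ℝ := fun ξ => ξ.2 (ν ξ.1)
    have hK : ContMDiff (cotModel d) 𝓘(ℝ, ℝ) ∞ K := fun ξ =>
      contMDiffAt_cotangent_apply (b := fun ξ : CotangentBundle d Y => ξ.1)
        (ξ := fun ξ => ξ.2) contMDiffAt_id ((hνs _).comp ξ (hproj ξ))
    have h1 : K ∘ Ψ =ᶠ[𝓝 (u, (0 : ℝ))] Prod.snd := by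
      filter_upwards [(hO.prod isOpen_univ).mem_nhds (⟨hu, trivial⟩ : (u, (0 : ℝ)) ∈ O ×ˢ univ)]
        with z hz
      change (1 + z.2) * lam (p z.1) (ν (p z.1)) - b z.1 (ν (p z.1)) = z.2
      rw [hν, hb1 _ hz.1]
      ring
    have h2 := h1.mfderiv_eq (I := (𝓡 m).prod 𝓘(ℝ, ℝ)) (I' := 𝓘(ℝ, ℝ))
    rw [mfderiv_snd] at h2
    have h3 := congrArg (fun L : F × ℝ →L[ℝ] ℝ => L (v, σ)) h2
    have h4 := mfderiv_comp_apply (u, (0 : ℝ)) ((hK _).mdifferentiableAt (by simp)) hΨd (v, σ)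
    refine h3.symm.trans (h4.trans ?_)
    exact (congrArg (mfderiv (cotModel d) 𝓘(ℝ, ℝ) K (Ψ (u, 0)) : E × (E →L[ℝ] ℝ) →L[ℝ] ℝ) hx).trans
      (map_zero (mfderiv (cotModel d) 𝓘(ℝ, ℝ) K (Ψ (u, 0)) : E × (E →L[ℝ] ℝ) →L[ℝ] ℝ))
  subst hσ
  let ψ : M → CotangentBundle d Y := fun x => Ψ (x, 0)
  have hincl : ∀ x : M, ContMDiffAt (𝓡 m) ((𝓡 m).prod 𝓘(ℝ, ℝ)) ∞ (fun x : M => (x, (0 : ℝ))) x :=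
    fun x => contMDiffAt_id.prodMk contMDiffAt_const
  have hψs : ∀ x ∈ O, ContMDiffAt (𝓡 m) (cotModel d) ∞ ψ x := fun x hx =>
    (hΨs x hx).comp x (hincl x)
  have hψv : (mfderiv (𝓡 m) (cotModel d) ψ u : F →L[ℝ] E × (E →L[ℝ] ℝ)) v = 0 := by
    have h1 := mfderiv_comp_apply (I := 𝓡 m) (I' := (𝓡 m).prod 𝓘(ℝ, ℝ)) (I'' := cotModel d) u
      (f := fun x : M => (x, (0 : ℝ))) (g := Ψ) hΨd ((hincl u).mdifferentiableAt (by simp)) v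
    rw [mfderiv_prod_left] at h1
    exact h1.trans hx
  have hψd := (hψs u hu).mdifferentiableAt (by simp)
  let q : M → W := fun x => ρ.emb (p x)
  let B : M → W →L[ℝ] ℝ := fun x => (b x : E →L[ℝ] ℝ).comp (ρ.dret (ρ.emb (p x)))
  -- On the slice `s = 0`, `H` recovers the covector `b` from the value of `Ψ`. Hence a vector
  -- killed by `dΨ` is killed by the differentials of `p` and of `b`, and
  -- `IsContactForm.eq_zero_of_ker_eq` applies.
  let H : CotangentBundle d Y → W →L[ℝ] ℝ := fun ξ =>
    (ρ.cotEmb (formMap lam ξ.1)).2 - (ρ.cotEmb ξ).2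
  have hH : ContMDiff (cotModel d) 𝓘(ℝ, W →L[ℝ] ℝ) ∞ H := fun ξ =>
    (ρ.contMDiffAt_cotangent_iff.1 ((hlam _).comp ξ (hproj ξ))).2.sub
      (ρ.contMDiffAt_cotangent_iff.1 contMDiffAt_id).2
  have hHψ : H ∘ ψ = B := by
    refine funext fun x => ContinuousLinearMap.ext fun w => ?_
    change lam (p x) (ρ.dret (ρ.emb (p x)) w) - ((1 + (0 : ℝ)) * lam (p x) (ρ.dret (ρ.emb (p x)) w) -
      b x (ρ.dret (ρ.emb (p x)) w)) = b x (ρ.dret (ρ.emb (p x)) w)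
    ring
  have hqs : ContMDiff (cotModel d) 𝓘(ℝ, W) ∞ (fun ξ : CotangentBundle d Y => ρ.emb ξ.1) :=
    ρ.contMDiff_emb.comp hproj
  have hpat : ∀ x ∈ O, ContMDiffAt (𝓡 m) (𝓡 d) ∞ p x := fun x hx =>
    hp.contMDiffAt (hO.mem_nhds hx)
  have hv : v = 0 := by
    refine hα.eq_zero_of_ker_eq (W := W) (q := q) (B := B) (u := u)
      ((hqs _).comp u (hψs u hu)) (hHψ ▸ (hH _).comp u (hψs u hu)) ?_ ?_ ?_
    · filter_upwards [hO.mem_nhds hu] with x hx w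
      refine (hker x hx w).trans (Eq.congr_left ?_)
      have h1 := mfderiv_comp_apply (I := 𝓡 m) (I' := 𝓡 d) (I'' := 𝓘(ℝ, W)) (f := p) (g := ρ.emb) x
        ((ρ.contMDiff_emb _).mdifferentiableAt (by simp))
        ((hpat x hx).mdifferentiableAt (by simp)) w
      refine Eq.trans ?_ (congrArg (B x) h1.symm)
      exact congrArg (b x : E →L[ℝ] ℝ) (ρ.dret_demb (p x) _).symm
    · refine (mfderiv_comp_apply (I := 𝓡 m) (I' := cotModel d) (I'' := 𝓘(ℝ, W)) (f := ψ) u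
        ((hqs _).mdifferentiableAt (by simp)) hψd v).trans ?_
      exact (congrArg (mfderiv (cotModel d) 𝓘(ℝ, W) _ (ψ u) : E × (E →L[ℝ] ℝ) →L[ℝ] W) hψv).trans
        (map_zero (_ : E × (E →L[ℝ] ℝ) →L[ℝ] W))
    · rw [← hHψ]
      refine (mfderiv_comp_apply (I := 𝓡 m) (I' := cotModel d) (I'' := 𝓘(ℝ, W →L[ℝ] ℝ)) (f := ψ) u
        ((hH _).mdifferentiableAt (by simp)) hψd v).trans ?_
      exact (congrArg (mfderiv (cotModel d) 𝓘(ℝ, W →L[ℝ] ℝ) _ (ψ u) :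
        E × (E →L[ℝ] ℝ) →L[ℝ] W →L[ℝ] ℝ) hψv).trans
        (map_zero (_ : E × (E →L[ℝ] ℝ) →L[ℝ] W →L[ℝ] ℝ))
  rw [hv]
  rfl

/-- Once `b` is rescaled to `b(ν) = 1`, the covector `λ - b` vanishes on `L` and so is the extension
of a leafwise covector. Instead of inverting the map into `T*F` directly, a real variable is added
in the direction `λ`. The map `Ψ` from `M × ℝ` to `T*Y` is between manifolds of dimension `2n + 2`,
and the slice `s = 0` corresponds to the covectors that vanish on `L`. -/
theorem exists_standardNbhd [T2Space M] [SecondCountableTopology M] [T2Space Y] [CompactSpace Y]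
    [Nonempty Y] (hdim : m + 1 = 2 * d) {α : (x : M) → CotangentAt m x} (hα : IsContactForm α)
    {ι : Y → M} (hι : IsSmoothEmbedding (𝓡 d) (𝓡 m) ∞ ι) (hco : IsCoisotropicMap (d := d) α ι)
    (hns : ∀ y : Y, pullbackForm (d := d) α ι y ≠ 0)
    {L : (y : Y) → Submodule ℝ (TangentSpace (𝓡 d) y)} (hL : IsSmoothLineField L)
    (hLF : ∀ y : Y, IsCompl (charFoliation (d := d) α ι y) (L y)) {O' : Set M} (hO' : IsOpen O')
    (hιO' : range ι ⊆ O') : ∃ N : StandardNbhd (d := d) α ι hLF, N.source ⊆ O' := by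
  obtain ⟨ρ⟩ := exists_smoothRetract d Y
  let lam := pullbackForm (d := d) α ι
  have hlam : IsSmoothForm lam := isSmoothForm_pullbackForm hα.1 hι.contMDiff
  obtain ⟨ν, hνs, hνL, hν⟩ := exists_transverse_field hlam hL hLF
  obtain ⟨p, b, O₀, hO₀, hιO₀, hp, hb, hbι, hker⟩ := exists_contact_retraction hα hι hco hns
  let c : M → ℝ := fun u => b u (ν (p u))
  have hc : ∀ u ∈ O₀, ContMDiffAt (𝓡 m) 𝓘(ℝ, ℝ) ∞ c u := fun u hu =>
    contMDiffAt_cotangent_apply (b := p) (ξ := b) (hb.contMDiffAt (hO₀.mem_nhds hu))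
      ((hνs _).comp u (hp.contMDiffAt (hO₀.mem_nhds hu)))
  let O : Set M := (O₀ ∩ c ⁻¹' {0}ᶜ) ∩ O'
  have hO : IsOpen O := (ContinuousOn.isOpen_inter_preimage
    (fun u hu => (hc u hu).continuousAt.continuousWithinAt) hO₀ isOpen_compl_singleton).inter hO'
  have hcι : ∀ y, c (ι y) = 1 := fun y => by
    have h1 := congrArg (fun ξ : CotangentBundle d Y => ξ.2 (ν ξ.1)) (hbι y)
    exact h1.trans (hν y)
  have hιO : ∀ y, ι y ∈ O := fun y =>
    ⟨⟨hιO₀ ⟨y, rfl⟩, by rw [mem_preimage, hcι]; simp⟩, hιO' ⟨y, rfl⟩⟩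
  have hpι : ∀ y, p (ι y) = y := fun y => congrArg (fun ξ : CotangentBundle d Y => ξ.1) (hbι y)
  let β : (u : M) → CotangentAt d (p u) := fun u => (c u)⁻¹ • b u
  have hβ1 : ∀ u ∈ O, β u (ν (p u)) = 1 := fun u hu => inv_mul_cancel₀ hu.1.2
  have hcinv : ∀ u ∈ O, ContMDiffAt (𝓡 m) 𝓘(ℝ, ℝ) ∞ (fun u => (c u)⁻¹) u := fun u hu =>
    (contMDiffAt_iff_contDiffAt.2 (contDiffAt_inv ℝ hu.1.2)).comp u (hc u hu.1.1)
  have hkerβ : ∀ u ∈ O, ∀ v, α u v = 0 ↔ β u (mfderiv (𝓡 m) (𝓡 d) p u v) = 0 := fun u hu v =>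
    (hker u hu.1.1 v).trans (mul_eq_zero_iff_left (inv_ne_zero hu.1.2)).symm
  let Ψ : M × ℝ → CotangentBundle d Y := fun z => ⟨p z.1, (1 + z.2) • lam (p z.1) - β z.1⟩
  have hΨ : ContMDiffOn ((𝓡 m).prod 𝓘(ℝ, ℝ)) (cotModel d) ∞ Ψ (O ×ˢ univ) := fun z hz => by
    have hfst : ContMDiffAt ((𝓡 m).prod 𝓘(ℝ, ℝ)) (𝓡 m) ∞ (Prod.fst : M × ℝ → M) z := contMDiffAt_fst
    have hsnd : ContMDiffAt ((𝓡 m).prod 𝓘(ℝ, ℝ)) 𝓘(ℝ, ℝ) ∞ (Prod.snd : M × ℝ → ℝ) z :=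
      contMDiffAt_snd
    have h1 := ρ.contMDiffWithinAt_smul_add (IN := (𝓡 m).prod 𝓘(ℝ, ℝ)) (N := M × ℝ) (s := univ)
      (b := fun z => p z.1) (ξ := fun z => lam (p z.1))
      (η := fun z => b z.1) (f := fun z => 1 + z.2) (g := fun z => -(c z.1)⁻¹) (p := z)
      ((hlam _).comp z ((hp.contMDiffAt (hO₀.mem_nhds hz.1.1.1)).comp z hfst)).contMDiffWithinAt
      ((hb.contMDiffAt (hO₀.mem_nhds hz.1.1.1)).comp z hfst).contMDiffWithinAt
      (contMDiffAt_const.add hsnd).contMDiffWithinAt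
      ((hcinv _ hz.1).comp z hfst).neg.contMDiffWithinAt
    refine ((contMDiffWithinAt_univ.1 h1).congr_of_eventuallyEq
      (Eventually.of_forall fun z => ?_)).contMDiffWithinAt
    refine SmoothRetract.cotangentBundle_ext rfl fun v => ?_
    change (1 + z.2) * lam (p z.1) v - (c z.1)⁻¹ * b z.1 v =
      (1 + z.2) * lam (p z.1) v + (-(c z.1)⁻¹) * b z.1 v
    ring
  have : T2Space (CotangentBundle d Y) := ρ.t2Space_cotangentBundle
  have : Nonempty M := ⟨ι (Classical.arbitrary Y)⟩
  obtain ⟨e, hCe, heU, he, hes⟩ := exists_diffeo_of_isCompact (I := (𝓡 m).prod 𝓘(ℝ, ℝ))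
    (J := cotModel d) (f := Ψ) (C := range fun y => (ι y, (0 : ℝ))) (U := O ×ˢ univ)
    (by
      rw [finrank_cotModel, Module.finrank_prod, Module.finrank_self, finrank_euclideanSpace_fin,
        hdim])
    (isCompact_range (hι.contMDiff.continuous.prodMk continuous_const))
    (by
      rintro _ ⟨y, rfl⟩ _ ⟨y', rfl⟩ h
      have h1 : p (ι y) = p (ι y') := congrArg (fun ξ : CotangentBundle d Y => ξ.1) h
      rw [hpι, hpι] at h1
      rw [h1])
    (hO.prod isOpen_univ) (by rintro _ ⟨y, rfl⟩; exact ⟨hιO y, trivial⟩) hΨ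
    (by
      rintro _ ⟨y, rfl⟩
      exact injective_mfderiv_of_contact ρ hα hlam hνs hν hO
        (hp.mono fun u hu => hu.1.1) hβ1 hkerβ hΨ (hιO y))
  let F := charFoliation (d := d) α ι
  let Φ : M → LeafCotangent F := fun u => restrictLeaf F ⟨p u, lam (p u) - β u⟩
  have hΦ : ∀ u ∈ O, extendLeaf hLF (Φ u) = Ψ (u, 0) := fun u hu => by
    refine (extendLeaf_restrictLeaf hLF hνL hν _).trans (SmoothRetract.cotangentBundle_ext rfl
      fun v => ?_)
    change (lam (p u) v - β u v) - (lam (p u) (ν (p u)) - β u (ν (p u))) * lam (p u) v =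
      (1 + (0 : ℝ)) * lam (p u) v - β u v
    rw [hν, hβ1 u hu]
    ring
  have hExt := ρ.contMDiff_extendLeaf_restrictLeaf hLF hlam hνs hνL hν
  -- The value of `Ψ (u, s)` on `ν` is `s`, so the preimage of a covector that vanishes on `L` lies
  -- in the slice.
  have hfib : ∀ f : LeafCotangent F, extendLeaf hLF f ∈ e.target →
      e.symm (extendLeaf hLF f) = ((e.symm (extendLeaf hLF f)).1, 0) ∧
      (e.symm (extendLeaf hLF f)).1 ∈ O ∧ Φ (e.symm (extendLeaf hLF f)).1 = f := fun f hf => by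
    set z := e.symm (extendLeaf hLF f) with hz
    have hzO : z.1 ∈ O := (heU (e.map_target hf)).1
    have h1 : Ψ z = extendLeaf hLF f := by rw [← he]; exact e.right_inv hf
    have h2 : z.2 = 0 := by
      have h3 := congrArg (fun ξ : CotangentBundle d Y => ξ.2 (ν ξ.1)) h1
      have h4 : extendAt hLF f.1 f.2 (ν f.1) = 0 := extendAt_apply_of_mem_line hLF f.2 (hνL _)
      have h5 : (1 + z.2) * lam (p z.1) (ν (p z.1)) - β z.1 (ν (p z.1)) = 0 := h3.trans h4
      rw [hν, hβ1 _ hzO] at h5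
      linarith
    have h3 : z = (z.1, 0) := Prod.ext rfl h2
    refine ⟨h3, hzO, extendLeaf_injective hLF ((hΦ _ hzO).trans ?_)⟩
    rw [← h3, h1]
  have heq : ∀ u ∈ {u | (u, (0 : ℝ)) ∈ e.source}, e (u, 0) = extendLeaf hLF (Φ u) := fun u hu => by
    rw [hΦ u (heU hu).1, he]
  refine ⟨{
    toFun := Φ
    invFun := fun f => (e.symm (extendLeaf hLF f)).1
    source := {u | (u, (0 : ℝ)) ∈ e.source}
    target := {f | extendLeaf hLF f ∈ e.target}
    map_source' := fun u hu => ?_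
    map_target' := fun f hf => ?_
    left_inv' := fun u hu => ?_
    right_inv' := fun f hf => (hfib f hf).2.2
    open_source := e.open_source.preimage (by fun_prop)
    open_target := e.open_target.preimage hExt.continuous
    contMDiffOn_toFun := fun u hu => ?_
    contMDiffOn_invFun := fun ξ hξ => ?_
    mem_source := fun y => hCe ⟨y, rfl⟩
    map_zero := fun y => ?_
    contact := fun u hu v => ?_ }, fun u hu => (heU hu).1.2⟩
  · change extendLeaf hLF (Φ u) ∈ e.target
    rw [← heq u hu]
    exact e.map_source hu
  · change ((e.symm (extendLeaf hLF f)).1, (0 : ℝ)) ∈ e.source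
    rw [← (hfib f hf).1]
    exact e.map_target hf
  · rw [← heq u hu, e.left_inv hu]
  · have h1 : ContMDiffAt (𝓡 m) (cotModel d) ∞ (fun u => Ψ (u, 0)) u :=
      (hΨ.contMDiffAt ((hO.prod isOpen_univ).mem_nhds (heU hu))).comp u
        (contMDiffAt_id.prodMk contMDiffAt_const)
    refine (h1.congr_of_eventuallyEq ?_).contMDiffWithinAt
    filter_upwards [hO.mem_nhds (heU hu).1] with x hx using hΦ x hx
  · exact (contMDiffAt_fst.comp ξ ((hes.contMDiffAt (e.open_target.mem_nhds hξ)).comp ξ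
      (hExt ξ))).contMDiffWithinAt
  · refine extendLeaf_injective hLF ((hΦ _ (hιO y)).trans ?_)
    have h1 : β (ι y) = b (ι y) := by simp only [β, hcι, inv_one, one_smul]
    refine (SmoothRetract.cotangentBundle_ext rfl fun v => ?_ :
      Ψ (ι y, 0) = ⟨p (ι y), lam (p (ι y)) - b (ι y)⟩).trans ?_
    · change (1 + (0 : ℝ)) * lam (p (ι y)) v - β (ι y) v = lam (p (ι y)) v - b (ι y) v
      rw [h1]
      ring
    · have h2 := congrArg (fun ξ : CotangentBundle d Y =>
        (⟨ξ.1, lam ξ.1 - ξ.2⟩ : CotangentBundle d Y)) (hbι y)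
      refine h2.trans (SmoothRetract.cotangentBundle_ext rfl fun v => ?_)
      exact sub_self (lam y v)
  -- The model form pulls back to `(λ - (λ - β)) ∘ dp = β ∘ dp`.
  · refine (hkerβ u (heU hu).1 v).trans (Eq.congr_left ?_)
    have h1 := congrArg (fun ξ : CotangentBundle d Y => (ξ.2 : EuclideanSpace ℝ (Fin d) →L[ℝ] ℝ)
      (mfderiv (𝓡 m) (𝓡 d) p u v)) (hΦ u (heU hu).1)
    refine Eq.trans ?_ (congrArg (fun t : ℝ => lam (p u) (mfderiv (𝓡 m) (𝓡 d) p u v) - t) h1.symm)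
    change _ = lam (p u) _ - ((1 + (0 : ℝ)) * lam (p u) _ - β u _)
    ring

end StandardNeighborhood

/-! ### Coisotropic subspaces of half dimension -/

section LinearCoisotropic

/-- In a symplectic vector space, a subspace of half the dimension is coisotropic if and only if
it is isotropic. -/
lemma orthogonal_le_iff_of_finrank {V : Type*} [AddCommGroup V] [Module ℝ V] [FiniteDimensional ℝ V]
    {B : LinearMap.BilinForm ℝ V} (hB : B.Nondegenerate) {T : Submodule ℝ V}
    (hT : Module.finrank ℝ V = 2 * Module.finrank ℝ T) :
    B.orthogonal T ≤ T ↔ T ≤ B.orthogonal T := by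
  have h1 := LinearMap.BilinForm.finrank_orthogonal hB T
  have h2 : Module.finrank ℝ (B.orthogonal T) = Module.finrank ℝ T := by omega
  exact ⟨fun h => (Submodule.eq_of_le_of_finrank_eq h h2).ge,
    fun h => (Submodule.eq_of_le_of_finrank_eq h h2.symm).ge⟩

/-- The linear algebra of Legendrian foliations: `T` maps injectively to a contact vector space,
not into the hyperplane `a = 0`. -/
lemma coisotropic_iff_isotropic {E F : Type*} [NormedAddCommGroup E] [NormedSpace ℝ E]
    [FiniteDimensional ℝ E] [NormedAddCommGroup F] [NormedSpace ℝ F] [FiniteDimensional ℝ F]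
    (hdim : Module.finrank ℝ F + 1 = 2 * Module.finrank ℝ E) {a : F →L[ℝ] ℝ} {Ω : F →ₗ[ℝ] F →ₗ[ℝ] ℝ}
    (hω : ∀ v w, Ω v w = -Ω w v) (ha : a ≠ 0)
    (hnd : ∀ v, a v = 0 → (∀ w, a w = 0 → Ω v w = 0) → v = 0) {A : E →L[ℝ] F}
    (hA : Function.Injective A) (haA : a.comp A ≠ 0) :
    (∀ v, a v = 0 → (∀ w, a (A w) = 0 → Ω v (A w) = 0) → ∃ w, A w = v) ↔
      ∀ u v, a (A u) = 0 → a (A v) = 0 → Ω (A u) (A v) = 0 := by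
  let K : Submodule ℝ F := LinearMap.ker (a : F →ₗ[ℝ] ℝ)
  let S : Submodule ℝ E := LinearMap.ker (a.comp A : E →ₗ[ℝ] ℝ)
  let A' : S →ₗ[ℝ] K := ((A : E →ₗ[ℝ] F).restrict (p := S) (q := K) fun x hx => hx)
  have hA' : Function.Injective A' := fun x y h =>
    Subtype.ext (hA (congrArg (fun z : K => (z : F)) h))
  let B : LinearMap.BilinForm ℝ K := (Ω.comp K.subtype).compl₂ K.subtype
  have hBr : B.IsRefl := fun x y h => by
    change Ω x y = 0 at h
    change Ω y x = 0
    rw [hω, h, neg_zero]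
  have hB : B.Nondegenerate := by
    refine hBr.nondegenerate_iff_separatingLeft.2 fun x hx => ?_
    exact Subtype.ext (hnd x x.2 fun w hw => hx ⟨w, hw⟩)
  have h1 : Module.finrank ℝ K + 1 = Module.finrank ℝ F :=
    Module.Dual.finrank_ker_add_one_of_ne_zero (f := (a : F →ₗ[ℝ] ℝ)) fun h =>
      ha (ContinuousLinearMap.ext fun x => LinearMap.congr_fun h x)
  have h2 : Module.finrank ℝ S + 1 = Module.finrank ℝ E :=
    Module.Dual.finrank_ker_add_one_of_ne_zero (f := (a.comp A : E →ₗ[ℝ] ℝ)) fun h =>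
      haA (ContinuousLinearMap.ext fun x => LinearMap.congr_fun h x)
  have h3 : Module.finrank ℝ (LinearMap.range A') = Module.finrank ℝ S :=
    LinearMap.finrank_range_of_inj hA'
  -- Passing to the two hyperplanes lowers both dimensions by one, so `range A'` has exactly half
  -- the dimension of `K`.
  have h4 := orthogonal_le_iff_of_finrank hB (T := LinearMap.range A') (by omega)
  constructor
  · intro h u v hu hv
    have h5 : LinearMap.range A' ≤ B.orthogonal (LinearMap.range A') := h4.1 fun x hx => by
      obtain ⟨w, hw⟩ := h x x.2 fun w hw => by
        have h6 : Ω (A w) x = 0 := hx (A' ⟨w, hw⟩) ⟨_, rfl⟩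
        rw [hω, h6, neg_zero]
      have hwS : w ∈ S := by
        change a (A w) = 0
        rw [hw]; exact x.2
      exact ⟨⟨w, hwS⟩, Subtype.ext hw⟩
    exact h5 ⟨⟨v, hv⟩, rfl⟩ (A' ⟨u, hu⟩) ⟨_, rfl⟩
  · intro h v hv hw
    have h5 : B.orthogonal (LinearMap.range A') ≤ LinearMap.range A' := h4.2 (by
      rintro _ ⟨v, rfl⟩ _ ⟨u, rfl⟩
      exact h u v u.2 v.2)
    obtain ⟨w, hw⟩ := h5 (x := ⟨v, hv⟩) (by
      rintro _ ⟨w, rfl⟩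
      change Ω (A w) v = 0
      rw [hω, hw w w.2, neg_zero])
    exact ⟨w, congrArg Subtype.val hw⟩

end LinearCoisotropic

/-! ### Coisotropic submanifolds as Legendrian foliations -/

section CoisotropicMaps

variable {m d : ℕ} {M : Type*} [TopologicalSpace M] [ChartedSpace (EuclideanSpace ℝ (Fin m)) M]
  [IsManifold (𝓡 m) ∞ M] {Y : Type*} [TopologicalSpace Y]
  [ChartedSpace (EuclideanSpace ℝ (Fin d)) Y] [IsManifold (𝓡 d) ∞ Y]
  {α : (x : M) → CotangentAt m x}

/-- The exterior derivative as a bilinear form. -/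
def extDForm (α : (x : M) → CotangentAt m x) (x : M) :
    EuclideanSpace ℝ (Fin m) →ₗ[ℝ] EuclideanSpace ℝ (Fin m) →ₗ[ℝ] ℝ :=
  LinearMap.mk₂ ℝ (fun u v => extD α x u v)
    (fun _ _ _ => by simp only [extD, map_add, add_apply]; ring)
    (fun _ _ _ => by simp only [extD, map_smul, smul_apply, smul_eq_mul]; ring)
    (fun _ _ _ => by simp only [extD, map_add, add_apply]; ring)
    (fun _ _ _ => by simp only [extD, map_smul, smul_apply, smul_eq_mul]; ring)

/-- A submanifold of dimension `n + 1` transverse to the contact structure is coisotropic if and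
only if it is foliated by Legendrian leaves. -/
lemma isCoisotropicMap_iff (hdim : m + 1 = 2 * d) (hα : IsContactForm α) {j : Y → M}
    (hj : ContMDiff (𝓡 d) (𝓡 m) ∞ j)
    (hinj : ∀ y, Function.Injective (mfderiv (𝓡 d) (𝓡 m) j y))
    (hne : ∀ y, pullbackForm (d := d) α j y ≠ 0) :
    IsCoisotropicMap (d := d) α j ↔
      IsCodimOneFoliation (kerField (pullbackForm (d := d) α j)) := by
  rw [isCodimOneFoliation_kerField_iff (isSmoothForm_pullbackForm hα.1 hj) hne]
  refine forall_congr' fun y => ?_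
  have h := coisotropic_iff_isotropic (E := EuclideanSpace ℝ (Fin d))
    (F := EuclideanSpace ℝ (Fin m)) (by simpa using hdim) (a := α (j y)) (Ω := extDForm α (j y))
    (fun v w => by change extD α (j y) v w = -extD α (j y) w v; simp only [extD]; ring)
    (hα.2 (j y)).1 (hα.2 (j y)).2 (A := mfderiv (𝓡 d) (𝓡 m) j y) (hinj y) (hne y)
  refine Iff.trans h (forall_congr' fun u => forall_congr' fun v => ?_)
  refine imp_congr Iff.rfl (imp_congr Iff.rfl ?_)
  exact Eq.congr_left (extD_pullbackForm (hj y) (hα.1 _) u v).symm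

/-- Forms with the same kernels define the same foliation; a criterion for coisotropy. -/
lemma isCoisotropicMap_iff_of_ker_eq (hdim : m + 1 = 2 * d) (hα : IsContactForm α) {j : Y → M}
    (hj : ContMDiff (𝓡 d) (𝓡 m) ∞ j)
    (hinj : ∀ y, Function.Injective (mfderiv (𝓡 d) (𝓡 m) j y))
    {μ : (y : Y) → CotangentAt d y} (hne : ∀ y, μ y ≠ 0)
    (hker : ∀ y v, pullbackForm (d := d) α j y v = 0 ↔ μ y v = 0) :
    IsCoisotropicMap (d := d) α j ↔ IsCodimOneFoliation (kerField μ) := by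
  have h1 : kerField (pullbackForm (d := d) α j) = kerField μ :=
    funext fun y => Submodule.ext fun v => hker y v
  rw [← h1]
  refine isCoisotropicMap_iff hdim hα hj hinj fun y h0 => hne y (ContinuousLinearMap.ext fun v => ?_)
  exact (hker y v).1 (by rw [h0]; rfl)

/-- A subspace that contains a coisotropic one is coisotropic, and the image of `dk` contains that
of `dj`. So surjectivity of `φ` is enough, and nothing is asked of its differential. -/
lemma IsCoisotropicMap.of_comp {j k : Y → M} {φ : Y → Y} (h : IsCoisotropicMap (d := d) α j)
    (hk : ContMDiff (𝓡 d) (𝓡 m) ∞ k) (hφ : ContMDiff (𝓡 d) (𝓡 d) ∞ φ) (hkφ : j = k ∘ φ)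
    (hsurj : Function.Surjective φ) : IsCoisotropicMap (d := d) α k := by
  intro z
  obtain ⟨y, rfl⟩ := hsurj z
  subst hkφ
  have h1 : ∀ w, mfderiv (𝓡 d) (𝓡 m) (k ∘ φ) y w =
      mfderiv (𝓡 d) (𝓡 m) k (φ y) (mfderiv (𝓡 d) (𝓡 d) φ y w) := fun w =>
    mfderiv_comp_apply y ((hk _).mdifferentiableAt (by simp)) ((hφ y).mdifferentiableAt (by simp)) w
  intro v hv hw
  obtain ⟨w, hw⟩ := h y v hv fun w hw' => by
    have h2 := hw (mfderiv (𝓡 d) (𝓡 d) φ y w) (by rw [← h1]; exact hw')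
    rw [← h1] at h2
    exact h2
  exact ⟨_, (h1 w).symm.trans hw⟩

end CoisotropicMaps

/-! ### Graphs of sections in a standard neighborhood -/

namespace StandardNbhd

variable {m d : ℕ} {M : Type*} [TopologicalSpace M] [ChartedSpace (EuclideanSpace ℝ (Fin m)) M]
  [IsManifold (𝓡 m) ∞ M] {Y : Type*} [TopologicalSpace Y]
  [ChartedSpace (EuclideanSpace ℝ (Fin d)) Y] [IsManifold (𝓡 d) ∞ Y]
  {α : (x : M) → CotangentAt m x} {ι : Y → M}
  {L : (y : Y) → Submodule ℝ (TangentSpace (𝓡 d) y)}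
  {hLF : ∀ y : Y, IsCompl (charFoliation (d := d) α ι y) (L y)} (N : StandardNbhd α ι hLF)
  {EN HN : Type*} [NormedAddCommGroup EN] [NormedSpace ℝ EN] [TopologicalSpace HN]
  {IN : ModelWithCorners ℝ EN HN} {P : Type*} [TopologicalSpace P] [ChartedSpace HN P]

/-- The projection of a standard neighborhood to `Y`. -/
def proj (u : M) : Y := (N.toFun u).1

/-- The one-form `λ - e` on `Y` at the point of `T*F` that corresponds to `u`. -/
def formAt (u : M) : CotangentBundle d Y :=
  ⟨N.proj u, pullbackForm (d := d) α ι (N.proj u) - extendAt hLF (N.proj u) (N.toFun u).2⟩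

/-- The parametrized graph of a section. -/
def graphMap (s : (y : Y) → (charFoliation (d := d) α ι y →L[ℝ] ℝ)) (y : Y) : M :=
  N.invFun ⟨y, s y⟩

lemma contMDiffAt_proj {u : M} (hu : u ∈ N.source) : ContMDiffAt (𝓡 m) (𝓡 d) ∞ N.proj u :=
  (contMDiff_proj (fun x : Y => CotangentAt d x) _).comp u
    (N.contMDiffOn_toFun.contMDiffAt (N.open_source.mem_nhds hu))

lemma contMDiffWithinAt_invFun {k : P → LeafCotangent (charFoliation (d := d) α ι)} {s : Set P}
    {p : P} (hk : ContMDiffWithinAt IN (cotModel d) ∞ (fun x => extendLeaf hLF (k x)) s p)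
    (hp : k p ∈ N.target) : ContMDiffWithinAt IN (𝓡 m) ∞ (fun x => N.invFun (k x)) s p := by
  have h1 : ContMDiffAt (cotModel d) (𝓡 m) ∞
      (fun p => N.invFun (restrictLeaf (charFoliation (d := d) α ι) p)) (extendLeaf hLF (k p)) :=
    N.contMDiffOn_invFun.contMDiffAt (N.open_target.mem_nhds
      (by rw [mem_preimage, restrictLeaf_extendLeaf]; exact hp))
  refine (h1.comp_contMDiffWithinAt p hk).congr (fun x _ => ?_) ?_ <;>
  · simp only [Function.comp_apply, restrictLeaf_extendLeaf]

lemma toFun_ι (y : Y) : N.toFun (ι y) = ⟨y, 0⟩ := N.map_zero y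

lemma invFun_zero (y : Y) : N.invFun ⟨y, 0⟩ = ι y := by
  rw [← N.map_zero]; exact N.left_inv (N.mem_source y)

lemma zero_mem_target (y : Y) :
    (⟨y, 0⟩ : LeafCotangent (charFoliation (d := d) α ι)) ∈ N.target := by
  rw [← N.map_zero]; exact N.map_source (N.mem_source y)

lemma formAt_ι (y : Y) : N.formAt (ι y) = formMap (pullbackForm (d := d) α ι) y := by
  have h1 : ∀ f : LeafCotangent (charFoliation (d := d) α ι), f = ⟨y, 0⟩ →
      (⟨f.1, pullbackForm (d := d) α ι f.1 - extendAt hLF f.1 f.2⟩ : CotangentBundle d Y) =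
        ⟨y, pullbackForm (d := d) α ι y⟩ := by
    rintro _ rfl
    simp only [extendAt_zero, sub_zero]
  exact h1 _ (N.map_zero y)

section Sections

variable {N} {s s' : (y : Y) → (charFoliation (d := d) α ι y →L[ℝ] ℝ)}

lemma toFun_graphMap (hs : s ∈ N.sections) (y : Y) : N.toFun (N.graphMap s y) = ⟨y, s y⟩ :=
  N.right_inv (hs.2 y)

lemma graphMap_mem (hs : s ∈ N.sections) (y : Y) : N.graphMap s y ∈ N.source :=
  N.map_target (hs.2 y)

lemma proj_graphMap (hs : s ∈ N.sections) (y : Y) : N.proj (N.graphMap s y) = y :=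
  congrArg Sigma.fst (toFun_graphMap hs y)

lemma eq_of_graph_eq (hs : s ∈ N.sections) (hs' : s' ∈ N.sections)
    (h : N.graph s = N.graph s') : s = s' := by
  funext y
  obtain ⟨y', hy'⟩ : N.graphMap s y ∈ N.graph s' := h ▸ ⟨y, rfl⟩
  have h1 : (⟨y', s' y'⟩ : LeafCotangent (charFoliation (d := d) α ι)) = ⟨y, s y⟩ := by
    rw [← toFun_graphMap hs y, ← hy']
    exact (toFun_graphMap hs' y').symm
  obtain rfl : y' = y := congrArg Sigma.fst h1
  exact (eq_of_heq (Sigma.mk.inj_iff.1 h1).2).symm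

lemma contMDiff_graphMap (hs : s ∈ N.sections) : ContMDiff (𝓡 d) (𝓡 m) ∞ (N.graphMap s) :=
  fun y => contMDiffWithinAt_univ.1
    (N.contMDiffWithinAt_invFun (contMDiffWithinAt_univ.2 (hs.1 y)) (hs.2 y))

lemma mfderiv_proj_graphMap (hs : s ∈ N.sections) (y : Y) (v : EuclideanSpace ℝ (Fin d)) :
    (mfderiv (𝓡 m) (𝓡 d) N.proj (N.graphMap s y)
      (mfderiv (𝓡 d) (𝓡 m) (N.graphMap s) y v) : EuclideanSpace ℝ (Fin d)) = v :=
  mfderiv_apply_of_leftInverse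
    ((N.contMDiffAt_proj (graphMap_mem hs y)).mdifferentiableAt (by simp))
    ((contMDiff_graphMap hs y).mdifferentiableAt (by simp))
    (Eventually.of_forall (proj_graphMap hs)) v

lemma injective_mfderiv_graphMap (hs : s ∈ N.sections) (y : Y) :
    Function.Injective (mfderiv (𝓡 d) (𝓡 m) (N.graphMap s) y) :=
  mfderiv_injective_of_leftInverse
    ((N.contMDiffAt_proj (graphMap_mem hs y)).mdifferentiableAt (by simp))
    ((contMDiff_graphMap hs y).mdifferentiableAt (by simp))
    (Eventually.of_forall (proj_graphMap hs))

lemma isSmoothEmbedding_graphMap [CompactSpace Y] [T2Space M] (hs : s ∈ N.sections) :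
    IsSmoothEmbedding (𝓡 d) (𝓡 m) ∞ (N.graphMap s) :=
  ⟨isImmersion_of_injective_mfderiv (contMDiff_graphMap hs) (injective_mfderiv_graphMap hs),
    ((contMDiff_graphMap hs).continuous.isClosedEmbedding
      (Function.LeftInverse.injective (proj_graphMap hs))).isEmbedding⟩

/-- The contact condition is evaluated on vectors tangent to the graph, which `d(proj)` sends back
to the vectors of `TY` they come from. -/
lemma pullbackForm_graphMap_eq_zero_iff (hs : s ∈ N.sections) (y : Y)
    (v : TangentSpace (𝓡 d) y) : pullbackForm (d := d) α (N.graphMap s) y v = 0 ↔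
      (barForm hLF s y - pullbackForm (d := d) α ι y) v = 0 := by
  refine (N.contact _ (graphMap_mem hs y) _).trans ?_
  have h1 : ∀ f : LeafCotangent (charFoliation (d := d) α ι), f = ⟨y, s y⟩ →
      ∀ w : EuclideanSpace ℝ (Fin d), (pullbackForm (d := d) α ι f.1 w - extendAt hLF f.1 f.2 w = 0 ↔
        (barForm hLF s y - pullbackForm (d := d) α ι y) w = 0) := by
    rintro _ rfl w
    change _ - barForm hLF s y w = 0 ↔ barForm hLF s y w - _ = 0
    rw [sub_eq_zero, sub_eq_zero, eq_comm]
    exact Iff.rfl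
  refine (h1 _ (toFun_graphMap hs y) _).trans ?_
  exact Eq.congr_left (congrArg (fun w : EuclideanSpace ℝ (Fin d) =>
    (barForm hLF s y - pullbackForm (d := d) α ι y) w) (mfderiv_proj_graphMap hs y v))

variable {ν : (y : Y) → TangentSpace (𝓡 d) y}

lemma barForm_apply_transverse (s : (y : Y) → (charFoliation (d := d) α ι y →L[ℝ] ℝ))
    (hνL : ∀ y, ν y ∈ L y) (y : Y) : barForm hLF s y (ν y) = 0 :=
  extendAt_apply_of_mem_line hLF (s y) (hνL y)

/-- This normalization fixes the scale, so that `s̄ - λ` can be recovered from its kernel. -/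
lemma barForm_sub_apply_transverse (s : (y : Y) → (charFoliation (d := d) α ι y →L[ℝ] ℝ))
    (hνL : ∀ y, ν y ∈ L y) (hν : ∀ y, pullbackForm (d := d) α ι y (ν y) = 1) (y : Y) :
    (barForm hLF s y - pullbackForm (d := d) α ι y) (ν y) = -1 := by
  change barForm hLF s y (ν y) - pullbackForm (d := d) α ι y (ν y) = -1
  rw [barForm_apply_transverse s hνL, hν]
  norm_num

lemma barForm_sub_ne_zero (s : (y : Y) → (charFoliation (d := d) α ι y →L[ℝ] ℝ))
    (hνL : ∀ y, ν y ∈ L y) (hν : ∀ y, pullbackForm (d := d) α ι y (ν y) = 1) (y : Y) :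
    barForm hLF s y - pullbackForm (d := d) α ι y ≠ 0 := fun h => by
  have h1 := barForm_sub_apply_transverse (hLF := hLF) s hνL hν y
  rw [h] at h1
  exact zero_ne_one ((neg_eq_iff_eq_neg.1 h1.symm).trans neg_zero).symm

lemma barForm_injective : Function.Injective
    (barForm hLF : ((y : Y) → (charFoliation (d := d) α ι y →L[ℝ] ℝ)) → _) := fun s s' h => by
  funext y
  have h1 : extendLeaf hLF ⟨y, s y⟩ = extendLeaf hLF ⟨y, s' y⟩ :=
    congrArg (fun a => (⟨y, a⟩ : CotangentBundle d Y)) (congrFun h y)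
  have h2 := extendLeaf_injective hLF h1
  exact eq_of_heq (Sigma.mk.inj_iff.1 h2).2

/-- A form with the kernel of `s̄ - λ` is a multiple of it. -/
lemma eq_smul_of_kerField_eq (hνL : ∀ y, ν y ∈ L y)
    (hν : ∀ y, pullbackForm (d := d) α ι y (ν y) = 1)
    {μ : (y : Y) → CotangentAt d y} (h : kerField μ = N.sectionField s) (hμ : ∀ y, μ y ≠ 0)
    (y : Y) : μ y (ν y) ≠ 0 ∧
      barForm hLF s y = pullbackForm (d := d) α ι y - (μ y (ν y))⁻¹ • μ y := by
  let γ := barForm hLF s y - pullbackForm (d := d) α ι y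
  have hγ : γ (ν y) = -1 := barForm_sub_apply_transverse s hνL hν y
  have hiff : ∀ v, μ y v = 0 ↔ γ v = 0 := fun v =>
    SetLike.ext_iff.1 (congrFun h y) v
  have h1 : ∀ v, μ y v = -γ v * μ y (ν y) := fun v => by
    have h2 := (hiff (v + γ v • ν y)).2 (by rw [map_add, map_smul, hγ]; simp)
    rw [map_add, map_smul, smul_eq_mul] at h2
    linarith
  have h0 : μ y (ν y) ≠ 0 := fun h => hμ y (ContinuousLinearMap.ext fun v => by rw [h1, h]; simp)
  refine ⟨h0, ContinuousLinearMap.ext fun v => ?_⟩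
  change barForm hLF s y v = pullbackForm (d := d) α ι y v - (μ y (ν y))⁻¹ * μ y v
  have h3 : γ v = barForm hLF s y v - pullbackForm (d := d) α ι y v := rfl
  rw [h1 v, h3]
  field_simp
  ring

lemma eq_of_sectionField_eq (hνL : ∀ y, ν y ∈ L y)
    (hν : ∀ y, pullbackForm (d := d) α ι y (ν y) = 1) (h : N.sectionField s = N.sectionField s') :
    s = s' := by
  refine barForm_injective (hLF := hLF) (funext fun y => ?_)
  have h1 := (eq_smul_of_kerField_eq (N := N) (s := s') hνL hν h
    (barForm_sub_ne_zero s hνL hν) y).2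
  rw [h1, barForm_sub_apply_transverse s hνL hν]
  refine ContinuousLinearMap.ext fun v => ?_
  change _ = pullbackForm (d := d) α ι y v - (-1 : ℝ)⁻¹ *
    (barForm hLF s y v - pullbackForm (d := d) α ι y v)
  norm_num

/-- The graph of `s` is coisotropic if and only if `ker (s̄ - λ)` is a foliation. -/
theorem isCoisotropicMap_graphMap_iff (hdim : m + 1 = 2 * d) (hα : IsContactForm α)
    (hνL : ∀ y, ν y ∈ L y) (hν : ∀ y, pullbackForm (d := d) α ι y (ν y) = 1)
    (hs : s ∈ N.sections) :
    IsCoisotropicMap (d := d) α (N.graphMap s) ↔ IsCodimOneFoliation (N.sectionField s) :=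
  isCoisotropicMap_iff_of_ker_eq hdim hα (contMDiff_graphMap hs) (injective_mfderiv_graphMap hs)
    (barForm_sub_ne_zero s hνL hν) (pullbackForm_graphMap_eq_zero_iff hs)

/-- A parametrized submanifold that is a graph. -/
lemma isCoisotropicMap_graphMap_of_range_eq (hs : s ∈ N.sections) {j : Y → M}
    (hj : ContMDiff (𝓡 d) (𝓡 m) ∞ j) (hco : IsCoisotropicMap (d := d) α j)
    (h : range j = N.graph s) : IsCoisotropicMap (d := d) α (N.graphMap s) := by
  have hmem : ∀ y, ∃ z, N.graphMap s z = j y := fun y => by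
    have h1 : j y ∈ N.graph s := h ▸ ⟨y, rfl⟩
    exact h1
  have hjs : ∀ y, j y ∈ N.source := fun y => by
    obtain ⟨z, hz⟩ := hmem y
    rw [← hz]; exact graphMap_mem hs z
  refine hco.of_comp (contMDiff_graphMap hs) (φ := N.proj ∘ j)
    (fun y => (N.contMDiffAt_proj (hjs y)).comp y (hj y)) ?_ fun z => ?_
  · funext y
    obtain ⟨z, hz⟩ := hmem y
    simp only [Function.comp_apply, ← hz, proj_graphMap hs]
  · obtain ⟨y, hy⟩ : N.graphMap s z ∈ range j := h ▸ ⟨z, rfl⟩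
    exact ⟨y, by simp only [Function.comp_apply, hy, proj_graphMap hs]⟩

/-- Coisotropy is known for some parametrization of the graph and passes to `N.graphMap s` by
`isCoisotropicMap_graphMap_of_range_eq`. Thus membership becomes a condition on the section alone.
-/
lemma mem_coisotropicGraphs_iff [CompactSpace Y] [T2Space M] (hdim : m + 1 = 2 * d)
    (hα : IsContactForm α) (hνL : ∀ y, ν y ∈ L y)
    (hν : ∀ y, pullbackForm (d := d) α ι y (ν y) = 1) {S : Set M} :
    S ∈ N.coisotropicGraphs ↔
      ∃ s ∈ N.sections, S = N.graph s ∧ IsCodimOneFoliation (N.sectionField s) := by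
  constructor
  · rintro ⟨⟨j, hj, rfl⟩, s, hs, h⟩
    exact ⟨s, hs, h, (isCoisotropicMap_graphMap_iff hdim hα hνL hν hs).1
      (isCoisotropicMap_graphMap_of_range_eq hs hj.1.contMDiff hj.2 h)⟩
  · rintro ⟨s, hs, h, hf⟩
    exact ⟨⟨N.graphMap s, ⟨isSmoothEmbedding_graphMap hs,
      (isCoisotropicMap_graphMap_iff hdim hα hνL hν hs).2 hf⟩, h.symm⟩, s, hs, h⟩

/-- A submanifold that projects identically to `Y` is the graph of a section. -/
lemma exists_section_of_proj_eq {k : Y → M} (hk : ContMDiff (𝓡 d) (𝓡 m) ∞ k)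
    (hks : ∀ y, k y ∈ N.source) (hkp : ∀ y, N.proj (k y) = y) :
    ∃ s ∈ N.sections, N.graphMap s = k ∧
      ∀ y, N.formAt (k y) = formMap (fun y => pullbackForm (d := d) α ι y - barForm hLF s y) y := by
  have h1 : ∀ y, ∃ e : charFoliation (d := d) α ι y →L[ℝ] ℝ, N.toFun (k y) = ⟨y, e⟩ := fun y => by
    have h2 : ∀ f : LeafCotangent (charFoliation (d := d) α ι), f.1 = y →
        ∃ e : charFoliation (d := d) α ι y →L[ℝ] ℝ, f = ⟨y, e⟩ := by
      rintro ⟨_, e⟩ rfl; exact ⟨e, rfl⟩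
    exact h2 _ (hkp y)
  choose s hs using h1
  refine ⟨s, ⟨fun y => ?_, fun y => ?_⟩, funext fun y => ?_, fun y => ?_⟩
  · have h3 : (fun y => extendLeaf hLF (N.toFun (k y))) = formMap (barForm hLF s) :=
      funext fun y => by rw [hs]; rfl
    rw [← h3]
    exact (N.contMDiffOn_toFun.contMDiffAt (N.open_source.mem_nhds (hks y))).comp y (hk y)
  · rw [← hs]; exact N.map_source (hks y)
  · change N.invFun ⟨y, s y⟩ = k y
    rw [← hs]; exact N.left_inv (hks y)
  · have h4 : ∀ f : LeafCotangent (charFoliation (d := d) α ι), f = ⟨y, s y⟩ →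
      (⟨f.1, pullbackForm (d := d) α ι f.1 - extendAt hLF f.1 f.2⟩ : CotangentBundle d Y) =
        formMap (fun y => pullbackForm (d := d) α ι y - barForm hLF s y) y := by
      rintro _ rfl; rfl
    exact h4 _ (hs y)

lemma sectionField_eq_kerField (s : (y : Y) → (charFoliation (d := d) α ι y →L[ℝ] ℝ)) :
    N.sectionField s = kerField fun y => pullbackForm (d := d) α ι y - barForm hLF s y := by
  refine funext fun y => Submodule.ext fun v => ?_
  change barForm hLF s y v - pullbackForm (d := d) α ι y v = 0 ↔
    pullbackForm (d := d) α ι y v - barForm hLF s y v = 0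
  rw [sub_eq_zero, sub_eq_zero, eq_comm]

end Sections

end StandardNbhd

/-! ### Convergence of families of maps, in the `C⁰` and `C¹` sense -/

section ContinuousConvergence

variable {A : Type*} {l : Filter A} {X Z : Type*} [TopologicalSpace X]

/-- The tube lemma, with an arbitrary filter in place of the neighborhoods of a parameter. -/
lemma IsCompact.eventually_forall_of_prod {K : Set X} (hK : IsCompact K) {P : A → X → Prop}
    (h : ∀ x ∈ K, ∀ᶠ p in l ×ˢ 𝓝 x, P p.1 p.2) : ∀ᶠ a in l, ∀ x ∈ K, P a x := by
  have h1 : {p : A × X | P p.1 p.2} ∈ l ×ˢ 𝓝ˢ K := hK.mem_prod_nhdsSet_of_forall h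
  obtain ⟨pa, hpa, px, hpx, h2⟩ := eventually_prod_iff.1 h1
  filter_upwards [hpa] with a ha x hx
  exact h2 ha (hpx.self_of_nhdsSet x hx)

lemma eventually_prod_nhds_eventually {x : X} {P : A × X → Prop} (h : ∀ᶠ p in l ×ˢ 𝓝 x, P p) :
    ∀ᶠ p in l ×ˢ 𝓝 x, ∀ᶠ y in 𝓝 p.2, P (p.1, y) := by
  obtain ⟨pa, hpa, px, hpx, h2⟩ := eventually_prod_iff.1 h
  refine eventually_prod_iff.2 ⟨pa, hpa, _, eventually_eventually_nhds.2 hpx, fun {a} ha {x} hx => ?_⟩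
  filter_upwards [hx] with y hy using h2 ha hy

/-- On a locally compact source, convergence in the compact-open topology is joint convergence in
the index and the point. This form composes without choosing compact sets. -/
lemma tendsto_nhdsC0_iff [LocallyCompactSpace X] [TopologicalSpace Z] {F : A → X → Z} {f : X → Z}
    (hf : Continuous f) : Tendsto F l (nhdsC0 f) ↔
      ∀ x, Tendsto (fun p : A × X => F p.1 p.2) (l ×ˢ 𝓝 x) (𝓝 (f x)) := by
  constructor
  · intro h x
    refine (nhds_basis_opens (f x)).tendsto_right_iff.2 fun O hO => ?_
    obtain ⟨K, hKx, hKO, hK⟩ := local_compact_nhds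
      (hf.continuousAt.preimage_mem_nhds (hO.2.mem_nhds hO.1))
    have h1 : {g : X → Z | MapsTo g K O} ∈ nhdsC0 f :=
      mem_iInf_of_mem K (mem_iInf_of_mem hK (mem_iInf_of_mem O (mem_iInf_of_mem hO.2
        (mem_iInf_of_mem hKO (mem_principal_self _)))))
    exact eventually_prod_iff.2 ⟨_, h h1, _, hKx, fun {a} ha {x} hx => ha hx⟩
  · intro h
    refine tendsto_iInf.2 fun K => tendsto_iInf.2 fun hK => tendsto_iInf.2 fun O =>
      tendsto_iInf.2 fun hO => tendsto_iInf.2 fun hKO => tendsto_principal.2 ?_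
    exact hK.eventually_forall_of_prod fun x hx => h x (hO.mem_nhds (hKO hx))

end ContinuousConvergence

section TendstoC1At

variable {E H : Type*} [NormedAddCommGroup E] [NormedSpace ℝ E] [TopologicalSpace H]
  {I : ModelWithCorners ℝ E H} {X : Type*} [TopologicalSpace X] [ChartedSpace H X]
  [IsManifold I 1 X]
  {E' H' : Type*} [NormedAddCommGroup E'] [NormedSpace ℝ E'] [TopologicalSpace H']
  {I' : ModelWithCorners ℝ E' H'} {X' : Type*} [TopologicalSpace X'] [ChartedSpace H' X']
  [IsManifold I' 1 X']
  {E'' H'' : Type*} [NormedAddCommGroup E''] [NormedSpace ℝ E''] [TopologicalSpace H'']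
  {I'' : ModelWithCorners ℝ E'' H''} {X'' : Type*} [TopologicalSpace X''] [ChartedSpace H'' X'']
  [IsManifold I'' 1 X'']
  {A : Type*} {l : Filter A}

/-- Convergence of a family of maps and their differentials, uniformly near a point. -/
structure TendstoC1At (I : ModelWithCorners ℝ E H) [IsManifold I 1 X]
    (I' : ModelWithCorners ℝ E' H') [IsManifold I' 1 X'] (l : Filter A)
    (g : A → X → X') (f : X → X') (x : X) : Prop where
  eventually_mdiff : ∀ᶠ p in l ×ˢ 𝓝 x, MDifferentiableAt I I' (g p.1) p.2
  mdiff : MDifferentiableAt I I' f x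
  tendsto_tangentMap : ∀ v : TangentSpace I x,
    Tendsto (fun p : A × TangentBundle I X => tangentMap I I' (g p.1) p.2)
      (l ×ˢ 𝓝 ⟨x, v⟩) (𝓝 (tangentMap I I' f ⟨x, v⟩))

namespace TendstoC1At

variable {g : A → X → X'} {f : X → X'} {x : X}

/-- Convergence of the tangent maps, read on the zero section and projected to the base. -/
lemma tendsto (h : TendstoC1At I I' l g f x) :
    Filter.Tendsto (fun p : A × X => g p.1 p.2) (l ×ˢ 𝓝 x) (𝓝 (f x)) := by
  have h1 : Tendsto (fun p : A × X =>
      (p.1, (zeroSection E (TangentSpace I : X → Type _) p.2 : TangentBundle I X)))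
      (l ×ˢ 𝓝 x) (l ×ˢ 𝓝 (zeroSection E (TangentSpace I : X → Type _) x : TangentBundle I X)) :=
    tendsto_id.prodMap
      ((contMDiff_zeroSection (IB := I) (n := 0) ℝ (TangentSpace I : X → Type _)).continuous.tendsto x)
  exact ((FiberBundle.continuous_proj E' (TangentSpace I' : X' → Type _)).tendsto _).comp
    ((h.tendsto_tangentMap 0).comp h1)

lemma tendsto_prod (h : TendstoC1At I I' l g f x) :
    Tendsto (fun p : A × X => (p.1, g p.1 p.2)) (l ×ˢ 𝓝 x) (l ×ˢ 𝓝 (f x)) :=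
  tendsto_fst.prodMk h.tendsto

lemma tendsto_proj (v : TangentSpace I x) :
    Tendsto (fun p : A × TangentBundle I X => (p.1, p.2.1)) (l ×ˢ 𝓝 ⟨x, v⟩) (l ×ˢ 𝓝 x) :=
  tendsto_id.prodMap ((FiberBundle.continuous_proj E (TangentSpace I : X → Type _)).tendsto _)

lemma comp {h : A → X' → X''} {k : X' → X''} (hh : TendstoC1At I' I'' l h k (f x))
    (hg : TendstoC1At I I' l g f x) :
    TendstoC1At I I'' l (fun a => h a ∘ g a) (k ∘ f) x := by
  have h1 : ∀ᶠ p in l ×ˢ 𝓝 x, MDifferentiableAt I' I'' (h p.1) (g p.1 p.2) :=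
    hg.tendsto_prod.eventually hh.eventually_mdiff
  refine ⟨?_, hh.mdiff.comp x hg.mdiff, fun v => ?_⟩
  · filter_upwards [hg.eventually_mdiff, h1] with p hp hp' using hp'.comp p.2 hp
  · rw [tangentMap_comp_at _ hh.mdiff hg.mdiff]
    refine Tendsto.congr' ?_ ((hh.tendsto_tangentMap _).comp
      (tendsto_fst.prodMk (hg.tendsto_tangentMap v)))
    filter_upwards [(tendsto_proj v).eventually hg.eventually_mdiff,
      (tendsto_proj v).eventually h1] with p hp hp'
    exact (tangentMap_comp_at p.2 hp' hp).symm

lemma congr {g' : A → X → X'} {f' : X → X'} (h : TendstoC1At I I' l g f x)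
    (hg : ∀ᶠ p in l ×ˢ 𝓝 x, g' p.1 p.2 = g p.1 p.2) (hf : f' =ᶠ[𝓝 x] f) :
    TendstoC1At I I' l g' f' x := by
  have h1 := eventually_prod_nhds_eventually hg
  have h2 : ∀ {k k' : X → X'} {y : X} (_ : k' =ᶠ[𝓝 y] k) (v : TangentSpace I y),
      tangentMap I I' k' ⟨y, v⟩ = tangentMap I I' k ⟨y, v⟩ := fun {k k' y} hk v => by
    have h3 : ∀ (z z' : X') (L L' : E →L[ℝ] E'), z = z' → L = L' →
      (⟨z, L v⟩ : TangentBundle I' X') = ⟨z', L' v⟩ := by rintro z _ L _ rfl rfl; rfl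
    exact h3 _ _ _ _ hk.self_of_nhds hk.mfderiv_eq
  refine ⟨?_, h.mdiff.congr_of_eventuallyEq hf, fun v => ?_⟩
  · filter_upwards [h.eventually_mdiff, h1] with p hp hp' using hp.congr_of_eventuallyEq hp'
  · rw [h2 hf]
    refine (h.tendsto_tangentMap v).congr' ?_
    filter_upwards [(tendsto_proj v).eventually h1] with p hp using (h2 hp p.2.2).symm

lemma of_contMDiffAt [IsManifold I ∞ X] [IsManifold I' ∞ X'] (hf : ContMDiffAt I I' ∞ f x) :
    TendstoC1At I I' l (fun _ => f) f x := by
  refine ⟨tendsto_snd.eventually (eventually_mdifferentiableAt hf), hf.mdifferentiableAt (by simp),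
    fun v => ?_⟩
  obtain ⟨u, hu, hfu⟩ := (contMDiffAt_iff_contMDiffOn_nhds (n := 1) (by simp)).1
    (hf.of_le (m := 1) (by simp))
  obtain ⟨O, hOu, hO, hxO⟩ := mem_nhds_iff.1 hu
  have h1 := (hfu.mono hOu).continuousOn_tangentMapWithin le_rfl hO.uniqueMDiffOn
  have h2 : IsOpen (TotalSpace.proj ⁻¹' O : Set (TangentBundle I X)) :=
    hO.preimage (FiberBundle.continuous_proj E (TangentSpace I : X → Type _))
  have h3 : ContinuousAt (tangentMapWithin I I' f O) (⟨x, v⟩ : TangentBundle I X) :=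
    h1.continuousAt (h2.mem_nhds hxO)
  have h4 : ContinuousAt (tangentMap I I' f) (⟨x, v⟩ : TangentBundle I X) := by
    refine h3.congr ?_
    filter_upwards [h2.mem_nhds (hxO : (⟨x, v⟩ : TangentBundle I X) ∈ _)] with p hp
    exact tangentMapWithin_eq_tangentMap (hO.uniqueMDiffOn p.1 hp)
      (((hfu.mono hOu).contMDiffAt (hO.mem_nhds hp)).mdifferentiableAt (by simp))
  exact h4.tendsto.comp tendsto_snd

end TendstoC1At

/-- Replaces the filter of `C¹`-neighborhoods by a condition local at each point, which is stable
under composition, passage to charts and inversion. -/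
lemma tendsto_nhdsC1_iff [FiniteDimensional ℝ E] [IsManifold I ∞ X] [IsManifold I' ∞ X']
    [LocallyCompactSpace (TangentBundle I X)] {g : A → X → X'} {f : X → X'}
    (hg : ∀ᶠ a in l, ContMDiff I I' ∞ (g a)) (hf : ContMDiff I I' ∞ f) :
    Tendsto g l (nhdsC1 I I' f) ↔ ∀ x, TendstoC1At I I' l g f x := by
  have hf1 : Continuous (tangentMap I I' f) := (hf.of_le (m := 1) (by simp)).continuous_tangentMap le_rfl
  refine tendsto_comap_iff.trans ((tendsto_nhdsC0_iff hf1).trans ⟨fun h x => ?_, fun h ξ => ?_⟩)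
  · refine ⟨?_, hf.mdifferentiable (by simp) x, fun v => h ⟨x, v⟩⟩
    filter_upwards [tendsto_fst.eventually hg] with p hp using hp.mdifferentiable (by simp) p.2
  · exact (h ξ.1).tendsto_tangentMap ξ.2

end TendstoC1At

section VectorSpace

variable {d : ℕ} {E' : Type*} [NormedAddCommGroup E'] [NormedSpace ℝ E'] {A : Type*} {l : Filter A}
  {g : A → EuclideanSpace ℝ (Fin d) → E'} {f : EuclideanSpace ℝ (Fin d) → E'}
  {z : EuclideanSpace ℝ (Fin d)}

/-- In finite dimension an operator is a finite combination of rank one operators with its values on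
a basis as coefficients, so pointwise convergence is norm convergence. -/
lemma tendsto_clm_of_forall {F : A → EuclideanSpace ℝ (Fin d) →L[ℝ] E'}
    {L : EuclideanSpace ℝ (Fin d) →L[ℝ] E'} (h : ∀ v, Tendsto (fun a => F a v) l (𝓝 (L v))) :
    Tendsto F l (𝓝 L) := by
  let b := EuclideanSpace.basisFun (Fin d) ℝ
  have h1 : ∀ T : EuclideanSpace ℝ (Fin d) →L[ℝ] E',
      T = ∑ i, (innerSL ℝ (b i)).smulRight (T (b i)) := fun T => by
    refine ContinuousLinearMap.ext fun v => ?_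
    conv_lhs => rw [← b.sum_repr' v, map_sum]
    simp [sum_apply]
  rw [h1 L, show F = fun a => ∑ i, (innerSL ℝ (b i)).smulRight (F a (b i)) from
    funext fun a => h1 (F a)]
  refine tendsto_finsetSum _ fun i _ => ?_
  exact ((ContinuousLinearMap.smulRightL ℝ (EuclideanSpace ℝ (Fin d)) E'
    (innerSL ℝ (b i))).continuous.tendsto _).comp (h (b i))

/-- With its converse `TendstoC1At.of_tendsto_fderiv`, this allows quantitative arguments in the
operator norm. -/
lemma TendstoC1At.tendsto_fderiv
    (h : TendstoC1At 𝓘(ℝ, EuclideanSpace ℝ (Fin d)) 𝓘(ℝ, E') l g f z) :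
    Tendsto (fun p : A × EuclideanSpace ℝ (Fin d) => fderiv ℝ (g p.1) p.2) (l ×ˢ 𝓝 z)
      (𝓝 (fderiv ℝ f z)) := by
  let E := EuclideanSpace ℝ (Fin d)
  refine tendsto_clm_of_forall fun v => ?_
  have h1 : Continuous fun w : E => (⟨w, v⟩ : TangentBundle 𝓘(ℝ, E) E) :=
    (tangentBundleModelSpaceHomeomorph 𝓘(ℝ, E)).symm.continuous.comp
      (continuous_id.prodMk continuous_const : Continuous fun w : E => (w, v))
  have h2 : Continuous fun ξ : TangentBundle 𝓘(ℝ, E') E' => (ξ.2 : E') :=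
    (continuous_snd : Continuous (Prod.snd : E' × E' → E')).comp
      (tangentBundleModelSpaceHomeomorph 𝓘(ℝ, E')).continuous
  have h3 := ((h2.tendsto _).comp (h.tendsto_tangentMap v)).comp
    (tendsto_id.prodMap (h1.tendsto z) : Tendsto _ (l ×ˢ 𝓝 z) _)
  have h4 : ∀ (k : E → E') (w : E), ((tangentMap 𝓘(ℝ, E) 𝓘(ℝ, E') k ⟨w, v⟩).2 : E') =
    fderiv ℝ k w v := fun k w => congrArg (fun L : E →L[ℝ] E' => L v) mfderiv_eq_fderiv
  rw [← h4]
  exact h3.congr fun p => h4 _ _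

lemma TendstoC1At.of_tendsto_fderiv (hd : ∀ᶠ p in l ×ˢ 𝓝 z, DifferentiableAt ℝ (g p.1) p.2)
    (hf : DifferentiableAt ℝ f z)
    (h : Tendsto (fun p : A × EuclideanSpace ℝ (Fin d) => g p.1 p.2) (l ×ˢ 𝓝 z) (𝓝 (f z)))
    (h' : Tendsto (fun p : A × EuclideanSpace ℝ (Fin d) => fderiv ℝ (g p.1) p.2) (l ×ˢ 𝓝 z)
      (𝓝 (fderiv ℝ f z))) :
    TendstoC1At 𝓘(ℝ, EuclideanSpace ℝ (Fin d)) 𝓘(ℝ, E') l g f z := by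
  let E := EuclideanSpace ℝ (Fin d)
  refine ⟨hd.mono fun p hp => hp.mdifferentiableAt, hf.mdifferentiableAt, fun v => ?_⟩
  let T := tangentBundleModelSpaceHomeomorph 𝓘(ℝ, E)
  let T' := tangentBundleModelSpaceHomeomorph 𝓘(ℝ, E')
  have h1 : Tendsto (fun p : A × TangentBundle 𝓘(ℝ, E) E => (p.1, p.2.1)) (l ×ˢ 𝓝 ⟨z, v⟩)
      (l ×ˢ 𝓝 z) := TendstoC1At.tendsto_proj (I := 𝓘(ℝ, E)) v
  have h2 : Tendsto (fun p : A × TangentBundle 𝓘(ℝ, E) E => (p.2.2 : E)) (l ×ˢ 𝓝 ⟨z, v⟩) (𝓝 v) :=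
    (((continuous_snd : Continuous (Prod.snd : E × E → E)).comp T.continuous).tendsto ⟨z, v⟩).comp
      tendsto_snd
  have h3 := (h.comp h1).prodMk_nhds
    (((isBoundedBilinearMap_apply (𝕜 := ℝ) (E := E) (F := E')).continuous.tendsto
      (fderiv ℝ f z, v)).comp ((h'.comp h1).prodMk_nhds h2))
  have h4 : ∀ (k : E → E') (ξ : TangentBundle 𝓘(ℝ, E) E), tangentMap 𝓘(ℝ, E) 𝓘(ℝ, E') k ξ =
      T'.symm (k ξ.1, fderiv ℝ k ξ.1 ξ.2) := fun k ξ => by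
    have h5 : ∀ L L' : E →L[ℝ] E', L = L' → (⟨k ξ.1, L ξ.2⟩ : TangentBundle 𝓘(ℝ, E') E') =
      ⟨k ξ.1, L' ξ.2⟩ := by rintro L _ rfl; rfl
    exact h5 _ _ mfderiv_eq_fderiv
  rw [h4]
  exact ((T'.symm.continuous.tendsto _).comp h3).congr fun p => (h4 _ _).symm

end VectorSpace

/-! ### Perturbations of the identity -/

section VectorSpace

variable {d : ℕ} {A : Type*} {l : Filter A}
  {g : A → EuclideanSpace ℝ (Fin d) → EuclideanSpace ℝ (Fin d)} {z : EuclideanSpace ℝ (Fin d)}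

/-- Near a point, a family that converges to the identity in the `C¹` sense is injective and
covers a neighborhood of the point, while any property that holds near the point can be kept. -/
lemma TendstoC1At.exists_closedBall
    (h : TendstoC1At 𝓘(ℝ, EuclideanSpace ℝ (Fin d)) 𝓘(ℝ, EuclideanSpace ℝ (Fin d)) l g id z)
    {Q : A → EuclideanSpace ℝ (Fin d) → Prop} (hQ : ∀ᶠ p in l ×ˢ 𝓝 z, Q p.1 p.2) :
    ∃ r > 0, ∀ᶠ a in l, InjOn (g a) (Metric.closedBall z r) ∧
      SurjOn (g a) (Metric.closedBall z r) (Metric.ball z (r / 4)) ∧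
      ∀ w ∈ Metric.closedBall z r, Q a w := by
  let E := EuclideanSpace ℝ (Fin d)
  have h1 : ∀ᶠ p in l ×ˢ 𝓝 z, ‖fderiv ℝ (g p.1) p.2 - ContinuousLinearMap.id ℝ E‖ ≤ 1 / 2 := by
    have h2 := h.tendsto_fderiv
    rw [fderiv_id] at h2
    filter_upwards [h2 (Metric.closedBall_mem_nhds _ (by norm_num : (0 : ℝ) < 1 / 2))] with p hp
    exact mem_closedBall_iff_norm.1 hp
  obtain ⟨pa, hpa, px, hpx, h2⟩ := eventually_prod_iff.1 ((h.eventually_mdiff.and h1).and hQ)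
  obtain ⟨r, hr, hrx⟩ := Metric.nhds_basis_closedBall.mem_iff.1 hpx
  have h3 : ∀ᶠ a in l, g a z ∈ Metric.ball z (r / 4) := by
    have h4 : Tendsto (fun a => (a, z)) l (l ×ˢ 𝓝 z) := tendsto_id.prodMk tendsto_const_pure |>.mono_right
      (Filter.prod_mono le_rfl (pure_le_nhds z))
    exact (h.tendsto.comp h4) (Metric.ball_mem_nhds z (by positivity))
  refine ⟨r, hr, ?_⟩
  filter_upwards [hpa, h3] with a ha hga
  have h4 : ∀ w ∈ Metric.closedBall z r, DifferentiableAt ℝ (g a) w ∧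
      ‖fderiv ℝ (g a) w - ContinuousLinearMap.id ℝ E‖ ≤ 1 / 2 := fun w hw =>
    ⟨(h2 ha (hrx hw)).1.1.differentiableAt, (h2 ha (hrx hw)).1.2⟩
  -- With derivative within `1 / 2` of the identity, `g a` is injective on the ball of radius `r`
  -- and its image contains the ball of radius `r / 2` about `g a z`. As `g a z` is within `r / 4`
  -- of `z`, the ball of radius `r / 4` about `z` is covered.
  have h5 : ApproximatesLinearOn (g a) (ContinuousLinearMap.id ℝ E) (Metric.closedBall z r)
      (1 / 2 : NNReal) := fun x hx y hy => by
    have := (convex_closedBall z r).norm_image_sub_le_of_norm_fderiv_le'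
      (fun w hw => (h4 w hw).1) (fun w hw => (h4 w hw).2) hy hx
    simpa using this
  refine ⟨fun x hx y hy hxy => ?_, fun w hw => ?_, fun w hw => (h2 ha (hrx hw)).2⟩
  · have h6 := h5 x hx y hy
    rw [hxy, sub_self, zero_sub, norm_neg] at h6
    rw [map_sub] at h6
    have h7 : ‖x - y‖ ≤ ((1 / 2 : NNReal) : ℝ) * ‖x - y‖ := h6
    rw [show ((1 / 2 : NNReal) : ℝ) = 1 / 2 by norm_num] at h7
    exact sub_eq_zero.1 (norm_le_zero_iff.1 (by linarith))
  · let R : (ContinuousLinearMap.id ℝ E).NonlinearRightInverse :=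
      ⟨id, 1, fun y => by simp, fun y => rfl⟩
    refine h5.surjOn_closedBall_of_nonlinearRightInverse R hr.le subset_rfl ?_
    have h6 : ((R.nnnorm : ℝ)⁻¹ - ((1 / 2 : NNReal) : ℝ)) * r = r / 2 := by
      simp only [R]; norm_num; ring
    rw [h6, Metric.mem_closedBall]
    have h7 := dist_triangle_right w (g a z) z
    rw [Metric.mem_ball] at hw hga
    linarith

/-- A right inverse of a family that converges to the identity in the `C¹` sense converges to the
identity in the `C¹` sense as soon as it does so in the `C⁰` sense. -/
lemma TendstoC1At.of_rightInverse
    (h : TendstoC1At 𝓘(ℝ, EuclideanSpace ℝ (Fin d)) 𝓘(ℝ, EuclideanSpace ℝ (Fin d)) l g id z)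
    {k : A → EuclideanSpace ℝ (Fin d) → EuclideanSpace ℝ (Fin d)}
    (hk : Tendsto (fun p : A × EuclideanSpace ℝ (Fin d) => k p.1 p.2) (l ×ˢ 𝓝 z) (𝓝 z))
    (hkd : ∀ᶠ p in l ×ˢ 𝓝 z, DifferentiableAt ℝ (k p.1) p.2)
    (hgk : ∀ᶠ p in l ×ˢ 𝓝 z, g p.1 (k p.1 p.2) = p.2) :
    TendstoC1At 𝓘(ℝ, EuclideanSpace ℝ (Fin d)) 𝓘(ℝ, EuclideanSpace ℝ (Fin d)) l k id z := by
  let E := EuclideanSpace ℝ (Fin d)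
  refine .of_tendsto_fderiv hkd differentiableAt_id hk ?_
  have h1 : Tendsto (fun p : A × E => (p.1, k p.1 p.2)) (l ×ˢ 𝓝 z) (l ×ˢ 𝓝 z) :=
    tendsto_fst.prodMk hk
  have h2 : Tendsto (fun p : A × E => fderiv ℝ (g p.1) (k p.1 p.2)) (l ×ˢ 𝓝 z) (𝓝 1) := by
    have h3 := h.tendsto_fderiv
    rw [fderiv_id] at h3
    exact h3.comp h1
  -- By the chain rule `dk` is the inverse of `dg` at the image point, and inversion is continuous
  -- at the identity.
  have h3 : Tendsto (fun p : A × E => Ring.inverse (fderiv ℝ (g p.1) (k p.1 p.2)))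
      (l ×ˢ 𝓝 z) (𝓝 1) := by
    have h4 := (NormedRing.inverse_continuousAt (1 : (E →L[ℝ] E)ˣ)).tendsto.comp h2
    rwa [Units.val_one, Ring.inverse_one] at h4
  have h4 : ∀ᶠ p in l ×ˢ 𝓝 z, IsUnit (fderiv ℝ (g p.1) (k p.1 p.2)) :=
    h2 (Units.isOpen.mem_nhds (by exact isUnit_one))
  rw [fderiv_id]
  refine Tendsto.congr' ?_ h3
  filter_upwards [h4, hkd, h1.eventually h.eventually_mdiff, eventually_prod_nhds_eventually hgk]
    with p hp hp1 hp2 hp3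
  have h5 : (fderiv ℝ (g p.1) (k p.1 p.2)) * (fderiv ℝ (k p.1) p.2) = 1 := by
    have h6 := (hp2.differentiableAt.hasFDerivAt.comp p.2 hp1.hasFDerivAt).fderiv
    have h7 : fderiv ℝ (g p.1 ∘ k p.1) p.2 = fderiv ℝ id p.2 :=
      Filter.EventuallyEq.fderiv_eq hp3
    rw [fderiv_id, h6] at h7
    exact h7
  rw [← mul_one (Ring.inverse _), ← h5, ← mul_assoc, Ring.inverse_mul_cancel _ hp, one_mul]

end VectorSpace

section Manifold

variable {d : ℕ} {Y : Type*} [TopologicalSpace Y] [ChartedSpace (EuclideanSpace ℝ (Fin d)) Y]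
  [IsManifold (𝓡 d) ∞ Y] {A : Type*} {l : Filter A} {φ : A → Y → Y} {y : Y}

lemma TendstoC1At.inChart (h : TendstoC1At (𝓡 d) (𝓡 d) l φ id y) :
    TendstoC1At 𝓘(ℝ, EuclideanSpace ℝ (Fin d)) 𝓘(ℝ, EuclideanSpace ℝ (Fin d)) l
      (fun a => extChartAt (𝓡 d) y ∘ φ a ∘ (extChartAt (𝓡 d) y).symm) id
      (extChartAt (𝓡 d) y y) := by
  have h1 : (extChartAt (𝓡 d) y).symm (extChartAt (𝓡 d) y y) = y := extChartAt_to_inv y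
  have h2 : TendstoC1At (𝓡 d) (𝓡 d) l φ id ((extChartAt (𝓡 d) y).symm (extChartAt (𝓡 d) y y)) := by
    rwa [h1]
  have h3 : TendstoC1At (𝓡 d) 𝓘(ℝ, EuclideanSpace ℝ (Fin d)) l
      (fun _ => (extChartAt (𝓡 d) y : Y → EuclideanSpace ℝ (Fin d))) (extChartAt (𝓡 d) y)
      (id ((extChartAt (𝓡 d) y).symm (extChartAt (𝓡 d) y y))) :=
    .of_contMDiffAt (contMDiffAt_extChartAt_of_mem
      ((extChartAt (𝓡 d) y).map_target (mem_extChartAt_target y)))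
  have h4 : TendstoC1At 𝓘(ℝ, EuclideanSpace ℝ (Fin d)) (𝓡 d) l
      (fun _ => ((extChartAt (𝓡 d) y).symm : EuclideanSpace ℝ (Fin d) → Y))
      (extChartAt (𝓡 d) y).symm (extChartAt (𝓡 d) y y) :=
    .of_contMDiffAt (contMDiffAt_extChartAt_symm_of_mem (mem_extChartAt_target y))
  have h5 := TendstoC1At.comp (f := id ∘ (extChartAt (𝓡 d) y).symm) h3 (h2.comp h4)
  refine h5.congr (Eventually.of_forall fun _ => rfl) ?_
  filter_upwards [extChartAt_target_mem_nhds (I := 𝓡 d) y] with z hz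
  exact ((extChartAt (𝓡 d) y).right_inv hz).symm

/-- Used twice: for surjectivity and, since `O` is arbitrary, for the `C⁰` convergence of the
inverses. -/
lemma TendstoC1At.eventually_exists_preimage (h : TendstoC1At (𝓡 d) (𝓡 d) l φ id y)
    {O : Set Y} (hO : O ∈ 𝓝 y) : ∀ᶠ p in l ×ˢ 𝓝 y, ∃ x ∈ O, φ p.1 x = p.2 := by
  let e := extChartAt (𝓡 d) y
  have h1 : (𝓝 (e y)).Tendsto e.symm (𝓝 y) := by
    have := (continuousAt_extChartAt_symm (I := 𝓡 d) y).tendsto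
    rwa [extChartAt_to_inv] at this
  have h2 : ∀ᶠ p in l ×ˢ 𝓝 (e y), e.symm p.2 ∈ O ∧ φ p.1 (e.symm p.2) ∈ e.source :=
    Eventually.and ((h1.comp tendsto_snd) hO) ((h.tendsto.comp
      (tendsto_fst.prodMk (h1.comp tendsto_snd))) (extChartAt_source_mem_nhds (I := 𝓡 d) y))
  obtain ⟨r, hr, h3⟩ := h.inChart.exists_closedBall (Q := fun a w => e.symm w ∈ O ∧
    φ a (e.symm w) ∈ e.source) h2
  have h4 : ∀ᶠ w in 𝓝 y, w ∈ e.source ∧ e w ∈ Metric.ball (e y) (r / 4) :=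
    Eventually.and (extChartAt_source_mem_nhds (I := 𝓡 d) y)
      ((continuousAt_extChartAt (I := 𝓡 d) y) (Metric.ball_mem_nhds _ (by positivity)))
  refine eventually_prod_iff.2 ⟨_, h3, _, h4, fun {a} ha {w} hw => ?_⟩
  obtain ⟨z, hz, hzw⟩ := ha.2.1 hw.2
  exact ⟨e.symm z, (ha.2.2 z hz).1, e.injOn (ha.2.2 z hz).2 hw.1 hzw⟩

lemma TendstoC1At.exists_eventually_injOn (h : TendstoC1At (𝓡 d) (𝓡 d) l φ id y) :
    ∃ O ∈ 𝓝 y, ∀ᶠ a in l, InjOn (φ a) O := by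
  let e := extChartAt (𝓡 d) y
  obtain ⟨r, hr, h3⟩ := h.inChart.exists_closedBall (Q := fun _ _ => True)
    (Eventually.of_forall fun _ => trivial)
  refine ⟨e.source ∩ e ⁻¹' Metric.closedBall (e y) r, inter_mem (extChartAt_source_mem_nhds y)
    ((continuousAt_extChartAt y) (Metric.closedBall_mem_nhds _ hr)), ?_⟩
  filter_upwards [h3] with a ha x hx x' hx' hxx
  refine e.injOn hx.1 hx'.1 (ha.1 hx.2 hx'.2 ?_)
  have h4 : e.symm (e x) = x := e.left_inv hx.1
  have h5 : e.symm (e x') = x' := e.left_inv hx'.1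
  change e (φ a (e.symm (e x))) = e (φ a (e.symm (e x')))
  rw [h4, h5, hxx]

/-- In the chart the derivative is close to the identity, hence invertible, and the chain rule
factors it through the differential of `φ p.1`. -/
lemma TendstoC1At.eventually_injective_mfderiv (h : TendstoC1At (𝓡 d) (𝓡 d) l φ id y) :
    ∀ᶠ p in l ×ˢ 𝓝 y, Function.Injective (mfderiv (𝓡 d) (𝓡 d) (φ p.1) p.2) := by
  let E := EuclideanSpace ℝ (Fin d)
  let e := extChartAt (𝓡 d) y
  have h1 : ∀ᶠ p in l ×ˢ 𝓝 (e y), IsUnit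
      (fderiv ℝ ((e : Y → E) ∘ φ p.1 ∘ e.symm) p.2 : E →L[ℝ] E) := by
    have h2 := h.inChart.tendsto_fderiv
    rw [fderiv_id] at h2
    exact h2 (Units.isOpen.mem_nhds (by exact isUnit_one))
  have h2 : Tendsto (fun p : A × Y => (p.1, e p.2)) (l ×ˢ 𝓝 y) (l ×ˢ 𝓝 (e y)) :=
    tendsto_id.prodMap (continuousAt_extChartAt (I := 𝓡 d) y)
  filter_upwards [h2.eventually h1, h.eventually_mdiff,
    h.tendsto (extChartAt_source_mem_nhds (I := 𝓡 d) y), tendsto_snd.eventually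
    (extChartAt_source_mem_nhds (I := 𝓡 d) y : ∀ᶠ w in 𝓝 y, w ∈ e.source)] with p hp hp1 hp2 hp3
  have h3 : e.symm (e p.2) = p.2 := e.left_inv hp3
  let S : E →L[ℝ] E := mfderiv (𝓡 d) (𝓡 d) e.symm (e p.2)
  let T : E →L[ℝ] E := mfderiv (𝓡 d) (𝓡 d) (φ p.1) p.2
  let R : E →L[ℝ] E := mfderiv (𝓡 d) (𝓡 d) e (φ p.1 p.2)
  have h4 : (fderiv ℝ ((e : Y → E) ∘ φ p.1 ∘ e.symm) (e p.2) : E →L[ℝ] E) = R ∘L (T ∘L S) := by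
    have h5 : HasMFDerivAt (𝓡 d) (𝓡 d) e.symm (e p.2) S :=
      ((contMDiffAt_extChartAt_symm_of_mem (e.map_source hp3)).mdifferentiableAt
        (by simp)).hasMFDerivAt
    have h6 : HasMFDerivAt (𝓡 d) (𝓡 d) (φ p.1) (e.symm (e p.2)) T := by
      rw [h3]; exact hp1.hasMFDerivAt
    have h7 : HasMFDerivAt (𝓡 d) (𝓡 d) e (φ p.1 (e.symm (e p.2))) R := by
      rw [h3]; exact ((contMDiffAt_extChartAt_of_mem hp2).mdifferentiableAt
        (by simp)).hasMFDerivAt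
    exact mfderiv_eq_fderiv.symm.trans (h7.comp (e p.2) (h6.comp (e p.2) h5)).mfderiv
  rw [h4] at hp
  have h5 : Function.Injective (R ∘ T ∘ S) := by
    obtain ⟨u, hu⟩ := hp
    have h6 : Function.LeftInverse (↑u⁻¹ : E →L[ℝ] E) (R ∘ T ∘ S) := fun v => by
      have := congrArg (fun L : E →L[ℝ] E => L v) (u.inv_mul)
      rw [hu] at this
      exact this
    exact h6.injective
  have h6 : Function.Surjective S :=
    LinearMap.injective_iff_surjective (f := S.toLinearMap).1 h5.of_comp.of_comp
  have h7 : Function.Injective T := by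
    intro v w hvw
    obtain ⟨v, rfl⟩ := h6 v
    obtain ⟨w, rfl⟩ := h6 w
    exact congrArg S (h5.of_comp hvw)
  exact h7

/-- The inverse of a family of diffeomorphisms converges to the identity in the `C¹` sense when
the family does. -/
lemma TendstoC1At.of_inverse {ψ : A → Y → Y} (h : TendstoC1At (𝓡 d) (𝓡 d) l φ id y)
    (hψ : ∀ᶠ a in l, ContMDiff (𝓡 d) (𝓡 d) ∞ (ψ a) ∧ Function.LeftInverse (ψ a) (φ a) ∧
      Function.RightInverse (ψ a) (φ a)) : TendstoC1At (𝓡 d) (𝓡 d) l ψ id y := by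
  let E := EuclideanSpace ℝ (Fin d)
  let e := extChartAt (𝓡 d) y
  have hψ' : ∀ᶠ p in l ×ˢ 𝓝 y, ContMDiff (𝓡 d) (𝓡 d) ∞ (ψ p.1) ∧
      Function.LeftInverse (ψ p.1) (φ p.1) ∧ Function.RightInverse (ψ p.1) (φ p.1) :=
    tendsto_fst.eventually hψ
  have h1 : Tendsto (fun p : A × Y => ψ p.1 p.2) (l ×ˢ 𝓝 y) (𝓝 y) := fun O hO => by
    change ∀ᶠ p in l ×ˢ 𝓝 y, ψ p.1 p.2 ∈ O
    filter_upwards [h.eventually_exists_preimage hO, hψ'] with p ⟨x, hx, hxp⟩ hp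
    rw [← hxp, hp.2.1]
    exact hx
  have h2 : Tendsto e.symm (𝓝 (e y)) (𝓝 y) := by
    have := (continuousAt_extChartAt_symm (I := 𝓡 d) y).tendsto
    rwa [extChartAt_to_inv] at this
  have h3 : Tendsto (fun p : A × E => (p.1, e.symm p.2)) (l ×ˢ 𝓝 (e y)) (l ×ˢ 𝓝 y) :=
    tendsto_id.prodMap h2
  have hs := extChartAt_source_mem_nhds (I := 𝓡 d) y
  have ht : ∀ᶠ p in l ×ˢ 𝓝 (e y), p.2 ∈ e.target :=
    tendsto_snd.eventually (extChartAt_target_mem_nhds (I := 𝓡 d) y)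
  have h4 := h.inChart.of_rightInverse (k := fun a => (e : Y → E) ∘ ψ a ∘ e.symm)
    ((continuousAt_extChartAt (I := 𝓡 d) y).tendsto.comp (h1.comp h3)) (by
      filter_upwards [h3.eventually hψ', ht, h3.eventually (h1 hs)] with p hp hp1 hp2
      refine MDifferentiableAt.differentiableAt (((contMDiffAt_extChartAt_of_mem hp2).comp p.2
        (hp.1.contMDiffAt.comp p.2 (contMDiffAt_extChartAt_symm_of_mem hp1))).mdifferentiableAt
          (by simp))) (by
      filter_upwards [h3.eventually hψ', ht, h3.eventually (h1 hs)] with p hp hp1 hp2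
      have h5 : e.symm (e (ψ p.1 (e.symm p.2))) = ψ p.1 (e.symm p.2) := e.left_inv hp2
      change e (φ p.1 (e.symm (e (ψ p.1 (e.symm p.2))))) = p.2
      rw [h5, hp.2.2]
      exact e.right_inv hp1)
  have h5 : TendstoC1At (𝓡 d) (𝓡 d) l (fun _ => (e.symm : E → Y)) e.symm (id (e y)) :=
    .of_contMDiffAt (contMDiffAt_extChartAt_symm_of_mem (mem_extChartAt_target y))
  have h6 : TendstoC1At (𝓡 d) 𝓘(ℝ, EuclideanSpace ℝ (Fin d)) l (fun _ => (e : Y → E)) e y :=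
    .of_contMDiffAt (contMDiffAt_extChartAt_of_mem (mem_extChartAt_source y))
  have h7 := TendstoC1At.comp (f := id ∘ (e : Y → E)) h5 (h4.comp h6)
  refine h7.congr ?_ ?_
  · filter_upwards [h1 hs, tendsto_snd.eventually (hs : ∀ᶠ w in 𝓝 y, w ∈ e.source)] with p hp hp1
    have h6 : e.symm (e p.2) = p.2 := e.left_inv hp1
    have h7 : e.symm (e (ψ p.1 p.2)) = ψ p.1 p.2 := e.left_inv hp
    change _ = e.symm (e (ψ p.1 (e.symm (e p.2))))
    rw [h6, h7]
  · filter_upwards [hs] with w hw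
    exact (e.left_inv hw).symm

/-- A family of smooth self-maps of a compact manifold that converges to the identity in the `C¹`
sense eventually consists of diffeomorphisms, whose inverses also converge to the identity. -/
theorem exists_inverse_of_tendstoC1At [CompactSpace Y] [T2Space Y]
    (hφ : ∀ᶠ a in l, ContMDiff (𝓡 d) (𝓡 d) ∞ (φ a))
    (h : ∀ y, TendstoC1At (𝓡 d) (𝓡 d) l φ id y) :
    ∃ ψ : A → Y → Y, (∀ᶠ a in l, ContMDiff (𝓡 d) (𝓡 d) ∞ (ψ a) ∧
      Function.LeftInverse (ψ a) (φ a) ∧ Function.RightInverse (ψ a) (φ a)) ∧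
      ∀ y, TendstoC1At (𝓡 d) (𝓡 d) l ψ id y := by
  rcases isEmpty_or_nonempty Y with hY | hY
  · exact ⟨φ, hφ.mono fun a ha => ⟨ha, hY.elim, hY.elim⟩, hY.elim⟩
  -- Compactness of `Y × Y`: near the diagonal the maps are locally injective with a uniform domain,
  -- and off the diagonal the images of two points stay apart by convergence to the identity.
  have hinj : ∀ᶠ a in l, ∀ p ∈ (univ : Set (Y × Y)), φ a p.1 = φ a p.2 → p.1 = p.2 := by
    refine isCompact_univ.eventually_forall_of_prod fun p _ => ?_
    rcases p with ⟨x, x'⟩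
    by_cases hxx : x = x'
    · subst hxx
      obtain ⟨O, hO, hinj⟩ := (h x).exists_eventually_injOn
      exact eventually_prod_iff.2 ⟨_, hinj, fun p => p ∈ O ×ˢ O, prod_mem_nhds hO hO,
        fun {a} ha {p} hp hpp => ha hp.1 hp.2 hpp⟩
    · have h1 : Tendsto (fun q : A × (Y × Y) => (φ q.1 q.2.1, φ q.1 q.2.2)) (l ×ˢ 𝓝 (x, x'))
          (𝓝 (x, x')) :=
        ((h x).tendsto.comp (tendsto_id.prodMap (continuous_fst.tendsto (x, x')))).prodMk_nhds
          ((h x').tendsto.comp (tendsto_id.prodMap (continuous_snd.tendsto (x, x'))))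
      filter_upwards [h1 ((isOpen_ne_fun continuous_fst continuous_snd).mem_nhds hxx)] with q hq hq'
      exact absurd hq' hq
  have hsurj : ∀ᶠ a in l, ∀ w ∈ (univ : Set Y), ∃ x ∈ (univ : Set Y), φ a x = w :=
    isCompact_univ.eventually_forall_of_prod fun w _ =>
      (h w).eventually_exists_preimage univ_mem
  have hder : ∀ᶠ a in l, ∀ x ∈ (univ : Set Y),
      Function.Injective (mfderiv (𝓡 d) (𝓡 d) (φ a) x) :=
    isCompact_univ.eventually_forall_of_prod fun w _ => (h w).eventually_injective_mfderiv
  let ψ : A → Y → Y := fun a => Function.invFun (φ a)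
  have hψ : ∀ᶠ a in l, ContMDiff (𝓡 d) (𝓡 d) ∞ (ψ a) ∧
      Function.LeftInverse (ψ a) (φ a) ∧ Function.RightInverse (ψ a) (φ a) := by
    filter_upwards [hφ, hinj, hsurj, hder] with a ha hai has had
    have h1 : Function.Injective (φ a) := fun x x' hx => hai (x, x') (mem_univ _) hx
    have h2 : Function.Surjective (φ a) := fun w => (has w (mem_univ _)).imp fun x hx => hx.2
    obtain ⟨e, he, -, hea, hes⟩ := exists_diffeo_of_isCompact (I := 𝓡 d) (J := 𝓡 d) rfl
      isCompact_univ h1.injOn isOpen_univ subset_rfl ha.contMDiffOn had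
    have h3 : ∀ w, w ∈ e.target := fun w => by
      obtain ⟨x, rfl⟩ := h2 w
      rw [← hea]
      exact e.map_source (he (mem_univ x))
    have h4 : ψ a = e.symm := funext fun w => h1 <| by
      rw [Function.rightInverse_invFun h2 w, ← hea, e.right_inv (h3 w)]
    refine ⟨?_, Function.leftInverse_invFun h1, Function.rightInverse_invFun h2⟩
    rw [h4]
    exact contMDiffOn_univ.1 (hes.mono fun w _ => h3 w)
  exact ⟨ψ, hψ, fun y => (h y).of_inverse hψ⟩

end Manifold

lemma locallyCompactSpace_tangentBundle (d : ℕ) (Y : Type*) [TopologicalSpace Y]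
    [ChartedSpace (EuclideanSpace ℝ (Fin d)) Y] [IsManifold (𝓡 d) ∞ Y] :
    LocallyCompactSpace (TangentBundle (𝓡 d) Y) :=
  Manifold.locallyCompact_of_finiteDimensional (𝓡 d).tangent

/-! ### From nearby submanifolds to sections, and back from forms -/

namespace StandardNbhd

variable {m d : ℕ} {M : Type*} [TopologicalSpace M] [ChartedSpace (EuclideanSpace ℝ (Fin m)) M]
  [IsManifold (𝓡 m) ∞ M] {Y : Type*} [TopologicalSpace Y]
  [ChartedSpace (EuclideanSpace ℝ (Fin d)) Y] [IsManifold (𝓡 d) ∞ Y]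
  {α : (x : M) → CotangentAt m x} {ι : Y → M}
  {L : (y : Y) → Submodule ℝ (TangentSpace (𝓡 d) y)}
  {hLF : ∀ y : Y, IsCompl (charFoliation (d := d) α ι y) (L y)} {N : StandardNbhd α ι hLF}
  {s s' : (y : Y) → (charFoliation (d := d) α ι y →L[ℝ] ℝ)}
  {ν : (y : Y) → TangentSpace (𝓡 d) y}

lemma contMDiffAt_formAt (ρ : SmoothRetract d Y)
    (hlam : IsSmoothForm (pullbackForm (d := d) α ι)) {u : M} (hu : u ∈ N.source) :
    ContMDiffAt (𝓡 m) (cotModel d) ∞ N.formAt u := by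
  have h1 := ρ.contMDiffWithinAt_smul_add (s := univ) (p := u) (b := N.proj)
    (ξ := fun u => pullbackForm (d := d) α ι (N.proj u))
    (η := fun u => extendAt hLF (N.proj u) (N.toFun u).2) (f := fun _ => 1) (g := fun _ => -1)
    ((hlam _).comp u (N.contMDiffAt_proj hu)).contMDiffWithinAt
    (N.contMDiffOn_toFun.contMDiffAt (N.open_source.mem_nhds hu)).contMDiffWithinAt
    contMDiffWithinAt_const contMDiffWithinAt_const
  refine (contMDiffWithinAt_univ.1 h1).congr_of_eventuallyEq (Eventually.of_forall fun u => ?_)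
  refine SmoothRetract.cotangentBundle_ext rfl fun v => ?_
  change pullbackForm (d := d) α ι (N.proj u) v - extendAt hLF (N.proj u) (N.toFun u).2 v =
    1 * pullbackForm (d := d) α ι (N.proj u) v + -1 * extendAt hLF (N.proj u) (N.toFun u).2 v
  ring

lemma formAt_graphMap (hs : s ∈ N.sections) (y : Y) : N.formAt (N.graphMap s y) =
    formMap (fun y => pullbackForm (d := d) α ι y - barForm hLF s y) y := by
  have h4 : ∀ f : LeafCotangent (charFoliation (d := d) α ι), f = ⟨y, s y⟩ →
      (⟨f.1, pullbackForm (d := d) α ι f.1 - extendAt hLF f.1 f.2⟩ : CotangentBundle d Y) =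
        formMap (fun y => pullbackForm (d := d) α ι y - barForm hLF s y) y := by
    rintro _ rfl; rfl
  exact h4 _ (toFun_graphMap hs y)

lemma sub_barForm_mem_foliationForms (ρ : SmoothRetract d Y)
    (hlam : IsSmoothForm (pullbackForm (d := d) α ι)) (hνL : ∀ y, ν y ∈ L y)
    (hν : ∀ y, pullbackForm (d := d) α ι y (ν y) = 1) (hs : s ∈ N.sections)
    (hf : IsCodimOneFoliation (N.sectionField s)) :
    (fun y => pullbackForm (d := d) α ι y - barForm hLF s y) ∈ foliationForms d Y := by
  refine ⟨fun y => ?_, fun y hy => ?_, N.sectionField_eq_kerField s ▸ hf⟩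
  · have h1 : formMap (fun y => pullbackForm (d := d) α ι y - barForm hLF s y) =
      N.formAt ∘ N.graphMap s := funext fun y => (formAt_graphMap hs y).symm
    rw [h1]
    exact (contMDiffAt_formAt ρ hlam (graphMap_mem hs y)).comp y (contMDiff_graphMap hs y)
  · refine barForm_sub_ne_zero (hLF := hLF) s hνL hν y ?_
    rw [← neg_sub]
    exact neg_eq_zero.2 hy

/-- A family of submanifolds that converges to `ι(Y)` in the `C¹` sense consists eventually of
graphs, and the corresponding one-forms converge to `λ`. -/
theorem exists_sections_of_tendstoC1At [CompactSpace Y] [T2Space Y] (ρ : SmoothRetract d Y)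
    (hlam : IsSmoothForm (pullbackForm (d := d) α ι)) (N : StandardNbhd α ι hLF) {A : Type*} {l : Filter A}
    {J : A → Y → M} (hJ : ∀ᶠ a in l, ContMDiff (𝓡 d) (𝓡 m) ∞ (J a))
    (hJι : ∀ y, TendstoC1At (𝓡 d) (𝓡 m) l J ι y) :
    ∃ s : A → (y : Y) → (charFoliation (d := d) α ι y →L[ℝ] ℝ),
      (∀ᶠ a in l, s a ∈ N.sections ∧ range (J a) = N.graph (s a)) ∧
      ∀ y, TendstoC1At (𝓡 d) (cotModel d) l
        (fun a => formMap fun y => pullbackForm (d := d) α ι y - barForm hLF (s a) y)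
        (formMap (pullbackForm (d := d) α ι)) y := by
  have hJs : ∀ᶠ a in l, ∀ y ∈ univ, J a y ∈ N.source :=
    isCompact_univ.eventually_forall_of_prod fun y _ =>
      (hJι y).tendsto (N.open_source.mem_nhds (N.mem_source y))
  have hproj : ∀ y, TendstoC1At (𝓡 m) (𝓡 d) l (fun _ => N.proj) N.proj (ι y) := fun y =>
    .of_contMDiffAt (N.contMDiffAt_proj (N.mem_source y))
  have hprojι : N.proj ∘ ι = id := funext fun y => congrArg Sigma.fst (N.toFun_ι y)
  -- `J a` need not project identically to `Y`. Its projection tends to the identity, and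
  -- precomposition with the inverse of the projection corrects the parametrization without losing
  -- `C¹` convergence.
  have hφ : ∀ y, TendstoC1At (𝓡 d) (𝓡 d) l (fun a => N.proj ∘ J a) id y := fun y => by
    rw [← hprojι]; exact (hproj y).comp (hJι y)
  obtain ⟨ψ, hψ, hψid⟩ := exists_inverse_of_tendstoC1At (by
    filter_upwards [hJ, hJs] with a ha has y
    exact (N.contMDiffAt_proj (has y (mem_univ y))).comp y (ha y)) hφ
  have hk : ∀ y, TendstoC1At (𝓡 d) (𝓡 m) l (fun a => J a ∘ ψ a) ι y := fun y =>
    TendstoC1At.comp (f := id) (hJι y) (hψid y)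
  have hex : ∀ a, ∃ s : (y : Y) → (charFoliation (d := d) α ι y →L[ℝ] ℝ),
      (ContMDiff (𝓡 d) (𝓡 m) ∞ (J a) → (∀ y ∈ univ, J a y ∈ N.source) →
        (ContMDiff (𝓡 d) (𝓡 d) ∞ (ψ a) ∧ Function.LeftInverse (ψ a) (N.proj ∘ J a) ∧
          Function.RightInverse (ψ a) (N.proj ∘ J a)) →
      s ∈ N.sections ∧ N.graphMap s = J a ∘ ψ a) := fun a => by
    by_cases h : ContMDiff (𝓡 d) (𝓡 m) ∞ (J a) ∧ (∀ y ∈ univ, J a y ∈ N.source) ∧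
        (ContMDiff (𝓡 d) (𝓡 d) ∞ (ψ a) ∧ Function.LeftInverse (ψ a) (N.proj ∘ J a) ∧
          Function.RightInverse (ψ a) (N.proj ∘ J a))
    · obtain ⟨s, hs, hsk, -⟩ := N.exists_section_of_proj_eq (h.1.comp h.2.2.1)
        (fun y => h.2.1 _ (mem_univ _)) fun y => h.2.2.2.2 y
      exact ⟨s, fun _ _ _ => ⟨hs, hsk⟩⟩
    · exact ⟨0, fun h1 h2 h3 => absurd ⟨h1, h2, h3⟩ h⟩
  choose s hs using hex
  have hs' : ∀ᶠ a in l, s a ∈ N.sections ∧ N.graphMap (s a) = J a ∘ ψ a := by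
    filter_upwards [hJ, hJs, hψ] with a h1 h2 h3 using hs a h1 h2 h3
  refine ⟨s, ?_, fun y => ?_⟩
  · filter_upwards [hs', hψ] with a ha hψa
    refine ⟨ha.1, ?_⟩
    change _ = range (N.graphMap (s a))
    rw [ha.2, hψa.2.1.surjective.range_comp]
  -- On the graph of `s` the fixed smooth map `N.formAt` gives `λ - s̄`, so the forms inherit the
  -- convergence of the graphs.
  · have h1 : TendstoC1At (𝓡 m) (cotModel d) l (fun _ => N.formAt) N.formAt (ι y) :=
      .of_contMDiffAt (contMDiffAt_formAt ρ hlam (N.mem_source y))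
    refine (h1.comp (hk y)).congr ?_ (Eventually.of_forall fun y => (N.formAt_ι y).symm)
    filter_upwards [tendsto_fst.eventually hs'] with p hp
    rw [← formAt_graphMap hp.1, hp.2]
    rfl

/-! ### From one-forms to graphs -/

/-- The leafwise covector `e` such that `ē - λ` is proportional to `ξ`. -/
def leafOfForm (α : (x : M) → CotangentAt m x) (ι : Y → M) (ν : (y : Y) → TangentSpace (𝓡 d) y)
    (ξ : CotangentBundle d Y) : LeafCotangent (charFoliation (d := d) α ι) :=
  restrictLeaf (charFoliation (d := d) α ι) ⟨ξ.1, (-(ξ.2 (ν ξ.1))⁻¹) • ξ.2⟩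

/-- The leafwise one-form `s` such that `s̄ - λ` is proportional to `μ`. -/
def sectionOfForm (α : (x : M) → CotangentAt m x) (ι : Y → M) (ν : (y : Y) → TangentSpace (𝓡 d) y)
    (μ : (y : Y) → CotangentAt d y) (y : Y) : charFoliation (d := d) α ι y →L[ℝ] ℝ :=
  (leafOfForm α ι ν (formMap μ y)).2

/-- The form `-μ / μ(ν)` takes on `ν` the value `-1`, as `s̄ - λ` does, and has the kernel of `μ`.
-/
lemma barForm_sectionOfForm (hνL : ∀ y, ν y ∈ L y)
    (hν : ∀ y, pullbackForm (d := d) α ι y (ν y) = 1) {μ : (y : Y) → CotangentAt d y} {y : Y}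
    (hμ : μ y (ν y) ≠ 0) : barForm hLF (sectionOfForm α ι ν μ) y =
      pullbackForm (d := d) α ι y - (μ y (ν y))⁻¹ • μ y := by
  have h1 := extendAt_restrict hLF hνL hν ((-(μ y (ν y))⁻¹) • μ y)
  refine h1.trans (ContinuousLinearMap.ext fun v => ?_)
  change -(μ y (ν y))⁻¹ * μ y v - -(μ y (ν y))⁻¹ * μ y (ν y) * pullbackForm (d := d) α ι y v =
    pullbackForm (d := d) α ι y v - (μ y (ν y))⁻¹ * μ y v
  rw [neg_mul _ (μ y (ν y)), inv_mul_cancel₀ hμ]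
  ring

lemma sectionField_sectionOfForm (hνL : ∀ y, ν y ∈ L y)
    (hν : ∀ y, pullbackForm (d := d) α ι y (ν y) = 1) {μ : (y : Y) → CotangentAt d y}
    (hμ : ∀ y, μ y (ν y) ≠ 0) : N.sectionField (sectionOfForm α ι ν μ) = kerField μ := by
  refine funext fun y => Submodule.ext fun v => ?_
  change barForm hLF (sectionOfForm α ι ν μ) y v - pullbackForm (d := d) α ι y v = 0 ↔ μ y v = 0
  rw [barForm_sectionOfForm hνL hν (hμ y)]
  change pullbackForm (d := d) α ι y v - (μ y (ν y))⁻¹ * μ y v - pullbackForm (d := d) α ι y v = 0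
    ↔ _
  rw [sub_sub_cancel_left, neg_eq_zero, mul_eq_zero, or_iff_right (inv_ne_zero (hμ y))]

/-- A section is determined by any form with the same kernel. -/
lemma sectionOfForm_eq (hνL : ∀ y, ν y ∈ L y)
    (hν : ∀ y, pullbackForm (d := d) α ι y (ν y) = 1) {μ : (y : Y) → CotangentAt d y}
    (h : kerField μ = N.sectionField s) (hμ : ∀ y, μ y ≠ 0) : sectionOfForm α ι ν μ = s := by
  refine barForm_injective (hLF := hLF) (funext fun y => ?_)
  have h1 := eq_smul_of_kerField_eq hνL hν h hμ y
  rw [h1.2, barForm_sectionOfForm hνL hν h1.1]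

lemma contMDiffAt_extendLeaf_leafOfForm (ρ : SmoothRetract d Y)
    (hlam : IsSmoothForm (pullbackForm (d := d) α ι))
    (hνs : ContMDiff (𝓡 d) (𝓡 d).tangent ∞ (fun y => (⟨y, ν y⟩ : TangentBundle (𝓡 d) Y)))
    (hνL : ∀ y, ν y ∈ L y) (hν : ∀ y, pullbackForm (d := d) α ι y (ν y) = 1)
    {ξ : CotangentBundle d Y} (hξ : ξ.2 (ν ξ.1) ≠ 0) :
    ContMDiffAt (cotModel d) (cotModel d) ∞ (fun ξ => extendLeaf hLF (leafOfForm α ι ν ξ)) ξ := by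
  have hproj : ContMDiffAt (cotModel d) (𝓡 d) ∞ (fun ξ : CotangentBundle d Y => ξ.1) ξ :=
    contMDiff_proj (fun x : Y => CotangentAt d x) ξ
  have h1 : ContMDiffAt (cotModel d) 𝓘(ℝ, ℝ) ∞
      (fun ξ : CotangentBundle d Y => ξ.2 (ν ξ.1)) ξ :=
    contMDiffAt_cotangent_apply (b := fun ξ : CotangentBundle d Y => ξ.1)
      (ξ := fun ξ => ξ.2) contMDiffAt_id ((hνs _).comp ξ hproj)
  have h2 : ContMDiffAt (cotModel d) 𝓘(ℝ, ℝ) ∞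
      (fun ξ : CotangentBundle d Y => -(ξ.2 (ν ξ.1))⁻¹) ξ :=
    ContMDiffAt.comp (I' := 𝓘(ℝ, ℝ)) (g := fun x : ℝ => -x⁻¹) ξ
      ((contDiffAt_inv ℝ hξ).neg.contMDiffAt) h1
  have h3 := ρ.contMDiffWithinAt_smul_add (s := univ) (b := fun ξ : CotangentBundle d Y => ξ.1)
    (ξ := fun ξ => ξ.2) (η := fun ξ => ξ.2) (g := fun _ => 0) (f := fun ξ => -(ξ.2 (ν ξ.1))⁻¹)
    contMDiffAt_id.contMDiffWithinAt contMDiffAt_id.contMDiffWithinAt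
    h2.contMDiffWithinAt contMDiffWithinAt_const
  have h4 : ContMDiffAt (cotModel d) (cotModel d) ∞ (fun ξ : CotangentBundle d Y =>
      (⟨ξ.1, (-(ξ.2 (ν ξ.1))⁻¹) • ξ.2⟩ : CotangentBundle d Y)) ξ := by
    refine (contMDiffWithinAt_univ.1 h3).congr_of_eventuallyEq (Eventually.of_forall fun ξ => ?_)
    refine SmoothRetract.cotangentBundle_ext rfl fun v => ?_
    change -(ξ.2 (ν ξ.1))⁻¹ * ξ.2 v = -(ξ.2 (ν ξ.1))⁻¹ * ξ.2 v + 0 * ξ.2 v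
    ring
  exact (ρ.contMDiff_extendLeaf_restrictLeaf hLF hlam hνs hνL hν _).comp ξ h4

/-- The covectors on `Y` that correspond to points of the standard neighborhood. -/
def goodForms (N : StandardNbhd α ι hLF) (ν : (y : Y) → TangentSpace (𝓡 d) y) :
    Set (CotangentBundle d Y) :=
  {ξ | ξ.2 (ν ξ.1) ≠ 0 ∧ leafOfForm α ι ν ξ ∈ N.target}

lemma contMDiffAt_invFun_leafOfForm (ρ : SmoothRetract d Y)
    (hlam : IsSmoothForm (pullbackForm (d := d) α ι))
    (hνs : ContMDiff (𝓡 d) (𝓡 d).tangent ∞ (fun y => (⟨y, ν y⟩ : TangentBundle (𝓡 d) Y)))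
    (hνL : ∀ y, ν y ∈ L y) (hν : ∀ y, pullbackForm (d := d) α ι y (ν y) = 1)
    {ξ : CotangentBundle d Y} (hξ : ξ ∈ N.goodForms ν) :
    ContMDiffAt (cotModel d) (𝓡 m) ∞ (fun ξ => N.invFun (leafOfForm α ι ν ξ)) ξ :=
  contMDiffWithinAt_univ.1 (N.contMDiffWithinAt_invFun (contMDiffWithinAt_univ.2
    (contMDiffAt_extendLeaf_leafOfForm ρ hlam hνs hνL hν hξ.1)) hξ.2)

/-- The condition on a form to come from a section of the neighborhood is open in its pointwise
values and involves no derivatives. This is why `C⁰`-closeness suffices. -/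
lemma goodForms_mem_nhds (ρ : SmoothRetract d Y)
    (hlam : IsSmoothForm (pullbackForm (d := d) α ι))
    (hνs : ContMDiff (𝓡 d) (𝓡 d).tangent ∞ (fun y => (⟨y, ν y⟩ : TangentBundle (𝓡 d) Y)))
    (hνL : ∀ y, ν y ∈ L y) (hν : ∀ y, pullbackForm (d := d) α ι y (ν y) = 1)
    {ξ : CotangentBundle d Y} (hξ : ξ ∈ N.goodForms ν) : N.goodForms ν ∈ 𝓝 ξ := by
  have h1 : ContMDiffAt (cotModel d) 𝓘(ℝ, ℝ) ∞
      (fun ξ : CotangentBundle d Y => ξ.2 (ν ξ.1)) ξ :=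
    contMDiffAt_cotangent_apply (b := fun ξ : CotangentBundle d Y => ξ.1)
      (ξ := fun ξ => ξ.2) contMDiffAt_id
      ((hνs _).comp ξ (contMDiff_proj (fun x : Y => CotangentAt d x) ξ))
  have h2 := (contMDiffAt_extendLeaf_leafOfForm (hLF := hLF) ρ hlam hνs hνL hν hξ.1).continuousAt
  filter_upwards [h1.continuousAt.eventually_ne hξ.1, h2.preimage_mem_nhds
    (N.open_target.mem_nhds (by rw [mem_preimage, restrictLeaf_extendLeaf]; exact hξ.2))]
    with ξ' h3 h4
  rw [mem_preimage, mem_preimage, restrictLeaf_extendLeaf] at h4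
  exact ⟨h3, h4⟩

lemma leafOfForm_formMap_pullbackForm (y : Y) :
    leafOfForm α ι ν (formMap (pullbackForm (d := d) α ι) y) = ⟨y, 0⟩ :=
  Sigma.ext rfl (heq_of_eq (ContinuousLinearMap.ext fun (v : charFoliation (d := d) α ι y) => by
    have h1 : pullbackForm (d := d) α ι y v = 0 := v.2
    change -(pullbackForm (d := d) α ι y (ν y))⁻¹ * pullbackForm (d := d) α ι y v = 0
    rw [h1, mul_zero]))

lemma formMap_mem_goodForms (hν : ∀ y, pullbackForm (d := d) α ι y (ν y) = 1) (y : Y) :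
    formMap (pullbackForm (d := d) α ι) y ∈ N.goodForms ν := by
  refine ⟨?_, ?_⟩
  · change pullbackForm (d := d) α ι y (ν y) ≠ 0
    rw [hν]; exact one_ne_zero
  · rw [leafOfForm_formMap_pullbackForm]; exact N.zero_mem_target y

lemma sectionOfForm_mem_sections (ρ : SmoothRetract d Y)
    (hlam : IsSmoothForm (pullbackForm (d := d) α ι))
    (hνs : ContMDiff (𝓡 d) (𝓡 d).tangent ∞ (fun y => (⟨y, ν y⟩ : TangentBundle (𝓡 d) Y)))
    (hνL : ∀ y, ν y ∈ L y) (hν : ∀ y, pullbackForm (d := d) α ι y (ν y) = 1)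
    {μ : (y : Y) → CotangentAt d y} (hμ : IsSmoothForm μ) (h : ∀ y, formMap μ y ∈ N.goodForms ν) :
    sectionOfForm α ι ν μ ∈ N.sections :=
  ⟨fun y => (contMDiffAt_extendLeaf_leafOfForm (hLF := hLF) ρ hlam hνs hνL hν (h y).1).comp y (hμ y),
    fun y => (h y).2⟩

lemma formMap_mem_goodForms_of_kerField_eq (hνL : ∀ y, ν y ∈ L y)
    (hν : ∀ y, pullbackForm (d := d) α ι y (ν y) = 1) {μ : (y : Y) → CotangentAt d y}
    (hs : s ∈ N.sections) (h : kerField μ = N.sectionField s) (hμ : ∀ y, μ y ≠ 0) (y : Y) :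
    formMap μ y ∈ N.goodForms ν := by
  refine ⟨(eq_smul_of_kerField_eq hνL hν h hμ y).1, ?_⟩
  have h1 := hs.2 y
  rw [← sectionOfForm_eq hνL hν h hμ] at h1
  exact h1

end StandardNbhd

/-- Membership in the `C⁰` neighborhood of a continuous form can be tested by an open set of
covectors. -/
lemma exists_isOpen_of_mem_nhdsC0 {X Z : Type*} [TopologicalSpace X] [T2Space X]
    [TopologicalSpace Z] {f : X → Z} {q : Z → X} (hq : Continuous q) (hf : ∀ x, q (f x) = x)
    {V : Set (X → Z)} (hV : V ∈ nhdsC0 f) : ∃ O : Set Z, IsOpen O ∧ (∀ x, f x ∈ O) ∧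
      ∀ g : X → Z, (∀ x, q (g x) = x) → (∀ x, g x ∈ O) → g ∈ V := by
  -- The sets with the required property form a filter, so only the generating neighborhoods have to
  -- be examined.
  let G : Filter (X → Z) :=
    { sets := {V | ∃ O : Set Z, IsOpen O ∧ (∀ x, f x ∈ O) ∧
        ∀ g : X → Z, (∀ x, q (g x) = x) → (∀ x, g x ∈ O) → g ∈ V}
      univ_sets := ⟨univ, isOpen_univ, fun _ => mem_univ _, fun _ _ _ => mem_univ _⟩
      sets_of_superset := fun ⟨O, h1, h2, h3⟩ h => ⟨O, h1, h2, fun g hg hgO => h (h3 g hg hgO)⟩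
      inter_sets := fun ⟨O, h1, h2, h3⟩ ⟨O', h1', h2', h3'⟩ =>
        ⟨O ∩ O', h1.inter h1', fun x => ⟨h2 x, h2' x⟩, fun g hg hgO =>
          ⟨h3 g hg fun x => (hgO x).1, h3' g hg fun x => (hgO x).2⟩⟩ }
  have hG : G ≤ nhdsC0 f := by
    -- A constraint over `K` becomes an open condition on values: points of `Z` outside the fibers
    -- over `K` are all allowed. A section `g` over `K` has its values in those fibers and must
    -- therefore land in `O`.
    refine le_iInf fun K => le_iInf fun hK => le_iInf fun O => le_iInf fun hO => le_iInf fun hKO =>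
      le_principal_iff.2 ⟨q ⁻¹' Kᶜ ∪ O, (hK.isClosed.isOpen_compl.preimage hq).union hO,
        fun x => ?_, fun g hg hgO x hx => (hgO x).resolve_left fun h => h ?_⟩
    · by_cases hx : x ∈ K
      · exact Or.inr (hKO hx)
      · exact Or.inl (by rw [mem_preimage, hf]; exact hx)
    · rw [hg]; exact hx
  exact hG hV

/-! ### The correspondence and its behavior near the given submanifold -/

namespace StandardNbhd

variable {m d : ℕ} {M : Type*} [TopologicalSpace M] [ChartedSpace (EuclideanSpace ℝ (Fin m)) M]
  [IsManifold (𝓡 m) ∞ M] {Y : Type*} [TopologicalSpace Y]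
  [ChartedSpace (EuclideanSpace ℝ (Fin d)) Y] [IsManifold (𝓡 d) ∞ Y]
  {α : (x : M) → CotangentAt m x} {ι : Y → M}
  {L : (y : Y) → Submodule ℝ (TangentSpace (𝓡 d) y)}
  {hLF : ∀ y : Y, IsCompl (charFoliation (d := d) α ι y) (L y)} {N : StandardNbhd α ι hLF}
  {s s' : (y : Y) → (charFoliation (d := d) α ι y →L[ℝ] ℝ)}
  {ν : (y : Y) → TangentSpace (𝓡 d) y}

open Classical in
/-- The foliation `ker (s̄ - λ)` that corresponds to the graph of `s`. -/
def graphFoliation (N : StandardNbhd α ι hLF) (S : Set M) :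
    (y : Y) → Submodule ℝ (TangentSpace (𝓡 d) y) :=
  if h : ∃ s ∈ N.sections, S = N.graph s then N.sectionField h.choose else ⊤

lemma graphFoliation_graph (hs : s ∈ N.sections) :
    N.graphFoliation (N.graph s) = N.sectionField s := by
  have h : ∃ s' ∈ N.sections, N.graph s = N.graph s' := ⟨s, hs, rfl⟩
  rw [graphFoliation, dif_pos h, eq_of_graph_eq h.choose_spec.1 hs h.choose_spec.2.symm]

lemma existsUnique_section {S : Set M} (hS : S ∈ N.coisotropicGraphs) :
    ∃! s, s ∈ N.sections ∧ S = N.graph s ∧ N.graphFoliation S = N.sectionField s := by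
  obtain ⟨-, s, hs, rfl⟩ := hS
  exact ⟨s, ⟨hs, rfl, graphFoliation_graph hs⟩, fun s' h => eq_of_graph_eq h.1 hs h.2.1.symm⟩

lemma bijOn_graphFoliation [CompactSpace Y] [T2Space M] (hdim : m + 1 = 2 * d)
    (hα : IsContactForm α) (hνL : ∀ y, ν y ∈ L y)
    (hν : ∀ y, pullbackForm (d := d) α ι y (ν y) = 1) (N : StandardNbhd α ι hLF) :
    BijOn N.graphFoliation N.coisotropicGraphs N.foliations := by
  have hmem : ∀ {S}, S ∈ N.coisotropicGraphs ↔
    ∃ s ∈ N.sections, S = N.graph s ∧ IsCodimOneFoliation (N.sectionField s) :=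
    mem_coisotropicGraphs_iff hdim hα hνL hν
  refine ⟨fun S hS => ?_, fun S hS S' hS' h => ?_, fun D hD => ?_⟩
  · obtain ⟨s, hs, rfl, hf⟩ := hmem.1 hS
    rw [graphFoliation_graph hs]
    exact ⟨hf, s, hs, rfl⟩
  · obtain ⟨-, s, hs, rfl⟩ := hS
    obtain ⟨-, s', hs', rfl⟩ := hS'
    rw [graphFoliation_graph hs, graphFoliation_graph hs'] at h
    rw [eq_of_sectionField_eq hνL hν h]
  · obtain ⟨hf, s, hs, rfl⟩ := hD
    exact ⟨N.graph s, hmem.2 ⟨s, hs, rfl, hf⟩, graphFoliation_graph hs⟩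

/-- `exists_sections_of_tendstoC1At` for the tautological family: the index is the embedding itself,
and the filter is that of the `C¹`-neighborhoods of `ι`. -/
lemma exists_sections_of_nhdsCoisotropicC1 [CompactSpace Y] [T2Space Y] (ρ : SmoothRetract d Y)
    (hι : ContMDiff (𝓡 d) (𝓡 m) ∞ ι) (hlam : IsSmoothForm (pullbackForm (d := d) α ι))
    (N : StandardNbhd α ι hLF) :
    ∃ s : (Y → M) → (y : Y) → (charFoliation (d := d) α ι y →L[ℝ] ℝ),
      (∀ᶠ j in nhdsC1 (𝓡 d) (𝓡 m) ι ⊓ 𝓟 (coisotropicEmbeddings (d := d) Y α),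
        s j ∈ N.sections ∧ range j = N.graph (s j)) ∧
      ∀ y, TendstoC1At (𝓡 d) (cotModel d)
        (nhdsC1 (𝓡 d) (𝓡 m) ι ⊓ 𝓟 (coisotropicEmbeddings (d := d) Y α))
        (fun j => formMap fun y => pullbackForm (d := d) α ι y - barForm hLF (s j) y)
        (formMap (pullbackForm (d := d) α ι)) y := by
  have := locallyCompactSpace_tangentBundle d Y
  have h1 : ∀ᶠ j in nhdsC1 (𝓡 d) (𝓡 m) ι ⊓ 𝓟 (coisotropicEmbeddings (d := d) Y α),
      ContMDiff (𝓡 d) (𝓡 m) ∞ j :=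
    (eventually_principal.2 fun j hj => hj.1.contMDiff).filter_mono inf_le_right
  exact exists_sections_of_tendstoC1At ρ hlam N h1 ((tendsto_nhdsC1_iff h1 hι).1
    (tendsto_id.mono_left inf_le_left))

/-- The graphs contain the coisotropic submanifolds that are `C¹`-close to `ι(Y)`. -/
theorem coisotropicGraphs_mem_nhdsCoisotropicC1 [CompactSpace Y] [T2Space Y]
    (ρ : SmoothRetract d Y) (hι : ContMDiff (𝓡 d) (𝓡 m) ∞ ι)
    (hlam : IsSmoothForm (pullbackForm (d := d) α ι)) (N : StandardNbhd α ι hLF) :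
    N.coisotropicGraphs ∈ nhdsCoisotropicC1 (d := d) α ι := by
  obtain ⟨s, hs, -⟩ := exists_sections_of_nhdsCoisotropicC1 ρ hι hlam N
  refine mem_map.2 ?_
  filter_upwards [hs, mem_inf_of_right (mem_principal_self _)] with j hj hjc
  exact ⟨⟨j, hjc, rfl⟩, s j, hj⟩

/-- One half of the equality of filters. The foliation is represented by `λ - s̄` instead of `s̄ -
λ`, since it is this form that converges to `λ`. -/
lemma tendsto_graphFoliation [CompactSpace Y] [T2Space Y] [T2Space M] (hdim : m + 1 = 2 * d)
    (hα : IsContactForm α) (ρ : SmoothRetract d Y) (hι : ContMDiff (𝓡 d) (𝓡 m) ∞ ι)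
    (hlam : IsSmoothForm (pullbackForm (d := d) α ι)) (hνL : ∀ y, ν y ∈ L y)
    (hν : ∀ y, pullbackForm (d := d) α ι y (ν y) = 1) (N : StandardNbhd α ι hLF) :
    Tendsto N.graphFoliation (nhdsCoisotropicC1 (d := d) α ι)
      (nhdsFoliationC1 (pullbackForm (d := d) α ι)) := by
  have := locallyCompactSpace_tangentBundle d Y
  obtain ⟨s, hs, hslim⟩ := exists_sections_of_nhdsCoisotropicC1 ρ hι hlam N
  have hev : ∀ᶠ j in nhdsC1 (𝓡 d) (𝓡 m) ι ⊓ 𝓟 (coisotropicEmbeddings (d := d) Y α),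
      (fun y => pullbackForm (d := d) α ι y - barForm hLF (s j) y) ∈ foliationForms d Y := by
    filter_upwards [hs, mem_inf_of_right (mem_principal_self _)] with j hj hjc
    exact sub_barForm_mem_foliationForms ρ hlam hνL hν hj.1
      ((isCoisotropicMap_graphMap_iff hdim hα hνL hν hj.1).1
        (isCoisotropicMap_graphMap_of_range_eq hj.1 hjc.1.contMDiff hjc.2 hj.2))
  refine tendsto_map'_iff.2 (Tendsto.congr' (f₁ := kerField ∘ fun j y =>
    pullbackForm (d := d) α ι y - barForm hLF (s j) y) ?_ (tendsto_map.comp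
      (tendsto_inf.2 ⟨tendsto_comap_iff.2 ((tendsto_nhdsC1_iff ?_ hlam).2 hslim),
        tendsto_principal.2 hev⟩)))
  · filter_upwards [hs] with j hj
    change _ = N.graphFoliation (range j)
    rw [hj.2, graphFoliation_graph hj.1, sectionField_eq_kerField]
    rfl
  · filter_upwards [hev] with j hj using hj.1

lemma eventually_formMap_mem_goodForms [CompactSpace Y] [LocallyCompactSpace Y]
    (ρ : SmoothRetract d Y) (hlam : IsSmoothForm (pullbackForm (d := d) α ι))
    (hνs : ContMDiff (𝓡 d) (𝓡 d).tangent ∞ (fun y => (⟨y, ν y⟩ : TangentBundle (𝓡 d) Y)))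
    (hνL : ∀ y, ν y ∈ L y) (hν : ∀ y, pullbackForm (d := d) α ι y (ν y) = 1)
    (N : StandardNbhd α ι hLF) {l : Filter ((y : Y) → CotangentAt d y)}
    (hl : ∀ y, Tendsto (fun p : ((y : Y) → CotangentAt d y) × Y => formMap p.1 p.2) (l ×ˢ 𝓝 y)
      (𝓝 (formMap (pullbackForm (d := d) α ι) y))) :
    ∀ᶠ μ in l, ∀ y, formMap μ y ∈ N.goodForms ν := by
  have h1 : ∀ᶠ μ in l, ∀ y ∈ univ, formMap μ y ∈ N.goodForms ν :=
    isCompact_univ.eventually_forall_of_prod fun y _ => hl y (goodForms_mem_nhds ρ hlam hνs hνL hν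
      (formMap_mem_goodForms hν y))
  exact h1.mono fun _ h y => h y (mem_univ y)

/-- The foliations of graphs contain those that are `C⁰`-close to `ker λ`. -/
theorem foliations_mem_nhdsFoliationC0 [CompactSpace Y] [LocallyCompactSpace Y]
    (ρ : SmoothRetract d Y) (hlam : IsSmoothForm (pullbackForm (d := d) α ι))
    (hνs : ContMDiff (𝓡 d) (𝓡 d).tangent ∞ (fun y => (⟨y, ν y⟩ : TangentBundle (𝓡 d) Y)))
    (hνL : ∀ y, ν y ∈ L y) (hν : ∀ y, pullbackForm (d := d) α ι y (ν y) = 1)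
    (N : StandardNbhd α ι hLF) :
    N.foliations ∈ nhdsFoliationC0 (pullbackForm (d := d) α ι) := by
  let l := (nhdsC0 (formMap (pullbackForm (d := d) α ι))).comap formMap ⊓ 𝓟 (foliationForms d Y)
  have h0 : Tendsto formMap l (nhdsC0 (formMap (pullbackForm (d := d) α ι))) :=
    tendsto_comap.mono_left inf_le_left
  have h1 := (tendsto_nhdsC0_iff hlam.continuous).1 h0
  refine mem_map.2 ?_
  filter_upwards [eventually_formMap_mem_goodForms ρ hlam hνs hνL hν N h1,
    mem_inf_of_right (mem_principal_self _)] with μ h2 hμ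
  exact ⟨hμ.2.2, sectionOfForm α ι ν μ,
    sectionOfForm_mem_sections ρ hlam hνs hνL hν hμ.1 h2,
    (sectionField_sectionOfForm hνL hν fun y => (h2 y).1).symm⟩

/-- The other half. For forms near `λ`, taking the kernel factors through the graph of the
associated section. This graph depends on the form by a fixed smooth map of covectors, so it
converges to `ι` in the `C¹` sense. -/
lemma nhdsFoliationC1_le_map [CompactSpace Y] [T2Space Y] [T2Space M] (hdim : m + 1 = 2 * d)
    (hα : IsContactForm α) (ρ : SmoothRetract d Y) (hι : ContMDiff (𝓡 d) (𝓡 m) ∞ ι)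
    (hlam : IsSmoothForm (pullbackForm (d := d) α ι))
    (hνs : ContMDiff (𝓡 d) (𝓡 d).tangent ∞ (fun y => (⟨y, ν y⟩ : TangentBundle (𝓡 d) Y)))
    (hνL : ∀ y, ν y ∈ L y) (hν : ∀ y, pullbackForm (d := d) α ι y (ν y) = 1)
    (N : StandardNbhd α ι hLF) : nhdsFoliationC1 (pullbackForm (d := d) α ι) ≤
      map N.graphFoliation (nhdsCoisotropicC1 (d := d) α ι) := by
  have := locallyCompactSpace_tangentBundle d Y
  let l := (nhdsC1 (𝓡 d) (cotModel d) (formMap (pullbackForm (d := d) α ι))).comap formMap ⊓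
    𝓟 (foliationForms d Y)
  have hmem : ∀ᶠ μ in l, μ ∈ foliationForms d Y := mem_inf_of_right (mem_principal_self _)
  have h1 : ∀ y, TendstoC1At (𝓡 d) (cotModel d) l formMap
      (formMap (pullbackForm (d := d) α ι)) y :=
    (tendsto_nhdsC1_iff (hmem.mono fun μ hμ => hμ.1) hlam).1 (tendsto_comap.mono_left inf_le_left)
  have hgood := eventually_formMap_mem_goodForms ρ hlam hνs hνL hν N fun y => (h1 y).tendsto
  have hsec : ∀ᶠ μ in l, sectionOfForm α ι ν μ ∈ N.sections := by
    filter_upwards [hmem, hgood] with μ hμ h2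
    exact sectionOfForm_mem_sections ρ hlam hνs hνL hν hμ.1 h2
  have h2 : ∀ y, TendstoC1At (𝓡 d) (𝓡 m) l (fun μ => N.graphMap (sectionOfForm α ι ν μ)) ι y :=
    fun y => by
      have h3 : TendstoC1At (cotModel d) (𝓡 m) l
          (fun _ => fun ξ => N.invFun (leafOfForm α ι ν ξ))
          (fun ξ => N.invFun (leafOfForm α ι ν ξ)) (formMap (pullbackForm (d := d) α ι) y) :=
        .of_contMDiffAt (contMDiffAt_invFun_leafOfForm ρ hlam hνs hνL hν
          (formMap_mem_goodForms hν y))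
      refine (h3.comp (h1 y)).congr (Eventually.of_forall fun _ => rfl)
        (Eventually.of_forall fun y => ?_)
      change ι y = N.invFun (leafOfForm α ι ν (formMap (pullbackForm (d := d) α ι) y))
      rw [leafOfForm_formMap_pullbackForm, N.invFun_zero]
  have h3 : Tendsto (fun μ => N.graphMap (sectionOfForm α ι ν μ)) l
      (nhdsC1 (𝓡 d) (𝓡 m) ι ⊓ 𝓟 (coisotropicEmbeddings (d := d) Y α)) := by
    refine tendsto_inf.2 ⟨(tendsto_nhdsC1_iff (hsec.mono fun μ hμ => contMDiff_graphMap hμ) hι).2 h2,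
      tendsto_principal.2 ?_⟩
    filter_upwards [hmem, hgood, hsec] with μ hμ hg hs
    refine ⟨isSmoothEmbedding_graphMap hs, (isCoisotropicMap_graphMap_iff hdim hα hνL hν hs).2 ?_⟩
    rw [sectionField_sectionOfForm (μ := μ) hνL hν fun y => (hg y).1]
    exact hμ.2.2
  have h4 : Tendsto kerField l (map N.graphFoliation (nhdsCoisotropicC1 (d := d) α ι)) := by
    refine (tendsto_map.comp (tendsto_map.comp h3)).congr' ?_
    filter_upwards [hgood, hsec] with μ hg hs
    change N.graphFoliation (N.graph (sectionOfForm α ι ν μ)) = _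
    rw [graphFoliation_graph hs, sectionField_sectionOfForm (μ := μ) hνL hν fun y => (hg y).1]
  exact h4

/-- A standard neighborhood can be shrunk by restricting the values of the associated forms. -/
def restrictForms (N : StandardNbhd α ι hLF) (ρ : SmoothRetract d Y)
    (hlam : IsSmoothForm (pullbackForm (d := d) α ι)) (O : Set (CotangentBundle d Y))
    (hO : IsOpen O) (hlamO : ∀ y, formMap (pullbackForm (d := d) α ι) y ∈ O) :
    StandardNbhd α ι hLF where
  toPartialEquiv := N.toPartialEquiv.restr (N.formAt ⁻¹' O)
  open_source := ContinuousOn.isOpen_inter_preimage (fun u hu =>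
    (contMDiffAt_formAt ρ hlam hu).continuousAt.continuousWithinAt) N.open_source hO
  open_target := by
    have h1 : ContinuousOn (fun p => N.formAt (N.invFun
        (restrictLeaf (charFoliation (d := d) α ι) p)))
        (restrictLeaf (charFoliation (d := d) α ι) ⁻¹' N.target) := fun p hp =>
      (ContinuousAt.comp (g := N.formAt)
        (f := fun p => N.invFun (restrictLeaf (charFoliation (d := d) α ι) p))
        (contMDiffAt_formAt ρ hlam (N.map_target hp)).continuousAt (N.contMDiffOn_invFun.contMDiffAt
          (N.open_target.mem_nhds hp)).continuousAt).continuousWithinAt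
    exact h1.isOpen_inter_preimage N.open_target hO
  contMDiffOn_toFun := N.contMDiffOn_toFun.mono inter_subset_left
  contMDiffOn_invFun := N.contMDiffOn_invFun.mono fun _ hp => hp.1
  mem_source y := ⟨N.mem_source y, by rw [mem_preimage, formAt_ι]; exact hlamO y⟩
  map_zero := N.map_zero
  contact u hu := N.contact u hu.1

/-- Shrinking a standard neighborhood makes the foliations of its graphs `C⁰`-close to `ker λ`. -/
theorem exists_restrict_foliations_subset [T2Space Y] (ρ : SmoothRetract d Y)
    (hlam : IsSmoothForm (pullbackForm (d := d) α ι)) (hνL : ∀ y, ν y ∈ L y)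
    (hν : ∀ y, pullbackForm (d := d) α ι y (ν y) = 1) (N : StandardNbhd α ι hLF)
    {𝒲 : Set ((y : Y) → Submodule ℝ (TangentSpace (𝓡 d) y))}
    (h𝒲 : 𝒲 ∈ nhdsFoliationC0 (pullbackForm (d := d) α ι)) :
    ∃ N' : StandardNbhd (d := d) α ι hLF,
      N'.source ⊆ N.source ∧ EqOn N'.toFun N.toFun N'.source ∧ N'.foliations ⊆ 𝒲 := by
  obtain ⟨V, hV, hV𝒲⟩ := mem_comap.1 (mem_inf_principal.1 (mem_map.1 h𝒲))
  obtain ⟨O, hO, hlamO, hOV⟩ := exists_isOpen_of_mem_nhdsC0 (q := TotalSpace.proj)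
    (FiberBundle.continuous_proj (EuclideanSpace ℝ (Fin d) →L[ℝ] ℝ) (fun y : Y => CotangentAt d y))
    (fun _ => rfl) hV
  let N' := N.restrictForms ρ hlam O hO hlamO
  refine ⟨N', inter_subset_left, fun _ _ => rfl, ?_⟩
  rintro D ⟨hD, s, hs, rfl⟩
  have h1 : (fun y => pullbackForm (d := d) α ι y - barForm hLF s y) ∈ foliationForms d Y :=
    sub_barForm_mem_foliationForms ρ hlam hνL hν hs hD
  have h2 : formMap (fun y => pullbackForm (d := d) α ι y - barForm hLF s y) ∈ V :=
    hOV _ (fun _ => rfl) fun y => by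
      rw [← formAt_graphMap (N := N') hs y]
      exact (graphMap_mem (N := N') hs y).2
  rw [sectionField_eq_kerField]
  exact hV𝒲 h2 h1

end StandardNbhd

/-- The inverse of a smooth family of bijective immersions of a compact manifold is smooth. -/
lemma exists_contMDiffOn_inverse_family {d : ℕ} {Y : Type*} [TopologicalSpace Y] [T2Space Y]
    [CompactSpace Y] [Nonempty Y] [ChartedSpace (EuclideanSpace ℝ (Fin d)) Y]
    [IsManifold (𝓡 d) ∞ Y] {φ : ℝ × Y → Y}
    (hφ : ContMDiff (𝓘(ℝ, ℝ).prod (𝓡 d)) (𝓡 d) ∞ φ)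
    (hbij : ∀ t, Function.Bijective fun y => φ (t, y))
    (hd : ∀ t y, Function.Injective (mfderiv (𝓡 d) (𝓡 d) (fun y => φ (t, y)) y)) :
    ∃ ψ : ℝ × Y → Y, ContMDiffOn (𝓘(ℝ, ℝ).prod (𝓡 d)) (𝓡 d) ∞ ψ (Icc 0 1 ×ˢ univ) ∧
      ∀ t ∈ Icc (0 : ℝ) 1, ∀ y, φ (t, ψ (t, y)) = y := by
  let E := EuclideanSpace ℝ (Fin d)
  -- With the time kept as a coordinate, smooth dependence of the inverses on `t` is the inverse
  -- function theorem along the compact set `[0,1] × Y`. This uses the family on an open set of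
  -- times.
  let G : ℝ × Y → ℝ × Y := fun p => (p.1, φ p)
  have hG : ContMDiff (𝓘(ℝ, ℝ).prod (𝓡 d)) (𝓘(ℝ, ℝ).prod (𝓡 d)) ∞ G := contMDiff_fst.prodMk hφ
  have hGinj : Function.Injective G := by
    rintro ⟨t, y⟩ ⟨t', y'⟩ h
    obtain rfl : t = t' := congrArg Prod.fst h
    exact congrArg (Prod.mk t) ((hbij t).1 (congrArg Prod.snd h))
  have hGd : ∀ p : ℝ × Y, Function.Injective
      (mfderiv (𝓘(ℝ, ℝ).prod (𝓡 d)) (𝓘(ℝ, ℝ).prod (𝓡 d)) G p) := by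
    rintro ⟨t, y⟩
    let Φ : ℝ × E →L[ℝ] E := mfderiv (𝓘(ℝ, ℝ).prod (𝓡 d)) (𝓡 d) φ (t, y)
    have h1 : HasMFDerivAt (𝓘(ℝ, ℝ).prod (𝓡 d)) (𝓡 d) φ (t, y) Φ :=
      (hφ.mdifferentiable (by simp) (t, y)).hasMFDerivAt
    let D : ℝ × E →L[ℝ] ℝ × E := (ContinuousLinearMap.fst ℝ ℝ E).prod Φ
    have h2 : HasMFDerivAt (𝓘(ℝ, ℝ).prod (𝓡 d)) (𝓘(ℝ, ℝ).prod (𝓡 d)) G (t, y) D :=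
      (hasMFDerivAt_fst (I := 𝓘(ℝ, ℝ)) (I' := 𝓡 d) (t, y)).prodMk h1
    let ι₂ : E →L[ℝ] ℝ × E := ContinuousLinearMap.inr ℝ ℝ E
    have h3 : HasMFDerivAt (𝓡 d) (𝓘(ℝ, ℝ).prod (𝓡 d)) (fun y : Y => (t, y)) y ι₂ := by
      exact (hasMFDerivAt_const (I := 𝓡 d) (I' := 𝓘(ℝ, ℝ)) t y).prodMk
        (hasMFDerivAt_id (I := 𝓡 d) y)
    have h4 : ∀ v : E, (mfderiv (𝓡 d) (𝓡 d) (fun y => φ (t, y)) y v : E) = Φ (0, v) := fun v =>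
      congrArg (fun T : E →L[ℝ] E => T v) (h1.comp y h3).mfderiv
    rw [h2.mfderiv]
    have h5 : Function.Injective D := by
      refine (injective_iff_map_eq_zero D).2 ?_
      rintro ⟨a, v⟩ h
      obtain rfl : a = 0 := congrArg Prod.fst h
      have h6 : Φ (0, v) = 0 := congrArg Prod.snd h
      rw [← h4] at h6
      have h7 : v = 0 := hd t y (h6.trans (map_zero _).symm)
      rw [h7]; rfl
    exact h5
  obtain ⟨e, he, -, heG, hes⟩ := exists_diffeo_of_isCompact (I := 𝓘(ℝ, ℝ).prod (𝓡 d))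
    (J := 𝓘(ℝ, ℝ).prod (𝓡 d)) rfl (isCompact_Icc.prod isCompact_univ :
      IsCompact (Icc (0 : ℝ) 1 ×ˢ (univ : Set Y))) hGinj.injOn isOpen_univ (subset_univ _)
    hG.contMDiffOn fun p _ => hGd p
  have hinv : ∀ t ∈ Icc (0 : ℝ) 1, ∀ y, (t, y) ∈ e.target ∧
      φ (t, (e.symm (t, y)).2) = y := fun t ht y => by
    obtain ⟨x, hx⟩ := (hbij t).2 y
    have h1 : (t, x) ∈ e.source := he ⟨ht, mem_univ x⟩
    have h2 : e (t, x) = (t, y) := by rw [heG]; exact congrArg (Prod.mk t) hx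
    have h3 : e.symm (t, y) = (t, x) := by rw [← h2, e.left_inv h1]
    refine ⟨h2 ▸ e.map_source h1, ?_⟩
    rw [h3]
    exact hx
  refine ⟨fun p => (e.symm p).2, ?_, fun t ht y => (hinv t ht y).2⟩
  exact contMDiff_snd.comp_contMDiffOn (hes.mono fun p hp => (hinv p.1 hp.1 p.2).1)

/-! ### Paths of coisotropic submanifolds and homotopies of foliations -/

namespace StandardNbhd

variable {m d : ℕ} {M : Type*} [TopologicalSpace M] [ChartedSpace (EuclideanSpace ℝ (Fin m)) M]
  [IsManifold (𝓡 m) ∞ M] {Y : Type*} [TopologicalSpace Y]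
  [ChartedSpace (EuclideanSpace ℝ (Fin d)) Y] [IsManifold (𝓡 d) ∞ Y]
  {α : (x : M) → CotangentAt m x} {ι : Y → M}
  {L : (y : Y) → Submodule ℝ (TangentSpace (𝓡 d) y)}
  {hLF : ∀ y : Y, IsCompl (charFoliation (d := d) α ι y) (L y)} {N : StandardNbhd α ι hLF}
  {s s' : (y : Y) → (charFoliation (d := d) α ι y →L[ℝ] ℝ)}
  {ν : (y : Y) → TangentSpace (𝓡 d) y}

lemma zero_mem_sections (ρ : SmoothRetract d Y)
    (hlam : IsSmoothForm (pullbackForm (d := d) α ι)) : (0 : (y : Y) → (charFoliation (d := d) α ι y →L[ℝ] ℝ)) ∈ N.sections := by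
  refine ⟨fun y => ?_, N.zero_mem_target⟩
  have h1 := ρ.contMDiffWithinAt_smul_add (s := univ) (b := fun y : Y => y)
    (f := fun _ => 0) (g := fun _ => 0) (hlam y).contMDiffWithinAt (hlam y).contMDiffWithinAt
    contMDiffWithinAt_const contMDiffWithinAt_const
  refine (contMDiffWithinAt_univ.1 h1).congr_of_eventuallyEq (Eventually.of_forall fun y => ?_)
  refine SmoothRetract.cotangentBundle_ext rfl fun v => ?_
  change extendAt hLF y 0 v =
    0 * pullbackForm (d := d) α ι y v + 0 * pullbackForm (d := d) α ι y v
  rw [extendAt_zero, zero_mul, add_zero]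
  rfl

lemma graph_zero : N.graph 0 = range ι :=
  congrArg range (funext fun y => N.invFun_zero y)

lemma sectionField_zero : N.sectionField 0 = charFoliation (d := d) α ι := by
  rw [sectionField_eq_kerField]
  refine congrArg kerField (funext fun y => ?_)
  change pullbackForm (d := d) α ι y - extendAt hLF y 0 = _
  rw [extendAt_zero, sub_zero]

/-- An embedding whose image is a graph projects diffeomorphically to `Y`. -/
lemma bijective_proj_comp {j : Y → M} (hs : s ∈ N.sections) (hj : Function.Injective j)
    (h : range j = N.graph s) : Function.Bijective (N.proj ∘ j) ∧
      ∀ y, j y = N.graphMap s (N.proj (j y)) := by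
  have h1 : ∀ y, j y = N.graphMap s (N.proj (j y)) := fun y => by
    obtain ⟨z, hz⟩ : j y ∈ N.graph s := h ▸ ⟨y, rfl⟩
    change N.graphMap s z = j y at hz
    rw [← hz, proj_graphMap hs]
  refine ⟨⟨fun y y' hy => hj ?_, fun z => ?_⟩, h1⟩
  · change N.proj (j y) = N.proj (j y') at hy
    rw [h1 y, h1 y', hy]
  · obtain ⟨y, hy⟩ : N.graphMap s z ∈ range j := h ▸ ⟨z, rfl⟩
    exact ⟨y, by rw [Function.comp_apply, hy, proj_graphMap hs]⟩

lemma injective_mfderiv_proj_comp {j : Y → M} (hs : s ∈ N.sections)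
    (hj : ContMDiff (𝓡 d) (𝓡 m) ∞ j) (h : ∀ y, j y = N.graphMap s (N.proj (j y))) (y : Y)
    (hd : Function.Injective (mfderiv (𝓡 d) (𝓡 m) j y)) :
    Function.Injective (mfderiv (𝓡 d) (𝓡 d) (N.proj ∘ j) y) := by
  have hjs : j y ∈ N.source := by rw [h]; exact graphMap_mem hs _
  have h1 : MDifferentiableAt (𝓡 d) (𝓡 d) (N.proj ∘ j) y :=
    ((N.contMDiffAt_proj hjs).comp y (hj y)).mdifferentiableAt (by simp)
  have h2 : N.graphMap s ∘ (N.proj ∘ j) = j := funext fun y => (h y).symm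
  have h3 : mfderiv (𝓡 d) (𝓡 m) (N.graphMap s ∘ (N.proj ∘ j)) y =
      (mfderiv (𝓡 d) (𝓡 m) (N.graphMap s) ((N.proj ∘ j) y)).comp
        (mfderiv (𝓡 d) (𝓡 d) (N.proj ∘ j) y) :=
    mfderiv_comp y ((contMDiff_graphMap hs _).mdifferentiableAt (by simp)) h1
  have h4 : Function.Injective (mfderiv (𝓡 d) (𝓡 m) (N.graphMap s ∘ (N.proj ∘ j)) y) := by
    have h5 : ∀ k, k = j → Function.Injective (mfderiv (𝓡 d) (𝓡 m) k y) := by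
      rintro _ rfl; exact hd
    exact h5 _ h2
  rw [h3] at h4
  intro v w hvw
  exact h4 (congrArg (mfderiv (𝓡 d) (𝓡 m) (N.graphMap s) ((N.proj ∘ j) y)) hvw)

/-- Each member of the path is a graph up to a diffeomorphism of `Y`, namely its projection. The
inverses of these diffeomorphisms form a smooth family, which yields a smooth family of forms `λ -
s̄`. -/
lemma CoisotropicHomotopic.foliationHomotopicIn [CompactSpace Y] [T2Space Y] [Nonempty Y]
    [T2Space M] (hdim : m + 1 = 2 * d) (hα : IsContactForm α) (ρ : SmoothRetract d Y)
    (hlam : IsSmoothForm (pullbackForm (d := d) α ι)) (hνL : ∀ y, ν y ∈ L y)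
    (hν : ∀ y, pullbackForm (d := d) α ι y (ν y) = 1) {S : Set M}
    (h : N.CoisotropicHomotopic (range ι) S) :
    FoliationHomotopicIn N.foliations (charFoliation (d := d) α ι) (N.graphFoliation S) := by
  obtain ⟨j, hj, hjN, hj0, hj1⟩ := h
  -- The path is given only for `t` in `[0,1]`. Reparametrized by a smooth step function it becomes
  -- smooth for all real times, with the same end points at `0` and `1`.
  let τ : ℝ → ℝ := Real.smoothTransition
  have hτ : ∀ t, τ t ∈ Icc (0 : ℝ) 1 := fun t =>
    ⟨Real.smoothTransition.nonneg t, Real.smoothTransition.le_one t⟩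
  let J : ℝ × Y → M := fun p => j (τ p.1) p.2
  have hJ : ContMDiff (𝓘(ℝ, ℝ).prod (𝓡 d)) (𝓡 m) ∞ J := by
    have h1 : ContMDiff (𝓘(ℝ, ℝ).prod (𝓡 d)) (𝓘(ℝ, ℝ).prod (𝓡 d)) ∞
        (fun p : ℝ × Y => (τ p.1, p.2)) :=
      (Real.smoothTransition.contDiff.contMDiff.comp contMDiff_fst).prodMk contMDiff_snd
    exact contMDiffOn_univ.1 (hj.comp (contMDiffOn_univ.2 h1) fun p _ => ⟨hτ p.1, mem_univ _⟩)
  have hex : ∀ t, ∃ s ∈ N.sections, range (j (τ t)) = N.graph s ∧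
      IsCodimOneFoliation (N.sectionField s) := fun t =>
    (mem_coisotropicGraphs_iff hdim hα hνL hν).1 (hjN _ (hτ t)).2
  choose s hs hjs hsf using hex
  have hbij : ∀ t, Function.Bijective (N.proj ∘ j (τ t)) ∧
      ∀ y, j (τ t) y = N.graphMap (s t) (N.proj (j (τ t) y)) := fun t =>
    bijective_proj_comp (hs t) (hjN _ (hτ t)).1.1.isEmbedding.injective (hjs t)
  have hJs : ∀ p, J p ∈ N.source := fun p => by
    change j (τ p.1) p.2 ∈ N.source
    rw [(hbij p.1).2]; exact graphMap_mem (hs _) _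
  obtain ⟨ψ, hψ, hψr⟩ := exists_contMDiffOn_inverse_family (φ := N.proj ∘ J)
    (fun p => (N.contMDiffAt_proj (hJs p)).comp p (hJ p)) (fun t => (hbij t).1)
    (fun t y => injective_mfderiv_proj_comp (hs t) (hjN _ (hτ t)).1.1.contMDiff (hbij t).2 y
      (injective_mfderiv_of_isSmoothEmbedding (hjN _ (hτ t)).1.1 y))
  have hend : ∀ t S, range (j (τ t)) = S → N.graphFoliation S =
      kerField fun y => pullbackForm (d := d) α ι y - barForm hLF (s t) y := by
    rintro t _ rfl
    rw [hjs, graphFoliation_graph (hs t), sectionField_eq_kerField]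
  refine ⟨fun t y => pullbackForm (d := d) α ι y - barForm hLF (s t) y, ?_, fun t _ => ⟨fun y =>
    (sub_barForm_mem_foliationForms ρ hlam hνL hν (hs t) (hsf t)).2.1 y, ?_⟩, ?_, ?_⟩
  · have h1 : ContMDiffOn (𝓘(ℝ, ℝ).prod (𝓡 d)) (cotModel d) ∞
        (fun p : ℝ × Y => N.formAt (J (p.1, ψ p))) (Icc 0 1 ×ˢ univ) := fun p hp =>
      (contMDiffAt_formAt ρ hlam (hJs (p.1, ψ p))).comp_contMDiffWithinAt p
        (ContMDiffAt.comp_contMDiffWithinAt (g := J) (f := fun p => (p.1, ψ p)) p (hJ (p.1, ψ p))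
          (contMDiffWithinAt_fst.prodMk (hψ p hp)))
    refine h1.congr fun p hp => ?_
    have h2 : N.proj (j (τ p.1) (ψ p)) = p.2 := hψr p.1 hp.1 p.2
    change _ = N.formAt (j (τ p.1) (ψ p))
    rw [(hbij p.1).2, h2, formAt_graphMap (hs _)]
  · rw [← N.sectionField_eq_kerField]
    exact ⟨hsf t, s t, hs t, rfl⟩
  · refine (hend 0 (range ι) ?_).symm.trans ?_
    · rw [← hj0]; exact congrArg (fun t => range (j t)) Real.smoothTransition.zero
    · rw [← graph_zero (N := N), graphFoliation_graph (zero_mem_sections ρ hlam), sectionField_zero]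
  · refine (hend 1 S ?_).symm
    rw [← hj1]; exact congrArg (fun t => range (j t)) Real.smoothTransition.one

/-- The sections attached to `μ t` are obtained by a fixed smooth map on covectors, so their graphs
form a smooth path. The division by `μ t (ν)` is legitimate because the kernel of `μ t` is that of
some `s̄ - λ`. -/
lemma coisotropicHomotopic_of_foliationHomotopicIn [CompactSpace Y] [T2Space M]
    (hdim : m + 1 = 2 * d) (hα : IsContactForm α) (ρ : SmoothRetract d Y)
    (hlam : IsSmoothForm (pullbackForm (d := d) α ι))
    (hνs : ContMDiff (𝓡 d) (𝓡 d).tangent ∞ (fun y => (⟨y, ν y⟩ : TangentBundle (𝓡 d) Y)))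
    (hνL : ∀ y, ν y ∈ L y) (hν : ∀ y, pullbackForm (d := d) α ι y (ν y) = 1) {S : Set M}
    (hS : S ∈ N.coisotropicGraphs)
    (h : FoliationHomotopicIn N.foliations (charFoliation (d := d) α ι) (N.graphFoliation S)) :
    N.CoisotropicHomotopic (range ι) S := by
  obtain ⟨μ, hμ, hμN, hμ0, hμ1⟩ := h
  obtain ⟨-, s₁, hs₁, rfl⟩ := hS
  have hsec : ∀ t ∈ Icc (0 : ℝ) 1, ∀ s ∈ N.sections, kerField (μ t) = N.sectionField s →
      sectionOfForm α ι ν (μ t) = s ∧ ∀ y, formMap (μ t) y ∈ N.goodForms ν := fun t ht s hs h =>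
    ⟨sectionOfForm_eq hνL hν h (hμN t ht).1,
      formMap_mem_goodForms_of_kerField_eq hνL hν hs h (hμN t ht).1⟩
  have hgood : ∀ t ∈ Icc (0 : ℝ) 1, sectionOfForm α ι ν (μ t) ∈ N.sections ∧
      IsCodimOneFoliation (N.sectionField (sectionOfForm α ι ν (μ t))) ∧
      ∀ y, formMap (μ t) y ∈ N.goodForms ν := fun t ht => by
    obtain ⟨hf, s, hs, h⟩ := (hμN t ht).2
    obtain ⟨h1, h2⟩ := hsec t ht s hs h
    rw [h1, ← h]
    exact ⟨hs, hf, h2⟩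
  refine ⟨fun t => N.graphMap (sectionOfForm α ι ν (μ t)), fun p hp => ?_, fun t ht => ?_, ?_, ?_⟩
  · exact ContMDiffAt.comp_contMDiffWithinAt (g := fun ξ => N.invFun (leafOfForm α ι ν ξ))
      (f := fun p : ℝ × Y => formMap (μ p.1) p.2) p (contMDiffAt_invFun_leafOfForm ρ hlam hνs hνL hν
        ((hgood p.1 hp.1).2.2 p.2)) (hμ p hp)
  · obtain ⟨hs, hf, -⟩ := hgood t ht
    exact ⟨⟨isSmoothEmbedding_graphMap hs,
      (isCoisotropicMap_graphMap_iff hdim hα hνL hν hs).2 hf⟩,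
      (mem_coisotropicGraphs_iff hdim hα hνL hν).2 ⟨_, hs, rfl, hf⟩⟩
  · change range (N.graphMap (sectionOfForm α ι ν (μ 0))) = _
    rw [(hsec 0 (by simp) 0 (zero_mem_sections ρ hlam) (by rw [hμ0, sectionField_zero])).1]
    exact graph_zero
  · change range (N.graphMap (sectionOfForm α ι ν (μ 1))) = _
    rw [(hsec 1 (by simp) s₁ hs₁ (by rw [hμ1, graphFoliation_graph hs₁])).1]
    rfl

end StandardNbhd

/-! ### Assembly of the theorem -/

theorem mainTheorem2 (n : ℕ) (hn : 1 ≤ n)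
    {M : Type*} [TopologicalSpace M] [T2Space M] [SecondCountableTopology M]
    [ChartedSpace (EuclideanSpace ℝ (Fin (2 * n + 1))) M] [IsManifold (𝓡 (2 * n + 1)) ∞ M]
    (α : (x : M) → CotangentAt (2 * n + 1) x) (hα : IsContactForm α)
    {Y : Type*} [TopologicalSpace Y] [T2Space Y] [CompactSpace Y] [Nonempty Y]
    [ChartedSpace (EuclideanSpace ℝ (Fin (n + 1))) Y] [IsManifold (𝓡 (n + 1)) ∞ Y]
    (ι : Y → M) (hι : IsSmoothEmbedding (𝓡 (n + 1)) (𝓡 (2 * n + 1)) ∞ ι)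
    (hco : IsCoisotropicMap (d := n + 1) α ι)
    (hns : ∀ y : Y, pullbackForm (d := n + 1) α ι y ≠ 0)
    (L : (y : Y) → Submodule ℝ (TangentSpace (𝓡 (n + 1)) y)) (hL : IsSmoothLineField L)
    (hLF : ∀ y : Y, IsCompl (charFoliation (d := n + 1) α ι y) (L y)) :
    (∀ O : Set M, IsOpen O → range ι ⊆ O →
      ∃ N : StandardNbhd (d := n + 1) α ι hLF, N.source ⊆ O) ∧
    ∀ N : StandardNbhd (d := n + 1) α ι hLF,
      N.coisotropicGraphs ∈ nhdsCoisotropicC1 (d := n + 1) α ι ∧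
      N.foliations ∈ nhdsFoliationC0 (pullbackForm (d := n + 1) α ι) ∧
      (∃ Θ : Set M → (y : Y) → Submodule ℝ (TangentSpace (𝓡 (n + 1)) y),
        (∀ S ∈ N.coisotropicGraphs,
          ∃! s, s ∈ N.sections ∧ S = N.graph s ∧ Θ S = N.sectionField s) ∧
        BijOn Θ N.coisotropicGraphs N.foliations ∧
        map Θ (nhdsCoisotropicC1 (d := n + 1) α ι) = nhdsFoliationC1 (pullbackForm (d := n + 1) α ι) ∧
        ∀ S ∈ N.coisotropicGraphs,
          N.CoisotropicHomotopic (range ι) S ↔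
            FoliationHomotopicIn N.foliations (charFoliation (d := n + 1) α ι) (Θ S)) ∧
      ∀ 𝒲 ∈ nhdsFoliationC0 (pullbackForm (d := n + 1) α ι), ∃ N' : StandardNbhd (d := n + 1) α ι hLF,
        N'.source ⊆ N.source ∧ EqOn N'.toFun N.toFun N'.source ∧ N'.foliations ⊆ 𝒲 := by
  have hdim : (2 * n + 1) + 1 = 2 * (n + 1) := by omega
  refine ⟨fun O hO hιO => exists_standardNbhd hdim hα hι hco hns hL hLF hO hιO, fun N => ?_⟩
  obtain ⟨ρ⟩ := exists_smoothRetract (n + 1) Y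
  have hlam : IsSmoothForm (pullbackForm (d := n + 1) α ι) :=
    isSmoothForm_pullbackForm hα.1 hι.contMDiff
  obtain ⟨ν, hνs, hνL, hν⟩ := exists_transverse_field hlam hL hLF
  have : LocallyCompactSpace Y := Manifold.locallyCompact_of_finiteDimensional (𝓡 (n + 1))
  refine ⟨N.coisotropicGraphs_mem_nhdsCoisotropicC1 ρ hι.contMDiff hlam,
    N.foliations_mem_nhdsFoliationC0 ρ hlam hνs hνL hν,
    ⟨N.graphFoliation, fun S hS => StandardNbhd.existsUnique_section hS,
      N.bijOn_graphFoliation hdim hα hνL hν,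
      le_antisymm (N.tendsto_graphFoliation hdim hα ρ hι.contMDiff hlam hνL hν)
        (N.nhdsFoliationC1_le_map hdim hα ρ hι.contMDiff hlam hνs hνL hν),
      fun S hS => ⟨fun h => h.foliationHomotopicIn hdim hα ρ hlam hνL hν,
        StandardNbhd.coisotropicHomotopic_of_foliationHomotopicIn hdim hα ρ hlam hνs hνL hν hS⟩⟩,
    fun 𝒲 h𝒲 => N.exists_restrict_foliations_subset ρ hlam hνL hν h𝒲⟩
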